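/- \textbf{Setting.} Let $(N,h)$ be a compact smooth Riemannian manifold of dimension $n\ge 1$ with strictly convex boundary, $\omega$ a smooth one-form on $N$, $\lambda>0$ a smooth function on $N$, and equip $M=\mathbb R_t\times N$ with the stationary Lorentzian metric $g=\lambda\big(-(dt+\omega)^2+h\big)$, time-oriented by $\partial_t$. Let $Y:TN\to TN$ be given by $(Yu,v)_h=d\omega(u,v)$. The solutions of $D_\sigma\dot x=Y\dot x$, $|\dot x|_h=1$, are the (unit speed) magnetic geodesics of $(N,h,\omega)$. For a boundary point $x\in\partial N$ and the magnetic geodesic $\gamma$ issued from $x$ in an inward direction $v$, with $v'$ the $h$-orthogonal projection of $v$ on $T_x\partial N$, put $\mathcal S_{\rm mag}(x,v')=(y,w')$ and $\ell_{\rm mag}(x,v')=\ell$ if $\gamma$ meets $\partial N$ again for the first time at $y=\gamma(\ell)$ with velocity projecting to $w'$ on $T_y\partial N$. The action of a magnetic geodesic $\gamma$ of length $\ell$ is $\ell-\int_\gamma\omega$. The system $(N,h,\omega)$ is called simple if for every $x\in N$ the magnetic exponential map at $x$ is a diffeomorphism from its pre-image of $N$ onto $N$ ($C^1$, and smooth away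 from $0\in T_xN$ and $x$), and $\partial N$ is strictly convex for the magnetic flow in either direction; then $\mathbb A(x,y)$ denotes the action of the unique magnetic geodesic from $x$ to $y$, with $\mathbb A(x,x)=0$. The Lorentzian scattering relation is $\mathcal S(p,v')=(q,w')$, if the future pointing affinely parametrized lightlike geodesic of $g$ entering $M$ at $p\in\mathbb R\times\partial N$, with velocity having the $g$-orthogonal projection $v'$ on $T_p(\mathbb R\times\partial N)$, meets $\mathbb R\times\partial N$ again for the first time at $q$, with velocity projecting to $w'$. For $v'\in T_{(t,x)}(\mathbb R\times\partial N)$ write $v'=[v'_t,v'_x]$, where $v'_x$ is its projection to $T_x\partial N$ and $v'_t=dt(v')+\omega(v'_x)$, which is minus the scalar product of $v'$ with $\partial_t$ in the metric $\lambda^{-1}g$. By rescaling the vectors at both ends by positive factors so that their time components are $1$, one gets the reduced relation $\mathcal S_{\rm red}(t,x,[1,v'_x])=(s,y,[1,w'_x])$. \textbf{Theorem.} (a) Let $\lambda=1$. For every lightlike geodesic $(t(\sigma),x(\sigma))$ on an interval there is a constant $k\neq0$ with $$\dot t+\omega(\dot x)=k,\qquad D_\sigma\dot x=kY\dot x,\qquad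 |\dot x|_h=|k|,$$ so that $t(\sigma)+\int_{\sigma_0}^{\sigma}\omega(\dot x)\,d\sigma-k\sigma$ is constant. The geodesic is future pointing if and only if $k>0$. An affine change of parameter $\sigma\mapsto c\sigma+d$, $c\ne0$, gives again a lightlike geodesic, with $k$ replaced by $ck$. (b) If $\mathcal S(t,x,[v'_t,v'_x])=(s,y,[w'_t,w'_x])$ and $v'_t=1$, then $\lambda(y)\,w'_t=\lambda(x)$ (in particular, $w'_t=1$ when $\lambda=1$), $$\mathcal S_{\rm mag}(x,v'_x)=(y,w'_x/w'_t),\qquad \ell_{\rm mag}(x,v'_x)=s-t+\int_{\gamma}\omega,$$ where $\gamma$ is the magnetic geodesic from $x$ to $y$ defining $\mathcal S_{\rm mag}(x,v'_x)$; in particular $s-t$ is the action of a magnetic geodesic from $x$ to $y$, and $\mathbb A(x,y)=s-t$ if $(N,h,\omega)$ is simple. (c) Let $n\ge2$ and let $(N,h,\omega)$, $(N,\hat h,\hat\omega)$ be simple, with smooth $\lambda,\hat\lambda>0$. Then the following are equivalent: (i) the scattering relations of $-(dt+\omega)^2+h$ and $-(dt+\hat\omega)^2+\hat h$ coincide; (ii)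 the reduced scattering relations of $\lambda(-(dt+\omega)^2+h)$ and $\hat\lambda(-(dt+\hat\omega)^2+\hat h)$ coincide; (iii) $\mathbb A=\hat{\mathbb A}$ on $\partial N\times\partial N$; (iv) $\mathcal S_{\rm mag}=\hat{\mathcal S}_{\rm mag}$, and $\omega=\hat\omega$ on $T\partial N$. So each of $\mathcal S$ and $\mathbb A$ determines the other, as well as $\mathcal S_{\rm mag}$ and the restriction of $\omega$ to $T\partial N$; and $\mathcal S_{\rm mag}$ determines $\mathcal S$ and $\mathbb A$ when this restriction is known. If only $\mathcal S_{\rm mag}=\hat{\mathcal S}_{\rm mag}$ is known, then there is a function $\varphi$ such that $\hat{\mathbb A}(x,y)=\mathbb A(x,y)+\varphi(x)-\varphi(y)$ for all $x,y\in\partial N$, and $\hat{\mathcal S}_{\rm red}(t,x,[1,v'_x])=(s,y,[1,w'_x])$ if and only if $\mathcal S_{\rm red}(t,x,[1,v'_x])=(s+\varphi(y)-\varphi(x),y,[1,w'_x])$. -/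

import Mathlib

open Set MeasureTheory Bundle
open scoped Manifold ContDiff Topology

noncomputable section

/-! ## Metrics, Christoffel symbols, geodesics on a manifold (possibly with boundary) -/

section General

variable {E : Type*} [NormedAddCommGroup E] [NormedSpace ℝ E]
  {H : Type*} [TopologicalSpace H] (I : ModelWithCorners ℝ E H)
  {M : Type*} [TopologicalSpace M] [ChartedSpace H M]

/-- A field `g(u, v)` of forms on pairs of tangent vectors; below, `g` is a Riemannian or a
Lorentzian metric. -/
abbrev TwoTensor (M : Type*) [TopologicalSpace M] [ChartedSpace H M] :=
  ∀ p : M, TangentSpace I p → TangentSpace I p → ℝ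

/-- The components of a tangent vector at `p` in the preferred chart at `p`. -/
def chartVec (p : M) : TangentSpace I p →L[ℝ] E :=
  mfderiv I 𝓘(ℝ, E) (extChartAt I p) p

/-- The velocity of a curve `γ` defined on an interval `J`. -/
def velocity (γ : ℝ → M) (J : Set ℝ) (σ : ℝ) : TangentSpace I (γ σ) :=
  mfderivWithin 𝓘(ℝ, ℝ) I γ J σ (1 : ℝ)

/-- `coordField I p z u` is the value, at the point with coordinates `z`, of the vector field with
constant components `u` in the preferred chart at `p`. -/
def coordField (p : M) (z : E) : E →L[ℝ] TangentSpace I ((extChartAt I p).symm z) :=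
  mfderivWithin 𝓘(ℝ, E) I (extChartAt I p).symm (range I) z

/-- `g_{ij}(z) u^i v^j` in the preferred chart at `p`. -/
def chartMetric (g : TwoTensor I M) (p : M) (z u v : E) : ℝ :=
  g ((extChartAt I p).symm z) (coordField I p z u) (coordField I p z v)

/-- `∂_k g_{ij} u^i v^j w^k` at `p` in the preferred chart at `p`. -/
def chartMetricDeriv (g : TwoTensor I M) (p : M) (w u v : E) : ℝ :=
  fderivWithin ℝ (fun z => chartMetric I g p z u v) (range I) (extChartAt I p p) w

/-- The Christoffel symbol of the first kind, `g(∇_u v, e)` for vector fields with constant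
components in the preferred chart at `p`, evaluated at `p`. -/
def christoffel (g : TwoTensor I M) (p : M) (u v e : E) : ℝ :=
  (1 / 2) * (chartMetricDeriv I g p u v e + chartMetricDeriv I g p v u e
    - chartMetricDeriv I g p e u v)

/-- `D_σ γ̇ = a` at the parameter `σ`, for the Levi-Civita connection of the nondegenerate
metric `g`; in the preferred chart at `γ σ` this reads
`g(a, e) = g(c'', e) + Γ(c', c'; e)` for all `e`, where `c` is the curve in the chart. -/
def HasCovAccel (g : TwoTensor I M) (γ : ℝ → M) (J : Set ℝ) (σ : ℝ)
    (a : TangentSpace I (γ σ)) : Prop :=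
  let c : ℝ → E := fun τ => extChartAt I (γ σ) (γ τ)
  ∀ e : TangentSpace I (γ σ),
    g (γ σ) a e =
      chartMetric I g (γ σ) (c σ) (derivWithin (derivWithin c J) J σ) (chartVec I (γ σ) e)
        + christoffel I g (γ σ) (derivWithin c J σ) (derivWithin c J σ) (chartVec I (γ σ) e)

/-- Smooth (affinely parametrized) geodesics on the interval `J`. -/
def IsGeodesicOn (g : TwoTensor I M) (γ : ℝ → M) (J : Set ℝ) : Prop :=
  ContMDiffOn 𝓘(ℝ, ℝ) I ∞ γ J ∧ ∀ σ ∈ J, HasCovAccel I g γ J σ 0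

/-- Nonzero null vectors. -/
def IsLightlike (g : TwoTensor I M) {p : M} (v : TangentSpace I p) : Prop :=
  v ≠ 0 ∧ g p v v = 0

/-- Geodesics with lightlike velocity. -/
def IsLightlikeGeodesicOn (g : TwoTensor I M) (γ : ℝ → M) (J : Set ℝ) : Prop :=
  IsGeodesicOn I g γ J ∧ ∀ σ ∈ J, IsLightlike I g (velocity I γ J σ)

/-- Smooth one-forms. -/
structure SmoothOneForm (M : Type*) [TopologicalSpace M] [ChartedSpace H M]
    [IsManifold I 1 M] where
  /-- The covector at each point. -/
  form : ∀ x : M, TangentSpace I x →L[ℝ] ℝ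
  contMDiff : ContMDiff I (I.prod 𝓘(ℝ, E →L[ℝ] ℝ)) ∞
    (fun x => TotalSpace.mk' (E →L[ℝ] ℝ) x (form x))

variable {I}

/-- The components `ω_j(z)` of a one-form in the preferred chart at `p`. -/
def chartForm [IsManifold I 1 M] (om : SmoothOneForm I M) (p : M) (z : E) : E →L[ℝ] ℝ :=
  (om.form ((extChartAt I p).symm z)).comp (coordField I p z)

/-- The exterior derivative `dω(u, v) = (∂_i ω_j - ∂_j ω_i) u^i v^j` at `p`. -/
def extD [IsManifold I 1 M] (om : SmoothOneForm I M) (p : M) (u v : TangentSpace I p) : ℝ :=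
  fderivWithin ℝ (chartForm om p) (range I) (extChartAt I p p) (chartVec I p u) (chartVec I p v)
    - fderivWithin ℝ (chartForm om p) (range I) (extChartAt I p p) (chartVec I p v)
        (chartVec I p u)

/-- `∫ ω` along the curve `γ` on the interval `J`, from `σ₀` to `σ`. -/
def lineIntegral [IsManifold I 1 M] (om : SmoothOneForm I M) (γ : ℝ → M) (J : Set ℝ)
    (σ₀ σ : ℝ) : ℝ :=
  ∫ τ in σ₀..σ, om.form (γ τ) (velocity I γ J τ)

end General

/-! ## Riemannian manifolds with boundary and magnetic systems -/

section Magnetic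

variable {n : ℕ} [NeZero n] {N : Type*} [TopologicalSpace N]
  [ChartedSpace (EuclideanHalfSpace n) N] [IsManifold (𝓡∂ n) ∞ N]

/-- Smooth Riemannian metrics on an `n`-dimensional manifold with boundary. -/
abbrev RMetric (n : ℕ) [NeZero n] (N : Type*) [TopologicalSpace N]
    [ChartedSpace (EuclideanHalfSpace n) N] [IsManifold (𝓡∂ n) ∞ N] :=
  ContMDiffRiemannianMetric (𝓡∂ n) ∞ (EuclideanSpace ℝ (Fin n))
    (fun x : N => TangentSpace (𝓡∂ n) x)

/-- The scalar product `(u, v)_h`. -/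
def hTensor (h : RMetric n N) : TwoTensor (𝓡∂ n) N := fun x u v => h.inner x u v

/-- The norm `|v|_h`. -/
def hNorm (h : RMetric n N) {x : N} (v : TangentSpace (𝓡∂ n) x) : ℝ :=
  Real.sqrt (h.inner x v v)

/-- The zeroth component of a tangent vector in the preferred chart at its base point `x`. The
manifold is `{z₀ ≥ 0}` in the chart, so at a boundary point the vectors with zero component are
those tangent to the boundary and those with positive component point strictly inwards. -/
def bdryComp {x : N} (v : TangentSpace (𝓡∂ n) x) : ℝ :=
  chartVec (𝓡∂ n) x v 0

/-- At a boundary point `x`: `v'` is the orthogonal projection of `v` to the tangent space of the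
boundary. -/
def IsBdryProj (h : RMetric n N) {x : N} (v v' : TangentSpace (𝓡∂ n) x) : Prop :=
  bdryComp v' = 0 ∧ ∀ u : TangentSpace (𝓡∂ n) x, bdryComp u = 0 → h.inner x (v - v') u = 0

/-- `ν` is the inward unit normal to the boundary at the boundary point `x`. -/
def IsInwardUnitNormal (h : RMetric n N) {x : N} (ν : TangentSpace (𝓡∂ n) x) : Prop :=
  0 < bdryComp ν ∧ h.inner x ν ν = 1 ∧
    ∀ u : TangentSpace (𝓡∂ n) x, bdryComp u = 0 → h.inner x ν u = 0

/-- The second fundamental form `h(∇_u u, ν)` of the boundary for `u` tangent to the boundary and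
`ν` the inward unit normal. (Constant components in the chart extend `u` to a field tangent to the
boundary.) -/
def secondForm (h : RMetric n N) (x : N) (u ν : TangentSpace (𝓡∂ n) x) : ℝ :=
  christoffel (𝓡∂ n) (hTensor h) x (chartVec (𝓡∂ n) x u) (chartVec (𝓡∂ n) x u)
    (chartVec (𝓡∂ n) x ν)

/-- The boundary is strictly convex: its second fundamental form is positive definite. -/
def HasStrictlyConvexBoundary (h : RMetric n N) : Prop :=
  ∀ x ∈ (𝓡∂ n).boundary N, ∀ u ν : TangentSpace (𝓡∂ n) x, u ≠ 0 → bdryComp u = 0 →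
    IsInwardUnitNormal h ν → 0 < secondForm h x u ν

theorem exists_extD_dual (h : RMetric n N) (om : SmoothOneForm (𝓡∂ n) N) (x : N)
    (u : TangentSpace (𝓡∂ n) x) :
    ∃ y : TangentSpace (𝓡∂ n) x, ∀ v, h.inner x y v = extD om x u v := by
  let V := TangentSpace (𝓡∂ n) x
  have : FiniteDimensional ℝ V :=
    inferInstanceAs (FiniteDimensional ℝ (EuclideanSpace ℝ (Fin n)))
  let L : V →ₗ[ℝ] Module.Dual ℝ V :=
    { toFun := fun y => (h.inner x y).toLinearMap
      map_add' := fun a b => by ext v; simp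
      map_smul' := fun a b => by ext v; simp }
  have hinj : Function.Injective L := by
    rw [injective_iff_map_eq_zero]
    intro y hy
    by_contra hne
    have h1 := h.pos x y hne
    have h2 : h.inner x y y = 0 := LinearMap.congr_fun hy y
    linarith
  have hsurj : Function.Surjective L :=
    (LinearMap.injective_iff_surjective_of_finrank_eq_finrank
      (Subspace.dual_finrank_eq (K := ℝ) (V := V)).symm).1 hinj
  let φ : Module.Dual ℝ V :=
    { toFun := fun v => extD om x u v
      map_add' := fun a b => by simp only [extD, map_add, add_apply]; ring
      map_smul' := fun a b => by
        simp only [extD, map_smul, smul_apply, smul_eq_mul, RingHom.id_apply]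
        ring }
  obtain ⟨y, hy⟩ := hsurj φ
  exact ⟨y, fun v => LinearMap.congr_fun hy v⟩

/-- The Lorentz force `Y : TN → TN`, defined by `(Y u, v)_h = dω(u, v)` for all `v`. -/
def lorentzForce (h : RMetric n N) (om : SmoothOneForm (𝓡∂ n) N) (x : N)
    (u : TangentSpace (𝓡∂ n) x) : TangentSpace (𝓡∂ n) x :=
  Classical.choose (exists_extD_dual h om x u)

/-- Solutions on the interval `J` of the magnetic geodesic equation `D_σ ẋ = k Y ẋ`. -/
def IsMagneticGeodesicOn (h : RMetric n N) (om : SmoothOneForm (𝓡∂ n) N) (k : ℝ)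
    (x : ℝ → N) (J : Set ℝ) : Prop :=
  ContMDiffOn 𝓘(ℝ, ℝ) (𝓡∂ n) ∞ x J ∧
    ∀ σ ∈ J, HasCovAccel (𝓡∂ n) (hTensor h) x J σ
      (k • lorentzForce h om (x σ) (velocity (𝓡∂ n) x J σ))

/-- Unit speed magnetic geodesics (`k = 1`) on the interval `J`. -/
def IsUnitMagneticGeodesicOn (h : RMetric n N) (om : SmoothOneForm (𝓡∂ n) N)
    (x : ℝ → N) (J : Set ℝ) : Prop :=
  IsMagneticGeodesicOn h om 1 x J ∧ ∀ σ ∈ J, hNorm h (velocity (𝓡∂ n) x J σ) = 1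

/-- `γ`, on `[0, ℓ]`, is the magnetic geodesic that enters `N` at the boundary point `X.proj`,
the projection of its initial velocity to the boundary being `X`, and that meets the boundary
again for the first time at `Y.proj`, the projection of its final velocity being `Y`. -/
def IsMagneticChord (h : RMetric n N) (om : SmoothOneForm (𝓡∂ n) N) (ℓ : ℝ) (γ : ℝ → N)
    (X Y : TangentBundle (𝓡∂ n) N) : Prop :=
  0 < ℓ ∧ IsUnitMagneticGeodesicOn h om γ (Icc 0 ℓ) ∧
  γ 0 ∈ (𝓡∂ n).boundary N ∧ γ ℓ ∈ (𝓡∂ n).boundary N ∧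
  (∀ σ ∈ Ioo 0 ℓ, γ σ ∈ (𝓡∂ n).interior N) ∧
  0 < bdryComp (velocity (𝓡∂ n) γ (Icc 0 ℓ) 0) ∧
  (∃ v', IsBdryProj h (velocity (𝓡∂ n) γ (Icc 0 ℓ) 0) v' ∧ X = ⟨γ 0, v'⟩) ∧
  (∃ w', IsBdryProj h (velocity (𝓡∂ n) γ (Icc 0 ℓ) ℓ) w' ∧ Y = ⟨γ ℓ, w'⟩)

/-- The (graph of the) magnetic scattering relation, `S_mag (x, v') = (y, w')`. -/
def MagneticScattering (h : RMetric n N) (om : SmoothOneForm (𝓡∂ n) N)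
    (X Y : TangentBundle (𝓡∂ n) N) : Prop :=
  ∃ ℓ γ, IsMagneticChord h om ℓ γ X Y

/-- The travel time `ℓ_mag (x, v')`: the length of the magnetic geodesic that enters `N` at `x` with
the projection `v'`. (The set has at most one element.) -/
def magneticTravelTime (h : RMetric n N) (om : SmoothOneForm (𝓡∂ n) N)
    (X : TangentBundle (𝓡∂ n) N) : ℝ :=
  sInf {ℓ | ∃ γ Y, IsMagneticChord h om ℓ γ X Y}

/-- The graph of the magnetic exponential map: `y = exp_x w`, where `W = (x, w)`. For `w ≠ 0`,
this means that the unit speed magnetic geodesic from `x` in the direction `w / |w|` stays in `N`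
up to the time `|w|`, when it is at `y`. -/
def IsMagneticExp (h : RMetric n N) (om : SmoothOneForm (𝓡∂ n) N)
    (W : TangentBundle (𝓡∂ n) N) (y : N) : Prop :=
  W = ⟨y, 0⟩ ∨
  ∃ ℓ γ, 0 < ℓ ∧ IsUnitMagneticGeodesicOn h om γ (Icc 0 ℓ) ∧
    W = ⟨γ 0, ℓ • velocity (𝓡∂ n) γ (Icc 0 ℓ) 0⟩ ∧ γ ℓ = y

/-- The pre-image of `N` under the magnetic exponential map at `x`. Tangent vectors at `x` are
identified with their components in the preferred chart at `x`. -/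
def magneticExpDomain (h : RMetric n N) (om : SmoothOneForm (𝓡∂ n) N) (x : N) :
    Set (EuclideanSpace ℝ (Fin n)) :=
  {w | ∃ (u : TangentSpace (𝓡∂ n) x) (y : N), chartVec (𝓡∂ n) x u = w ∧ IsMagneticExp h om ⟨x, u⟩ y}

/-- The magnetic exponential map at `x` is a diffeomorphism from its domain onto `N`. As usual, this
means a `C¹` diffeomorphism that is smooth away from the zero vector, since magnetic
exponential maps are in general not smooth at zero. -/
def MagneticExpIsDiffeo (h : RMetric n N) (om : SmoothOneForm (𝓡∂ n) N) (x : N) : Prop :=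
  ∃ (e : EuclideanSpace ℝ (Fin n) → N) (l : N → EuclideanSpace ℝ (Fin n)),
    (∀ (u : TangentSpace (𝓡∂ n) x) (y : N), IsMagneticExp h om ⟨x, u⟩ y ↔
      chartVec (𝓡∂ n) x u ∈ magneticExpDomain h om x ∧ e (chartVec (𝓡∂ n) x u) = y) ∧
    (∀ w ∈ magneticExpDomain h om x, l (e w) = w) ∧
    (∀ y, l y ∈ magneticExpDomain h om x ∧ e (l y) = y) ∧
    ContMDiffOn 𝓘(ℝ, EuclideanSpace ℝ (Fin n)) (𝓡∂ n) 1 e (magneticExpDomain h om x) ∧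
    ContMDiffOn 𝓘(ℝ, EuclideanSpace ℝ (Fin n)) (𝓡∂ n) ∞ e (magneticExpDomain h om x \ {0}) ∧
    ContMDiff (𝓡∂ n) 𝓘(ℝ, EuclideanSpace ℝ (Fin n)) 1 l ∧
    ContMDiffOn (𝓡∂ n) 𝓘(ℝ, EuclideanSpace ℝ (Fin n)) ∞ l {x}ᶜ

/-- The boundary is strictly convex with respect to the magnetic flow, in either direction:
`II(u, u) > (Y u, ν)_h` for all unit vectors `u` tangent to the boundary, with `ν` the inward
unit normal. (Replacing `u` by `-u` gives the convexity for the reversed flow.) -/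
def HasMagneticallyConvexBoundary (h : RMetric n N) (om : SmoothOneForm (𝓡∂ n) N) : Prop :=
  ∀ x ∈ (𝓡∂ n).boundary N, ∀ u ν : TangentSpace (𝓡∂ n) x, hNorm h u = 1 → bdryComp u = 0 →
    IsInwardUnitNormal h ν → h.inner x (lorentzForce h om x u) ν < secondForm h x u ν

/-- Simple magnetic systems. -/
def IsSimpleMagnetic (h : RMetric n N) (om : SmoothOneForm (𝓡∂ n) N) : Prop :=
  (∀ x : N, MagneticExpIsDiffeo h om x) ∧ HasMagneticallyConvexBoundary h om

/-- `a` is the action `ℓ - ∫_γ ω` of a unit speed magnetic geodesic `γ` from `x` to `y` (of length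
`ℓ`); the action of the constant curve is `0`. -/
def IsMagneticAction (h : RMetric n N) (om : SmoothOneForm (𝓡∂ n) N) (x y : N) (a : ℝ) : Prop :=
  (x = y ∧ a = 0) ∨
  ∃ ℓ γ, 0 < ℓ ∧ IsUnitMagneticGeodesicOn h om γ (Icc 0 ℓ) ∧ γ 0 = x ∧ γ ℓ = y ∧
    a = ℓ - lineIntegral om γ (Icc 0 ℓ) 0 ℓ

/-- The action function `𝔸(x, y)`; for a simple magnetic system, the set has exactly one element. -/
def magneticAction (h : RMetric n N) (om : SmoothOneForm (𝓡∂ n) N) (x y : N) : ℝ :=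
  sInf {a | IsMagneticAction h om x y a}

end Magnetic

/-! ## Stationary Lorentzian metrics on `ℝ × N` -/

section Stationary

/-- The model of `ℝ × N`. -/
abbrev stModel (n : ℕ) [NeZero n] :
    ModelWithCorners ℝ (ℝ × EuclideanSpace ℝ (Fin n)) (ModelProd ℝ (EuclideanHalfSpace n)) :=
  𝓘(ℝ, ℝ).prod (𝓡∂ n)

variable {n : ℕ} [NeZero n] {N : Type*} [TopologicalSpace N]
  [ChartedSpace (EuclideanHalfSpace n) N] [IsManifold (𝓡∂ n) ∞ N]

/-- The time component `v_t = dt(v)`. -/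
def dTime (p : ℝ × N) : TangentSpace (stModel n) p →L[ℝ] ℝ :=
  mfderiv (stModel n) 𝓘(ℝ, ℝ) (Prod.fst : ℝ × N → ℝ) p

/-- The spatial component `v_x = dπ(v)`, with `π` the projection `ℝ × N → N`. -/
def dSpace (p : ℝ × N) : TangentSpace (stModel n) p →L[ℝ] TangentSpace (𝓡∂ n) p.2 :=
  mfderiv (stModel n) (𝓡∂ n) (Prod.snd : ℝ × N → N) p

/-- The Killing vector field `∂/∂t`. -/
def partialT (p : ℝ × N) : TangentSpace (stModel n) p :=
  mfderiv 𝓘(ℝ, ℝ) (stModel n) (fun s : ℝ => (s, p.2)) p.1 (1 : ℝ)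

/-- The covector `dt + ω`. -/
def dtPlus (om : SmoothOneForm (𝓡∂ n) N) (p : ℝ × N) : TangentSpace (stModel n) p →L[ℝ] ℝ :=
  dTime p + (om.form p.2).comp (dSpace p)

/-- The stationary metric `λ (-(dt + ω)² + h)` on `ℝ × N`. -/
def stationaryMetric (lam : N → ℝ) (om : SmoothOneForm (𝓡∂ n) N) (h : RMetric n N) :
    TwoTensor (stModel n) (ℝ × N) := fun p v w =>
  lam p.2 * (-(dtPlus om p v * dtPlus om p w) + h.inner p.2 (dSpace p v) (dSpace p w))

/-- Future pointing lightlike vectors: `(v, ∂/∂t)_g < 0`. -/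
def IsFuturePointing (g : TwoTensor (stModel n) (ℝ × N)) {p : ℝ × N}
    (v : TangentSpace (stModel n) p) : Prop :=
  g p v (partialT p) < 0

/-- At a point `p` of `∂(ℝ × N) = ℝ × ∂N`: `v'` is the `g`-orthogonal projection of `v` to the tangent
space of the boundary. -/
def IsLateralProj (g : TwoTensor (stModel n) (ℝ × N)) {p : ℝ × N}
    (v v' : TangentSpace (stModel n) p) : Prop :=
  bdryComp (dSpace p v') = 0 ∧
    ∀ u : TangentSpace (stModel n) p, bdryComp (dSpace p u) = 0 → g p (v - v') u = 0

/-- The (graph of the) Lorentzian scattering relation of `g` on the lateral boundary `ℝ × ∂N`: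
`S P = Q` if `P`, `Q` are the projections to the boundary of the initial and the final velocity of a
future pointing lightlike geodesic that enters `ℝ × N` at the boundary point `P.proj` and meets
the boundary again for the first time at `Q.proj`. -/
def LorentzScattering (g : TwoTensor (stModel n) (ℝ × N))
    (P Q : TangentBundle (stModel n) (ℝ × N)) : Prop :=
  ∃ (b : ℝ) (Γ : ℝ → ℝ × N), 0 < b ∧
    IsLightlikeGeodesicOn (stModel n) g Γ (Icc 0 b) ∧
    (∀ σ ∈ Icc 0 b, IsFuturePointing g (velocity (stModel n) Γ (Icc 0 b) σ)) ∧
    (Γ 0).2 ∈ (𝓡∂ n).boundary N ∧ (Γ b).2 ∈ (𝓡∂ n).boundary N ∧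
    (∀ σ ∈ Ioo 0 b, (Γ σ).2 ∈ (𝓡∂ n).interior N) ∧
    0 < bdryComp (dSpace (Γ 0) (velocity (stModel n) Γ (Icc 0 b) 0)) ∧
    (∃ v', IsLateralProj g (velocity (stModel n) Γ (Icc 0 b) 0) v' ∧ P = ⟨Γ 0, v'⟩) ∧
    (∃ w', IsLateralProj g (velocity (stModel n) Γ (Icc 0 b) b) w' ∧ Q = ⟨Γ b, w'⟩)

/-- The component `v'_t = -(v', ∂/∂t)` in the notation `v' = [v'_t, v'_x]`, computed in the normalized
metric `-(dt + ω)² + h`. -/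
def timePart (om : SmoothOneForm (𝓡∂ n) N) (h : RMetric n N)
    (P : TangentBundle (stModel n) (ℝ × N)) : ℝ :=
  -stationaryMetric (fun _ => 1) om h P.proj P.snd (partialT P.proj)

/-- The component `v'_x = dπ(v')` in the notation `v' = [v'_t, v'_x]`, with its base point. -/
def spacePart (P : TangentBundle (stModel n) (ℝ × N)) : TangentBundle (𝓡∂ n) N :=
  ⟨P.proj.2, dSpace P.proj P.snd⟩

/-- Multiplication of tangent vectors by a scalar. -/
def scaleVec (c : ℝ) (X : TangentBundle (𝓡∂ n) N) : TangentBundle (𝓡∂ n) N :=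
  ⟨X.proj, c • X.snd⟩

/-- The reduced scattering relation `S(t, x, [1, v'_x]) = (s, y, [1, w'_x])`, where `X = (x, v'_x)` and
`Y = (y, w'_x)`: the scattering relation with the vectors at both ends rescaled by positive
factors so that their time components are `1`. -/
def ReducedScattering (lam : N → ℝ) (om : SmoothOneForm (𝓡∂ n) N) (h : RMetric n N)
    (t : ℝ) (X : TangentBundle (𝓡∂ n) N) (s : ℝ) (Y : TangentBundle (𝓡∂ n) N) : Prop :=
  ∃ P Q, LorentzScattering (stationaryMetric lam om h) P Q ∧
    P.proj.1 = t ∧ timePart om h P = 1 ∧ spacePart P = X ∧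
    Q.proj.1 = s ∧ scaleVec (timePart om h Q)⁻¹ (spacePart Q) = Y

end Stationary

end

section Development

open Filter

set_option maxSynthPendingDepth 3
set_option linter.unusedSectionVars false

section GeneralCharts

variable {E : Type*} [NormedAddCommGroup E] [NormedSpace ℝ E]
  {H : Type*} [TopologicalSpace H] {I : ModelWithCorners ℝ E H}
  {M : Type*} [TopologicalSpace M] [ChartedSpace H M]

theorem chartVec_apply [IsManifold I 1 M] (p : M) (v : TangentSpace I p) :
    chartVec I p v = v := by
  unfold chartVec
  rw [mfderiv_extChartAt_self]
  rfl

theorem coordField_self [IsManifold I 1 M] (p : M) (u : E) :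
    (coordField I p (extChartAt I p p) u : E) = u := by
  unfold coordField
  rw [mfderivWithin_range_extChartAt_symm]
  rfl

theorem velocity_eq_derivWithin {γ : ℝ → M} {J : Set ℝ} {σ : ℝ}
    (h : MDifferentiableWithinAt 𝓘(ℝ, ℝ) I γ J σ) :
    (velocity I γ J σ : E) = derivWithin (fun τ => extChartAt I (γ σ) (γ τ)) J σ := by
  have h1 : (velocity I γ J σ : E) = fderivWithin ℝ (writtenInExtChartAt 𝓘(ℝ, ℝ) I σ γ)
      ((extChartAt 𝓘(ℝ, ℝ) σ).symm ⁻¹' J ∩ range 𝓘(ℝ, ℝ)) (extChartAt 𝓘(ℝ, ℝ) σ σ) (1 : ℝ) :=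
    DFunLike.congr_fun h.mfderivWithin (1 : ℝ)
  rw [h1]
  simp [writtenInExtChartAt, derivWithin, Function.comp_def]
  rfl

theorem chart_velocity [IsManifold I 1 M] {γ : ℝ → M} {J : Set ℝ} {σ : ℝ} {p : M}
    (h : MDifferentiableWithinAt 𝓘(ℝ, ℝ) I γ J σ) (hJ : UniqueDiffWithinAt ℝ J σ)
    (hp : γ σ ∈ (chartAt H p).source) :
    mfderiv I 𝓘(ℝ, E) (extChartAt I p) (γ σ) (velocity I γ J σ)
      = derivWithin (fun τ => extChartAt I p (γ τ)) J σ := by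
  have h1 := mfderiv_comp_mfderivWithin σ (mdifferentiableAt_extChartAt (I := I) hp) h
    hJ.uniqueMDiffWithinAt
  have h2 : mfderivWithin 𝓘(ℝ, ℝ) 𝓘(ℝ, E) ((extChartAt I p) ∘ γ) J σ (1 : ℝ)
      = derivWithin (fun τ => extChartAt I p (γ τ)) J σ := by
    rw [mfderivWithin_eq_fderivWithin]; rfl
  rw [← h2, h1]
  rfl

theorem velocity_eq_coordField [IsManifold I 1 M] {γ : ℝ → M} {J : Set ℝ} {σ : ℝ} {p : M}
    (h : MDifferentiableWithinAt 𝓘(ℝ, ℝ) I γ J σ) (hJ : UniqueDiffWithinAt ℝ J σ)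
    (hp : γ σ ∈ (chartAt H p).source) :
    (velocity I γ J σ : E) = coordField I p (extChartAt I p (γ σ))
      (derivWithin (fun τ => extChartAt I p (γ τ)) J σ) := by
  rw [← chart_velocity h hJ hp]
  have := mfderivWithin_extChartAt_symm_comp_mfderiv_extChartAt' (I := I)
    (x := p) (y := γ σ) (by simpa using hp)
  exact (DFunLike.congr_fun this (velocity I γ J σ)).symm

end GeneralCharts

section HalfSpace

variable {n : ℕ} [NeZero n]

theorem range_halfSpace_model : range (𝓡∂ n) = {z : EuclideanSpace ℝ (Fin n) | 0 ≤ z 0} :=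
  range_euclideanHalfSpace n

end HalfSpace
noncomputable section ChartObjects

variable {n : ℕ} [NeZero n] {N : Type*} [TopologicalSpace N]
  [ChartedSpace (EuclideanHalfSpace n) N] [IsManifold (𝓡∂ n) ∞ N]

local notation "𝔼" => EuclideanSpace ℝ (Fin n)

/-- The metric coefficients in the preferred chart at `p`, as a bilinear form. -/
def metC (h : RMetric n N) (p : N) (z : EuclideanSpace ℝ (Fin n)) :
    EuclideanSpace ℝ (Fin n) →L[ℝ] EuclideanSpace ℝ (Fin n) →L[ℝ] ℝ :=
  let A : EuclideanSpace ℝ (Fin n) →L[ℝ] EuclideanSpace ℝ (Fin n) := coordField (𝓡∂ n) p z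
  let B : EuclideanSpace ℝ (Fin n) →L[ℝ] EuclideanSpace ℝ (Fin n) →L[ℝ] ℝ :=
    h.inner ((extChartAt (𝓡∂ n) p).symm z)
  B.bilinearComp A A

theorem metC_apply (h : RMetric n N) (p : N) (z u v : EuclideanSpace ℝ (Fin n)) :
    metC h p z u v = h.inner ((extChartAt (𝓡∂ n) p).symm z) (coordField (𝓡∂ n) p z u)
      (coordField (𝓡∂ n) p z v) := rfl

theorem metC_symm (h : RMetric n N) (p : N) (z u v : EuclideanSpace ℝ (Fin n)) :
    metC h p z u v = metC h p z v u := h.symm _ _ _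

theorem contMDiffOn_coordField (p : N) (u : EuclideanSpace ℝ (Fin n)) :
    ContMDiffOn 𝓘(ℝ, 𝔼) ((𝓡∂ n).prod 𝓘(ℝ, 𝔼)) ∞
      (fun z => TotalSpace.mk' 𝔼 (E := TangentSpace (𝓡∂ n)) ((extChartAt (𝓡∂ n) p).symm z)
        (coordField (𝓡∂ n) p z u)) (extChartAt (𝓡∂ n) p).target := by
  have h1 : ContMDiffOn 𝓘(ℝ, 𝔼) (𝓡∂ n) ∞ (extChartAt (𝓡∂ n) p).symm
    (extChartAt (𝓡∂ n) p).target := contMDiffOn_extChartAt_symm p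
  let e := trivializationAt 𝔼 (TangentSpace (𝓡∂ n)) p
  have h2 := e.contMDiffOn_symm (n := ∞) (IB := 𝓡∂ n)
  have hsrc : ∀ z ∈ (extChartAt (𝓡∂ n) p).target,
      (extChartAt (𝓡∂ n) p).symm z ∈ (chartAt (EuclideanHalfSpace n) p).source := fun z hz => by
    have := (extChartAt (𝓡∂ n) p).map_target hz
    simpa using this
  have h3 : ContMDiffOn 𝓘(ℝ, 𝔼) ((𝓡∂ n).prod 𝓘(ℝ, 𝔼)) ∞
      (fun z : 𝔼 => ((extChartAt (𝓡∂ n) p).symm z, u)) (extChartAt (𝓡∂ n) p).target :=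
    h1.prodMk contMDiffOn_const
  have h4 := h2.comp h3 (fun z hz => by
    simpa [e, Trivialization.mem_target] using hsrc z hz)
  refine h4.congr fun z hz => ?_
  simp only [Function.comp]
  have hb : (extChartAt (𝓡∂ n) p).symm z ∈ e.baseSet := by simpa [e] using hsrc z hz
  rw [← e.mk_symm hb, ← Trivialization.symmL_apply (R := ℝ) e hb]
  have h5 := TangentBundle.symmL_trivializationAt (I := 𝓡∂ n) (hsrc z hz)
  rw [(extChartAt (𝓡∂ n) p).right_inv hz] at h5
  congr 1
  exact (DFunLike.congr_fun h5 u).symm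

theorem contDiffOn_metC (h : RMetric n N) (p : N) :
    ContDiffOn ℝ ∞ (metC h p) (extChartAt (𝓡∂ n) p).target := by
  rw [contDiffOn_clm_apply]
  intro u
  rw [contDiffOn_clm_apply]
  intro v
  rw [← contMDiffOn_iff_contDiffOn]
  have h1 : ContMDiffOn 𝓘(ℝ, 𝔼) (𝓡∂ n) ∞ (extChartAt (𝓡∂ n) p).symm
    (extChartAt (𝓡∂ n) p).target := contMDiffOn_extChartAt_symm p
  have h2 := h.contMDiff.comp_contMDiffOn h1
  have h3 := ContMDiffOn.clm_bundle_apply₂ (F₁ := 𝔼) (F₂ := 𝔼) (F₃ := ℝ)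
    (E₃ := Bundle.Trivial N ℝ) h2 (contMDiffOn_coordField p u) (contMDiffOn_coordField p v)
  intro z hz
  have h4 := h3 z hz
  rw [contMDiffWithinAt_totalSpace] at h4
  exact h4.2

/-- The components of a one-form in the preferred chart at `p`. -/
def formC (om : SmoothOneForm (𝓡∂ n) N) (p : N) (z : EuclideanSpace ℝ (Fin n)) :
    EuclideanSpace ℝ (Fin n) →L[ℝ] ℝ := chartForm om p z

theorem formC_apply (om : SmoothOneForm (𝓡∂ n) N) (p : N) (z u : EuclideanSpace ℝ (Fin n)) :
    formC om p z u = om.form ((extChartAt (𝓡∂ n) p).symm z) (coordField (𝓡∂ n) p z u) := rfl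

theorem contDiffOn_formC (om : SmoothOneForm (𝓡∂ n) N) (p : N) :
    ContDiffOn ℝ ∞ (formC om p) (extChartAt (𝓡∂ n) p).target := by
  rw [contDiffOn_clm_apply]
  intro u
  rw [← contMDiffOn_iff_contDiffOn]
  have h1 : ContMDiffOn 𝓘(ℝ, 𝔼) (𝓡∂ n) ∞ (extChartAt (𝓡∂ n) p).symm
    (extChartAt (𝓡∂ n) p).target := contMDiffOn_extChartAt_symm p
  intro z hz
  have h2 : ContMDiffWithinAt 𝓘(ℝ, 𝔼) ((𝓡∂ n).prod 𝓘(ℝ, 𝔼 →L[ℝ] ℝ)) ∞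
    (fun z => TotalSpace.mk' (𝔼 →L[ℝ] ℝ)
      (E := fun x : N => TangentSpace (𝓡∂ n) x →L[ℝ] Bundle.Trivial N ℝ x)
      ((extChartAt (𝓡∂ n) p).symm z)
      (om.form ((extChartAt (𝓡∂ n) p).symm z))) (extChartAt (𝓡∂ n) p).target z := by
    exact (om.contMDiff.comp_contMDiffOn h1) z hz
  have h3 := ContMDiffWithinAt.clm_bundle_apply (F₁ := 𝔼) (F₂ := ℝ)
    (E₂ := Bundle.Trivial N ℝ) h2 (contMDiffOn_coordField p u z hz)
  rw [contMDiffWithinAt_totalSpace] at h3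
  exact h3.2

end ChartObjects

section LocalEquation

variable {E : Type*} [NormedAddCommGroup E] [NormedSpace ℝ E]

/-- The magnetic geodesic equation with strength `k` for metric coefficients `m` and one-form
components `f`, at the point `z`, for the velocity `u` and the second derivative `a`. -/
def MagEqAt (S : Set E) (m : E → E →L[ℝ] E →L[ℝ] ℝ) (f : E → E →L[ℝ] ℝ) (k : ℝ) (z u a : E) :
    Prop :=
  ∀ e, m z a e + (fderivWithin ℝ m S z u u e - (1 / 2) * fderivWithin ℝ m S z e u u)
    = k * (fderivWithin ℝ f S z u e - fderivWithin ℝ f S z e u)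

theorem hasDerivWithinAt_of_contDiffWithinAt {J : Set ℝ} {σ : ℝ} {c : ℝ → E}
    (hc : ContDiffWithinAt ℝ 2 c J σ) (hJ : UniqueDiffOn ℝ J) (hσ : σ ∈ J) :
    HasDerivWithinAt (derivWithin c J) (derivWithin (derivWithin c J) J σ) J σ ∧
      ∀ᶠ τ in 𝓝[J] σ, HasDerivWithinAt c (derivWithin c J τ) J τ := by
  have h1 : ContDiffWithinAt ℝ 1 (derivWithin c J) J σ :=
    (hc.fderivWithin_right hJ (m := 1) (by norm_num) hσ).clm_apply contDiffWithinAt_const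
  refine ⟨(h1.differentiableWithinAt (by norm_num)).hasDerivWithinAt, ?_⟩
  have h2 := hc.eventually (by simp)
  rw [insert_eq_of_mem hσ] at h2
  filter_upwards [h2] with τ hτ
  exact (hτ.differentiableWithinAt (by norm_num)).hasDerivWithinAt

set_option synthInstance.maxHeartbeats 200000 in
set_option maxHeartbeats 1000000 in
theorem MagEqAt.pullback {S : Set E} {m m' : E → E →L[ℝ] E →L[ℝ] ℝ} {f f' : E → E →L[ℝ] ℝ}
    {φ : E → E} {y₀ : E} (hS : UniqueDiffOn ℝ S) (hy : y₀ ∈ S) (hyi : y₀ ∈ closure (interior S))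
    (hφ : ContDiffWithinAt ℝ 2 φ S y₀) (hmaps : ∀ᶠ y in 𝓝[S] y₀, φ y ∈ S)
    (hm : DifferentiableWithinAt ℝ m S (φ y₀)) (hf : DifferentiableWithinAt ℝ f S (φ y₀))
    (hms : ∀ u v, m (φ y₀) u v = m (φ y₀) v u)
    (hm' : ∀ᶠ y in 𝓝[S] y₀, ∀ u v,
      m' y u v = m (φ y) (fderivWithin ℝ φ S y u) (fderivWithin ℝ φ S y v))
    (hf' : ∀ᶠ y in 𝓝[S] y₀, ∀ u, f' y u = f (φ y) (fderivWithin ℝ φ S y u))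
    (hdm' : DifferentiableWithinAt ℝ m' S y₀) (hdf' : DifferentiableWithinAt ℝ f' S y₀)
    {J : Set ℝ} {σ : ℝ} {c : ℝ → E} (hc : ContDiffWithinAt ℝ 2 c J σ) (hJ : UniqueDiffOn ℝ J)
    (hσ : σ ∈ J) (hcS : ∀ᶠ τ in 𝓝[J] σ, c τ ∈ S) (hc0 : c σ = y₀) {k : ℝ}
    (heq : MagEqAt S m f k (φ y₀) (derivWithin (φ ∘ c) J σ)
      (derivWithin (derivWithin (φ ∘ c) J) J σ)) :
    MagEqAt S m' f' k y₀ (derivWithin c J σ) (derivWithin (derivWithin c J) J σ) := by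
  obtain ⟨hc2, hc1⟩ := hasDerivWithinAt_of_contDiffWithinAt hc hJ hσ
  set B := fderivWithin ℝ (fderivWithin ℝ φ S) S y₀ with hB
  set A := fderivWithin ℝ φ S y₀ with hA
  have hsymm : ∀ v w, B v w = B w v := fun v w =>
    (hφ.isSymmSndFDerivWithinAt (by simp) hS hyi hy).eq v w
  have hφd : ∀ᶠ y in 𝓝[S] y₀, HasFDerivWithinAt φ (fderivWithin ℝ φ S y) S y := by
    have h2 := hφ.eventually (by simp)
    rw [insert_eq_of_mem hy] at h2
    filter_upwards [h2] with y h
    exact (h.differentiableWithinAt (by norm_num)).hasFDerivWithinAt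
  have hφ2 : HasFDerivWithinAt (fderivWithin ℝ φ S) B S y₀ := by
    have h1 := hφ.fderivWithin_right hS (m := 1) (by norm_num) hy
    exact (h1.differentiableWithinAt (by norm_num)).hasFDerivWithinAt
  have hφ1 : HasFDerivWithinAt φ A S y₀ := hφd.self_of_nhdsWithin hy
  -- the curve
  have hctend : Tendsto c (𝓝[J] σ) (𝓝[S] y₀) := by
    rw [← hc0]
    exact tendsto_nhdsWithin_of_tendsto_nhds_of_eventually_within _
      (hc.continuousWithinAt) hcS
  have hd1 : ∀ᶠ τ in 𝓝[J] σ, HasDerivWithinAt (φ ∘ c)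
      (fderivWithin ℝ φ S (c τ) (derivWithin c J τ)) J τ := by
    have hcS' : ∀ᶠ τ in 𝓝[J] σ, ∀ᶠ τ' in 𝓝[J] τ, c τ' ∈ S :=
      eventually_eventually_nhdsWithin.2 hcS
    filter_upwards [hc1, hctend.eventually hφd, hcS'] with τ h1 h2 h3
    have h4 := h2.mono_of_mem_nhdsWithin (t := S) self_mem_nhdsWithin
    have h5 : HasDerivWithinAt (φ ∘ c) (fderivWithin ℝ φ S (c τ) (derivWithin c J τ))
        (J ∩ c ⁻¹' S) τ :=
      HasFDerivWithinAt.comp_hasDerivWithinAt τ h4 (h1.mono inter_subset_left) (fun x hx => hx.2)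
    exact h5.mono_of_mem_nhdsWithin (inter_mem self_mem_nhdsWithin h3)
  have hd1' : ∀ᶠ τ in 𝓝[J] σ, derivWithin (φ ∘ c) J τ
      = fderivWithin ℝ φ S (c τ) (derivWithin c J τ) := by
    filter_upwards [hd1, self_mem_nhdsWithin] with τ h hτ
    exact h.derivWithin (hJ τ hτ)
  have e1 : derivWithin (φ ∘ c) J σ = A (derivWithin c J σ) := by
    have := hd1'.self_of_nhdsWithin hσ
    rwa [hc0] at this
  have e2 : derivWithin (derivWithin (φ ∘ c) J) J σ
      = B (derivWithin c J σ) (derivWithin c J σ) + A (derivWithin (derivWithin c J) J σ) := by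
    have h1 : HasDerivWithinAt (fun τ => fderivWithin ℝ φ S (c τ)) (B (derivWithin c J σ)) J σ := by
      have h5 : HasDerivWithinAt (fderivWithin ℝ φ S ∘ c) (B (derivWithin c J σ))
        (J ∩ c ⁻¹' S) σ :=
        HasFDerivWithinAt.comp_hasDerivWithinAt σ (t := S) (by rw [hc0]; exact hφ2)
          ((hc1.self_of_nhdsWithin hσ).mono inter_subset_left) (fun x hx => hx.2)
      exact h5.mono_of_mem_nhdsWithin (inter_mem self_mem_nhdsWithin hcS)
    have h2 := h1.clm_apply hc2
    rw [hc0] at h2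
    have h3 := h2.congr_of_eventuallyEq (f₁ := derivWithin (φ ∘ c) J)
      hd1' (hd1'.self_of_nhdsWithin hσ)
    exact h3.derivWithin (hJ σ hσ)
  rw [e1, e2] at heq
  -- derivatives of the coefficients
  have hmc : HasFDerivWithinAt (m ∘ φ) ((fderivWithin ℝ m S (φ y₀)).comp A) S y₀ := by
    have h5 : HasFDerivWithinAt (m ∘ φ) ((fderivWithin ℝ m S (φ y₀)).comp A) (S ∩ φ ⁻¹' S) y₀ :=
      HasFDerivWithinAt.comp (F := E) (G := E →L[ℝ] E →L[ℝ] ℝ) (g := m) (f := φ) (t := S) y₀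
      hm.hasFDerivWithinAt (hφ1.mono (inter_subset_left (t := φ ⁻¹' S))) (fun x hx => hx.2)
    exact h5.mono_of_mem_nhdsWithin (inter_mem self_mem_nhdsWithin hmaps)
  have hfc : HasFDerivWithinAt (f ∘ φ) ((fderivWithin ℝ f S (φ y₀)).comp A) S y₀ := by
    have h5 := hf.hasFDerivWithinAt.comp y₀
      (hφ1.mono (inter_subset_left (t := φ ⁻¹' S))) (fun x hx => hx.2)
    exact h5.mono_of_mem_nhdsWithin (inter_mem self_mem_nhdsWithin hmaps)
  have hφu : ∀ u, HasFDerivWithinAt (fun y => fderivWithin ℝ φ S y u) (B.flip u) S y₀ := by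
    intro u
    have := hφ2.clm_apply (hasFDerivWithinAt_const u y₀ S)
    convert this using 1
    ext w; simp
  have hDm : ∀ w u v, fderivWithin ℝ m' S y₀ w u v
      = fderivWithin ℝ m S (φ y₀) (A w) (A u) (A v) + m (φ y₀) (B w u) (A v)
        + m (φ y₀) (A u) (B w v) := by
    intro w u v
    have h1 : HasFDerivWithinAt (fun y => m' y u v)
        ((((fderivWithin ℝ m' S y₀).flip u).flip v)) S y₀ := by
      have := (hdm'.hasFDerivWithinAt.clm_apply (hasFDerivWithinAt_const u y₀ S)).clm_apply
        (hasFDerivWithinAt_const v y₀ S)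
      exact this.congr_fderiv (by ext w; simp)
    have h2 := ((hmc.clm_apply (hφu u)).clm_apply (hφu v)).congr_of_eventuallyEq
      (f₁ := fun y => m' y u v) (by filter_upwards [hm'] with y h using h u v)
      (hm'.self_of_nhdsWithin hy u v)
    have h3 := DFunLike.congr_fun ((hS y₀ hy).eq h1 h2) w
    simp at h3
    rw [h3]
    ring
  have hDf : ∀ w u, fderivWithin ℝ f' S y₀ w u
      = fderivWithin ℝ f S (φ y₀) (A w) (A u) + f (φ y₀) (B w u) := by
    intro w u
    have h1 : HasFDerivWithinAt (fun y => f' y u)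
        ((fderivWithin ℝ f' S y₀).flip u) S y₀ := by
      have := (hdf'.hasFDerivWithinAt.clm_apply (hasFDerivWithinAt_const u y₀ S))
      exact this.congr_fderiv (by ext w; simp)
    have h2 := (hfc.clm_apply (hφu u)).congr_of_eventuallyEq
      (f₁ := fun y => f' y u) (by filter_upwards [hf'] with y h using h u)
      (hf'.self_of_nhdsWithin hy u)
    have h3 := DFunLike.congr_fun ((hS y₀ hy).eq h1 h2) w
    simp at h3
    rw [h3]
    ring
  intro e
  have h := heq (A e)
  rw [hDm, hDm, hDf, hDf, hm'.self_of_nhdsWithin hy]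
  simp only [map_add, add_apply] at h
  rw [hsymm e (derivWithin c J σ)]
  have := hms (B (derivWithin c J σ) e) (A (derivWithin c J σ))
  linarith

end LocalEquation

section MagneticEquation

variable {n : ℕ} [NeZero n] {N : Type*} [TopologicalSpace N]
  [ChartedSpace (EuclideanHalfSpace n) N] [IsManifold (𝓡∂ n) ∞ N]

local notation "𝔼" => EuclideanSpace ℝ (Fin n)

theorem inner_lorentzForce (h : RMetric n N) (om : SmoothOneForm (𝓡∂ n) N) (x : N)
    (u v : TangentSpace (𝓡∂ n) x) : h.inner x (lorentzForce h om x u) v = extD om x u v :=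
  Classical.choose_spec (exists_extD_dual h om x u) v

theorem differentiableWithinAt_metC (h : RMetric n N) (p : N) {z : 𝔼}
    (hz : z ∈ (extChartAt (𝓡∂ n) p).target) :
    DifferentiableWithinAt ℝ (metC h p) (range (𝓡∂ n)) z :=
  ((contDiffOn_metC h p z hz).differentiableWithinAt (by simp)).mono_of_mem_nhdsWithin
    (extChartAt_target_mem_nhdsWithin_of_mem hz)

theorem differentiableWithinAt_formC (om : SmoothOneForm (𝓡∂ n) N) (p : N) {z : 𝔼}
    (hz : z ∈ (extChartAt (𝓡∂ n) p).target) :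
    DifferentiableWithinAt ℝ (formC om p) (range (𝓡∂ n)) z :=
  ((contDiffOn_formC om p z hz).differentiableWithinAt (by simp)).mono_of_mem_nhdsWithin
    (extChartAt_target_mem_nhdsWithin_of_mem hz)

theorem chartMetricDeriv_hTensor (h : RMetric n N) (p : N) (w u v : 𝔼) :
    chartMetricDeriv (𝓡∂ n) (hTensor h) p w u v
      = fderivWithin ℝ (metC h p) (range (𝓡∂ n)) (extChartAt (𝓡∂ n) p p) w u v := by
  unfold chartMetricDeriv
  have h0 := (differentiableWithinAt_metC h p (mem_extChartAt_target p)).hasFDerivWithinAt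
  have h1 := (h0.clm_apply (hasFDerivWithinAt_const u _ _)).clm_apply
    (hasFDerivWithinAt_const v _ _)
  have h2 := h1.fderivWithin ((𝓡∂ n).uniqueDiffOn _ (mem_range_self _))
  have h3 : (fun z => chartMetric (𝓡∂ n) (hTensor h) p z u v) = fun z => metC h p z u v := rfl
  rw [h3]
  have h4 := DFunLike.congr_fun h2 w
  simp at h4
  exact h4

theorem christoffel_hTensor (h : RMetric n N) (p : N) (u e : 𝔼) :
    christoffel (𝓡∂ n) (hTensor h) p u u e
      = fderivWithin ℝ (metC h p) (range (𝓡∂ n)) (extChartAt (𝓡∂ n) p p) u u e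
        - (1 / 2) * fderivWithin ℝ (metC h p) (range (𝓡∂ n)) (extChartAt (𝓡∂ n) p p) e u u := by
  rw [christoffel, chartMetricDeriv_hTensor, chartMetricDeriv_hTensor]
  ring

theorem extD_eq_formC (om : SmoothOneForm (𝓡∂ n) N) (p : N) (u v : 𝔼) :
    extD om p u v = fderivWithin ℝ (formC om p) (range (𝓡∂ n)) (extChartAt (𝓡∂ n) p p) u v
      - fderivWithin ℝ (formC om p) (range (𝓡∂ n)) (extChartAt (𝓡∂ n) p p) v u := by
  have h1 : (chartVec (𝓡∂ n) p u : 𝔼) = u := chartVec_apply p u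
  have h2 : (chartVec (𝓡∂ n) p v : 𝔼) = v := chartVec_apply p v
  unfold extD
  rw [h1, h2]
  rfl

theorem covAccel_iff_magEqAt (h : RMetric n N) (om : SmoothOneForm (𝓡∂ n) N) {k : ℝ}
    {γ : ℝ → N} {J : Set ℝ} {σ : ℝ} (hγ : MDifferentiableWithinAt 𝓘(ℝ, ℝ) (𝓡∂ n) γ J σ) :
    HasCovAccel (𝓡∂ n) (hTensor h) γ J σ
      (k • lorentzForce h om (γ σ) (velocity (𝓡∂ n) γ J σ)) ↔
    MagEqAt (range (𝓡∂ n)) (metC h (γ σ)) (formC om (γ σ)) k (extChartAt (𝓡∂ n) (γ σ) (γ σ))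
      (derivWithin (fun τ => extChartAt (𝓡∂ n) (γ σ) (γ τ)) J σ)
      (derivWithin (derivWithin (fun τ => extChartAt (𝓡∂ n) (γ σ) (γ τ)) J) J σ) := by
  have hv := velocity_eq_derivWithin hγ
  have key : ∀ e : 𝔼,
      hTensor h (γ σ) (k • lorentzForce h om (γ σ) (velocity (𝓡∂ n) γ J σ)) e
        = k * (fderivWithin ℝ (formC om (γ σ)) (range (𝓡∂ n)) (extChartAt (𝓡∂ n) (γ σ) (γ σ))
            (derivWithin (fun τ => extChartAt (𝓡∂ n) (γ σ) (γ τ)) J σ) e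
          - fderivWithin ℝ (formC om (γ σ)) (range (𝓡∂ n)) (extChartAt (𝓡∂ n) (γ σ) (γ σ)) e
            (derivWithin (fun τ => extChartAt (𝓡∂ n) (γ σ) (γ τ)) J σ)) := by
    intro e
    refine Eq.trans ?_ (congrArg (k * ·) (extD_eq_formC om (γ σ) _ e))
    have h1 := inner_lorentzForce h om (γ σ) (velocity (𝓡∂ n) γ J σ) e
    have h2 : extD om (γ σ) (velocity (𝓡∂ n) γ J σ) e
      = extD om (γ σ) (derivWithin (fun τ => extChartAt (𝓡∂ n) (γ σ) (γ τ)) J σ) e :=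
      congrArg (fun w : 𝔼 => extD om (γ σ) w e) hv
    refine Eq.trans ?_ (congrArg (k * ·) (h1.trans h2))
    unfold hTensor
    rw [map_smul]
    rfl
  have key2 : ∀ (c : 𝔼) (e : 𝔼), c = extChartAt (𝓡∂ n) (γ σ) (γ σ) →
      chartMetric (𝓡∂ n) (hTensor h) (γ σ) c
        (derivWithin (derivWithin (fun τ => extChartAt (𝓡∂ n) (γ σ) (γ τ)) J) J σ)
        (chartVec (𝓡∂ n) (γ σ) e) = metC h (γ σ) (extChartAt (𝓡∂ n) (γ σ) (γ σ))
        (derivWithin (derivWithin (fun τ => extChartAt (𝓡∂ n) (γ σ) (γ τ)) J) J σ) e := by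
    intro c e hc
    rw [hc, show (chartVec (𝓡∂ n) (γ σ) e : 𝔼) = e from chartVec_apply _ e]
    rfl
  have key3 : ∀ (u e : 𝔼), christoffel (𝓡∂ n) (hTensor h) (γ σ) u u (chartVec (𝓡∂ n) (γ σ) e)
      = christoffel (𝓡∂ n) (hTensor h) (γ σ) u u e := by
    intro u e
    rw [show (chartVec (𝓡∂ n) (γ σ) e : 𝔼) = e from chartVec_apply _ e]
  unfold HasCovAccel MagEqAt
  constructor
  · intro H e
    have h1 := H e
    rw [key3] at h1
    have h2 := (key e).symm.trans (h1.trans (congrArg (· + _) (key2 _ e rfl)))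
    rw [christoffel_hTensor] at h2
    linarith
  · intro H
    have H' : ∀ e : 𝔼, _ := H
    intro c e
    have h1 := H' e
    simp only [c]
    refine Eq.trans ?_ (congrArg (_ + ·) (key3 _ e)).symm
    refine (key e).trans (Eq.trans ?_ (congrArg (· + _) (key2 _ e rfl)).symm)
    refine Eq.trans ?_ (congrArg (_ + ·) (christoffel_hTensor h (γ σ) _ e)).symm
    exact h1.symm

theorem coordField_transition (p q : N) {z : 𝔼} (hz : z ∈ (extChartAt (𝓡∂ n) p).target)
    (hq : (extChartAt (𝓡∂ n) p).symm z ∈ (extChartAt (𝓡∂ n) q).source) (u : 𝔼) :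
    (coordField (𝓡∂ n) q (extChartAt (𝓡∂ n) q ((extChartAt (𝓡∂ n) p).symm z))
      (fderivWithin ℝ (extChartAt (𝓡∂ n) q ∘ (extChartAt (𝓡∂ n) p).symm) (range (𝓡∂ n)) z u) : 𝔼)
    = coordField (𝓡∂ n) p z u := by
  have h1 := mfderiv_comp_mfderivWithin z
    (mdifferentiableAt_extChartAt (I := 𝓡∂ n) (x := q)
      (y := (extChartAt (𝓡∂ n) p).symm z) (by simpa using hq))
    (mdifferentiableWithinAt_extChartAt_symm (I := 𝓡∂ n) (x := p) hz)
    ((𝓡∂ n).uniqueDiffOn _ (extChartAt_target_subset_range p hz)).uniqueMDiffWithinAt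
  rw [mfderivWithin_eq_fderivWithin] at h1
  have h2 := mfderivWithin_extChartAt_symm_comp_mfderiv_extChartAt' (I := 𝓡∂ n) hq
  have h3 := DFunLike.congr_fun h2 (coordField (𝓡∂ n) p z u)
  have h4 := DFunLike.congr_fun h1 u
  refine Eq.trans ?_ h3
  unfold coordField
  exact congrArg _ h4

theorem inner_congr_point (h : RMetric n N) {x y : N} (hxy : x = y) (u v : 𝔼) :
    h.inner x (show TangentSpace (𝓡∂ n) x from u) (show TangentSpace (𝓡∂ n) x from v)
      = h.inner y (show TangentSpace (𝓡∂ n) y from u) (show TangentSpace (𝓡∂ n) y from v) := by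
  subst hxy; rfl

theorem form_congr_point (om : SmoothOneForm (𝓡∂ n) N) {x y : N} (hxy : x = y) (u : 𝔼) :
    om.form x (show TangentSpace (𝓡∂ n) x from u)
      = om.form y (show TangentSpace (𝓡∂ n) y from u) := by
  subst hxy; rfl

theorem metC_transition (h : RMetric n N) (p q : N) {z : 𝔼}
    (hz : z ∈ (extChartAt (𝓡∂ n) p).target)
    (hq : (extChartAt (𝓡∂ n) p).symm z ∈ (extChartAt (𝓡∂ n) q).source) (u v : 𝔼) :
    metC h p z u v = metC h q ((extChartAt (𝓡∂ n) q ∘ (extChartAt (𝓡∂ n) p).symm) z)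
      (fderivWithin ℝ (extChartAt (𝓡∂ n) q ∘ (extChartAt (𝓡∂ n) p).symm) (range (𝓡∂ n)) z u)
      (fderivWithin ℝ (extChartAt (𝓡∂ n) q ∘ (extChartAt (𝓡∂ n) p).symm) (range (𝓡∂ n)) z v) := by
  rw [metC_apply, metC_apply]
  simp only [Function.comp_apply]
  have hu := coordField_transition p q hz hq u
  have hv := coordField_transition p q hz hq v
  refine Eq.trans ?_ (inner_congr_point h ((extChartAt (𝓡∂ n) q).left_inv hq).symm _ _)
  erw [hu, hv]

theorem formC_transition (om : SmoothOneForm (𝓡∂ n) N) (p q : N) {z : 𝔼}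
    (hz : z ∈ (extChartAt (𝓡∂ n) p).target)
    (hq : (extChartAt (𝓡∂ n) p).symm z ∈ (extChartAt (𝓡∂ n) q).source) (u : 𝔼) :
    formC om p z u = formC om q ((extChartAt (𝓡∂ n) q ∘ (extChartAt (𝓡∂ n) p).symm) z)
      (fderivWithin ℝ (extChartAt (𝓡∂ n) q ∘ (extChartAt (𝓡∂ n) p).symm) (range (𝓡∂ n)) z u) := by
  rw [formC_apply, formC_apply]
  simp only [Function.comp_apply]
  have hu := coordField_transition p q hz hq u
  refine Eq.trans ?_ (form_congr_point om ((extChartAt (𝓡∂ n) q).left_inv hq).symm _)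
  erw [hu]

theorem range_halfSpace_subset_closure_interior :
    range (𝓡∂ n) ⊆ closure (interior (range (𝓡∂ n))) := by
  exact (𝓡∂ n).range_subset_closure_interior

theorem contDiffWithinAt_chart_curve {γ : ℝ → N} {J : Set ℝ} {σ : ℝ} {p : N}
    (hγ : ContMDiffWithinAt 𝓘(ℝ, ℝ) (𝓡∂ n) ∞ γ J σ)
    (hp : γ σ ∈ (extChartAt (𝓡∂ n) p).source) :
    ContDiffWithinAt ℝ ∞ (fun τ => extChartAt (𝓡∂ n) p (γ τ)) J σ := by
  rw [← contMDiffWithinAt_iff_contDiffWithinAt]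
  exact (contMDiffAt_extChartAt' (by simpa using hp)).comp_contMDiffWithinAt σ hγ

theorem magEqAt_change_chart (h : RMetric n N) (om : SmoothOneForm (𝓡∂ n) N) {k : ℝ}
    {γ : ℝ → N} {J : Set ℝ} {σ : ℝ} (hγ : ContMDiffWithinAt 𝓘(ℝ, ℝ) (𝓡∂ n) ∞ γ J σ)
    (hJ : UniqueDiffOn ℝ J) (hσ : σ ∈ J) {p q : N}
    (hp : γ σ ∈ (extChartAt (𝓡∂ n) p).source) (hq : γ σ ∈ (extChartAt (𝓡∂ n) q).source)
    (heq : MagEqAt (range (𝓡∂ n)) (metC h q) (formC om q) k (extChartAt (𝓡∂ n) q (γ σ))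
      (derivWithin (fun τ => extChartAt (𝓡∂ n) q (γ τ)) J σ)
      (derivWithin (derivWithin (fun τ => extChartAt (𝓡∂ n) q (γ τ)) J) J σ)) :
    MagEqAt (range (𝓡∂ n)) (metC h p) (formC om p) k (extChartAt (𝓡∂ n) p (γ σ))
      (derivWithin (fun τ => extChartAt (𝓡∂ n) p (γ τ)) J σ)
      (derivWithin (derivWithin (fun τ => extChartAt (𝓡∂ n) p (γ τ)) J) J σ) := by
  set φ := extChartAt (𝓡∂ n) q ∘ (extChartAt (𝓡∂ n) p).symm with hφ
  set y₀ := extChartAt (𝓡∂ n) p (γ σ) with hy₀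
  have hyt : y₀ ∈ (extChartAt (𝓡∂ n) p).target := (extChartAt (𝓡∂ n) p).map_source hp
  have hyr : y₀ ∈ range (𝓡∂ n) := extChartAt_target_subset_range p hyt
  have hsy : (extChartAt (𝓡∂ n) p).symm y₀ = γ σ := (extChartAt (𝓡∂ n) p).left_inv hp
  have hφy : φ y₀ = extChartAt (𝓡∂ n) q (γ σ) := by
    rw [hφ, Function.comp_apply, hsy]
  have hov : ∀ᶠ z in 𝓝[range (𝓡∂ n)] y₀, z ∈ (extChartAt (𝓡∂ n) p).target ∧
      (extChartAt (𝓡∂ n) p).symm z ∈ (extChartAt (𝓡∂ n) q).source := by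
    have h1 := extChartAt_target_mem_nhdsWithin_of_mem (I := 𝓡∂ n) (x := p) hyt
    have h2 : ContinuousWithinAt (extChartAt (𝓡∂ n) p).symm (range (𝓡∂ n)) y₀ :=
      (continuousAt_extChartAt_symm' hp).continuousWithinAt
    have h3 := h2.preimage_mem_nhdsWithin
      (by rw [hsy]; exact (isOpen_extChartAt_source q).mem_nhds hq)
    filter_upwards [h1, h3] with z a b using ⟨a, b⟩
  have hφs : ContDiffWithinAt ℝ ∞ φ (range (𝓡∂ n)) y₀ := by
    rw [← contMDiffWithinAt_iff_contDiffWithinAt]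
    have h1 : ContMDiffWithinAt 𝓘(ℝ, 𝔼) (𝓡∂ n) ∞ (extChartAt (𝓡∂ n) p).symm (range (𝓡∂ n)) y₀ :=
      contMDiffWithinAt_extChartAt_symm_range p hyt
    have h2 : ContMDiffAt (𝓡∂ n) 𝓘(ℝ, 𝔼) ∞ (extChartAt (𝓡∂ n) q)
      ((extChartAt (𝓡∂ n) p).symm y₀) := contMDiffAt_extChartAt' (by rw [hsy]; simpa using hq)
    exact h2.comp_contMDiffWithinAt y₀ h1
  have hcc : ∀ᶠ τ in 𝓝[J] σ, γ τ ∈ (extChartAt (𝓡∂ n) p).source :=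
    hγ.continuousWithinAt.preimage_mem_nhdsWithin
      ((isOpen_extChartAt_source p).mem_nhds hp)
  have hcomp : ∀ᶠ τ in 𝓝[J] σ, (φ ∘ fun τ => extChartAt (𝓡∂ n) p (γ τ)) τ
      = extChartAt (𝓡∂ n) q (γ τ) := by
    filter_upwards [hcc] with τ hτ
    simp only [hφ, Function.comp_apply, (extChartAt (𝓡∂ n) p).left_inv hτ]
  have hd1 : ∀ᶠ τ in 𝓝[J] σ, derivWithin (φ ∘ fun τ => extChartAt (𝓡∂ n) p (γ τ)) J τ
      = derivWithin (fun τ => extChartAt (𝓡∂ n) q (γ τ)) J τ := by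
    filter_upwards [eventually_eventually_nhdsWithin.2 hcomp, self_mem_nhdsWithin] with τ hτ hτJ
    exact Filter.EventuallyEq.derivWithin_eq hτ (hτ.self_of_nhdsWithin hτJ)
  have hd2 := Filter.EventuallyEq.derivWithin_eq hd1 (hd1.self_of_nhdsWithin hσ)
  refine MagEqAt.pullback (φ := φ) (m := metC h q) (f := formC om q) (𝓡∂ n).uniqueDiffOn hyr
    (range_halfSpace_subset_closure_interior hyr) (hφs.of_le ENat.LEInfty.out) ?_ ?_ ?_
    (fun u v => metC_symm h q _ u v) ?_ ?_ (differentiableWithinAt_metC h p hyt)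
    (differentiableWithinAt_formC om p hyt)
    ((contDiffWithinAt_chart_curve hγ hp).of_le ENat.LEInfty.out) hJ hσ ?_ rfl ?_
  · filter_upwards [hov] with z hz
    exact extChartAt_target_subset_range q ((extChartAt (𝓡∂ n) q).map_source hz.2)
  · rw [hφy]
    exact differentiableWithinAt_metC h q ((extChartAt (𝓡∂ n) q).map_source hq)
  · rw [hφy]
    exact differentiableWithinAt_formC om q ((extChartAt (𝓡∂ n) q).map_source hq)
  · filter_upwards [hov] with z hz u v using metC_transition h p q hz.1 hz.2 u v
  · filter_upwards [hov] with z hz u using formC_transition om p q hz.1 hz.2 u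
  · filter_upwards [hcc] with τ hτ
    exact extChartAt_target_subset_range p ((extChartAt (𝓡∂ n) p).map_source hτ)
  · rw [hφy, hd2, hd1.self_of_nhdsWithin hσ]
    exact heq

theorem covAccel_iff_magEqAt_chart (h : RMetric n N) (om : SmoothOneForm (𝓡∂ n) N) {k : ℝ}
    {γ : ℝ → N} {J : Set ℝ} {σ : ℝ} (hγ : ContMDiffWithinAt 𝓘(ℝ, ℝ) (𝓡∂ n) ∞ γ J σ)
    (hJ : UniqueDiffOn ℝ J) (hσ : σ ∈ J) {p : N}
    (hp : γ σ ∈ (extChartAt (𝓡∂ n) p).source) :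
    HasCovAccel (𝓡∂ n) (hTensor h) γ J σ
      (k • lorentzForce h om (γ σ) (velocity (𝓡∂ n) γ J σ)) ↔
    MagEqAt (range (𝓡∂ n)) (metC h p) (formC om p) k (extChartAt (𝓡∂ n) p (γ σ))
      (derivWithin (fun τ => extChartAt (𝓡∂ n) p (γ τ)) J σ)
      (derivWithin (derivWithin (fun τ => extChartAt (𝓡∂ n) p (γ τ)) J) J σ) := by
  rw [covAccel_iff_magEqAt h om (hγ.mdifferentiableWithinAt (by simp))]
  exact ⟨magEqAt_change_chart h om hγ hJ hσ hp (mem_extChartAt_source _),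
    magEqAt_change_chart h om hγ hJ hσ (mem_extChartAt_source _) hp⟩

end MagneticEquation

noncomputable section OdeForm

variable {E : Type*} [NormedAddCommGroup E] [NormedSpace ℝ E]

theorem contDiffOn_of_hasDerivWithinAt_ode {W : Type*} [NormedAddCommGroup W] [NormedSpace ℝ W]
    {w : ℝ → W} {J : Set ℝ} {G : W → W} {T : Set W} (hJ : UniqueDiffOn ℝ J)
    (hw : ∀ t ∈ J, HasDerivWithinAt w (G (w t)) J t) (hG : ContDiffOn ℝ ∞ G T)
    (hT : MapsTo w J T) : ContDiffOn ℝ ∞ w J := by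
  rw [contDiffOn_infty]
  intro m
  induction m with
  | zero => exact contDiffOn_zero.2 fun t ht => (hw t ht).continuousWithinAt
  | succ m ih =>
    have h1 : ContDiffOn ℝ m (fun t => G (w t)) J := (contDiffOn_infty.1 hG m).comp ih hT
    have : ((m + 1 : ℕ) : WithTop ℕ∞) = (m : WithTop ℕ∞) + 1 := by norm_cast
    rw [this, contDiffOn_succ_iff_derivWithin hJ]
    refine ⟨fun t ht => (hw t ht).differentiableWithinAt, by simp, ?_⟩
    exact h1.congr fun t ht => (hw t ht).derivWithin (hJ t ht)

theorem ContDiffOn.clm_flip {X F : Type*} [NormedAddCommGroup X] [NormedSpace ℝ X]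
    [NormedAddCommGroup F] [NormedSpace ℝ F] {D : Set X} {g : X → E →L[ℝ] E →L[ℝ] F}
    (hg : ContDiffOn ℝ ∞ g D) : ContDiffOn ℝ ∞ (fun x => (g x).flip) D :=
  (ContinuousLinearMap.flipₗᵢ ℝ E E F).contDiff.comp_contDiffOn hg

/-- The covector `e ↦ k dω(u, e) - Γ(u, u; e)`. -/
def magR (S : Set E) (m : E → E →L[ℝ] E →L[ℝ] ℝ) (f : E → E →L[ℝ] ℝ) (k : ℝ) (z u : E) :
    E →L[ℝ] ℝ :=
  k • (fderivWithin ℝ f S z u - (fderivWithin ℝ f S z).flip u)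
    - (fderivWithin ℝ m S z u u - (1 / 2 : ℝ) • ((fderivWithin ℝ m S z).flip u).flip u)

/-- The right hand side of the magnetic geodesic equation, solved for the second derivative. -/
def magF (S : Set E) (m : E → E →L[ℝ] E →L[ℝ] ℝ) (f : E → E →L[ℝ] ℝ) (k : ℝ) (z u : E) : E :=
  (m z).inverse (magR S m f k z u)

theorem magEqAt_iff_magF {S : Set E} {m : E → E →L[ℝ] E →L[ℝ] ℝ} {f : E → E →L[ℝ] ℝ} {k : ℝ}
    {z u a : E} (hz : (m z).IsInvertible) :
    MagEqAt S m f k z u a ↔ a = magF S m f k z u := by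
  have h1 : MagEqAt S m f k z u a ↔ m z a = magR S m f k z u := by
    constructor
    · intro H
      ext e
      have := H e
      simp [magR] at this ⊢
      linarith
    · intro H e
      have := DFunLike.congr_fun H e
      simp [magR] at this ⊢
      linarith
  rw [h1]
  obtain ⟨e, he⟩ := hz
  unfold magF
  rw [← he, ContinuousLinearMap.inverse_equiv]
  exact ⟨fun h => by simp [← h], fun h => by simp [h]⟩

set_option synthInstance.maxHeartbeats 200000 in
set_option maxHeartbeats 1000000 in
theorem contDiffOn_magF [CompleteSpace E] {S T : Set E} {m : E → E →L[ℝ] E →L[ℝ] ℝ}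
    {f : E → E →L[ℝ] ℝ}
    (hm : ContDiffOn ℝ ∞ m T)
    (hdm : ContDiffOn ℝ ∞ (fderivWithin ℝ m S) T) (hdf : ContDiffOn ℝ ∞ (fderivWithin ℝ f S) T)
    (hinv : ∀ z ∈ T, (m z).IsInvertible) :
    ContDiffOn ℝ ∞ (fun x : ℝ × E × E => magF S m f x.1 x.2.1 x.2.2) (univ ×ˢ T ×ˢ univ) := by
  set D : Set (ℝ × E × E) := univ ×ˢ T ×ˢ univ with hD
  have hk : ContDiffOn ℝ ∞ (fun x : ℝ × E × E => x.1) D := contDiff_fst.contDiffOn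
  have hz : ContDiffOn ℝ ∞ (fun x : ℝ × E × E => x.2.1) D :=
    (contDiff_fst.comp contDiff_snd).contDiffOn
  have hu : ContDiffOn ℝ ∞ (fun x : ℝ × E × E => x.2.2) D :=
    (contDiff_snd.comp contDiff_snd).contDiffOn
  have hmaps : MapsTo (fun x : ℝ × E × E => x.2.1) D T := fun x hx => hx.2.1
  have h1 := hdm.comp hz hmaps
  have h2 := hdf.comp hz hmaps
  have hR : ContDiffOn ℝ ∞ (fun x : ℝ × E × E => magR S m f x.1 x.2.1 x.2.2) D := by
    unfold magR
    refine ContDiffOn.sub (hk.smul ((h2.clm_apply hu).sub ((ContDiffOn.clm_flip h2).clm_apply hu))) ?_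
    refine ContDiffOn.sub ((h1.clm_apply hu).clm_apply hu) ?_
    exact ((ContDiffOn.clm_flip ((ContDiffOn.clm_flip h1).clm_apply hu)).clm_apply hu).const_smul (1 / 2 : ℝ)
  have hinvS : ContDiffOn ℝ ∞ (fun x : ℝ × E × E => (m x.2.1).inverse) D := by
    intro x hx
    obtain ⟨e, he⟩ := hinv _ (hmaps hx)
    have h3 := contDiffAt_map_inverse (𝕜 := ℝ) (n := ∞) e
    rw [he] at h3
    exact h3.comp_contDiffWithinAt x ((hm.comp hz hmaps) x hx)
  exact hinvS.clm_apply hR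

end OdeForm

section OdeManifold

variable {n : ℕ} [NeZero n] {N : Type*} [TopologicalSpace N]
  [ChartedSpace (EuclideanHalfSpace n) N] [IsManifold (𝓡∂ n) ∞ N]

local notation "𝔼" => EuclideanSpace ℝ (Fin n)

theorem metC_pos (h : RMetric n N) (p : N) {z : 𝔼} (hz : z ∈ (extChartAt (𝓡∂ n) p).target)
    {u : 𝔼} (hu : u ≠ 0) : 0 < metC h p z u u := by
  rw [metC_apply]
  apply h.pos
  intro h0
  apply hu
  have h1 := mfderiv_extChartAt_comp_mfderivWithin_extChartAt_symm (I := 𝓡∂ n) hz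
  have h2 := DFunLike.congr_fun h1 u
  refine Eq.trans h2.symm ?_
  exact (congrArg (mfderiv (𝓡∂ n) 𝓘(ℝ, 𝔼) (extChartAt (𝓡∂ n) p) ((extChartAt (𝓡∂ n) p).symm z))
    h0).trans (ContinuousLinearMap.map_zero _)

theorem isInvertible_metC (h : RMetric n N) (p : N) {z : 𝔼}
    (hz : z ∈ (extChartAt (𝓡∂ n) p).target) : (metC h p z).IsInvertible := by
  have hinj : Function.Injective (metC h p z) := by
    rw [injective_iff_map_eq_zero]
    intro u hu
    by_contra hne
    have := metC_pos h p hz hne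
    rw [hu] at this
    simp at this
  have hfr : Module.finrank ℝ 𝔼 = Module.finrank ℝ (𝔼 →L[ℝ] ℝ) :=
    (InnerProductSpace.toDual ℝ 𝔼).toLinearEquiv.finrank_eq
  have : FiniteDimensional ℝ (𝔼 →L[ℝ] ℝ) :=
    (InnerProductSpace.toDual ℝ 𝔼).toLinearEquiv.finiteDimensional
  have hsurj : Function.Surjective (metC h p z).toLinearMap :=
    (LinearMap.injective_iff_surjective_of_finrank_eq_finrank hfr).1 hinj
  exact ⟨(LinearEquiv.ofBijective (metC h p z).toLinearMap ⟨hinj, hsurj⟩).toContinuousLinearEquiv,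
    by ext; rfl⟩

omit [IsManifold (𝓡∂ n) ∞ N] in
theorem fderivWithin_range_eq_target {F : Type*} [NormedAddCommGroup F] [NormedSpace ℝ F] {p : N}
    {g : 𝔼 → F} {z : 𝔼} (hz : z ∈ (extChartAt (𝓡∂ n) p).target) :
    fderivWithin ℝ g (range (𝓡∂ n)) z = fderivWithin ℝ g (extChartAt (𝓡∂ n) p).target z :=
  fderivWithin_congr_set (extChartAt_target_eventuallyEq_of_mem hz).symm

set_option synthInstance.maxHeartbeats 200000 in
set_option maxHeartbeats 1000000 in
theorem contDiffOn_magF_chart (h : RMetric n N) (om : SmoothOneForm (𝓡∂ n) N) (p : N) :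
    ContDiffOn ℝ ∞ (fun x : ℝ × 𝔼 × 𝔼 =>
      magF (range (𝓡∂ n)) (metC h p) (formC om p) x.1 x.2.1 x.2.2)
      (univ ×ˢ (extChartAt (𝓡∂ n) p).target ×ˢ univ) := by
  have hm := contDiffOn_metC h p
  have hf := contDiffOn_formC om p
  refine contDiffOn_magF hm ?_ ?_ (fun z hz => isInvertible_metC h p hz)
  · exact (hm.fderivWithin (uniqueDiffOn_extChartAt_target p) (m := ∞) (by simp)).congr
      fun z hz => fderivWithin_range_eq_target hz
  · exact (hf.fderivWithin (uniqueDiffOn_extChartAt_target p) (m := ∞) (by simp)).congr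
      fun z hz => fderivWithin_range_eq_target hz

theorem metC_velocity (h : RMetric n N) {γ : ℝ → N} {J : Set ℝ} {σ : ℝ} {p : N}
    (hγ : MDifferentiableWithinAt 𝓘(ℝ, ℝ) (𝓡∂ n) γ J σ) (hJ : UniqueDiffWithinAt ℝ J σ)
    (hp : γ σ ∈ (extChartAt (𝓡∂ n) p).source) (w : 𝔼) :
    metC h p (extChartAt (𝓡∂ n) p (γ σ)) (derivWithin (fun τ => extChartAt (𝓡∂ n) p (γ τ)) J σ) w
    = h.inner (γ σ) (velocity (𝓡∂ n) γ J σ)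
      (show 𝔼 from coordField (𝓡∂ n) p (extChartAt (𝓡∂ n) p (γ σ)) w) := by
  rw [metC_apply]
  have h1 := velocity_eq_coordField (p := p) hγ hJ (by simpa using hp)
  have h2 := inner_congr_point h ((extChartAt (𝓡∂ n) p).left_inv hp)
    (coordField (𝓡∂ n) p (extChartAt (𝓡∂ n) p (γ σ))
      (derivWithin (fun τ => extChartAt (𝓡∂ n) p (γ τ)) J σ))
    (coordField (𝓡∂ n) p (extChartAt (𝓡∂ n) p (γ σ)) w)
  refine h2.trans ?_
  rw [← h1]

theorem metC_velocity_velocity (h : RMetric n N) {γ : ℝ → N} {J : Set ℝ} {σ : ℝ} {p : N}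
    (hγ : MDifferentiableWithinAt 𝓘(ℝ, ℝ) (𝓡∂ n) γ J σ) (hJ : UniqueDiffWithinAt ℝ J σ)
    (hp : γ σ ∈ (extChartAt (𝓡∂ n) p).source) :
    metC h p (extChartAt (𝓡∂ n) p (γ σ)) (derivWithin (fun τ => extChartAt (𝓡∂ n) p (γ τ)) J σ)
      (derivWithin (fun τ => extChartAt (𝓡∂ n) p (γ τ)) J σ)
    = h.inner (γ σ) (velocity (𝓡∂ n) γ J σ) (velocity (𝓡∂ n) γ J σ) := by
  rw [metC_velocity h hγ hJ hp]
  have h1 := velocity_eq_coordField (p := p) hγ hJ (by simpa using hp)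
  exact congrArg (fun w : 𝔼 => h.inner (γ σ) (velocity (𝓡∂ n) γ J σ) w) h1.symm

theorem formC_velocity (om : SmoothOneForm (𝓡∂ n) N) {γ : ℝ → N} {J : Set ℝ} {σ : ℝ} {p : N}
    (hγ : MDifferentiableWithinAt 𝓘(ℝ, ℝ) (𝓡∂ n) γ J σ) (hJ : UniqueDiffWithinAt ℝ J σ)
    (hp : γ σ ∈ (extChartAt (𝓡∂ n) p).source) :
    formC om p (extChartAt (𝓡∂ n) p (γ σ)) (derivWithin (fun τ => extChartAt (𝓡∂ n) p (γ τ)) J σ)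
    = om.form (γ σ) (velocity (𝓡∂ n) γ J σ) := by
  rw [formC_apply]
  have h1 := velocity_eq_coordField (p := p) hγ hJ (by simpa using hp)
  refine (form_congr_point om ((extChartAt (𝓡∂ n) p).left_inv hp) _).trans ?_
  exact congrArg (fun w : 𝔼 => om.form (γ σ) w) h1.symm

end OdeManifold

section Intervals

theorem Set.OrdConnected.uniqueDiffOn_real {J : Set ℝ} (hJ : J.OrdConnected)
    (hn : J.Nontrivial) : UniqueDiffOn ℝ J := by
  refine uniqueDiffOn_convex hJ.convex ?_
  obtain ⟨a, ha, b, hb, hab⟩ := hn.exists_lt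
  refine ⟨(a + b) / 2, ?_⟩
  have : Ioo a b ⊆ J := Ioo_subset_Icc_self.trans (hJ.out ha hb)
  exact interior_maximal this isOpen_Ioo ⟨by linarith, by linarith⟩

end Intervals

section Estimates

variable {E : Type*} [NormedAddCommGroup E] [NormedSpace ℝ E]

theorem norm_sub_le_of_hasDerivWithinAt_uIcc {c c' : ℝ → E} {J : Set ℝ} {B s t : ℝ}
    (hJ : J.OrdConnected) (hs : s ∈ J) (ht : t ∈ J)
    (hc : ∀ τ ∈ uIcc s t, HasDerivWithinAt c (c' τ) J τ) (hB : ∀ τ ∈ uIcc s t, ‖c' τ‖ ≤ B) :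
    ‖c t - c s‖ ≤ B * |t - s| := by
  have hsub : uIcc s t ⊆ J := hJ.uIcc_subset hs ht
  exact (convex_uIcc s t).norm_image_sub_le_of_norm_hasDerivWithin_le
    (fun τ hτ => (hc τ hτ).mono hsub) hB left_mem_uIcc right_mem_uIcc

theorem second_order_ode_estimates {c u a : ℝ → E} {J : Set ℝ} {B L Λ : ℝ}
    (hJ : J.OrdConnected)
    (hc : ∀ t ∈ J, HasDerivWithinAt c (u t) J t) (hu : ∀ t ∈ J, HasDerivWithinAt u (a t) J t)
    (hL : ∀ t ∈ J, ‖u t‖ ≤ L) (hB : ∀ t ∈ J, ‖a t‖ ≤ B) (hΛ0 : 0 ≤ Λ)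
    (hΛ : ∀ s ∈ J, ∀ t ∈ J, ‖a t - a s‖ ≤ Λ * (‖c t - c s‖ + ‖u t - u s‖))
    {s t : ℝ} (hs : s ∈ J) (ht : t ∈ J) :
    ‖c t - c s‖ ≤ L * |t - s| ∧ ‖u t - u s‖ ≤ B * |t - s| ∧
      ‖c t - c s - (t - s) • u s‖ ≤ B * |t - s| ^ 2 ∧
      ‖u t - u s - (t - s) • a s‖ ≤ Λ * (L + B) * |t - s| ^ 2 := by
  have hsub : uIcc s t ⊆ J := hJ.uIcc_subset hs ht
  have hle : ∀ τ ∈ uIcc s t, |τ - s| ≤ |t - s| := fun τ hτ => abs_sub_left_of_mem_uIcc hτ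
  have hB0 : 0 ≤ B := (norm_nonneg _).trans (hB s hs)
  have hL0 : 0 ≤ L := (norm_nonneg _).trans (hL s hs)
  have e1 : ∀ τ ∈ uIcc s t, ‖c τ - c s‖ ≤ L * |τ - s| := fun τ hτ =>
    norm_sub_le_of_hasDerivWithinAt_uIcc hJ hs (hsub hτ)
      (fun x hx => hc x (hJ.uIcc_subset hs (hsub hτ) hx))
      (fun x hx => hL x (hJ.uIcc_subset hs (hsub hτ) hx))
  have e2 : ∀ τ ∈ uIcc s t, ‖u τ - u s‖ ≤ B * |τ - s| := fun τ hτ =>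
    norm_sub_le_of_hasDerivWithinAt_uIcc hJ hs (hsub hτ)
      (fun x hx => hu x (hJ.uIcc_subset hs (hsub hτ) hx))
      (fun x hx => hB x (hJ.uIcc_subset hs (hsub hτ) hx))
  refine ⟨e1 t right_mem_uIcc, e2 t right_mem_uIcc, ?_, ?_⟩
  · have h1 := norm_sub_le_of_hasDerivWithinAt_uIcc (c := fun τ => c τ - (τ - s) • u s)
      (c' := fun τ => u τ - (1 : ℝ) • u s) (B := B * |t - s|) hJ hs ht
      (fun τ hτ => (hc τ (hsub hτ)).sub
        ((((hasDerivAt_id τ).sub_const s).smul_const (u s)).hasDerivWithinAt))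
      (fun τ hτ => by
        rw [one_smul]
        exact (e2 τ hτ).trans (mul_le_mul_of_nonneg_left (hle τ hτ) hB0))
    simp only [sub_self, zero_smul, sub_zero] at h1
    calc _ = ‖c t - (t - s) • u s - c s‖ := by congr 1; abel
      _ ≤ _ := h1
      _ = _ := by ring
  · have h1 := norm_sub_le_of_hasDerivWithinAt_uIcc (c := fun τ => u τ - (τ - s) • a s)
      (c' := fun τ => a τ - (1 : ℝ) • a s) (B := Λ * (L + B) * |t - s|) hJ hs ht
      (fun τ hτ => (hu τ (hsub hτ)).sub
        ((((hasDerivAt_id τ).sub_const s).smul_const (a s)).hasDerivWithinAt))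
      (fun τ hτ => by
        rw [one_smul]
        calc _ ≤ Λ * (‖c τ - c s‖ + ‖u τ - u s‖) := hΛ s hs τ (hsub hτ)
          _ ≤ Λ * (L * |τ - s| + B * |τ - s|) := by gcongr; exact e1 τ hτ; exact e2 τ hτ
          _ = Λ * (L + B) * |τ - s| := by ring
          _ ≤ _ := mul_le_mul_of_nonneg_left (hle τ hτ)
            (mul_nonneg hΛ0 (add_nonneg hL0 hB0)))
    simp only [sub_self, zero_smul, sub_zero] at h1
    calc _ = ‖u t - (t - s) • a s - u s‖ := by congr 1; abel
      _ ≤ _ := h1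
      _ = _ := by ring

end Estimates

section Staying

variable {n : ℕ} [NeZero n] {N : Type*} [TopologicalSpace N] [T2Space N]
  [ChartedSpace (EuclideanHalfSpace n) N]

local notation "𝔼" => EuclideanSpace ℝ (Fin n)

theorem stays_in_chart_right {q : N} {ρ L s t : ℝ} {x : ℝ → N} (hρ : 0 < ρ)
    (hK : Metric.closedBall (extChartAt (𝓡∂ n) q q) ρ ∩ range (𝓡∂ n)
      ⊆ (extChartAt (𝓡∂ n) q).target)
    (hx : ContinuousOn x (Icc s t)) (hs : x s ∈ (extChartAt (𝓡∂ n) q).source)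
    (hs' : extChartAt (𝓡∂ n) q (x s) ∈ Metric.ball (extChartAt (𝓡∂ n) q q) (ρ / 2))
    (hL : ∀ b ∈ Icc s t, (∀ τ ∈ Icc s b, x τ ∈ (extChartAt (𝓡∂ n) q).source ∧
      extChartAt (𝓡∂ n) q (x τ) ∈ Metric.ball (extChartAt (𝓡∂ n) q q) ρ) →
      ‖extChartAt (𝓡∂ n) q (x b) - extChartAt (𝓡∂ n) q (x s)‖ ≤ L * |b - s|)
    (hL0 : 0 ≤ L) (hδ : L * (t - s) ≤ ρ / 4) {τ : ℝ} (hτ : τ ∈ Icc s t) :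
    x τ ∈ (extChartAt (𝓡∂ n) q).source ∧
      extChartAt (𝓡∂ n) q (x τ) ∈ Metric.ball (extChartAt (𝓡∂ n) q q) ρ := by
  set φ := extChartAt (𝓡∂ n) q with hφ
  set z := φ q with hz
  set U : Set N := φ.source ∩ φ ⁻¹' Metric.ball z ρ with hU
  have hUo : IsOpen U := (continuousOn_extChartAt q).isOpen_inter_preimage
    (isOpen_extChartAt_source q) Metric.isOpen_ball
  set V : Set N := φ.symm '' (Metric.closedBall z (3 * ρ / 4) ∩ range (𝓡∂ n)) with hV
  have hsubK : Metric.closedBall z (3 * ρ / 4) ∩ range (𝓡∂ n) ⊆ φ.target :=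
    (inter_subset_inter_left _ (Metric.closedBall_subset_closedBall (by linarith))).trans hK
  have hVc : IsClosed V := by
    refine IsCompact.isClosed (IsCompact.image_of_continuousOn ?_ ?_)
    · exact (isCompact_closedBall z _).inter_right (𝓡∂ n).isClosed_range
    · exact (continuousOn_extChartAt_symm q).mono hsubK
  have hVU : V ⊆ U := by
    rintro _ ⟨w, hw, rfl⟩
    refine ⟨φ.map_target (hsubK hw), ?_⟩
    rw [mem_preimage, φ.right_inv (hsubK hw)]
    exact Metric.closedBall_subset_ball (by linarith) hw.1
  by_contra hbad
  have hτU : x τ ∉ U := fun h => hbad ⟨h.1, h.2⟩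
  set B : Set ℝ := Icc s t ∩ x ⁻¹' Uᶜ with hB
  have hBc : IsClosed B := hx.preimage_isClosed_of_isClosed isClosed_Icc hUo.isClosed_compl
  have hBne : B.Nonempty := ⟨τ, hτ, hτU⟩
  have hBb : BddBelow B := ⟨s, fun y hy => hy.1.1⟩
  have hmem := hBc.csInf_mem hBne hBb
  set r := sInf B with hr
  have hsU : x s ∈ U := ⟨hs, Metric.ball_subset_ball (by linarith) hs'⟩
  have hsr : s < r := lt_of_le_of_ne hmem.1.1 (fun h => hmem.2 (h ▸ hsU))
  have hlt : ∀ y ∈ Ico s r, x y ∈ V := by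
    intro y hy
    have hyt : y ∈ Icc s t := ⟨hy.1, hy.2.le.trans hmem.1.2⟩
    have hin : ∀ w ∈ Icc s y, x w ∈ U := by
      intro w hw
      by_contra hwU
      exact absurd (csInf_le hBb ⟨⟨hw.1, hw.2.trans hyt.2⟩, hwU⟩) (by
        rw [not_le]; exact hw.2.trans_lt hy.2)
    have h1 := hL y hyt (fun w hw => ⟨(hin w hw).1, (hin w hw).2⟩)
    have h2 : L * |y - s| ≤ ρ / 4 := by
      refine le_trans ?_ hδ
      rw [abs_of_nonneg (by linarith [hy.1])]
      exact mul_le_mul_of_nonneg_left (by linarith [hyt.2]) hL0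
    have hyU := hin y ⟨hy.1, le_rfl⟩
    refine ⟨φ (x y), ⟨?_, ?_⟩, φ.left_inv hyU.1⟩
    · rw [Metric.mem_closedBall, dist_eq_norm]
      rw [Metric.mem_ball, dist_eq_norm] at hs'
      calc ‖φ (x y) - z‖ = ‖(φ (x y) - φ (x s)) + (φ (x s) - z)‖ := by congr 1; abel
        _ ≤ _ := norm_add_le _ _
        _ ≤ _ := by linarith
    · exact extChartAt_target_subset_range q (φ.map_source hyU.1)
  have hxr : x r ∈ V := by
    have hcl : r ∈ closure (Ico s r) := by rw [closure_Ico hsr.ne]; exact ⟨hsr.le, le_rfl⟩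
    have hcont : ContinuousWithinAt x (Ico s r) r :=
      (hx r hmem.1).mono (fun y hy => ⟨hy.1, hy.2.le.trans hmem.1.2⟩)
    have := hcont.mem_closure hcl hlt
    rwa [hVc.closure_eq] at this
  exact hmem.2 (hVU hxr)

theorem stays_in_chart {q : N} {ρ L δ s t : ℝ} {x : ℝ → N} {J : Set ℝ} (hρ : 0 < ρ)
    (hK : Metric.closedBall (extChartAt (𝓡∂ n) q q) ρ ∩ range (𝓡∂ n)
      ⊆ (extChartAt (𝓡∂ n) q).target) (hJ : J.OrdConnected)
    (hx : ContinuousOn x J) (hsJ : s ∈ J) (hs : x s ∈ (extChartAt (𝓡∂ n) q).source)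
    (hs' : extChartAt (𝓡∂ n) q (x s) ∈ Metric.ball (extChartAt (𝓡∂ n) q q) (ρ / 2))
    (hL : ∀ b ∈ J, (∀ τ ∈ uIcc s b, x τ ∈ (extChartAt (𝓡∂ n) q).source ∧
      extChartAt (𝓡∂ n) q (x τ) ∈ Metric.ball (extChartAt (𝓡∂ n) q q) ρ) →
      ‖extChartAt (𝓡∂ n) q (x b) - extChartAt (𝓡∂ n) q (x s)‖ ≤ L * |b - s|)
    (hL0 : 0 ≤ L) (hδ : L * δ ≤ ρ / 4) (ht : t ∈ J) (hts : |t - s| ≤ δ) :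
    x t ∈ (extChartAt (𝓡∂ n) q).source ∧
      extChartAt (𝓡∂ n) q (x t) ∈ Metric.ball (extChartAt (𝓡∂ n) q q) ρ := by
  have hδ' : L * |t - s| ≤ ρ / 4 := (mul_le_mul_of_nonneg_left hts hL0).trans hδ
  rcases le_total s t with hst | hst
  · have hsub : Icc s t ⊆ J := hJ.out hsJ ht
    refine stays_in_chart_right (L := L) hρ hK (hx.mono hsub) hs hs' (fun b hb H => ?_) hL0
      (by rwa [abs_of_nonneg (by linarith)] at hδ') ⟨hst, le_rfl⟩
    exact hL b (hsub hb) (by rw [uIcc_of_le hb.1]; exact H)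
  · have hsub : Icc t s ⊆ J := hJ.out ht hsJ
    have key := stays_in_chart_right (L := L) (x := fun τ => x (-τ)) (s := -s) (t := -t) hρ hK
      ((hx.mono hsub).comp continuousOn_neg
        (fun τ hτ => ⟨by linarith [hτ.2], by linarith [hτ.1]⟩))
      (by simpa using hs) (by simpa using hs') (fun b hb H => ?_) hL0
      (by rw [abs_of_nonpos (by linarith)] at hδ'; linarith) (τ := -t) ⟨by linarith, le_rfl⟩
    · simpa using key
    · have h1 := hL (-b) (hsub ⟨by linarith [hb.2], by linarith [hb.1]⟩) (fun τ hτ => by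
        rw [uIcc_of_ge (by linarith [hb.1])] at hτ
        simpa using H (-τ) ⟨by linarith [hτ.2], by linarith [hτ.1]⟩)
      have : |(-b) - s| = |b - -s| := by rw [← abs_neg]; congr 1; ring
      rw [this] at h1
      simpa using h1

end Staying

noncomputable section ChartOde

/-- A curve in the preferred chart at `p`. -/
def chartCurve (n : ℕ) [NeZero n] {N : Type*} [TopologicalSpace N]
    [ChartedSpace (EuclideanHalfSpace n) N] (p : N) (x : ℝ → N) (t : ℝ) :
    EuclideanSpace ℝ (Fin n) :=
  extChartAt (𝓡∂ n) p (x t)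

/-- The velocity of a curve in the preferred chart at `p`. -/
def chartVel (n : ℕ) [NeZero n] {N : Type*} [TopologicalSpace N]
    [ChartedSpace (EuclideanHalfSpace n) N] (p : N) (x : ℝ → N) (J : Set ℝ) (t : ℝ) :
    EuclideanSpace ℝ (Fin n) :=
  derivWithin (chartCurve n p x) J t

variable {n : ℕ} [NeZero n] {N : Type*} [TopologicalSpace N]
  [ChartedSpace (EuclideanHalfSpace n) N] [IsManifold (𝓡∂ n) ∞ N]

local notation "𝔼" => EuclideanSpace ℝ (Fin n)

/-- The right-hand side of the magnetic geodesic equation `c'' = F(c, c')` in the chart at `p`. -/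
def chartAccel (h : RMetric n N) (om : SmoothOneForm (𝓡∂ n) N) (p : N) (k : ℝ)
    (z u : EuclideanSpace ℝ (Fin n)) : EuclideanSpace ℝ (Fin n) :=
  magF (range (𝓡∂ n)) (metC h p) (formC om p) k z u

theorem contDiffWithinAt_chartCurve {x : ℝ → N} {J : Set ℝ} {t : ℝ} {p : N}
    (hx : ContMDiffWithinAt 𝓘(ℝ, ℝ) (𝓡∂ n) ∞ x J t) (hp : x t ∈ (extChartAt (𝓡∂ n) p).source) :
    ContDiffWithinAt ℝ ∞ (chartCurve n p x) J t :=
  contDiffWithinAt_chart_curve hx hp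

theorem hasDerivWithinAt_chartCurve {x : ℝ → N} {J : Set ℝ} {t : ℝ} {p : N}
    (hx : ContMDiffWithinAt 𝓘(ℝ, ℝ) (𝓡∂ n) ∞ x J t) (hp : x t ∈ (extChartAt (𝓡∂ n) p).source) :
    HasDerivWithinAt (chartCurve n p x) (chartVel n p x J t) J t :=
  ((contDiffWithinAt_chartCurve hx hp).differentiableWithinAt (by simp)).hasDerivWithinAt

theorem IsMagneticGeodesicOn.hasDerivWithinAt_chartVel {h : RMetric n N}
    {om : SmoothOneForm (𝓡∂ n) N} {k : ℝ} {x : ℝ → N} {J : Set ℝ} {t : ℝ} {p : N}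
    (hx : IsMagneticGeodesicOn h om k x J) (hJ : UniqueDiffOn ℝ J) (ht : t ∈ J)
    (hp : x t ∈ (extChartAt (𝓡∂ n) p).source) :
    HasDerivWithinAt (chartVel n p x J)
      (chartAccel h om p k (chartCurve n p x t) (chartVel n p x J t)) J t := by
  have h1 := (covAccel_iff_magEqAt_chart h om (hx.1 t ht) hJ ht hp).1 (hx.2 t ht)
  have h2 := (magEqAt_iff_magF
    (isInvertible_metC h p ((extChartAt (𝓡∂ n) p).map_source hp))).1 h1
  have h3 := (hasDerivWithinAt_of_contDiffWithinAt
    ((contDiffWithinAt_chartCurve (hx.1 t ht) hp).of_le ENat.LEInfty.out) hJ ht).1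
  unfold chartAccel
  rw [show magF (range (𝓡∂ n)) (metC h p) (formC om p) k (chartCurve n p x t) (chartVel n p x J t)
    = derivWithin (derivWithin (chartCurve n p x) J) J t from h2.symm]
  exact h3

theorem contMDiffWithinAt_of_chartCurve {x : ℝ → N} {J : Set ℝ} {t : ℝ} {p : N}
    (hs : ∀ᶠ τ in 𝓝[J] t, x τ ∈ (extChartAt (𝓡∂ n) p).source) (ht : t ∈ J)
    (hc : ContDiffWithinAt ℝ ∞ (chartCurve n p x) J t) :
    ContMDiffWithinAt 𝓘(ℝ, ℝ) (𝓡∂ n) ∞ x J t := by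
  have hst := hs.self_of_nhdsWithin ht
  have h1 : ContMDiffWithinAt 𝓘(ℝ, 𝔼) (𝓡∂ n) ∞ (extChartAt (𝓡∂ n) p).symm
    (extChartAt (𝓡∂ n) p).target (chartCurve n p x t) :=
    contMDiffOn_extChartAt_symm p _ ((extChartAt (𝓡∂ n) p).map_source hst)
  have h2 : ContMDiffWithinAt 𝓘(ℝ, ℝ) 𝓘(ℝ, 𝔼) ∞ (chartCurve n p x) J t :=
    contMDiffWithinAt_iff_contDiffWithinAt.2 hc
  have h3 := (h1.comp t (h2.mono inter_subset_left) (t := (extChartAt (𝓡∂ n) p).target)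
    (s := J ∩ {τ | x τ ∈ (extChartAt (𝓡∂ n) p).source})
    (fun τ hτ => (extChartAt (𝓡∂ n) p).map_source hτ.2)).mono_of_mem_nhdsWithin
      (inter_mem self_mem_nhdsWithin hs)
  refine h3.congr_of_eventuallyEq ?_ ((extChartAt (𝓡∂ n) p).left_inv hst).symm
  filter_upwards [hs] with τ hτ using ((extChartAt (𝓡∂ n) p).left_inv hτ).symm

theorem ContDiffOn.comp_prodMk_left {E F : Type*} [NormedAddCommGroup E] [NormedSpace ℝ E]
    [NormedAddCommGroup F] [NormedSpace ℝ F] {G : ℝ × E → F} {T : Set E}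
    (hG : ContDiffOn ℝ ∞ G (univ ×ˢ T)) (k : ℝ) : ContDiffOn ℝ ∞ (fun w => G (k, w)) T := by
  have h0 : ContDiff ℝ ∞ (fun w : E => (k, w)) := contDiff_const.prodMk contDiff_id
  exact hG.comp h0.contDiffOn (fun w hw => ⟨mem_univ _, hw⟩)

theorem contDiffOn_chartAccel (h : RMetric n N) (om : SmoothOneForm (𝓡∂ n) N) (p : N) (k : ℝ) :
    ContDiffOn ℝ ∞ (fun w : 𝔼 × 𝔼 => chartAccel h om p k w.1 w.2)
      ((extChartAt (𝓡∂ n) p).target ×ˢ univ) :=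
  (contDiffOn_magF_chart h om p).comp_prodMk_left k

/-- Curves that solve the geodesic equation in charts are magnetic geodesics. -/
theorem isMagneticGeodesicOn_of_chart {h : RMetric n N} {om : SmoothOneForm (𝓡∂ n) N} {k : ℝ}
    {x : ℝ → N} {J : Set ℝ} (hJ : UniqueDiffOn ℝ J)
    (H : ∀ s ∈ J, ∃ (p : N) (U : Set ℝ) (u : ℝ → 𝔼), IsOpen U ∧ s ∈ U ∧
      ∀ t ∈ J ∩ U, x t ∈ (extChartAt (𝓡∂ n) p).source ∧
        HasDerivWithinAt (chartCurve n p x) (u t) J t ∧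
        HasDerivWithinAt u (chartAccel h om p k (chartCurve n p x t) (u t)) J t) :
    IsMagneticGeodesicOn h om k x J := by
  have key : ∀ s ∈ J, ContMDiffWithinAt 𝓘(ℝ, ℝ) (𝓡∂ n) ∞ x J s ∧ HasCovAccel (𝓡∂ n) (hTensor h) x J s
      (k • lorentzForce h om (x s) (velocity (𝓡∂ n) x J s)) := by
    intro s hs
    obtain ⟨p, U, u, hU, hsU, H⟩ := H s hs
    have hJU : UniqueDiffOn ℝ (J ∩ U) := hJ.inter hU
    have hev : ∀ᶠ τ in 𝓝[J] s, τ ∈ J ∩ U :=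
      inter_mem self_mem_nhdsWithin (mem_nhdsWithin_of_mem_nhds (hU.mem_nhds hsU))
    have hsJ : s ∈ J ∩ U := ⟨hs, hsU⟩
    have hsm : ContDiffOn ℝ ∞ (fun t => (chartCurve n p x t, u t)) (J ∩ U) := by
      refine contDiffOn_of_hasDerivWithinAt_ode
        (G := fun w : 𝔼 × 𝔼 => (w.2, chartAccel h om p k w.1 w.2))
        (T := (extChartAt (𝓡∂ n) p).target ×ˢ univ) hJU (fun t ht => ?_) ?_ (fun t ht => ?_)
      · exact ((H t ht).2.1.mono inter_subset_left).prodMk ((H t ht).2.2.mono inter_subset_left)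
      · exact contDiff_snd.contDiffOn.prodMk (contDiffOn_chartAccel h om p k)
      · exact ⟨(extChartAt (𝓡∂ n) p).map_source (H t ht).1, mem_univ _⟩
    have hc : ContDiffWithinAt ℝ ∞ (chartCurve n p x) J s :=
      ((contDiff_fst.comp_contDiffOn hsm) s hsJ).mono_of_mem_nhdsWithin hev
    have hsm' := contMDiffWithinAt_of_chartCurve (hev.mono fun t ht => (H t ht).1) hs hc
    refine ⟨hsm', (covAccel_iff_magEqAt_chart h om hsm' hJ hs (H s hsJ).1).2 ?_⟩
    rw [magEqAt_iff_magF
      (isInvertible_metC h p ((extChartAt (𝓡∂ n) p).map_source (H s hsJ).1))]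
    have hu : ∀ t ∈ J ∩ U, derivWithin (chartCurve n p x) J t = u t := fun t ht =>
      (H t ht).2.1.derivWithin (hJ t ht.1)
    have h2 : derivWithin (derivWithin (chartCurve n p x) J) J s
        = chartAccel h om p k (chartCurve n p x s) (u s) := by
      refine HasDerivWithinAt.derivWithin ?_ (hJ s hs)
      refine (H s hsJ).2.2.congr_of_eventuallyEq ?_ (hu s hsJ)
      filter_upwards [hev] with t ht using hu t ht
    have h3 := hu s hsJ
    unfold chartAccel at h2
    rw [← h3] at h2
    exact h2
  exact ⟨fun s hs => (key s hs).1, fun s hs => (key s hs).2⟩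

end ChartOde

noncomputable section LocalConstants

variable {n : ℕ} [NeZero n] {N : Type*} [TopologicalSpace N]
  [ChartedSpace (EuclideanHalfSpace n) N] [IsManifold (𝓡∂ n) ∞ N]

local notation "𝔼" => EuclideanSpace ℝ (Fin n)

/-- The part of the model half-space within distance `ρ` of the coordinates of `q`. -/
def chartBall (q : N) (ρ : ℝ) : Set (EuclideanSpace ℝ (Fin n)) :=
  Metric.closedBall (extChartAt (𝓡∂ n) q q) ρ ∩ range (𝓡∂ n)

theorem isCompact_chartBall (q : N) (ρ : ℝ) : IsCompact (chartBall (n := n) q ρ) :=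
  (isCompact_closedBall _ _).inter_right (𝓡∂ n).isClosed_range

theorem convex_range_halfSpace : Convex ℝ (range (𝓡∂ n)) := by
  rw [range_halfSpace_model]
  intro x hx y hy a b ha hb _
  simp only [mem_ofPred_eq, PiLp.add_apply, PiLp.smul_apply, smul_eq_mul] at *
  positivity

theorem convex_chartBall (q : N) (ρ : ℝ) : Convex ℝ (chartBall (n := n) q ρ) :=
  (convex_closedBall _ _).inter convex_range_halfSpace

theorem exists_chartBall_subset (q : N) :
    ∃ ρ > 0, chartBall q ρ ⊆ (extChartAt (𝓡∂ n) q).target := by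
  obtain ⟨ε, hε, hsub⟩ := Metric.mem_nhdsWithin_iff.1 (extChartAt_target_mem_nhdsWithin (I := 𝓡∂ n) q)
  exact ⟨ε / 2, by positivity, (inter_subset_inter_left _
    (Metric.closedBall_subset_ball (by linarith))).trans hsub⟩

/-- Bounds near `q` for the geodesic equations with parameter in `[-R, R]`. -/
structure ChartBounds (h : RMetric n N) (om : SmoothOneForm (𝓡∂ n) N) (q : N) (R ρ L B : ℝ)
    (Λ : NNReal) : Prop where
  rho_pos : 0 < ρ
  L_pos : 0 < L
  B_nonneg : 0 ≤ B
  subset : chartBall q ρ ⊆ (extChartAt (𝓡∂ n) q).target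
  norm_le : ∀ z ∈ chartBall q ρ, ∀ u : 𝔼, metC h q z u u ≤ R ^ 2 → ‖u‖ ≤ L
  accel_le : ∀ k ∈ Icc (-R) R, ∀ z ∈ chartBall q ρ, ∀ u ∈ Metric.closedBall (0 : 𝔼) L,
    ‖chartAccel h om q k z u‖ ≤ B
  lipschitz : LipschitzOnWith Λ (fun w : ℝ × 𝔼 × 𝔼 => chartAccel h om q w.1 w.2.1 w.2.2)
    (Icc (-R) R ×ˢ chartBall q ρ ×ˢ Metric.closedBall 0 L)

theorem exists_metC_lower_bound (h : RMetric n N) (q : N) {K : Set 𝔼} (hK : IsCompact K)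
    (hKt : K ⊆ (extChartAt (𝓡∂ n) q).target) :
    ∃ c > 0, ∀ z ∈ K, ∀ u : 𝔼, c * ‖u‖ ^ 2 ≤ metC h q z u u := by
  have hcomp : IsCompact (K ×ˢ Metric.sphere (0 : 𝔼) 1) := hK.prod (isCompact_sphere _ _)
  have hcont : ContinuousOn (fun w : 𝔼 × 𝔼 => metC h q w.1 w.2 w.2)
      (K ×ˢ Metric.sphere (0 : 𝔼) 1) := by
    have h1 : ContinuousOn (fun w : 𝔼 × 𝔼 => metC h q w.1) (K ×ˢ Metric.sphere (0 : 𝔼) 1) :=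
      ((contDiffOn_metC h q).continuousOn.mono hKt).comp continuousOn_fst (fun w hw => hw.1)
    exact (h1.clm_apply continuousOn_snd).clm_apply continuousOn_snd
  have hpos : ∀ w ∈ K ×ˢ Metric.sphere (0 : 𝔼) 1, 0 < metC h q w.1 w.2 w.2 := fun w hw =>
    metC_pos h q (hKt hw.1) (by
      rintro h0
      have := hw.2
      rw [h0] at this
      simp at this)
  obtain ⟨c, hc, hle⟩ : ∃ c > 0, ∀ w ∈ K ×ˢ Metric.sphere (0 : 𝔼) 1, c ≤ metC h q w.1 w.2 w.2 := by
    rcases (K ×ˢ Metric.sphere (0 : 𝔼) 1).eq_empty_or_nonempty with he | hne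
    · exact ⟨1, one_pos, fun w hw => by rw [he] at hw; exact hw.elim⟩
    · obtain ⟨w, hw, hmin⟩ := hcomp.exists_isMinOn hne hcont
      exact ⟨_, hpos w hw, fun w' hw' => hmin hw'⟩
  refine ⟨c, hc, fun z hz u => ?_⟩
  by_cases hu : u = 0
  · simp [hu]
  · have hn : ‖u‖ ≠ 0 := norm_ne_zero_iff.2 hu
    have h1 := hle (z, ‖u‖⁻¹ • u) ⟨hz, by simp [norm_smul, hn]⟩
    simp only [map_smul, smul_apply, smul_eq_mul] at h1
    have h2 : metC h q z u u = ‖u‖ ^ 2 * (‖u‖⁻¹ * (‖u‖⁻¹ * metC h q z u u)) := by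
      field_simp
    rw [h2, mul_comm]
    exact mul_le_mul_of_nonneg_left h1 (by positivity)

theorem exists_chartBounds (h : RMetric n N) (om : SmoothOneForm (𝓡∂ n) N) (q : N) (R : ℝ) :
    ∃ ρ L B Λ, ChartBounds h om q R ρ L B Λ := by
  obtain ⟨ρ, hρ, hsub⟩ := exists_chartBall_subset (n := n) q
  obtain ⟨c, hc, hlow⟩ := exists_metC_lower_bound h q (isCompact_chartBall q ρ) hsub
  set L : ℝ := Real.sqrt (R ^ 2 / c) + 1 with hL
  have hcomp : IsCompact (Icc (-R) R ×ˢ chartBall (n := n) q ρ ×ˢ Metric.closedBall (0 : 𝔼) L) :=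
    isCompact_Icc.prod ((isCompact_chartBall q ρ).prod (isCompact_closedBall _ _))
  have hconv : Convex ℝ (Icc (-R) R ×ˢ chartBall (n := n) q ρ ×ˢ Metric.closedBall (0 : 𝔼) L) :=
    (convex_Icc _ _).prod ((convex_chartBall q ρ).prod (convex_closedBall _ _))
  have hsm : ContDiffOn ℝ ∞ (fun w : ℝ × 𝔼 × 𝔼 => chartAccel h om q w.1 w.2.1 w.2.2)
      (Icc (-R) R ×ˢ chartBall q ρ ×ˢ Metric.closedBall (0 : 𝔼) L) :=
    (contDiffOn_magF_chart h om q).mono (prod_mono (subset_univ _)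
      (prod_mono hsub (subset_univ _)))
  obtain ⟨Λ, hΛ⟩ := hsm.exists_lipschitzOnWith (by simp) hconv hcomp
  obtain ⟨B, hB⟩ := hcomp.exists_bound_of_continuousOn hsm.continuousOn
  refine ⟨ρ, L, max B 0, Λ, hρ, by positivity, le_max_right _ _, hsub, fun z hz u hu => ?_,
    fun k hk z hz u hu => (hB (k, z, u) ⟨hk, hz, hu⟩).trans (le_max_left _ _), hΛ⟩
  have h1 : ‖u‖ ^ 2 ≤ R ^ 2 / c := by
    rw [le_div_iff₀ hc, mul_comm]
    exact (hlow z hz u).trans hu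
  have h2 : ‖u‖ ≤ Real.sqrt (R ^ 2 / c) := Real.le_sqrt_of_sq_le h1
  linarith

end LocalConstants

theorem hasDerivWithinAt_of_quadratic {E : Type*} [NormedAddCommGroup E] [NormedSpace ℝ E]
    {f : ℝ → E} {v : E} {J : Set ℝ} {t C : ℝ}
    (H : ∀ᶠ s in 𝓝[J] t, ‖f s - f t - (s - t) • v‖ ≤ C * |s - t| ^ 2) :
    HasDerivWithinAt f v J t := by
  rw [hasDerivWithinAt_iff_isLittleO]
  have h1 : (fun s => f s - f t - (s - t) • v) =O[𝓝[J] t] fun s => (s - t) ^ 2 := by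
    refine Asymptotics.IsBigO.of_bound C ?_
    filter_upwards [H] with s hs
    rwa [norm_pow, Real.norm_eq_abs]
  refine h1.trans_isLittleO ?_
  have h2 : Tendsto (fun s : ℝ => s - t) (𝓝[J] t) (𝓝 0) := by
    have : Tendsto (fun s : ℝ => s - t) (𝓝 t) (𝓝 (t - t)) := (continuous_id.sub continuous_const).tendsto t
    rw [sub_self] at this
    exact this.mono_left nhdsWithin_le_nhds
  exact (Asymptotics.isLittleO_pow_id (by norm_num)).comp_tendsto h2

noncomputable section GeodesicBounds

variable {n : ℕ} [NeZero n] {N : Type*} [TopologicalSpace N] [T2Space N]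
  [ChartedSpace (EuclideanHalfSpace n) N] [IsManifold (𝓡∂ n) ∞ N]

local notation "𝔼" => EuclideanSpace ℝ (Fin n)

/-- Magnetic geodesics `D ẋ = k Y ẋ` of speed `|k|`. -/
def IsSpeedGeodesicOn (h : RMetric n N) (om : SmoothOneForm (𝓡∂ n) N) (k : ℝ) (x : ℝ → N)
    (J : Set ℝ) : Prop :=
  IsMagneticGeodesicOn h om k x J ∧ ∀ σ ∈ J, hNorm h (velocity (𝓡∂ n) x J σ) = |k|

theorem isUnitMagneticGeodesicOn_iff {h : RMetric n N} {om : SmoothOneForm (𝓡∂ n) N} {x : ℝ → N}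
    {J : Set ℝ} : IsUnitMagneticGeodesicOn h om x J ↔ IsSpeedGeodesicOn h om 1 x J := by
  simp [IsUnitMagneticGeodesicOn, IsSpeedGeodesicOn]

theorem inner_self_nonneg' (h : RMetric n N) {x : N} (v : TangentSpace (𝓡∂ n) x) :
    0 ≤ h.inner x v v := by
  by_cases hv : v = 0
  · rw [hv]; simp
  · exact (h.pos x v hv).le

theorem hNorm_nonneg (h : RMetric n N) {x : N} (v : TangentSpace (𝓡∂ n) x) : 0 ≤ hNorm h v :=
  Real.sqrt_nonneg _

theorem hNorm_sq (h : RMetric n N) {x : N} (v : TangentSpace (𝓡∂ n) x) :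
    hNorm h v ^ 2 = h.inner x v v :=
  Real.sq_sqrt (inner_self_nonneg' h v)

variable {h : RMetric n N} {om : SmoothOneForm (𝓡∂ n) N} {k : ℝ} {x : ℝ → N} {J : Set ℝ}

theorem metC_chartVel {t : ℝ} {p : N} (hx : ContMDiffWithinAt 𝓘(ℝ, ℝ) (𝓡∂ n) ∞ x J t)
    (hJ : UniqueDiffWithinAt ℝ J t) (hp : x t ∈ (extChartAt (𝓡∂ n) p).source) :
    metC h p (chartCurve n p x t) (chartVel n p x J t) (chartVel n p x J t)
      = h.inner (x t) (velocity (𝓡∂ n) x J t) (velocity (𝓡∂ n) x J t) :=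
  metC_velocity_velocity h (hx.mdifferentiableWithinAt (by simp)) hJ hp

theorem IsSpeedGeodesicOn.metC_chartVel (hx : IsSpeedGeodesicOn h om k x J) {t : ℝ} {p : N}
    (ht : t ∈ J) (hJ : UniqueDiffWithinAt ℝ J t) (hp : x t ∈ (extChartAt (𝓡∂ n) p).source) :
    metC h p (chartCurve n p x t) (chartVel n p x J t) (chartVel n p x J t) = k ^ 2 := by
  rw [_root_.metC_chartVel (hx.1.1 t ht) hJ hp, ← hNorm_sq, hx.2 t ht, sq_abs]

theorem chartCurve_mem_range (p : N) (x : ℝ → N) (t : ℝ) : chartCurve n p x t ∈ range (𝓡∂ n) :=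
  mem_range_self _

variable {q : N} {R ρ L B : ℝ} {Λ : NNReal}

theorem ChartBounds.norm_chartVel_le (hb : ChartBounds h om q R ρ L B Λ) (hk : k ∈ Icc (-R) R)
    (hx : IsSpeedGeodesicOn h om k x J) (hJ : UniqueDiffOn ℝ J) {t : ℝ} (ht : t ∈ J)
    (hs : x t ∈ (extChartAt (𝓡∂ n) q).source)
    (hz : chartCurve n q x t ∈ Metric.ball (extChartAt (𝓡∂ n) q q) ρ) :
    ‖chartVel n q x J t‖ ≤ L := by
  refine hb.norm_le _ ⟨Metric.ball_subset_closedBall hz, chartCurve_mem_range q x t⟩ _ ?_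
  rw [hx.metC_chartVel ht (hJ t ht) hs, ← sq_abs]
  exact pow_le_pow_left₀ (abs_nonneg _) (abs_le.2 hk) 2

theorem ChartBounds.stays (hb : ChartBounds h om q R ρ L B Λ) (hk : k ∈ Icc (-R) R)
    (hx : IsSpeedGeodesicOn h om k x J) (hJ : J.OrdConnected) (hJn : J.Nontrivial) {s t : ℝ}
    (hs : s ∈ J) (hss : x s ∈ (extChartAt (𝓡∂ n) q).source)
    (hsz : chartCurve n q x s ∈ Metric.ball (extChartAt (𝓡∂ n) q q) (ρ / 2))
    (ht : t ∈ J) (hts : |t - s| ≤ ρ / (4 * L)) :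
    x t ∈ (extChartAt (𝓡∂ n) q).source ∧
      chartCurve n q x t ∈ Metric.ball (extChartAt (𝓡∂ n) q q) ρ := by
  have hJu := hJ.uniqueDiffOn_real hJn
  refine stays_in_chart (L := L) hb.rho_pos hb.subset hJ (fun t ht => (hx.1.1 t ht).continuousWithinAt)
    hs hss hsz (fun b hbJ H => ?_) hb.L_pos.le (δ := ρ / (4 * L)) ?_ ht hts
  · change ‖chartCurve n q x b - chartCurve n q x s‖ ≤ _
    exact norm_sub_le_of_hasDerivWithinAt_uIcc (c := chartCurve n q x)
      (c' := chartVel n q x J) hJ hs hbJ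
      (fun τ hτ => hasDerivWithinAt_chartCurve (hx.1.1 τ (hJ.uIcc_subset hs hbJ hτ)) (H τ hτ).1)
      (fun τ hτ => hb.norm_chartVel_le hk hx hJu (hJ.uIcc_subset hs hbJ hτ) (H τ hτ).1 (H τ hτ).2)
  · have := hb.L_pos
    field_simp
    rfl

theorem ChartBounds.estimates (hb : ChartBounds h om q R ρ L B Λ) (hk : k ∈ Icc (-R) R)
    (hx : IsSpeedGeodesicOn h om k x J) (hJ : J.OrdConnected) (hJn : J.Nontrivial) {s t t' : ℝ}
    (hs : s ∈ J) (hss : x s ∈ (extChartAt (𝓡∂ n) q).source)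
    (hsz : chartCurve n q x s ∈ Metric.ball (extChartAt (𝓡∂ n) q q) (ρ / 2))
    (ht : t ∈ J) (hts : |t - s| ≤ ρ / (4 * L)) (ht' : t' ∈ J) (hts' : |t' - s| ≤ ρ / (4 * L)) :
    ‖chartCurve n q x t' - chartCurve n q x t‖ ≤ L * |t' - t| ∧
    ‖chartVel n q x J t' - chartVel n q x J t‖ ≤ B * |t' - t| ∧
    ‖chartCurve n q x t' - chartCurve n q x t - (t' - t) • chartVel n q x J t‖
      ≤ B * |t' - t| ^ 2 ∧
    ‖chartVel n q x J t' - chartVel n q x J t - (t' - t) •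
      chartAccel h om q k (chartCurve n q x t) (chartVel n q x J t)‖
      ≤ Λ * (L + B) * |t' - t| ^ 2 := by
  have hJu := hJ.uniqueDiffOn_real hJn
  set J' : Set ℝ := J ∩ Icc (s - ρ / (4 * L)) (s + ρ / (4 * L)) with hJ'
  have hin : ∀ τ ∈ J', x τ ∈ (extChartAt (𝓡∂ n) q).source ∧
      chartCurve n q x τ ∈ Metric.ball (extChartAt (𝓡∂ n) q q) ρ := fun τ hτ =>
    hb.stays hk hx hJ hJn hs hss hsz hτ.1
      (abs_le.2 ⟨by linarith [hτ.2.1], by linarith [hτ.2.2]⟩)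
  have hmem : ∀ τ ∈ J', chartCurve n q x τ ∈ chartBall q ρ := fun τ hτ =>
    ⟨Metric.ball_subset_closedBall (hin τ hτ).2, chartCurve_mem_range q x τ⟩
  have hL : ∀ τ ∈ J', ‖chartVel n q x J τ‖ ≤ L := fun τ hτ =>
    hb.norm_chartVel_le hk hx hJu hτ.1 (hin τ hτ).1 (hin τ hτ).2
  have hL' : ∀ τ ∈ J', chartVel n q x J τ ∈ Metric.closedBall (0 : 𝔼) L := fun τ hτ => by
    simpa using hL τ hτ
  refine second_order_ode_estimates (J := J') (u := chartVel n q x J)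
    (a := fun τ => chartAccel h om q k (chartCurve n q x τ) (chartVel n q x J τ))
    (hJ.inter ordConnected_Icc) (fun τ hτ => ?_) (fun τ hτ => ?_) hL (fun τ hτ => ?_) Λ.2
    (fun τ hτ τ' hτ' => ?_) ?_ ?_
  · exact (hasDerivWithinAt_chartCurve (hx.1.1 τ hτ.1) (hin τ hτ).1).mono inter_subset_left
  · exact (hx.1.hasDerivWithinAt_chartVel hJu hτ.1 (hin τ hτ).1).mono inter_subset_left
  · exact hb.accel_le k hk _ (hmem τ hτ) _ (hL' τ hτ)
  · have h1 := hb.lipschitz.dist_le_mul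
      (k, chartCurve n q x τ', chartVel n q x J τ') ⟨hk, hmem τ' hτ', hL' τ' hτ'⟩
      (k, chartCurve n q x τ, chartVel n q x J τ) ⟨hk, hmem τ hτ, hL' τ hτ⟩
    rw [dist_eq_norm] at h1
    refine h1.trans (mul_le_mul_of_nonneg_left ?_ Λ.2)
    rw [Prod.dist_eq, Prod.dist_eq, dist_self, dist_eq_norm, dist_eq_norm]
    have e1 := norm_nonneg (chartCurve n q x τ' - chartCurve n q x τ)
    have e2 := norm_nonneg (chartVel n q x J τ' - chartVel n q x J τ)
    exact max_le (by positivity) (max_le (by simp) (by simp))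
  · rw [abs_le] at hts
    exact ⟨ht, by linarith [hts.1], by linarith [hts.2]⟩
  · rw [abs_le] at hts'
    exact ⟨ht', by linarith [hts'.1], by linarith [hts'.2]⟩

end GeodesicBounds

noncomputable section Compactness

variable {n : ℕ} [NeZero n] {N : Type*} [TopologicalSpace N] [T2Space N]
  [ChartedSpace (EuclideanHalfSpace n) N] [IsManifold (𝓡∂ n) ∞ N]

local notation "𝔼" => EuclideanSpace ℝ (Fin n)

theorem ContinuousOn.tendsto_of_eventually_mem {α β ι : Type*} [TopologicalSpace α]
    [TopologicalSpace β] {g : α → β} {S : Set α} (hg : ContinuousOn g S) {f : ι → α} {l : Filter ι}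
    {a : α} (ha : a ∈ S) (hf : Tendsto f l (𝓝 a)) (hS : ∀ᶠ i in l, f i ∈ S) :
    Tendsto (fun i => g (f i)) l (𝓝 (g a)) :=
  (hg a ha).tendsto.comp (tendsto_nhdsWithin_iff.2 ⟨hf, hS⟩)

theorem LipschitzOnWith.tendsto_triple {E F : Type*} [NormedAddCommGroup E]
    [NormedAddCommGroup F] {G : ℝ → E → E → F} {S : Set ℝ} {T V : Set E} {Λ : NNReal}
    (hG : LipschitzOnWith Λ (fun w : ℝ × E × E => G w.1 w.2.1 w.2.2) (S ×ˢ T ×ˢ V))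
    {ι : Type*} {l : Filter ι} {κ : ℝ} {z u : E} (hκ : κ ∈ S) (hz : z ∈ T) (hu : u ∈ V)
    {k : ι → ℝ} {c v : ι → E} (hk : Tendsto k l (𝓝 κ)) (hc : Tendsto c l (𝓝 z))
    (hv : Tendsto v l (𝓝 u)) (hS : ∀ᶠ i in l, k i ∈ S ∧ c i ∈ T ∧ v i ∈ V) :
    Tendsto (fun i => G (k i) (c i) (v i)) l (𝓝 (G κ z u)) :=
  hG.continuousOn.tendsto_of_eventually_mem (a := (κ, z, u)) ⟨hκ, hz, hu⟩
    (hk.prodMk_nhds (hc.prodMk_nhds hv)) hS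

theorem Filter.Tendsto.clm_apply₂ {E F ι : Type*} [NormedAddCommGroup E] [NormedSpace ℝ E]
    [NormedAddCommGroup F] [NormedSpace ℝ F] {l : Filter ι} {m : ι → E →L[ℝ] E →L[ℝ] F}
    {m₀ : E →L[ℝ] E →L[ℝ] F} {u v : ι → E} {u₀ v₀ : E} (hm : Tendsto m l (𝓝 m₀))
    (hu : Tendsto u l (𝓝 u₀)) (hv : Tendsto v l (𝓝 v₀)) :
    Tendsto (fun i => m i (u i) (v i)) l (𝓝 (m₀ u₀ v₀)) := by
  have h1 : Tendsto (fun i => m i (u i)) l (𝓝 (m₀ u₀)) :=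
    ((isBoundedBilinearMap_apply (𝕜 := ℝ) (E := E) (F := E →L[ℝ] F)).continuous.tendsto
      (m₀, u₀)).comp (hm.prodMk_nhds hu)
  exact ((isBoundedBilinearMap_apply (𝕜 := ℝ) (E := E) (F := F)).continuous.tendsto
      (m₀ u₀, v₀)).comp (h1.prodMk_nhds hv)

theorem velocity_eq_chartVel {x : ℝ → N} {J : Set ℝ} {t : ℝ}
    (hx : ContMDiffWithinAt 𝓘(ℝ, ℝ) (𝓡∂ n) ∞ x J t) :
    (velocity (𝓡∂ n) x J t : 𝔼) = chartVel n (x t) x J t :=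
  velocity_eq_derivWithin (hx.mdifferentiableWithinAt (by simp))

theorem exists_limit_geodesic [CompactSpace N] (h : RMetric n N) (om : SmoothOneForm (𝓡∂ n) N)
    {ι : Type*} (𝓕 : Ultrafilter ι) {k : ι → ℝ} {κ : ℝ} (hk : Tendsto k 𝓕 (𝓝 κ))
    {x : ι → ℝ → N} {J : Set ℝ} (hJ : J.OrdConnected) (hJn : J.Nontrivial)
    (hx : ∀ i, IsSpeedGeodesicOn h om (k i) (x i) J) :
    ∃ X : ℝ → N, IsSpeedGeodesicOn h om κ X J ∧
      (∀ t ∈ J, Tendsto (fun i => x i t) 𝓕 (𝓝 (X t))) ∧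
      ∀ t ∈ J, Tendsto (fun i => chartVel n (X t) (x i) J t) 𝓕
        (𝓝 (velocity (𝓡∂ n) X J t : 𝔼)) := by
  have hJu := hJ.uniqueDiffOn_real hJn
  have hlim : ∀ t : ℝ, ∃ y : N, Tendsto (fun i => x i t) 𝓕 (𝓝 y) := fun t => by
    obtain ⟨y, -, hy⟩ := isCompact_univ.ultrafilter_le_nhds (𝓕.map (fun i => x i t)) (by simp)
    exact ⟨y, hy⟩
  choose X hX using hlim
  have hkR : ∀ᶠ i in (𝓕 : Filter ι), k i ∈ Icc (-(|κ| + 1)) (|κ| + 1) := by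
    refine hk.eventually (Icc_mem_nhds ?_ ?_)
    · linarith [neg_abs_le κ]
    · linarith [le_abs_self κ]
  have main : ∀ s ∈ J, ∃ (U : Set ℝ) (u : ℝ → 𝔼), IsOpen U ∧ s ∈ U ∧ ∀ t ∈ J ∩ U,
      X t ∈ (extChartAt (𝓡∂ n) (X s)).source ∧
      HasDerivWithinAt (chartCurve n (X s) X) (u t) J t ∧
      HasDerivWithinAt u (chartAccel h om (X s) κ (chartCurve n (X s) X t) (u t)) J t ∧
      Tendsto (fun i => chartVel n (X s) (x i) J t) 𝓕 (𝓝 (u t)) ∧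
      metC h (X s) (chartCurve n (X s) X t) (u t) (u t) = κ ^ 2 := by
    intro s hs
    set q := X s with hq
    obtain ⟨ρ, L, B, Λ, hb⟩ := exists_chartBounds h om q (|κ| + 1)
    set δ := ρ / (4 * L) with hδ
    have hδ0 : 0 < δ := div_pos hb.rho_pos (by linarith [hb.L_pos])
    have hstart : ∀ᶠ i in (𝓕 : Filter ι), x i s ∈ (extChartAt (𝓡∂ n) q).source ∧
        chartCurve n q (x i) s ∈ Metric.ball (extChartAt (𝓡∂ n) q q) (ρ / 2) := by
      refine ((hX s).eventually (extChartAt_source_mem_nhds (I := 𝓡∂ n) q)).and ?_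
      have h1 : Tendsto (fun i => extChartAt (𝓡∂ n) q (x i s)) 𝓕 (𝓝 (extChartAt (𝓡∂ n) q q)) :=
        (continuousAt_extChartAt q).tendsto.comp (hX s)
      exact h1.eventually (Metric.ball_mem_nhds _ (by linarith [hb.rho_pos]))
    have hgood := hkR.and hstart
    have hmem : ∀ t ∈ J, |t - s| ≤ δ → ∀ᶠ i in (𝓕 : Filter ι),
        x i t ∈ (extChartAt (𝓡∂ n) q).source ∧ chartCurve n q (x i) t ∈ chartBall q ρ ∧
        chartVel n q (x i) J t ∈ Metric.closedBall (0 : 𝔼) L := by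
      intro t ht hts
      filter_upwards [hgood] with i hi
      have h1 := hb.stays hi.1 (hx i) hJ hJn hs hi.2.1 hi.2.2 ht hts
      refine ⟨h1.1, ⟨Metric.ball_subset_closedBall h1.2, chartCurve_mem_range _ _ _⟩, ?_⟩
      simpa using hb.norm_chartVel_le hi.1 (hx i) hJu ht h1.1 h1.2
    have hXs : ∀ t ∈ J, |t - s| ≤ δ → X t ∈ (extChartAt (𝓡∂ n) q).source ∧
        Tendsto (fun i => chartCurve n q (x i) t) 𝓕 (𝓝 (chartCurve n q X t)) ∧
        chartCurve n q X t ∈ chartBall q ρ := by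
      intro t ht hts
      have hcl : IsClosed ((extChartAt (𝓡∂ n) q).symm '' chartBall q ρ) :=
        ((isCompact_chartBall q ρ).image_of_continuousOn
          ((continuousOn_extChartAt_symm q).mono hb.subset)).isClosed
      have h1 : X t ∈ (extChartAt (𝓡∂ n) q).symm '' chartBall q ρ := by
        refine hcl.mem_of_tendsto (hX t) ?_
        filter_upwards [hmem t ht hts] with i hi
        exact ⟨_, hi.2.1, (extChartAt (𝓡∂ n) q).left_inv hi.1⟩
      have h2 : X t ∈ (extChartAt (𝓡∂ n) q).source := by
        obtain ⟨z, hz, hzX⟩ := h1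
        rw [← hzX]
        exact (extChartAt (𝓡∂ n) q).map_target (hb.subset hz)
      have h3 : Tendsto (fun i => chartCurve n q (x i) t) 𝓕 (𝓝 (chartCurve n q X t)) :=
        (continuousAt_extChartAt' h2).tendsto.comp (hX t)
      exact ⟨h2, h3, (isCompact_chartBall q ρ).isClosed.mem_of_tendsto h3
        ((hmem t ht hts).mono fun i hi => hi.2.1)⟩
    have hul : ∀ t, ∃ w : 𝔼, t ∈ J → |t - s| ≤ δ →
        Tendsto (fun i => chartVel n q (x i) J t) 𝓕 (𝓝 w) ∧ w ∈ Metric.closedBall (0 : 𝔼) L := by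
      intro t
      by_cases ht : t ∈ J ∧ |t - s| ≤ δ
      · obtain ⟨w, hw, hw'⟩ := (isCompact_closedBall (0 : 𝔼) L).ultrafilter_le_nhds
          (𝓕.map (fun i => chartVel n q (x i) J t)) (by
            rw [le_principal_iff]
            exact (hmem t ht.1 ht.2).mono fun i hi => hi.2.2)
        exact ⟨w, fun _ _ => ⟨hw', hw⟩⟩
      · exact ⟨0, fun h1 h2 => absurd ⟨h1, h2⟩ ht⟩
    choose u hu using hul
    have hk' : κ ∈ Icc (-(|κ| + 1)) (|κ| + 1) :=
      ⟨by linarith [neg_abs_le κ], by linarith [le_abs_self κ]⟩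
    have hF : ∀ t ∈ J, |t - s| ≤ δ → Tendsto (fun i => chartAccel h om q (k i)
        (chartCurve n q (x i) t) (chartVel n q (x i) J t)) 𝓕
        (𝓝 (chartAccel h om q κ (chartCurve n q X t) (u t))) := by
      intro t ht hts
      exact hb.lipschitz.tendsto_triple (G := chartAccel h om q) hk' (hXs t ht hts).2.2
        (hu t ht hts).2 hk (hXs t ht hts).2.1 (hu t ht hts).1 (by
        filter_upwards [hkR, hmem t ht hts] with i hi hi' using ⟨hi, hi'.2.1, hi'.2.2⟩)
    refine ⟨Metric.ball s δ, u, Metric.isOpen_ball, Metric.mem_ball_self hδ0, fun t ht => ?_⟩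
    have hts : |t - s| ≤ δ := (Metric.mem_ball.1 ht.2).le
    have hev : ∀ᶠ t' in 𝓝[J] t, t' ∈ J ∧ |t' - s| ≤ δ := by
      filter_upwards [self_mem_nhdsWithin,
        mem_nhdsWithin_of_mem_nhds (Metric.isOpen_ball.mem_nhds ht.2)] with t' h1 h2
      exact ⟨h1, (Metric.mem_ball.1 h2).le⟩
    refine ⟨(hXs t ht.1 hts).1, ?_, ?_, (hu t ht.1 hts).1, ?_⟩
    · refine hasDerivWithinAt_of_quadratic (C := B) (hev.mono fun t' ht' => ?_)
      refine le_of_tendsto ((((hXs t' ht'.1 ht'.2).2.1.sub (hXs t ht.1 hts).2.1).sub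
        ((hu t ht.1 hts).1.const_smul (t' - t))).norm) ?_
      filter_upwards [hgood] with i hi
      exact (hb.estimates hi.1 (hx i) hJ hJn hs hi.2.1 hi.2.2 ht.1 hts ht'.1 ht'.2).2.2.1
    · refine hasDerivWithinAt_of_quadratic (C := Λ * (L + B)) (hev.mono fun t' ht' => ?_)
      refine le_of_tendsto ((((hu t' ht'.1 ht'.2).1.sub (hu t ht.1 hts).1).sub
        ((hF t ht.1 hts).const_smul (t' - t))).norm) ?_
      filter_upwards [hgood] with i hi
      exact (hb.estimates hi.1 (hx i) hJ hJn hs hi.2.1 hi.2.2 ht.1 hts ht'.1 ht'.2).2.2.2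
    · have h0 : ContinuousWithinAt (metC h q) (extChartAt (𝓡∂ n) q).target (chartCurve n q X t) :=
        (contDiffOn_metC h q).continuousOn _ (hb.subset (hXs t ht.1 hts).2.2)
      have h1 : Tendsto (fun i => metC h q (chartCurve n q (x i) t)) 𝓕
          (𝓝 (metC h q (chartCurve n q X t))) :=
        h0.tendsto.comp (tendsto_nhdsWithin_iff.2 ⟨(hXs t ht.1 hts).2.1, by
          filter_upwards [hmem t ht.1 hts] with i hi using hb.subset hi.2.1⟩)
      have h2 := h1.clm_apply₂ (hu t ht.1 hts).1 (hu t ht.1 hts).1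
      refine tendsto_nhds_unique h2 ((hk.pow 2).congr' ?_)
      filter_upwards [hmem t ht.1 hts] with i hi
      exact ((hx i).metC_chartVel ht.1 (hJu t ht.1) hi.1).symm
  have hgeo : IsMagneticGeodesicOn h om κ X J := by
    refine isMagneticGeodesicOn_of_chart hJu fun s hs => ?_
    obtain ⟨U, u, hU, hsU, H⟩ := main s hs
    exact ⟨X s, U, u, hU, hsU, fun t ht => ⟨(H t ht).1, (H t ht).2.1, (H t ht).2.2.1⟩⟩
  refine ⟨X, ⟨hgeo, fun s hs => ?_⟩, fun t _ => hX t, fun s hs => ?_⟩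
  · obtain ⟨U, u, hU, hsU, H⟩ := main s hs
    obtain ⟨h1, h2, -, -, h3⟩ := H s ⟨hs, hsU⟩
    have h4 : chartVel n (X s) X J s = u s := h2.derivWithin (hJu s hs)
    have h5 := metC_chartVel (h := h) (hgeo.1 s hs) (hJu s hs) h1
    rw [h4, h3] at h5
    rw [← hNorm_sq, sq_eq_sq_iff_abs_eq_abs, eq_comm] at h5
    rwa [abs_of_nonneg (hNorm_nonneg h _)] at h5
  · obtain ⟨U, u, hU, hsU, H⟩ := main s hs
    obtain ⟨h1, h2, -, h3, -⟩ := H s ⟨hs, hsU⟩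
    have h4 : chartVel n (X s) X J s = u s := h2.derivWithin (hJu s hs)
    have h5 := velocity_eq_chartVel (hgeo.1 s hs)
    rw [h4] at h5
    exact h5 ▸ h3

end Compactness

section OdeUnique

variable {E : Type*} [NormedAddCommGroup E] [NormedSpace ℝ E]

theorem LipschitzOnWith.prodMk_left_const {F : Type*} [NormedAddCommGroup F] {G : ℝ → E → E → F}
    {S : Set ℝ} {T V : Set E} {Λ : NNReal}
    (hG : LipschitzOnWith Λ (fun w : ℝ × E × E => G w.1 w.2.1 w.2.2) (S ×ˢ T ×ˢ V)) {k : ℝ}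
    (hk : k ∈ S) : LipschitzOnWith Λ (fun w : E × E => G k w.1 w.2) (T ×ˢ V) := by
  intro w hw w' hw'
  refine (hG (x := (k, w)) ⟨hk, hw⟩ (y := (k, w')) ⟨hk, hw'⟩).trans ?_
  gcongr
  rw [Prod.edist_eq]
  simp

theorem second_order_ode_unique {F : E → E → E} {T V : Set E} {Λ : NNReal}
    (hF : LipschitzOnWith Λ (fun w : E × E => F w.1 w.2) (T ×ˢ V)) {a b : ℝ}
    {c u c' u' : ℝ → E}
    (hc : ∀ t ∈ Icc a b, HasDerivWithinAt c (u t) (Icc a b) t)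
    (hu : ∀ t ∈ Icc a b, HasDerivWithinAt u (F (c t) (u t)) (Icc a b) t)
    (hc' : ∀ t ∈ Icc a b, HasDerivWithinAt c' (u' t) (Icc a b) t)
    (hu' : ∀ t ∈ Icc a b, HasDerivWithinAt u' (F (c' t) (u' t)) (Icc a b) t)
    (hm : ∀ t ∈ Icc a b, c t ∈ T ∧ u t ∈ V) (hm' : ∀ t ∈ Icc a b, c' t ∈ T ∧ u' t ∈ V)
    (h0 : c a = c' a) (h1 : u a = u' a) : EqOn c c' (Icc a b) := by
  have hL : LipschitzOnWith (max 1 Λ) (fun w : E × E => (w.2, F w.1 w.2)) (T ×ˢ V) :=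
    (LipschitzWith.prod_snd.lipschitzOnWith).prodMk hF
  have hnhds : ∀ t ∈ Ico a b, Icc a b ∈ 𝓝[Ici t] t := fun t ht =>
    mem_of_superset (Icc_mem_nhdsGE ht.2) (Icc_subset_Icc_left ht.1)
  have key := ODE_solution_unique_of_mem_Icc_right (v := fun _ w => (w.2, F w.1 w.2))
    (s := fun _ => T ×ˢ V) (K := max 1 Λ) (f := fun t => (c t, u t)) (g := fun t => (c' t, u' t))
    (a := a) (b := b) (fun _ _ => hL)
    (fun t ht => ((hc t ht).continuousWithinAt).prodMk (hu t ht).continuousWithinAt)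
    (fun t ht => ((hc t (Ico_subset_Icc_self ht)).prodMk
      (hu t (Ico_subset_Icc_self ht))).mono_of_mem_nhdsWithin (hnhds t ht))
    (fun t ht => hm t (Ico_subset_Icc_self ht))
    (fun t ht => ((hc' t ht).continuousWithinAt).prodMk (hu' t ht).continuousWithinAt)
    (fun t ht => ((hc' t (Ico_subset_Icc_self ht)).prodMk
      (hu' t (Ico_subset_Icc_self ht))).mono_of_mem_nhdsWithin (hnhds t ht))
    (fun t ht => hm' t (Ico_subset_Icc_self ht)) (by rw [h0, h1])
  exact fun t ht => (Prod.ext_iff.1 (key ht)).1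

end OdeUnique

noncomputable section Uniqueness

variable {n : ℕ} [NeZero n] {N : Type*} [TopologicalSpace N] [T2Space N]
  [ChartedSpace (EuclideanHalfSpace n) N] [IsManifold (𝓡∂ n) ∞ N]

local notation "𝔼" => EuclideanSpace ℝ (Fin n)

variable {h : RMetric n N} {om : SmoothOneForm (𝓡∂ n) N} {k : ℝ} {x y : ℝ → N} {J J' : Set ℝ}

theorem velocity_mono {t : ℝ} (hx : MDifferentiableWithinAt 𝓘(ℝ, ℝ) (𝓡∂ n) x J t)
    (hJ' : UniqueDiffWithinAt ℝ J' t) (hsub : J' ⊆ J) :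
    velocity (𝓡∂ n) x J' t = velocity (𝓡∂ n) x J t := by
  unfold velocity
  rw [mfderivWithin_subset hsub hJ'.uniqueMDiffWithinAt hx]

theorem exists_chart_window (hx : ContinuousOn x J) {s : ℝ} (hs : s ∈ J) {p : N}
    (hp : x s ∈ (extChartAt (𝓡∂ n) p).source) :
    ∃ U : Set ℝ, IsOpen U ∧ s ∈ U ∧ ∀ t ∈ J ∩ U, x t ∈ (extChartAt (𝓡∂ n) p).source := by
  obtain ⟨U, hU, hUe⟩ := continuousOn_iff'.1 hx _ (isOpen_extChartAt_source (I := 𝓡∂ n) p)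
  have h1 : s ∈ x ⁻¹' (extChartAt (𝓡∂ n) p).source ∩ J := ⟨hp, hs⟩
  exact ⟨U, hU, (hUe ▸ h1).1, fun t ht => (hUe.symm ▸ (⟨ht.2, ht.1⟩ : t ∈ U ∩ J) :
    t ∈ x ⁻¹' (extChartAt (𝓡∂ n) p).source ∩ J).1⟩

theorem IsMagneticGeodesicOn.mono (hx : IsMagneticGeodesicOn h om k x J) (hJ : UniqueDiffOn ℝ J)
    (hJ' : UniqueDiffOn ℝ J') (hsub : J' ⊆ J) : IsMagneticGeodesicOn h om k x J' := by
  refine isMagneticGeodesicOn_of_chart hJ' fun s hs => ?_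
  obtain ⟨U, hU, hsU, H⟩ := exists_chart_window hx.1.continuousOn (hsub hs)
    (mem_extChartAt_source (I := 𝓡∂ n) (x s))
  exact ⟨x s, U, chartVel n (x s) x J, hU, hsU, fun t ht => ⟨H t ⟨hsub ht.1, ht.2⟩,
    (hasDerivWithinAt_chartCurve (hx.1 t (hsub ht.1)) (H t ⟨hsub ht.1, ht.2⟩)).mono hsub,
    (hx.hasDerivWithinAt_chartVel hJ (hsub ht.1) (H t ⟨hsub ht.1, ht.2⟩)).mono hsub⟩⟩

theorem IsSpeedGeodesicOn.mono (hx : IsSpeedGeodesicOn h om k x J) (hJ : UniqueDiffOn ℝ J)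
    (hJ' : UniqueDiffOn ℝ J') (hsub : J' ⊆ J) : IsSpeedGeodesicOn h om k x J' :=
  ⟨hx.1.mono hJ hJ' hsub, fun σ hσ => by
    rw [velocity_mono ((hx.1.1 σ (hsub hσ)).mdifferentiableWithinAt (by simp)) (hJ' σ hσ) hsub]
    exact hx.2 σ (hsub hσ)⟩

theorem chartVel_congr {p : N} {t : ℝ} (hxy : EqOn x y J) (ht : t ∈ J) :
    chartVel n p x J t = chartVel n p y J t := by
  unfold chartVel
  exact derivWithin_congr (fun τ hτ => by simp [chartCurve, hxy hτ]) (by simp [chartCurve, hxy ht])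

theorem chartVel_mono {p : N} {t : ℝ} (hx : ContMDiffWithinAt 𝓘(ℝ, ℝ) (𝓡∂ n) ∞ x J t)
    (hp : x t ∈ (extChartAt (𝓡∂ n) p).source) (hJ' : UniqueDiffWithinAt ℝ J' t) (hsub : J' ⊆ J) :
    chartVel n p x J' t = chartVel n p x J t :=
  ((hasDerivWithinAt_chartCurve hx hp).mono hsub).derivWithin hJ'

theorem IsSpeedGeodesicOn.unique {a b : ℝ} (hab : a < b)
    (hx : IsSpeedGeodesicOn h om k x (Icc a b)) (hy : IsSpeedGeodesicOn h om k y (Icc a b))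
    (h0 : x a = y a)
    (hv : (velocity (𝓡∂ n) x (Icc a b) a : 𝔼) = velocity (𝓡∂ n) y (Icc a b) a) :
    EqOn x y (Icc a b) := by
  have hJ := uniqueDiffOn_Icc hab
  have hJn : (Icc a b).Nontrivial := ⟨a, ⟨le_rfl, hab.le⟩, b, ⟨hab.le, le_rfl⟩, hab.ne⟩
  have hcl : IsClosed ({t | x t = y t} ∩ Icc a b) := by
    have := (hx.1.1.continuousOn.prodMk hy.1.1.continuousOn).preimage_isClosed_of_isClosed
      isClosed_Icc (isClosed_diagonal (X := N))
    rw [inter_comm]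
    exact this
  refine hcl.Icc_subset_of_forall_mem_nhdsGT_of_Icc_subset h0 fun t ht hS => ?_
  have htJ : t ∈ Icc a b := Ico_subset_Icc_self ht
  have hxyt : x t = y t := hS ⟨ht.1, le_rfl⟩
  set q := x t with hq
  have hqx : x t ∈ (extChartAt (𝓡∂ n) q).source := mem_extChartAt_source _
  have hqy : y t ∈ (extChartAt (𝓡∂ n) q).source := by rw [← hxyt]; exact mem_extChartAt_source _
  have hvel : chartVel n q x (Icc a b) t = chartVel n q y (Icc a b) t := by
    rcases ht.1.eq_or_lt with rfl | hat
    · have h1 := velocity_eq_chartVel (hx.1.1 a htJ)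
      have h2 := velocity_eq_chartVel (hy.1.1 a htJ)
      rw [← hxyt] at h2
      exact (h1.symm.trans hv).trans h2
    · have hsub : Icc a t ⊆ Icc a b := Icc_subset_Icc_right ht.2.le
      have hu := uniqueDiffOn_Icc hat t ⟨hat.le, le_rfl⟩
      rw [← chartVel_mono (hx.1.1 t htJ) hqx hu hsub, ← chartVel_mono (hy.1.1 t htJ) hqy hu hsub]
      exact chartVel_congr hS ⟨hat.le, le_rfl⟩
  obtain ⟨ρ, L, B, Λ, hb⟩ := exists_chartBounds h om q |k|
  have hk : k ∈ Icc (-|k|) |k| := ⟨neg_abs_le k, le_abs_self k⟩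
  set δ := min (ρ / (4 * L)) (b - t) with hδ
  have hδ0 : 0 < δ := lt_min (div_pos hb.rho_pos (by linarith [hb.L_pos])) (by linarith [ht.2])
  have hδ1 : δ ≤ ρ / (4 * L) := min_le_left _ _
  have hδ2 : δ ≤ b - t := min_le_right _ _
  have hsub : Icc t (t + δ) ⊆ Icc a b := Icc_subset_Icc ht.1 (by linarith)
  have hball : extChartAt (𝓡∂ n) q q ∈ Metric.ball (extChartAt (𝓡∂ n) q q) (ρ / 2) :=
    Metric.mem_ball_self (by linarith [hb.rho_pos])
  have prep : ∀ {w : ℝ → N}, IsSpeedGeodesicOn h om k w (Icc a b) → w t = q →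
      ∀ τ ∈ Icc t (t + δ), w τ ∈ (extChartAt (𝓡∂ n) q).source ∧
      chartCurve n q w τ ∈ chartBall q ρ ∧
      chartVel n q w (Icc a b) τ ∈ Metric.closedBall (0 : 𝔼) L := by
    intro w hw hwt τ hτ
    have h1 := hb.stays hk hw ordConnected_Icc hJn htJ (by rw [hwt]; exact mem_extChartAt_source _)
      (by unfold chartCurve; rw [hwt]; exact hball) (hsub hτ) (by
        rw [abs_of_nonneg (by linarith [hτ.1])]; linarith [hτ.2])
    refine ⟨h1.1, ⟨Metric.ball_subset_closedBall h1.2, chartCurve_mem_range _ _ _⟩, ?_⟩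
    simpa using hb.norm_chartVel_le hk hw hJ (hsub hτ) h1.1 h1.2
  have px := prep hx rfl
  have py := prep hy hxyt.symm
  have key := second_order_ode_unique (F := chartAccel h om q k)
    (hb.lipschitz.prodMk_left_const (G := chartAccel h om q) hk) (a := t) (b := t + δ)
    (c := chartCurve n q x) (u := chartVel n q x (Icc a b))
    (c' := chartCurve n q y) (u' := chartVel n q y (Icc a b))
    (fun τ hτ => (hasDerivWithinAt_chartCurve (hx.1.1 τ (hsub hτ)) (px τ hτ).1).mono hsub)
    (fun τ hτ => (hx.1.hasDerivWithinAt_chartVel hJ (hsub hτ) (px τ hτ).1).mono hsub)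
    (fun τ hτ => (hasDerivWithinAt_chartCurve (hy.1.1 τ (hsub hτ)) (py τ hτ).1).mono hsub)
    (fun τ hτ => (hy.1.hasDerivWithinAt_chartVel hJ (hsub hτ) (py τ hτ).1).mono hsub)
    (fun τ hτ => (px τ hτ).2) (fun τ hτ => (py τ hτ).2)
    (by unfold chartCurve; rw [← hxyt]) hvel
  refine mem_of_superset (Icc_mem_nhdsGT (show t < t + δ by linarith)) fun τ hτ => ?_
  exact (extChartAt (𝓡∂ n) q).injOn (px τ hτ).1 (py τ hτ).1 (key hτ)

end Uniqueness

noncomputable section Reparametrization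

variable {n : ℕ} [NeZero n] {N : Type*} [TopologicalSpace N]
  [ChartedSpace (EuclideanHalfSpace n) N] [IsManifold (𝓡∂ n) ∞ N]

local notation "𝔼" => EuclideanSpace ℝ (Fin n)

theorem eq_of_inner_eq (h : RMetric n N) {x : N} {u v : TangentSpace (𝓡∂ n) x}
    (H : ∀ e, h.inner x u e = h.inner x v e) : u = v := by
  by_contra hne
  have h1 := h.pos x (u - v) (sub_ne_zero.2 hne)
  have h2 : h.inner x (u - v) (u - v) = h.inner x u (u - v) - h.inner x v (u - v) :=
    DFunLike.congr_fun (map_sub (h.inner x) u v) (u - v)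
  rw [h2, H (u - v), sub_self] at h1
  exact lt_irrefl _ h1

theorem lorentzForce_smul (h : RMetric n N) (om : SmoothOneForm (𝓡∂ n) N) (x : N) (c : ℝ)
    (u : TangentSpace (𝓡∂ n) x) :
    lorentzForce h om x (c • u) = c • lorentzForce h om x u := by
  refine eq_of_inner_eq h fun e => ?_
  rw [inner_lorentzForce, map_smul]
  refine Eq.trans ?_ (congrArg (fun r => c * r) (inner_lorentzForce h om x u e).symm)
  simp only [extD, map_smul, smul_apply, smul_eq_mul]
  ring

variable {h : RMetric n N} {om : SmoothOneForm (𝓡∂ n) N} {x : ℝ → N} {J J' : Set ℝ} {ψ : ℝ → ℝ}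

theorem velocity_comp {s : ℝ} (hx : ContMDiffWithinAt 𝓘(ℝ, ℝ) (𝓡∂ n) ∞ x J (ψ s))
    (hψ : ContDiffWithinAt ℝ ∞ ψ J' s) (hm : MapsTo ψ J' J) (hJ' : UniqueDiffWithinAt ℝ J' s) :
    (velocity (𝓡∂ n) (fun τ => x (ψ τ)) J' s : 𝔼)
      = derivWithin ψ J' s • (velocity (𝓡∂ n) x J (ψ s) : 𝔼) := by
  have hy : ContMDiffWithinAt 𝓘(ℝ, ℝ) (𝓡∂ n) ∞ (fun τ => x (ψ τ)) J' s :=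
    hx.comp s (contMDiffWithinAt_iff_contDiffWithinAt.2 hψ) hm
  have h1 : (velocity (𝓡∂ n) x J (ψ s) : 𝔼) = chartVel n (x (ψ s)) x J (ψ s) :=
    velocity_eq_derivWithin (hx.mdifferentiableWithinAt (by simp))
  have h2 : (velocity (𝓡∂ n) (fun τ => x (ψ τ)) J' s : 𝔼)
      = chartVel n (x (ψ s)) (fun τ => x (ψ τ)) J' s :=
    velocity_eq_derivWithin (hy.mdifferentiableWithinAt (by simp))
  rw [h1, h2]
  exact ((hasDerivWithinAt_chartCurve hx (mem_extChartAt_source _)).scomp s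
    (hψ.differentiableWithinAt (by simp)).hasDerivWithinAt hm).derivWithin hJ'

theorem metC_self (h : RMetric n N) (p : N) (u v : 𝔼) :
    metC h p (extChartAt (𝓡∂ n) p p) u v
      = h.inner p (show TangentSpace (𝓡∂ n) p from u) (show TangentSpace (𝓡∂ n) p from v) := by
  rw [metC_apply]
  have h4 : (coordField (𝓡∂ n) p (extChartAt (𝓡∂ n) p p) u : 𝔼) = u := coordField_self p u
  have h5 : (coordField (𝓡∂ n) p (extChartAt (𝓡∂ n) p p) v : 𝔼) = v := coordField_self p v
  refine Eq.trans ?_ (inner_congr_point h ((extChartAt (𝓡∂ n) p).left_inv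
    (mem_extChartAt_source p)) u v)
  erw [h4, h5]

theorem formC_self (om : SmoothOneForm (𝓡∂ n) N) (p : N) (u : 𝔼) :
    formC om p (extChartAt (𝓡∂ n) p p) u
      = om.form p (show TangentSpace (𝓡∂ n) p from u) := by
  rw [formC_apply]
  have h4 : (coordField (𝓡∂ n) p (extChartAt (𝓡∂ n) p p) u : 𝔼) = u := coordField_self p u
  refine Eq.trans ?_ (form_congr_point om ((extChartAt (𝓡∂ n) p).left_inv
    (mem_extChartAt_source p)) u)
  erw [h4]

/-- The covariant acceleration in the preferred chart at the point. -/
theorem hasCovAccel_hTensor_iff {s : ℝ} {a : 𝔼} :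
    HasCovAccel (𝓡∂ n) (hTensor h) x J s (show TangentSpace (𝓡∂ n) (x s) from a) ↔
    ∀ e : 𝔼, metC h (x s) (chartCurve n (x s) x s) a e
      = metC h (x s) (chartCurve n (x s) x s)
          (derivWithin (derivWithin (chartCurve n (x s) x) J) J s) e
        + (fderivWithin ℝ (metC h (x s)) (range (𝓡∂ n)) (chartCurve n (x s) x s)
            (derivWithin (chartCurve n (x s) x) J s) (derivWithin (chartCurve n (x s) x) J s) e
          - (1 / 2) * fderivWithin ℝ (metC h (x s)) (range (𝓡∂ n)) (chartCurve n (x s) x s) e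
            (derivWithin (chartCurve n (x s) x) J s)
            (derivWithin (chartCurve n (x s) x) J s)) := by
  refine forall_congr' fun e => ?_
  have hce : (chartVec (𝓡∂ n) (x s) e : 𝔼) = e := chartVec_apply (x s) e
  have h1 := metC_self h (x s) a e
  have h2 := christoffel_hTensor h (x s) (derivWithin (chartCurve n (x s) x) J s) e
  have h3 : (chartCurve n (x s) x s : 𝔼) = extChartAt (𝓡∂ n) (x s) (x s) := rfl
  rw [h3, h1, ← h2]
  erw [hce]
  rfl

/-- The acceleration of a reparametrized curve. -/
theorem HasCovAccel.comp {s : ℝ} (hx : ContMDiffOn 𝓘(ℝ, ℝ) (𝓡∂ n) ∞ x J)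
    (hψ : ContDiffOn ℝ ∞ ψ J') (hm : MapsTo ψ J' J) (hJ : UniqueDiffOn ℝ J)
    (hJ' : UniqueDiffOn ℝ J') (hs : s ∈ J') {a v : 𝔼}
    (hv : (velocity (𝓡∂ n) x J (ψ s) : 𝔼) = v)
    (ha : HasCovAccel (𝓡∂ n) (hTensor h) x J (ψ s) (show TangentSpace (𝓡∂ n) (x (ψ s)) from a)) :
    HasCovAccel (𝓡∂ n) (hTensor h) (fun τ => x (ψ τ)) J' s
      (show TangentSpace (𝓡∂ n) (x (ψ s)) from
        derivWithin ψ J' s ^ 2 • a + derivWithin (derivWithin ψ J') J' s • v) := by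
  have hps : x (ψ s) ∈ (extChartAt (𝓡∂ n) (x (ψ s))).source := mem_extChartAt_source _
  set C := chartCurve n (x (ψ s)) x with hC
  have hC2 : ContDiffWithinAt ℝ 2 C J (ψ s) :=
    (contDiffWithinAt_chartCurve (hx (ψ s) (hm hs)) hps).of_le ENat.LEInfty.out
  obtain ⟨hC', hCe⟩ := hasDerivWithinAt_of_contDiffWithinAt hC2 hJ (hm hs)
  have hψ2 : ContDiffWithinAt ℝ 2 ψ J' s := (hψ s hs).of_le ENat.LEInfty.out
  obtain ⟨hψ', hψe⟩ := hasDerivWithinAt_of_contDiffWithinAt hψ2 hJ' hs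
  have hψt : Tendsto ψ (𝓝[J'] s) (𝓝[J] (ψ s)) :=
    tendsto_nhdsWithin_iff.2 ⟨(hψ s hs).continuousWithinAt,
      eventually_mem_nhdsWithin.mono fun τ hτ => hm hτ⟩
  have e1 : ∀ᶠ τ in 𝓝[J'] s, derivWithin (C ∘ ψ) J' τ = derivWithin ψ J' τ • derivWithin C J (ψ τ) := by
    filter_upwards [hψt.eventually hCe, hψe, self_mem_nhdsWithin] with τ h1 h2 h3
    exact (h1.scomp τ h2 hm).derivWithin (hJ' τ h3)
  have e1s := e1.self_of_nhdsWithin hs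
  have h2 := hψ'.smul (hC'.scomp s (hψe.self_of_nhdsWithin hs) hm)
  have e2 := (h2.congr_of_eventuallyEq e1 e1s).derivWithin (hJ' s hs)
  have hvel : (velocity (𝓡∂ n) x J (ψ s) : 𝔼) = derivWithin C J (ψ s) :=
    velocity_eq_derivWithin ((hx _ (hm hs)).mdifferentiableWithinAt (by simp))
  have ha' := hasCovAccel_hTensor_iff.1 ha
  refine hasCovAccel_hTensor_iff.2 fun e => ?_
  have hae := ha' e
  change metC h (x (ψ s)) (C (ψ s)) (derivWithin ψ J' s ^ 2 • a
    + derivWithin (derivWithin ψ J') J' s • v) e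
    = metC h (x (ψ s)) (C (ψ s)) (derivWithin (derivWithin (C ∘ ψ) J') J' s) e
      + (fderivWithin ℝ (metC h (x (ψ s))) (range (𝓡∂ n)) (C (ψ s))
          (derivWithin (C ∘ ψ) J' s) (derivWithin (C ∘ ψ) J' s) e
        - (1 / 2) * fderivWithin ℝ (metC h (x (ψ s))) (range (𝓡∂ n)) (C (ψ s)) e
          (derivWithin (C ∘ ψ) J' s) (derivWithin (C ∘ ψ) J' s))
  rw [e2, e1s, hv.symm.trans hvel]
  rw [← hC] at hae
  simp only [map_add, map_smul, add_apply, smul_apply, smul_eq_mul, Function.comp_apply]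
  linear_combination (derivWithin ψ J' s) ^ 2 * hae

end Reparametrization

section StationaryAlgebra

variable {E : Type*} [NormedAddCommGroup E] [NormedSpace ℝ E]

theorem fderivWithin_stationary {S : Set E} {Λ : E → ℝ} {f : E → E →L[ℝ] ℝ}
    {m : E → E →L[ℝ] E →L[ℝ] ℝ} {ζ : E} (t₀ : ℝ) (hS : UniqueDiffOn ℝ S) (hζ : ζ ∈ S)
    (hΛ : DifferentiableWithinAt ℝ Λ S ζ) (hf : DifferentiableWithinAt ℝ f S ζ)
    (hm : DifferentiableWithinAt ℝ m S ζ) (a b : ℝ) (v e : E) (w : ℝ × E) :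
    fderivWithin ℝ (fun z : ℝ × E => Λ z.2 * (-((a + f z.2 v) * (b + f z.2 e)) + m z.2 v e))
      (univ ×ˢ S) (t₀, ζ) w
      = fderivWithin ℝ Λ S ζ w.2 * (-((a + f ζ v) * (b + f ζ e)) + m ζ v e)
        + Λ ζ * (-(fderivWithin ℝ f S ζ w.2 v * (b + f ζ e)
          + (a + f ζ v) * fderivWithin ℝ f S ζ w.2 e) + fderivWithin ℝ m S ζ w.2 v e) := by
  have hmaps : MapsTo (Prod.snd : ℝ × E → E) (univ ×ˢ S) S := fun z hz => hz.2
  have hsnd : HasFDerivWithinAt (Prod.snd : ℝ × E → E) (ContinuousLinearMap.snd ℝ ℝ E)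
    (univ ×ˢ S) (t₀, ζ) := hasFDerivWithinAt_snd
  have h1 := HasFDerivWithinAt.comp (g := Λ) (f := (Prod.snd : ℝ × E → E)) (t₀, ζ)
    hΛ.hasFDerivWithinAt hsnd hmaps
  have h2 := HasFDerivWithinAt.comp (g := f) (f := (Prod.snd : ℝ × E → E)) (t₀, ζ)
    hf.hasFDerivWithinAt hsnd hmaps
  have h3 := HasFDerivWithinAt.comp (g := m) (f := (Prod.snd : ℝ × E → E)) (t₀, ζ)
    hm.hasFDerivWithinAt hsnd hmaps
  have h2v := (h2.clm_apply (hasFDerivWithinAt_const v _ _)).const_add a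
  have h2e := (h2.clm_apply (hasFDerivWithinAt_const e _ _)).const_add b
  have h3v := (h3.clm_apply (hasFDerivWithinAt_const v _ _)).clm_apply
    (hasFDerivWithinAt_const e _ _)
  have h4 := h1.mul ((h2v.mul h2e).neg.add h3v)
  have hu : UniqueDiffWithinAt ℝ ((univ : Set ℝ) ×ˢ S) (t₀, ζ) :=
    uniqueDiffWithinAt_univ.prod (hS ζ hζ)
  have h5 := DFunLike.congr_fun (h4.fderivWithin hu) w
  refine h5.trans ?_
  simp
  ring

/-- The null geodesic equation of a stationary metric, in coordinates. -/
theorem stationary_equation_iff {θ θ' Λ Λu t'' : ℝ} (hΛ : Λ ≠ 0) {u A : E} {f Λ' : E →L[ℝ] ℝ}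
    {f' : E →L[ℝ] E →L[ℝ] ℝ} {m : E →L[ℝ] E →L[ℝ] ℝ} {m' : E →L[ℝ] E →L[ℝ] E →L[ℝ] ℝ}
    (hnull : m u u = θ ^ 2) (hθ' : θ' = t'' + f A + f' u u) (hΛu : Λu = Λ' u) :
    (∀ (b : ℝ) (w : E), Λ * (-((t'' + f A) * (b + f w)) + m A w)
      + ((Λ' u * (-(θ * (b + f w)) + m u w)
          + Λ * (-(f' u u * (b + f w) + θ * f' u w) + m' u u w))
        - (1 / 2) * (Λ' w * (-(θ * θ) + m u u)
          + Λ * (-(f' w u * θ + θ * f' w u) + m' w u u))) = 0) ↔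
    Λu * θ + Λ * θ' = 0 ∧ ∀ w : E, θ * (f' u w - f' w u) - Λu / Λ * m u w
      = m A w + (m' u u w - (1 / 2) * m' w u u) := by
  subst hθ' hΛu
  constructor
  · intro H
    have h1 := H 1 0
    simp only [map_zero, zero_apply, hnull] at h1
    refine ⟨by linear_combination -h1, fun w => ?_⟩
    have h2 := H (-f w) w
    rw [hnull] at h2
    field_simp
    linear_combination (-2) * h2
  · rintro ⟨h1, h2⟩ b w
    have h3 := h2 w
    field_simp at h3
    rw [hnull]
    linear_combination -(b + f w) * h1 - (1 / 2) * h3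

end StationaryAlgebra

noncomputable section StationaryCharts

variable {n : ℕ} [NeZero n] {N : Type*} [TopologicalSpace N]
  [ChartedSpace (EuclideanHalfSpace n) N] [IsManifold (𝓡∂ n) ∞ N]

local notation "𝔼" => EuclideanSpace ℝ (Fin n)

theorem extChartAt_st (p : ℝ × N) (y : ℝ × N) :
    extChartAt (stModel n) p y = (y.1, extChartAt (𝓡∂ n) p.2 y.2) := by
  rw [extChartAt_prod]
  rfl

theorem extChartAt_st_symm (p : ℝ × N) (z : ℝ × 𝔼) :
    (extChartAt (stModel n) p).symm z = (z.1, (extChartAt (𝓡∂ n) p.2).symm z.2) := by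
  rw [extChartAt_prod]
  rfl

theorem range_stModel : range (stModel n) = univ ×ˢ range (𝓡∂ n) := by
  rw [ModelWithCorners.range_prod]
  simp

theorem mem_extChartAt_st_target {p : ℝ × N} {z : ℝ × 𝔼}
    (hz : z.2 ∈ (extChartAt (𝓡∂ n) p.2).target) : z ∈ (extChartAt (stModel n) p).target := by
  rw [extChartAt_prod]
  exact ⟨by rw [extChartAt_model_space_eq_id]; trivial, hz⟩

theorem dTime_apply (p : ℝ × N) (v : TangentSpace (stModel n) p) : dTime p v = v.1 := by
  unfold dTime
  rw [mfderiv_fst]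
  rfl

theorem dSpace_apply (p : ℝ × N) (v : TangentSpace (stModel n) p) : dSpace p v = v.2 := by
  unfold dSpace
  rw [mfderiv_snd]
  rfl

theorem coordField_st {p : ℝ × N} {z : ℝ × 𝔼} (hz : z.2 ∈ (extChartAt (𝓡∂ n) p.2).target)
    (u : ℝ × 𝔼) :
    (coordField (stModel n) p z u : ℝ × 𝔼)
      = (u.1, (coordField (𝓡∂ n) p.2 z.2 u.2 : 𝔼)) := by
  have hzt := mem_extChartAt_st_target hz
  have hd := mdifferentiableWithinAt_extChartAt_symm (I := stModel n) hzt
  have hU : UniqueMDiffWithinAt 𝓘(ℝ, ℝ × 𝔼) (range (stModel n)) z :=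
    ((stModel n).uniqueDiffOn _ (extChartAt_target_subset_range p hzt)).uniqueMDiffWithinAt
  have h1 := mfderiv_comp_mfderivWithin z
    (mdifferentiableAt_fst (I := 𝓘(ℝ, ℝ)) (I' := 𝓡∂ n) (x := (extChartAt (stModel n) p).symm z))
    hd hU
  have h2 := mfderiv_comp_mfderivWithin z
    (mdifferentiableAt_snd (I := 𝓘(ℝ, ℝ)) (I' := 𝓡∂ n) (x := (extChartAt (stModel n) p).symm z))
    hd hU
  rw [mfderiv_fst] at h1
  rw [mfderiv_snd] at h2
  have e1 : (Prod.fst ∘ (extChartAt (stModel n) p).symm : ℝ × 𝔼 → ℝ) = Prod.fst :=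
    funext fun w => congrArg Prod.fst (extChartAt_st_symm p w)
  have e2 : (Prod.snd ∘ (extChartAt (stModel n) p).symm : ℝ × 𝔼 → N)
      = (extChartAt (𝓡∂ n) p.2).symm ∘ Prod.snd :=
    funext fun w => congrArg Prod.snd (extChartAt_st_symm p w)
  have h3 : mfderivWithin 𝓘(ℝ, ℝ × 𝔼) (𝓡∂ n) ((extChartAt (𝓡∂ n) p.2).symm ∘ Prod.snd)
      (range (stModel n)) z = (coordField (𝓡∂ n) p.2 z.2).comp (ContinuousLinearMap.snd ℝ ℝ 𝔼) := by
    have h4 := mfderivWithin_comp z (mdifferentiableWithinAt_extChartAt_symm (I := 𝓡∂ n) hz)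
      ((differentiableAt_snd (𝕜 := ℝ) (p := z)).differentiableWithinAt
        (s := range (stModel n))).mdifferentiableWithinAt
      (fun w hw => by rw [range_stModel] at hw; exact hw.2) hU
    rw [h4, mfderivWithin_eq_fderivWithin, fderivWithin_snd hU.uniqueDiffWithinAt]
    rfl
  refine Prod.ext ?_ ?_
  · refine (DFunLike.congr_fun h1 u).symm.trans ?_
    rw [e1, mfderivWithin_eq_fderivWithin, fderivWithin_fst hU.uniqueDiffWithinAt]
    rfl
  · refine (DFunLike.congr_fun h2 u).symm.trans ?_
    rw [e2, h3]
    rfl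

/-- A function in the preferred chart at `p`. -/
def funC (lam : N → ℝ) (p : N) (z : EuclideanSpace ℝ (Fin n)) : ℝ :=
  lam ((extChartAt (𝓡∂ n) p).symm z)

variable {lam : N → ℝ} {om : SmoothOneForm (𝓡∂ n) N} {h : RMetric n N}

theorem differentiableWithinAt_funC (hlam : ContMDiff (𝓡∂ n) 𝓘(ℝ, ℝ) ∞ lam) {p : N} {z : 𝔼}
    (hz : z ∈ (extChartAt (𝓡∂ n) p).target) :
    DifferentiableWithinAt ℝ (funC (n := n) lam p) (range (𝓡∂ n)) z := by
  have h1 : ContMDiffOn 𝓘(ℝ, 𝔼) 𝓘(ℝ, ℝ) ∞ (fun z => lam ((extChartAt (𝓡∂ n) p).symm z))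
    (extChartAt (𝓡∂ n) p).target := hlam.comp_contMDiffOn (contMDiffOn_extChartAt_symm p)
  exact (((contMDiffOn_iff_contDiffOn.1 h1) z hz).differentiableWithinAt (by simp)).mono_of_mem_nhdsWithin
    (extChartAt_target_mem_nhdsWithin_of_mem hz)

theorem chartMetric_st {p : ℝ × N} {z : ℝ × 𝔼} (hz : z.2 ∈ (extChartAt (𝓡∂ n) p.2).target)
    (u v : ℝ × 𝔼) :
    chartMetric (stModel n) (stationaryMetric lam om h) p z u v
      = funC (n := n) lam p.2 z.2 * (-((u.1 + formC om p.2 z.2 u.2) * (v.1 + formC om p.2 z.2 v.2))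
        + metC h p.2 z.2 u.2 v.2) := by
  have hu := coordField_st hz u
  have hv := coordField_st hz v
  have key : ∀ (q : ℝ × N) (a b : ℝ × 𝔼),
      stationaryMetric lam om h q (show TangentSpace (stModel n) q from a)
        (show TangentSpace (stModel n) q from b)
      = lam q.2 * (-((a.1 + om.form q.2 (show TangentSpace (𝓡∂ n) q.2 from a.2)) *
          (b.1 + om.form q.2 (show TangentSpace (𝓡∂ n) q.2 from b.2)))
        + h.inner q.2 (show TangentSpace (𝓡∂ n) q.2 from a.2)
          (show TangentSpace (𝓡∂ n) q.2 from b.2)) := by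
    intro q a b
    have e1 : ∀ w : ℝ × 𝔼, dtPlus om q (show TangentSpace (stModel n) q from w)
        = w.1 + om.form q.2 (show TangentSpace (𝓡∂ n) q.2 from w.2) := fun w => by
      have h1 := dTime_apply q w
      have h2 := dSpace_apply q w
      exact congrArg₂ (· + ·) h1 (congrArg (om.form q.2) h2)
    unfold stationaryMetric
    rw [e1, e1, dSpace_apply, dSpace_apply]
  unfold chartMetric
  have hq : ((extChartAt (stModel n) p).symm z).2 = (extChartAt (𝓡∂ n) p.2).symm z.2 := by
    rw [extChartAt_st_symm]
  refine (congrArg₂ (fun a b : ℝ × 𝔼 => stationaryMetric lam om h ((extChartAt (stModel n) p).symm z)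
    (show TangentSpace (stModel n) _ from a) (show TangentSpace (stModel n) _ from b)) hu hv).trans ?_
  refine (key _ _ _).trans ?_
  rw [formC_apply, formC_apply, metC_apply]
  unfold funC
  have e1 := form_congr_point om hq (coordField (𝓡∂ n) p.2 z.2 u.2)
  have e2 := form_congr_point om hq (coordField (𝓡∂ n) p.2 z.2 v.2)
  have e3 := inner_congr_point h hq (coordField (𝓡∂ n) p.2 z.2 u.2)
    (coordField (𝓡∂ n) p.2 z.2 v.2)
  exact congrArg₂ (· * ·) (congrArg lam hq) (congrArg₂ (· + ·)
    (congrArg Neg.neg (congrArg₂ (· * ·) (congrArg (u.1 + ·) e1) (congrArg (v.1 + ·) e2))) e3)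

theorem chartMetricDeriv_st (hlam : ContMDiff (𝓡∂ n) 𝓘(ℝ, ℝ) ∞ lam) (p : ℝ × N) (w u v : ℝ × 𝔼) :
    chartMetricDeriv (stModel n) (stationaryMetric lam om h) p w u v
    = fderivWithin ℝ (funC (n := n) lam p.2) (range (𝓡∂ n)) (extChartAt (𝓡∂ n) p.2 p.2) w.2
        * (-((u.1 + formC om p.2 (extChartAt (𝓡∂ n) p.2 p.2) u.2)
            * (v.1 + formC om p.2 (extChartAt (𝓡∂ n) p.2 p.2) v.2))
          + metC h p.2 (extChartAt (𝓡∂ n) p.2 p.2) u.2 v.2)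
      + funC (n := n) lam p.2 (extChartAt (𝓡∂ n) p.2 p.2)
        * (-(fderivWithin ℝ (formC om p.2) (range (𝓡∂ n)) (extChartAt (𝓡∂ n) p.2 p.2) w.2 u.2
              * (v.1 + formC om p.2 (extChartAt (𝓡∂ n) p.2 p.2) v.2)
            + (u.1 + formC om p.2 (extChartAt (𝓡∂ n) p.2 p.2) u.2)
              * fderivWithin ℝ (formC om p.2) (range (𝓡∂ n)) (extChartAt (𝓡∂ n) p.2 p.2) w.2 v.2)
          + fderivWithin ℝ (metC h p.2) (range (𝓡∂ n)) (extChartAt (𝓡∂ n) p.2 p.2)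
              w.2 u.2 v.2) := by
  have hz := mem_extChartAt_target (I := 𝓡∂ n) p.2
  have h1 := fderivWithin_stationary (ζ := extChartAt (𝓡∂ n) p.2 p.2) (m := metC h p.2) p.1
    (𝓡∂ n).uniqueDiffOn (mem_range_self _)
    (differentiableWithinAt_funC (n := n) hlam hz) (differentiableWithinAt_formC om p.2 hz)
    (differentiableWithinAt_metC h p.2 hz) u.1 v.1 u.2 v.2 w
  refine Eq.trans ?_ h1
  unfold chartMetricDeriv
  rw [range_stModel, extChartAt_st]
  have hev : (fun z => chartMetric (stModel n) (stationaryMetric lam om h) p z u v)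
      =ᶠ[𝓝[univ ×ˢ range (𝓡∂ n)] (p.1, extChartAt (𝓡∂ n) p.2 p.2)]
      fun z : ℝ × 𝔼 => funC (n := n) lam p.2 z.2 * (-((u.1 + formC om p.2 z.2 u.2)
        * (v.1 + formC om p.2 z.2 v.2)) + metC h p.2 z.2 u.2 v.2) := by
    rw [nhdsWithin_prod_eq]
    have : ∀ᶠ ζ in 𝓝[range (𝓡∂ n)] (extChartAt (𝓡∂ n) p.2 p.2), ζ ∈ (extChartAt (𝓡∂ n) p.2).target :=
      extChartAt_target_mem_nhdsWithin p.2
    exact (this.prod_inr _).mono fun z hz => chartMetric_st hz u v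
  rw [hev.fderivWithin_eq (chartMetric_st hz u v)]

end StationaryCharts

noncomputable section StationaryCurves

variable {n : ℕ} [NeZero n] {N : Type*} [TopologicalSpace N] [T2Space N]
  [ChartedSpace (EuclideanHalfSpace n) N] [IsManifold (𝓡∂ n) ∞ N]

local notation "𝔼" => EuclideanSpace ℝ (Fin n)

/-- The Lorentz force, as a map of the model space. -/
def lorentzE (h : RMetric n N) (om : SmoothOneForm (𝓡∂ n) N) (x : N)
    (v : EuclideanSpace ℝ (Fin n)) : EuclideanSpace ℝ (Fin n) :=
  lorentzForce h om x v

/-- The time component `t` of a curve in `ℝ × N`. -/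
def timeCurve {N : Type*} (Γ : ℝ → ℝ × N) (τ : ℝ) : ℝ := (Γ τ).1

/-- The spatial component `x` of a curve in `ℝ × N`. -/
def spaceCurve {N : Type*} (Γ : ℝ → ℝ × N) (τ : ℝ) : N := (Γ τ).2

/-- `ṫ + ω(ẋ)` for a curve `(t, x)` in `ℝ × N`. -/
def clockRate (om : SmoothOneForm (𝓡∂ n) N) (Γ : ℝ → ℝ × N) (J : Set ℝ) (σ : ℝ) : ℝ :=
  derivWithin (timeCurve Γ) J σ + om.form (Γ σ).2 (velocity (𝓡∂ n) (spaceCurve Γ) J σ)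

variable {lam : N → ℝ} {om : SmoothOneForm (𝓡∂ n) N} {h : RMetric n N} {Γ : ℝ → ℝ × N}
  {J : Set ℝ} {σ : ℝ}

theorem contMDiffOn_st_iff : ContMDiffOn 𝓘(ℝ, ℝ) (stModel n) ∞ Γ J ↔
    ContDiffOn ℝ ∞ (timeCurve Γ) J ∧ ContMDiffOn 𝓘(ℝ, ℝ) (𝓡∂ n) ∞ (spaceCurve Γ) J := by
  rw [← contMDiffOn_iff_contDiffOn]
  exact ⟨fun H => ⟨contMDiff_fst.comp_contMDiffOn H, contMDiff_snd.comp_contMDiffOn H⟩,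
    fun H => H.1.prodMk H.2⟩

theorem velocity_st (hΓ : ContMDiffWithinAt 𝓘(ℝ, ℝ) (stModel n) ∞ Γ J σ)
    (hJ : UniqueDiffWithinAt ℝ J σ) :
    (velocity (stModel n) Γ J σ : ℝ × 𝔼)
      = (derivWithin (timeCurve Γ) J σ, (velocity (𝓡∂ n) (spaceCurve Γ) J σ : 𝔼)) := by
  have hd := hΓ.mdifferentiableWithinAt (by simp)
  have h1 := mfderiv_comp_mfderivWithin σ
    (mdifferentiableAt_fst (I := 𝓘(ℝ, ℝ)) (I' := 𝓡∂ n) (x := Γ σ)) hd hJ.uniqueMDiffWithinAt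
  have h2 := mfderiv_comp_mfderivWithin σ
    (mdifferentiableAt_snd (I := 𝓘(ℝ, ℝ)) (I' := 𝓡∂ n) (x := Γ σ)) hd hJ.uniqueMDiffWithinAt
  rw [mfderiv_fst] at h1
  rw [mfderiv_snd] at h2
  refine Prod.ext ?_ ?_
  · refine (DFunLike.congr_fun h1 (1 : ℝ)).symm.trans ?_
    rw [mfderivWithin_eq_fderivWithin]
    rfl
  · exact (DFunLike.congr_fun h2 (1 : ℝ)).symm

theorem dTime_velocity (hΓ : ContMDiffWithinAt 𝓘(ℝ, ℝ) (stModel n) ∞ Γ J σ)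
    (hJ : UniqueDiffWithinAt ℝ J σ) :
    dTime (Γ σ) (velocity (stModel n) Γ J σ) = derivWithin (timeCurve Γ) J σ := by
  rw [dTime_apply]
  exact congrArg Prod.fst (velocity_st hΓ hJ)

theorem dSpace_velocity (hΓ : ContMDiffWithinAt 𝓘(ℝ, ℝ) (stModel n) ∞ Γ J σ)
    (hJ : UniqueDiffWithinAt ℝ J σ) :
    dSpace (Γ σ) (velocity (stModel n) Γ J σ) = velocity (𝓡∂ n) (spaceCurve Γ) J σ := by
  rw [dSpace_apply]
  exact congrArg Prod.snd (velocity_st hΓ hJ)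

theorem dtPlus_velocity (hΓ : ContMDiffWithinAt 𝓘(ℝ, ℝ) (stModel n) ∞ Γ J σ)
    (hJ : UniqueDiffWithinAt ℝ J σ) :
    dtPlus om (Γ σ) (velocity (stModel n) Γ J σ) = clockRate om Γ J σ :=
  congrArg₂ (· + ·) (dTime_velocity hΓ hJ) (congrArg (om.form (Γ σ).2) (dSpace_velocity hΓ hJ))

theorem clockRate_eventually (hx : ContMDiffOn 𝓘(ℝ, ℝ) (𝓡∂ n) ∞ (spaceCurve Γ) J)
    (hJ : UniqueDiffOn ℝ J) (hσ : σ ∈ J) {p : N}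
    (hp : spaceCurve Γ σ ∈ (extChartAt (𝓡∂ n) p).source) :
    ∀ᶠ τ in 𝓝[J] σ, clockRate om Γ J τ = derivWithin (timeCurve Γ) J τ
      + formC om p (chartCurve n p (spaceCurve Γ) τ) (chartVel n p (spaceCurve Γ) J τ) := by
  have h1 : ∀ᶠ τ in 𝓝[J] σ, spaceCurve Γ τ ∈ (extChartAt (𝓡∂ n) p).source :=
    (hx σ hσ).continuousWithinAt.eventually (isOpen_extChartAt_source p |>.mem_nhds hp)
  filter_upwards [h1, self_mem_nhdsWithin] with τ h2 h3
  exact congrArg (derivWithin (timeCurve Γ) J τ + ·)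
    (formC_velocity om ((hx τ h3).mdifferentiableWithinAt (by simp)) (hJ τ h3) h2).symm

theorem hasDerivWithinAt_clockRate (ht : ContDiffOn ℝ ∞ (timeCurve Γ) J)
    (hx : ContMDiffOn 𝓘(ℝ, ℝ) (𝓡∂ n) ∞ (spaceCurve Γ) J)
    (hJ : UniqueDiffOn ℝ J) (hσ : σ ∈ J) {p : N}
    (hp : spaceCurve Γ σ ∈ (extChartAt (𝓡∂ n) p).source) :
    HasDerivWithinAt (clockRate om Γ J)
      (derivWithin (derivWithin (timeCurve Γ) J) J σ
        + (fderivWithin ℝ (formC om p) (range (𝓡∂ n)) (chartCurve n p (spaceCurve Γ) σ)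
            (chartVel n p (spaceCurve Γ) J σ) (chartVel n p (spaceCurve Γ) J σ)
          + formC om p (chartCurve n p (spaceCurve Γ) σ)
            (derivWithin (chartVel n p (spaceCurve Γ) J) J σ))) J σ := by
  have hev := clockRate_eventually (om := om) hx hJ hσ hp
  refine HasDerivWithinAt.congr_of_eventuallyEq ?_ hev (hev.self_of_nhdsWithin hσ)
  have h1 := (hasDerivWithinAt_of_contDiffWithinAt
    ((ht σ hσ).of_le ENat.LEInfty.out) hJ hσ).1
  have h2 := (hasDerivWithinAt_of_contDiffWithinAt
    ((contDiffWithinAt_chartCurve (hx σ hσ) hp).of_le ENat.LEInfty.out) hJ hσ).1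
  have h3 := (differentiableWithinAt_formC om p
    ((extChartAt (𝓡∂ n) p).map_source hp)).hasFDerivWithinAt.comp_hasDerivWithinAt
    (f := chartCurve n p (spaceCurve Γ)) σ
    (hasDerivWithinAt_chartCurve (hx σ hσ) hp) (fun τ _ => chartCurve_mem_range p _ τ)
  exact h1.add (h3.clm_apply h2)

theorem hasDerivWithinAt_lam (hlam : ContMDiff (𝓡∂ n) 𝓘(ℝ, ℝ) ∞ lam) {x : ℝ → N}
    (hx : ContMDiffOn 𝓘(ℝ, ℝ) (𝓡∂ n) ∞ x J) (hσ : σ ∈ J) :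
    HasDerivWithinAt (fun τ => lam (x τ))
      (fderivWithin ℝ (funC (n := n) lam (x σ)) (range (𝓡∂ n)) (chartCurve n (x σ) x σ)
        (chartVel n (x σ) x J σ)) J σ := by
  have hp : x σ ∈ (extChartAt (𝓡∂ n) (x σ)).source := mem_extChartAt_source _
  have h1 : ∀ᶠ τ in 𝓝[J] σ, x τ ∈ (extChartAt (𝓡∂ n) (x σ)).source :=
    (hx σ hσ).continuousWithinAt.eventually (isOpen_extChartAt_source (x σ) |>.mem_nhds hp)
  have h2 : ∀ᶠ τ in 𝓝[J] σ, lam (x τ) = funC (n := n) lam (x σ) (chartCurve n (x σ) x τ) :=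
    h1.mono fun τ hτ => congrArg lam ((extChartAt (𝓡∂ n) (x σ)).left_inv hτ).symm
  refine HasDerivWithinAt.congr_of_eventuallyEq ?_ h2 (h2.self_of_nhdsWithin hσ)
  exact (differentiableWithinAt_funC (n := n) hlam
    ((extChartAt (𝓡∂ n) (x σ)).map_source hp)).hasFDerivWithinAt.comp_hasDerivWithinAt
    (f := chartCurve n (x σ) x) σ
    (hasDerivWithinAt_chartCurve (hx σ hσ) hp) (fun τ _ => chartCurve_mem_range _ _ τ)

/-- The geodesic equation of a stationary metric along a null curve. -/
theorem covAccel_st_iff (hlam : ContMDiff (𝓡∂ n) 𝓘(ℝ, ℝ) ∞ lam) (hpos : ∀ x, 0 < lam x)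
    (ht : ContDiffOn ℝ ∞ (timeCurve Γ) J) (hx : ContMDiffOn 𝓘(ℝ, ℝ) (𝓡∂ n) ∞ (spaceCurve Γ) J)
    (hJ : UniqueDiffOn ℝ J) (hσ : σ ∈ J) {v : 𝔼}
    (hv : (velocity (𝓡∂ n) (spaceCurve Γ) J σ : 𝔼) = v)
    (hnull : hNorm h (velocity (𝓡∂ n) (spaceCurve Γ) J σ) ^ 2 = clockRate om Γ J σ ^ 2) :
    HasCovAccel (stModel n) (stationaryMetric lam om h) Γ J σ 0 ↔
    derivWithin (fun τ => lam (spaceCurve Γ τ) * clockRate om Γ J τ) J σ = 0 ∧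
    HasCovAccel (𝓡∂ n) (hTensor h) (spaceCurve Γ) J σ
      (show TangentSpace (𝓡∂ n) (spaceCurve Γ σ) from
        clockRate om Γ J σ • lorentzE h om (spaceCurve Γ σ) v
        - (derivWithin (fun τ => lam (spaceCurve Γ τ)) J σ / lam (spaceCurve Γ σ)) • v) := by
  set x := spaceCurve Γ with hxdef
  have hp : x σ ∈ (extChartAt (𝓡∂ n) (x σ)).source := mem_extChartAt_source _
  set C := chartCurve n (x σ) x with hC
  set u := derivWithin C J σ with hu
  set A := derivWithin (derivWithin C J) J σ with hA
  set z := extChartAt (𝓡∂ n) (x σ) (x σ) with hz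
  have hCz : C σ = z := rfl
  have huv : u = v := by
    rw [← hv]
    exact (velocity_eq_derivWithin ((hx σ hσ).mdifferentiableWithinAt (by simp))).symm
  have hθ := hasDerivWithinAt_clockRate (om := om) ht hx hJ hσ hp
  have hΛ := hasDerivWithinAt_lam (n := n) hlam hx hσ
  have hθ0 := (clockRate_eventually (om := om) hx hJ hσ hp).self_of_nhdsWithin hσ
  have hprod := (hΛ.mul hθ).derivWithin (hJ σ hσ)
  have hm : metC h (x σ) z u u = clockRate om Γ J σ ^ 2 := by
    rw [← hnull, hNorm_sq]
    exact metC_chartVel (hx σ hσ) (hJ σ hσ) hp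
  have hlamz : funC (n := n) lam (x σ) z = lam (x σ) :=
    congrArg lam ((extChartAt (𝓡∂ n) (x σ)).left_inv hp)
  have hcurve : (fun τ => extChartAt (stModel n) (Γ σ) (Γ τ)) = fun τ => (timeCurve Γ τ, C τ) :=
    funext fun τ => extChartAt_st _ _
  obtain ⟨ht2, ht1⟩ := hasDerivWithinAt_of_contDiffWithinAt
    ((ht σ hσ).of_le ENat.LEInfty.out) hJ hσ
  obtain ⟨hC2, hC1⟩ := hasDerivWithinAt_of_contDiffWithinAt
    ((contDiffWithinAt_chartCurve (hx σ hσ) hp).of_le ENat.LEInfty.out) hJ hσ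
  have hd1 : ∀ᶠ τ in 𝓝[J] σ, derivWithin (fun τ => (timeCurve Γ τ, C τ)) J τ
      = (derivWithin (timeCurve Γ) J τ, derivWithin C J τ) := by
    filter_upwards [ht1, hC1, self_mem_nhdsWithin] with τ h1 h2 h3
    exact (h1.prodMk h2).derivWithin (hJ τ h3)
  have hd1' := hd1.self_of_nhdsWithin hσ
  have hd2 : derivWithin (derivWithin (fun τ => (timeCurve Γ τ, C τ)) J) J σ
      = (derivWithin (derivWithin (timeCurve Γ) J) J σ, A) :=
    ((ht2.prodMk hC2).congr_of_eventuallyEq hd1 hd1').derivWithin (hJ σ hσ)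
  have halg := stationary_equation_iff (m := metC h (x σ) z) (f := formC om (x σ) z)
    (Λ' := fderivWithin ℝ (funC (n := n) lam (x σ)) (range (𝓡∂ n)) z)
    (f' := fderivWithin ℝ (formC om (x σ)) (range (𝓡∂ n)) z)
    (m' := fderivWithin ℝ (metC h (x σ)) (range (𝓡∂ n)) z)
    (t'' := derivWithin (derivWithin (timeCurve Γ) J) J σ) (A := A)
    (θ' := derivWithin (derivWithin (timeCurve Γ) J) J σ
        + formC om (x σ) z A + fderivWithin ℝ (formC om (x σ)) (range (𝓡∂ n)) z u u)
    (hpos (x σ)).ne' hm rfl rfl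
  have hleft : HasCovAccel (stModel n) (stationaryMetric lam om h) Γ J σ 0 ↔
      ∀ (b : ℝ) (w : 𝔼), lam (x σ) * (-((derivWithin (derivWithin (timeCurve Γ) J) J σ
          + formC om (x σ) z A) * (b + formC om (x σ) z w)) + metC h (x σ) z A w)
      + ((fderivWithin ℝ (funC (n := n) lam (x σ)) (range (𝓡∂ n)) z u
          * (-(clockRate om Γ J σ * (b + formC om (x σ) z w)) + metC h (x σ) z u w)
          + lam (x σ) * (-(fderivWithin ℝ (formC om (x σ)) (range (𝓡∂ n)) z u u
              * (b + formC om (x σ) z w)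
              + clockRate om Γ J σ * fderivWithin ℝ (formC om (x σ)) (range (𝓡∂ n)) z u w)
            + fderivWithin ℝ (metC h (x σ)) (range (𝓡∂ n)) z u u w))
        - (1 / 2) * (fderivWithin ℝ (funC (n := n) lam (x σ)) (range (𝓡∂ n)) z w
            * (-(clockRate om Γ J σ * clockRate om Γ J σ) + metC h (x σ) z u u)
          + lam (x σ) * (-(fderivWithin ℝ (formC om (x σ)) (range (𝓡∂ n)) z w u
              * clockRate om Γ J σ
              + clockRate om Γ J σ * fderivWithin ℝ (formC om (x σ)) (range (𝓡∂ n)) z w u)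
            + fderivWithin ℝ (metC h (x σ)) (range (𝓡∂ n)) z w u u))) = 0 := by
    have hone : ∀ e : ℝ × 𝔼, (stationaryMetric lam om h (Γ σ) 0
        (show TangentSpace (stModel n) (Γ σ) from e) = 0) := fun e => by
      simp [stationaryMetric]
    have htarget : z ∈ (extChartAt (𝓡∂ n) (x σ)).target := mem_extChartAt_target _
    have key : ∀ e : ℝ × 𝔼,
        chartMetric (stModel n) (stationaryMetric lam om h) (Γ σ)
          (extChartAt (stModel n) (Γ σ) (Γ σ))
          (derivWithin (derivWithin (fun τ => extChartAt (stModel n) (Γ σ) (Γ τ)) J) J σ) e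
        + christoffel (stModel n) (stationaryMetric lam om h) (Γ σ)
          (derivWithin (fun τ => extChartAt (stModel n) (Γ σ) (Γ τ)) J σ)
          (derivWithin (fun τ => extChartAt (stModel n) (Γ σ) (Γ τ)) J σ) e
        = lam (x σ) * (-((derivWithin (derivWithin (timeCurve Γ) J) J σ
          + formC om (x σ) z A) * (e.1 + formC om (x σ) z e.2)) + metC h (x σ) z A e.2)
      + ((fderivWithin ℝ (funC (n := n) lam (x σ)) (range (𝓡∂ n)) z u
          * (-(clockRate om Γ J σ * (e.1 + formC om (x σ) z e.2)) + metC h (x σ) z u e.2)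
          + lam (x σ) * (-(fderivWithin ℝ (formC om (x σ)) (range (𝓡∂ n)) z u u
              * (e.1 + formC om (x σ) z e.2)
              + clockRate om Γ J σ * fderivWithin ℝ (formC om (x σ)) (range (𝓡∂ n)) z u e.2)
            + fderivWithin ℝ (metC h (x σ)) (range (𝓡∂ n)) z u u e.2))
        - (1 / 2) * (fderivWithin ℝ (funC (n := n) lam (x σ)) (range (𝓡∂ n)) z e.2
            * (-(clockRate om Γ J σ * clockRate om Γ J σ) + metC h (x σ) z u u)
          + lam (x σ) * (-(fderivWithin ℝ (formC om (x σ)) (range (𝓡∂ n)) z e.2 u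
              * clockRate om Γ J σ
              + clockRate om Γ J σ * fderivWithin ℝ (formC om (x σ)) (range (𝓡∂ n)) z e.2 u)
            + fderivWithin ℝ (metC h (x σ)) (range (𝓡∂ n)) z e.2 u u))) := by
      intro e
      rw [hcurve, hd2, hd1', extChartAt_st, chartMetric_st (by exact htarget)]
      unfold christoffel
      rw [chartMetricDeriv_st hlam, chartMetricDeriv_st hlam]
      have e1 : (Γ σ).2 = x σ := rfl
      have e2 : extChartAt (𝓡∂ n) (x σ) (x σ) = z := rfl
      have e3 : derivWithin C J σ = u := rfl
      simp only [e1, e2, e3, hlamz]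
      have e4 : derivWithin (timeCurve Γ) J σ + formC om (x σ) z u = clockRate om Γ J σ :=
        hθ0.symm
      rw [e4]
      ring
    constructor
    · intro H b w
      have h1 := H ((b, w) : ℝ × 𝔼)
      have h2 : (chartVec (stModel n) (Γ σ) ((b, w) : ℝ × 𝔼) : ℝ × 𝔼) = (b, w) :=
        chartVec_apply (Γ σ) _
      have h3 := (hone (b, w)).symm.trans h1
      have h4 := key (b, w)
      refine h4.symm.trans (Eq.trans ?_ h3.symm)
      erw [h2]
    · intro H e
      have h2 : (chartVec (stModel n) (Γ σ) e : ℝ × 𝔼) = e := chartVec_apply (Γ σ) _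
      have h4 := (key e).trans (H _ _)
      refine (hone e).trans (h4.symm.trans ?_)
      erw [h2]
  rw [hleft, halg]
  refine and_congr ?_ ?_
  · have e1 : derivWithin (fun τ => lam (x τ) * clockRate om Γ J τ) J σ
      = fderivWithin ℝ (funC (n := n) lam (x σ)) (range (𝓡∂ n)) z u * clockRate om Γ J σ
        + lam (x σ) * (derivWithin (derivWithin (timeCurve Γ) J) J σ
        + (fderivWithin ℝ (formC om (x σ)) (range (𝓡∂ n)) z u u + formC om (x σ) z A)) := hprod
    rw [e1]
    constructor <;> intro H <;> linear_combination H
  · have e1 : derivWithin (fun τ => lam (x τ)) J σ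
      = fderivWithin ℝ (funC (n := n) lam (x σ)) (range (𝓡∂ n)) z u := hΛ.derivWithin (hJ σ hσ)
    rw [e1]
    refine Iff.trans ?_ hasCovAccel_hTensor_iff.symm
    refine forall_congr' fun w => ?_
    have e2 : metC h (x σ) z (lorentzE h om (x σ) v) w
        = fderivWithin ℝ (formC om (x σ)) (range (𝓡∂ n)) z u w
          - fderivWithin ℝ (formC om (x σ)) (range (𝓡∂ n)) z w u := by
      rw [huv]
      exact (metC_self h (x σ) _ w).trans ((inner_lorentzForce h om (x σ) v w).trans
        (extD_eq_formC om (x σ) v w))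
    have e3 : metC h (x σ) z (clockRate om Γ J σ • lorentzE h om (x σ) v
        - (fderivWithin ℝ (funC (n := n) lam (x σ)) (range (𝓡∂ n)) z u / lam (x σ)) • v : 𝔼) w
        = clockRate om Γ J σ * (fderivWithin ℝ (formC om (x σ)) (range (𝓡∂ n)) z u w
          - fderivWithin ℝ (formC om (x σ)) (range (𝓡∂ n)) z w u)
        - fderivWithin ℝ (funC (n := n) lam (x σ)) (range (𝓡∂ n)) z u / lam (x σ)
          * metC h (x σ) z u w := by
      rw [← e2, ← huv, map_sub, map_smul, map_smul]
      rfl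
    exact ⟨fun H => e3.trans H, fun H => e3.symm.trans H⟩

end StationaryCurves

noncomputable section LightlikeGeodesics

variable {n : ℕ} [NeZero n] {N : Type*} [TopologicalSpace N] [T2Space N]
  [ChartedSpace (EuclideanHalfSpace n) N] [IsManifold (𝓡∂ n) ∞ N]

local notation "𝔼" => EuclideanSpace ℝ (Fin n)

theorem dTime_partialT (p : ℝ × N) : dTime (n := n) p (partialT p) = 1 := by
  have hd : MDifferentiableAt 𝓘(ℝ, ℝ) (stModel n) (fun s : ℝ => (s, p.2)) p.1 :=
    mdifferentiableAt_id.prodMk mdifferentiableAt_const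
  have h1 := mfderiv_comp p.1
    (mdifferentiableAt_fst (I := 𝓘(ℝ, ℝ)) (I' := 𝓡∂ n) (x := (p.1, p.2))) hd
  have h2 := DFunLike.congr_fun h1 (1 : ℝ)
  refine h2.symm.trans ?_
  have h3 : (Prod.fst ∘ fun s : ℝ => (s, p.2)) = (id : ℝ → ℝ) := rfl
  rw [h3, mfderiv_id]
  rfl

theorem dSpace_partialT (p : ℝ × N) : (dSpace p (partialT p) : 𝔼) = 0 := by
  have hd : MDifferentiableAt 𝓘(ℝ, ℝ) (stModel n) (fun s : ℝ => (s, p.2)) p.1 :=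
    mdifferentiableAt_id.prodMk mdifferentiableAt_const
  have h1 := mfderiv_comp p.1
    (mdifferentiableAt_snd (I := 𝓘(ℝ, ℝ)) (I' := 𝓡∂ n) (x := (p.1, p.2))) hd
  have h2 := DFunLike.congr_fun h1 (1 : ℝ)
  refine h2.symm.trans ?_
  have h3 : (Prod.snd ∘ fun s : ℝ => (s, p.2)) = fun _ : ℝ => p.2 := rfl
  rw [h3, mfderiv_const]
  rfl

theorem dtPlus_partialT (om : SmoothOneForm (𝓡∂ n) N) (p : ℝ × N) :
    dtPlus om p (partialT p) = 1 := by
  have h1 : om.form p.2 (dSpace p (partialT p)) = 0 :=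
    (congrArg (om.form p.2) (dSpace_partialT p)).trans (map_zero _)
  exact (congrArg₂ (· + ·) (dTime_partialT p) h1).trans (add_zero 1)

theorem stationaryMetric_partialT (lam : N → ℝ) (om : SmoothOneForm (𝓡∂ n) N) (h : RMetric n N)
    (p : ℝ × N) (v : TangentSpace (stModel n) p) :
    stationaryMetric lam om h p v (partialT p) = -(lam p.2 * dtPlus om p v) := by
  have h1 : h.inner p.2 (dSpace p v) (dSpace p (partialT p)) = 0 :=
    (congrArg (h.inner p.2 (dSpace p v)) (dSpace_partialT p)).trans (map_zero _)
  unfold stationaryMetric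
  rw [h1, dtPlus_partialT]
  ring

/-- The velocity of a curve, as a vector of the model space. -/
def velE (n : ℕ) [NeZero n] {N : Type*} [TopologicalSpace N] [ChartedSpace (EuclideanHalfSpace n) N]
    (x : ℝ → N) (J : Set ℝ) (σ : ℝ) : EuclideanSpace ℝ (Fin n) :=
  velocity (𝓡∂ n) x J σ

variable {lam : N → ℝ} {om : SmoothOneForm (𝓡∂ n) N} {h : RMetric n N} {Γ : ℝ → ℝ × N}
  {J : Set ℝ}

theorem isConst_of_hasDerivWithinAt_zero {f : ℝ → ℝ} (hJ : J.OrdConnected)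
    (hf : ∀ t ∈ J, HasDerivWithinAt f 0 J t) {s t : ℝ} (hs : s ∈ J) (ht : t ∈ J) : f t = f s := by
  have h1 := norm_sub_le_of_hasDerivWithinAt_uIcc (c' := fun _ => (0 : ℝ)) (B := 0) hJ hs ht
    (fun τ hτ => hf τ (hJ.uIcc_subset hs ht hτ)) (by simp)
  rw [zero_mul, norm_le_zero_iff, sub_eq_zero] at h1
  exact h1

/-- Lightlike geodesics of a stationary metric. -/
theorem isLightlikeGeodesicOn_st_iff (hlam : ContMDiff (𝓡∂ n) 𝓘(ℝ, ℝ) ∞ lam)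
    (hpos : ∀ x, 0 < lam x) (hJ : J.OrdConnected) (hJn : J.Nontrivial) :
    IsLightlikeGeodesicOn (stModel n) (stationaryMetric lam om h) Γ J ↔
    ContDiffOn ℝ ∞ (timeCurve Γ) J ∧ ContMDiffOn 𝓘(ℝ, ℝ) (𝓡∂ n) ∞ (spaceCurve Γ) J ∧
    ∃ k : ℝ, k ≠ 0 ∧ ∀ σ ∈ J, lam (spaceCurve Γ σ) * clockRate om Γ J σ = k ∧
      hNorm h (velocity (𝓡∂ n) (spaceCurve Γ) J σ) = |clockRate om Γ J σ| ∧
      HasCovAccel (𝓡∂ n) (hTensor h) (spaceCurve Γ) J σ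
        (show TangentSpace (𝓡∂ n) (spaceCurve Γ σ) from
          clockRate om Γ J σ • lorentzE h om (spaceCurve Γ σ) (velE n (spaceCurve Γ) J σ)
          - (derivWithin (fun τ => lam (spaceCurve Γ τ)) J σ / lam (spaceCurve Γ σ))
            • velE n (spaceCurve Γ) J σ) := by
  have hJu := hJ.uniqueDiffOn_real hJn
  have hnullv : ∀ σ ∈ J, ContMDiffOn 𝓘(ℝ, ℝ) (stModel n) ∞ Γ J →
      stationaryMetric lam om h (Γ σ) (velocity (stModel n) Γ J σ) (velocity (stModel n) Γ J σ)
      = lam (spaceCurve Γ σ) * (-(clockRate om Γ J σ ^ 2)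
        + hNorm h (velocity (𝓡∂ n) (spaceCurve Γ) J σ) ^ 2) := by
    intro σ hσ hΓ
    unfold stationaryMetric
    rw [dtPlus_velocity (hΓ σ hσ) (hJu σ hσ), dSpace_velocity (hΓ σ hσ) (hJu σ hσ), hNorm_sq, sq]
    rfl
  constructor
  · rintro ⟨⟨hΓ, hacc⟩, hlight⟩
    obtain ⟨ht, hx⟩ := contMDiffOn_st_iff.1 hΓ
    have hsq : ∀ σ ∈ J, hNorm h (velocity (𝓡∂ n) (spaceCurve Γ) J σ) ^ 2
        = clockRate om Γ J σ ^ 2 := by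
      intro σ hσ
      have h1 := (hlight σ hσ).2
      rw [hnullv σ hσ hΓ] at h1
      rcases mul_eq_zero.1 h1 with h2 | h2
      · exact absurd h2 (hpos _).ne'
      · linarith
    have hne : ∀ σ ∈ J, clockRate om Γ J σ ≠ 0 := by
      intro σ hσ h0
      apply (hlight σ hσ).1
      have h1 := hsq σ hσ
      rw [h0, hNorm_sq] at h1
      have h2 : (velocity (𝓡∂ n) (spaceCurve Γ) J σ : 𝔼) = 0 := by
        by_contra hv
        exact (h.pos _ _ hv).ne' (by rw [h1]; norm_num)
      have h3 : derivWithin (timeCurve Γ) J σ = 0 := by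
        have h4 : om.form (Γ σ).2 (velocity (𝓡∂ n) (spaceCurve Γ) J σ) = 0 :=
          (congrArg (om.form (Γ σ).2) h2).trans (map_zero _)
        unfold clockRate at h0
        rwa [h4, add_zero] at h0
      refine (velocity_st (hΓ σ hσ) (hJu σ hσ)).trans ?_
      rw [h3, h2]
      rfl
    have hiff := fun σ hσ => (covAccel_st_iff hlam hpos ht hx hJu hσ rfl (hsq σ hσ)).1 (hacc σ hσ)
    have hdiff : ∀ σ ∈ J, HasDerivWithinAt
        (fun τ => lam (spaceCurve Γ τ) * clockRate om Γ J τ) 0 J σ := by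
      intro σ hσ
      have h1 := (hasDerivWithinAt_lam (n := n) hlam hx hσ).mul
        (hasDerivWithinAt_clockRate (om := om) ht hx hJu hσ (mem_extChartAt_source _))
      have h2 := h1.differentiableWithinAt.hasDerivWithinAt
      rw [show derivWithin ((fun τ => lam (spaceCurve Γ τ)) * clockRate om Γ J) J σ = 0 from
        (hiff σ hσ).1] at h2
      exact h2
    obtain ⟨σ₀, hσ₀⟩ := hJn.nonempty
    refine ⟨ht, hx, lam (spaceCurve Γ σ₀) * clockRate om Γ J σ₀,
      mul_ne_zero (hpos _).ne' (hne σ₀ hσ₀), fun σ hσ => ⟨?_, ?_, (hiff σ hσ).2⟩⟩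
    · exact isConst_of_hasDerivWithinAt_zero hJ hdiff hσ₀ hσ
    · rw [← abs_of_nonneg (hNorm_nonneg h (velocity (𝓡∂ n) (spaceCurve Γ) J σ))]
      exact (sq_eq_sq_iff_abs_eq_abs _ _).1 (hsq σ hσ)
  · rintro ⟨ht, hx, k, hk, H⟩
    have hΓ := contMDiffOn_st_iff.2 ⟨ht, hx⟩
    have hsq : ∀ σ ∈ J, hNorm h (velocity (𝓡∂ n) (spaceCurve Γ) J σ) ^ 2
        = clockRate om Γ J σ ^ 2 := fun σ hσ => by rw [(H σ hσ).2.1, sq_abs]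
    refine ⟨⟨hΓ, fun σ hσ => ?_⟩, fun σ hσ => ⟨fun h0 => ?_, ?_⟩⟩
    · refine (covAccel_st_iff hlam hpos ht hx hJu hσ rfl (hsq σ hσ)).2 ⟨?_, (H σ hσ).2.2⟩
      rw [derivWithin_congr (fun τ hτ => (H τ hτ).1) (H σ hσ).1]
      simp
    · have h1 := dtPlus_velocity (om := om) (hΓ σ hσ) (hJu σ hσ)
      rw [h0, map_zero] at h1
      have h2 := (H σ hσ).1
      rw [← h1, mul_zero] at h2
      exact hk h2.symm
    · rw [hnullv σ hσ hΓ, hsq σ hσ]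
      ring

theorem isFuturePointing_velocity_iff (hpos : ∀ x, 0 < lam x)
    (hΓ : ContMDiffOn 𝓘(ℝ, ℝ) (stModel n) ∞ Γ J) (hJ : UniqueDiffOn ℝ J) {σ : ℝ} (hσ : σ ∈ J) :
    IsFuturePointing (stationaryMetric lam om h) (velocity (stModel n) Γ J σ) ↔
      0 < clockRate om Γ J σ := by
  unfold IsFuturePointing
  rw [stationaryMetric_partialT, dtPlus_velocity (hΓ σ hσ) (hJ σ hσ), neg_lt_zero,
    mul_pos_iff_of_pos_left (hpos _)]

theorem integral_derivWithin_eq_sub {t : ℝ → ℝ} (ht : ContDiffOn ℝ ∞ t J)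
    (hJ : J.OrdConnected) (hJn : J.Nontrivial) {a b : ℝ} (ha : a ∈ J) (hb : b ∈ J) :
    ∫ τ in a..b, derivWithin t J τ = t b - t a := by
  have hJu := hJ.uniqueDiffOn_real hJn
  have hsub : uIcc a b ⊆ J := hJ.uIcc_subset ha hb
  have hcont : ContinuousOn (derivWithin t J) (uIcc a b) :=
    (ht.continuousOn_derivWithin hJu (by simp)).mono hsub
  refine intervalIntegral.integral_eq_sub_of_hasDeriv_right (ht.continuousOn.mono hsub)
    (fun x hx => ?_) hcont.intervalIntegrable
  have hxJ : x ∈ J := hsub ⟨hx.1.le, hx.2.le⟩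
  have h1 := ((ht x hxJ).differentiableWithinAt (by simp)).hasDerivWithinAt
  have h2 : J ∈ 𝓝 x := mem_of_superset (Icc_mem_nhds hx.1 hx.2) hsub
  exact (h1.hasDerivAt h2).hasDerivWithinAt

theorem time_add_lineIntegral {k : ℝ} (ht : ContDiffOn ℝ ∞ (timeCurve Γ) J) (hJ : J.OrdConnected)
    (hJn : J.Nontrivial) (hk : ∀ σ ∈ J, clockRate om Γ J σ = k) {a b : ℝ} (ha : a ∈ J)
    (hb : b ∈ J) :
    lineIntegral om (spaceCurve Γ) J a b = k * (b - a) - (timeCurve Γ b - timeCurve Γ a) := by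
  have hJu := hJ.uniqueDiffOn_real hJn
  have hsub : uIcc a b ⊆ J := hJ.uIcc_subset ha hb
  have hcont : ContinuousOn (derivWithin (timeCurve Γ) J) (uIcc a b) :=
    (ht.continuousOn_derivWithin hJu (by simp)).mono hsub
  have h1 : lineIntegral om (spaceCurve Γ) J a b
      = ∫ τ in a..b, (k - derivWithin (timeCurve Γ) J τ) := by
    refine intervalIntegral.integral_congr fun τ hτ => ?_
    have h2 := hk τ (hsub hτ)
    unfold clockRate at h2
    exact eq_sub_of_add_eq' h2
  rw [h1, intervalIntegral.integral_sub intervalIntegrable_const hcont.intervalIntegrable,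
    integral_derivWithin_eq_sub ht hJ hJn ha hb, intervalIntegral.integral_const, smul_eq_mul,
    mul_comm]

theorem clockRate_comp {J' : Set ℝ} {ψ : ℝ → ℝ} (ht : ContDiffOn ℝ ∞ (timeCurve Γ) J)
    (hx : ContMDiffOn 𝓘(ℝ, ℝ) (𝓡∂ n) ∞ (spaceCurve Γ) J) (hψ : ContDiffOn ℝ ∞ ψ J')
    (hm : MapsTo ψ J' J) (hJ' : UniqueDiffOn ℝ J') {s : ℝ} (hs : s ∈ J') :
    clockRate om (fun τ => Γ (ψ τ)) J' s = derivWithin ψ J' s * clockRate om Γ J (ψ s) := by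
  have h1 : derivWithin (timeCurve fun τ => Γ (ψ τ)) J' s
      = derivWithin ψ J' s * derivWithin (timeCurve Γ) J (ψ s) := by
    have := (((ht _ (hm hs)).differentiableWithinAt (by simp)).hasDerivWithinAt.scomp s
      ((hψ s hs).differentiableWithinAt (by simp)).hasDerivWithinAt hm).derivWithin (hJ' s hs)
    exact this
  have h2 := velocity_comp (hx _ (hm hs)) (hψ s hs) hm (hJ' s hs)
  have h3 : om.form (Γ (ψ s)).2 (velocity (𝓡∂ n) (spaceCurve fun τ => Γ (ψ τ)) J' s)
      = derivWithin ψ J' s * om.form (Γ (ψ s)).2 (velocity (𝓡∂ n) (spaceCurve Γ) J (ψ s)) :=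
    (congrArg (om.form (Γ (ψ s)).2) h2).trans (map_smul _ _ _)
  unfold clockRate
  rw [h1, h3]
  ring

theorem hNorm_smul (h : RMetric n N) {x : N} (c : ℝ) (v : TangentSpace (𝓡∂ n) x) :
    hNorm h (c • v) = |c| * hNorm h v := by
  unfold hNorm
  have h1 : h.inner x (c • v) (c • v) = c ^ 2 * h.inner x v v := by
    have h2 := DFunLike.congr_fun (map_smul (h.inner x) c v) (c • v)
    refine h2.trans ?_
    have h3 : h.inner x v (c • v) = c * h.inner x v v := map_smul (h.inner x v) c v
    exact (congrArg (fun r => c * r) h3).trans (by ring)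
  rw [h1, Real.sqrt_mul (sq_nonneg c), Real.sqrt_sq_eq_abs]

theorem affine_preimage_ordConnected {c d : ℝ} (hc : c ≠ 0) (hJ : J.OrdConnected) :
    ((fun τ => c * τ + d) ⁻¹' J).OrdConnected := by
  rcases lt_or_gt_of_ne hc with h1 | h1
  · exact hJ.preimage_anti (fun a b hab => by nlinarith [mul_le_mul_of_nonpos_left hab h1.le])
  · exact hJ.preimage_mono (fun a b hab => by nlinarith [mul_le_mul_of_nonneg_left hab h1.le])

theorem affine_preimage_nontrivial {c d : ℝ} (hc : c ≠ 0) (hJ : J.Nontrivial) :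
    ((fun τ => c * τ + d) ⁻¹' J).Nontrivial := by
  obtain ⟨a, ha, b, hb, hab⟩ := hJ
  refine ⟨(a - d) / c, ?_, (b - d) / c, ?_, fun h => hab ?_⟩
  · simpa [mul_div_cancel₀ _ hc] using ha
  · simpa [mul_div_cancel₀ _ hc] using hb
  · field_simp at h
    linarith

theorem contDiff_affine (c d : ℝ) : ContDiff ℝ ∞ (fun τ : ℝ => c * τ + d) :=
  (contDiff_const.mul contDiff_id).add contDiff_const

theorem derivWithin_affine {J' : Set ℝ} (hJ' : UniqueDiffOn ℝ J') (c d : ℝ) {s : ℝ} (hs : s ∈ J') :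
    derivWithin (fun τ : ℝ => c * τ + d) J' s = c := by
  have h1 : HasDerivAt (fun τ : ℝ => c * τ + d) (c * 1) s := ((hasDerivAt_id s).const_mul c).add_const d
  rw [mul_one] at h1
  exact h1.hasDerivWithinAt.derivWithin (hJ' s hs)

theorem derivWithin_derivWithin_affine {J' : Set ℝ} (hJ' : UniqueDiffOn ℝ J') (c d : ℝ) {s : ℝ}
    (hs : s ∈ J') : derivWithin (derivWithin (fun τ : ℝ => c * τ + d) J') J' s = 0 := by
  rw [derivWithin_congr (fun τ hτ => derivWithin_affine hJ' c d hτ) (derivWithin_affine hJ' c d hs)]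
  simp

theorem lorentzE_smul (h : RMetric n N) (om : SmoothOneForm (𝓡∂ n) N) (x : N) (c : ℝ) (v : 𝔼) :
    lorentzE h om x (c • v) = c • lorentzE h om x v :=
  lorentzForce_smul h om x c v

/-- An affine change of parameter multiplies the parameter `k` of a magnetic geodesic. -/
theorem IsSpeedGeodesicOn.comp_affine {x : ℝ → N} {k c d : ℝ} (hc : c ≠ 0)
    (hJ : UniqueDiffOn ℝ J) (hJ' : UniqueDiffOn ℝ ((fun τ => c * τ + d) ⁻¹' J))
    (hx : IsSpeedGeodesicOn h om k x J) :
    IsSpeedGeodesicOn h om (c * k) (fun τ => x (c * τ + d)) ((fun τ => c * τ + d) ⁻¹' J) := by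
  have hψ : ContDiffOn ℝ ∞ (fun τ : ℝ => c * τ + d) ((fun τ => c * τ + d) ⁻¹' J) :=
    (contDiff_affine c d).contDiffOn
  have hm : MapsTo (fun τ : ℝ => c * τ + d) ((fun τ => c * τ + d) ⁻¹' J) J := fun τ hτ => hτ
  refine ⟨⟨hx.1.1.comp (contMDiffOn_iff_contDiffOn.2 hψ) hm, fun s hs => ?_⟩, fun s hs => ?_⟩
  · have h1 := HasCovAccel.comp (h := h) (ψ := fun τ => c * τ + d) hx.1.1 hψ hm hJ hJ' hs rfl
      (a := k • lorentzE h om (x (c * s + d)) (velE n x J (c * s + d))) (hx.1.2 _ hs)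
    rw [derivWithin_affine hJ' c d hs, derivWithin_derivWithin_affine hJ' c d hs] at h1
    have h2 : (velE n (fun τ => x (c * τ + d)) ((fun τ => c * τ + d) ⁻¹' J) s : 𝔼)
        = c • velE n x J (c * s + d) := by
      have := velocity_comp (ψ := fun τ => c * τ + d) (hx.1.1 _ hs) (hψ s hs) hm (hJ' s hs)
      rw [derivWithin_affine hJ' c d hs] at this
      exact this
    have h3 : (c ^ 2 • k • lorentzE h om (x (c * s + d)) (velE n x J (c * s + d))
        + (0 : ℝ) • velE n x J (c * s + d) : 𝔼)
        = (c * k) • lorentzE h om (x (c * s + d))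
          (velE n (fun τ => x (c * τ + d)) ((fun τ => c * τ + d) ⁻¹' J) s) := by
      rw [h2, lorentzE_smul, zero_smul, add_zero, smul_smul, smul_smul]
      congr 1
      ring
    exact (show (show TangentSpace (𝓡∂ n) (x (c * s + d)) from _) = _ from h3) ▸ h1
  · have h2 := velocity_comp (ψ := fun τ => c * τ + d) (hx.1.1 _ hs) (hψ s hs) hm (hJ' s hs)
    rw [derivWithin_affine hJ' c d hs] at h2
    have h3 : hNorm h (velocity (𝓡∂ n) (fun τ => x (c * τ + d)) ((fun τ => c * τ + d) ⁻¹' J) s)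
        = hNorm h (c • velocity (𝓡∂ n) x J (c * s + d)) :=
      congrArg (fun w : 𝔼 => hNorm h (x := x (c * s + d)) w) h2
    rw [h3, hNorm_smul, hx.2 _ hs, abs_mul]

/-- Lightlike geodesics of `-(dt + ω)² + h` and magnetic geodesics. -/
theorem isLightlikeGeodesicOn_one_iff (hJ : J.OrdConnected) (hJn : J.Nontrivial) :
    IsLightlikeGeodesicOn (stModel n) (stationaryMetric (fun _ => 1) om h) Γ J ↔
    ContDiffOn ℝ ∞ (timeCurve Γ) J ∧ ∃ k : ℝ, k ≠ 0 ∧ (∀ σ ∈ J, clockRate om Γ J σ = k) ∧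
      IsSpeedGeodesicOn h om k (spaceCurve Γ) J := by
  rw [isLightlikeGeodesicOn_st_iff contMDiff_const (fun _ => one_pos) hJ hJn]
  have hd : ∀ σ, derivWithin (fun _ : ℝ => (1 : ℝ)) J σ / 1 = 0 := by simp
  have key : ∀ σ, HasCovAccel (𝓡∂ n) (hTensor h) (spaceCurve Γ) J σ
        (show TangentSpace (𝓡∂ n) (spaceCurve Γ σ) from
          clockRate om Γ J σ • lorentzE h om (spaceCurve Γ σ) (velE n (spaceCurve Γ) J σ)
          - (derivWithin (fun _ : ℝ => (1 : ℝ)) J σ / 1) • velE n (spaceCurve Γ) J σ) ↔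
      HasCovAccel (𝓡∂ n) (hTensor h) (spaceCurve Γ) J σ (clockRate om Γ J σ •
        lorentzForce h om (spaceCurve Γ σ) (velocity (𝓡∂ n) (spaceCurve Γ) J σ)) := by
    intro σ
    rw [hd, zero_smul, sub_zero]
    rfl
  constructor
  · rintro ⟨ht, hx, k, hk, H⟩
    have hkk : ∀ σ ∈ J, clockRate om Γ J σ = k := fun σ hσ => by simpa using (H σ hσ).1
    refine ⟨ht, k, hk, hkk, ⟨hx, fun σ hσ => ?_⟩, fun σ hσ => ?_⟩
    · have h1 := (key σ).1 (H σ hσ).2.2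
      rwa [hkk σ hσ] at h1
    · rw [(H σ hσ).2.1, hkk σ hσ]
  · rintro ⟨ht, k, hk, hkk, hx⟩
    refine ⟨ht, hx.1.1, k, hk, fun σ hσ => ⟨by simpa using hkk σ hσ, ?_, ?_⟩⟩
    · rw [hx.2 σ hσ, hkk σ hσ]
    · refine (key σ).2 ?_
      rw [hkk σ hσ]
      exact hx.1.2 σ hσ

theorem lightlike_geodesics_project (hJ : J.OrdConnected) (hJn : J.Nontrivial)
    (hΓ : IsLightlikeGeodesicOn (stModel n) (stationaryMetric (fun _ => 1) om h) Γ J) :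
      ∃ k : ℝ, k ≠ 0 ∧
        (∀ σ ∈ J, derivWithin (fun τ => (Γ τ).1) J σ
          + om.form (Γ σ).2 (velocity (𝓡∂ n) (fun τ => (Γ τ).2) J σ) = k) ∧
        IsMagneticGeodesicOn h om k (fun τ => (Γ τ).2) J ∧
        (∀ σ ∈ J, hNorm h (velocity (𝓡∂ n) (fun τ => (Γ τ).2) J σ) = |k|) ∧
        (∀ σ ∈ J, IsFuturePointing (stationaryMetric (fun _ => 1) om h)
          (velocity (stModel n) Γ J σ) ↔ 0 < k) ∧
        (∀ σ₀ ∈ J, ∃ C : ℝ, ∀ σ ∈ J,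
          (Γ σ).1 + lineIntegral om (fun τ => (Γ τ).2) J σ₀ σ - k * σ = C) ∧
        (∀ c d : ℝ, c ≠ 0 →
          IsLightlikeGeodesicOn (stModel n) (stationaryMetric (fun _ => 1) om h)
            (fun τ => Γ (c * τ + d)) ((fun τ => c * τ + d) ⁻¹' J) ∧
          ∀ σ ∈ (fun τ => c * τ + d) ⁻¹' J,
            derivWithin (fun τ => (Γ (c * τ + d)).1) ((fun τ => c * τ + d) ⁻¹' J) σ
              + om.form (Γ (c * σ + d)).2
                (velocity (𝓡∂ n) (fun τ => (Γ (c * τ + d)).2) ((fun τ => c * τ + d) ⁻¹' J) σ)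
              = c * k) := by
  have hJu := hJ.uniqueDiffOn_real hJn
  obtain ⟨ht, k, hk, hkk, hx⟩ := (isLightlikeGeodesicOn_one_iff hJ hJn).1 hΓ
  have hsm := contMDiffOn_st_iff.2 ⟨ht, hx.1.1⟩
  refine ⟨k, hk, hkk, hx.1, hx.2, fun σ hσ => ?_, fun σ₀ hσ₀ => ?_, fun c d hc => ?_⟩
  · rw [isFuturePointing_velocity_iff (fun _ => one_pos) hsm hJu hσ, hkk σ hσ]
  · refine ⟨(Γ σ₀).1 - k * σ₀, fun σ hσ => ?_⟩
    have h1 := time_add_lineIntegral ht hJ hJn hkk hσ₀ hσ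
    change timeCurve Γ σ + lineIntegral om (spaceCurve Γ) J σ₀ σ - k * σ = timeCurve Γ σ₀ - k * σ₀
    rw [h1]
    ring
  · have hJ' := affine_preimage_ordConnected (d := d) hc hJ
    have hJn' := affine_preimage_nontrivial (d := d) hc hJn
    have hJu' := hJ'.uniqueDiffOn_real hJn'
    have hψ : ContDiffOn ℝ ∞ (fun τ : ℝ => c * τ + d) ((fun τ => c * τ + d) ⁻¹' J) :=
      (contDiff_affine c d).contDiffOn
    have hm : MapsTo (fun τ : ℝ => c * τ + d) ((fun τ => c * τ + d) ⁻¹' J) J := fun τ hτ => hτ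
    have hrate : ∀ σ ∈ (fun τ => c * τ + d) ⁻¹' J,
        clockRate om (fun τ => Γ (c * τ + d)) ((fun τ => c * τ + d) ⁻¹' J) σ = c * k := by
      intro σ hσ
      rw [clockRate_comp (ψ := fun τ => c * τ + d) ht hx.1.1 hψ hm hJu' hσ,
        derivWithin_affine hJu' c d hσ, hkk _ hσ]
    refine ⟨(isLightlikeGeodesicOn_one_iff hJ' hJn').2 ⟨?_, c * k, mul_ne_zero hc hk, hrate, ?_⟩,
      hrate⟩
    · exact ht.comp hψ hm
    · exact hx.comp_affine hc hJu hJu'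

end LightlikeGeodesics

section RealReparametrization

theorem continuous_IccExtend_of_continuousOn {a b : ℝ} (hab : a ≤ b) {f : ℝ → ℝ}
    (hf : ContinuousOn f (Icc a b)) :
    Continuous (IccExtend hab (fun x : Icc a b => f x)) :=
  (continuousOn_iff_continuous_domRestrict.1 hf).Icc_extend'

theorem hasDerivAt_integral_IccExtend {a b : ℝ} (hab : a ≤ b) {f : ℝ → ℝ}
    (hf : ContinuousOn f (Icc a b)) (s : ℝ) :
    HasDerivAt (fun t => ∫ τ in a..t, IccExtend hab (fun x : Icc a b => f x) τ)
      (IccExtend hab (fun x : Icc a b => f x) s) s :=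
  ((continuous_IccExtend_of_continuousOn hab hf).integral_hasStrictDerivAt a s).hasDerivAt

theorem contDiffOn_of_derivWithin_eq {J : Set ℝ} (hJ : UniqueDiffOn ℝ J) {f g : ℝ → ℝ}
    (hf : ∀ t ∈ J, HasDerivWithinAt f (g t) J t) (hg : ContDiffOn ℝ ∞ g J) :
    ContDiffOn ℝ ∞ f J := by
  rw [contDiffOn_infty_iff_derivWithin hJ]
  exact ⟨fun t ht => (hf t ht).differentiableWithinAt,
    hg.congr fun t ht => (hf t ht).derivWithin (hJ t ht)⟩

/-- The reparametrization with `ψ' = 1 / f(ψ)`. -/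
theorem exists_reparametrization {b : ℝ} (hb : 0 < b) {f : ℝ → ℝ} (hf : ContDiffOn ℝ ∞ f (Icc 0 b))
    (hpos : ∀ σ ∈ Icc 0 b, 0 < f σ) :
    ∃ (ℓ : ℝ) (ψ : ℝ → ℝ), 0 < ℓ ∧ ContDiffOn ℝ ∞ ψ (Icc 0 ℓ) ∧ ψ 0 = 0 ∧ ψ ℓ = b ∧
      MapsTo ψ (Icc 0 ℓ) (Icc 0 b) ∧ MapsTo ψ (Ioo 0 ℓ) (Ioo 0 b) ∧
      ∀ s ∈ Icc 0 ℓ, HasDerivWithinAt ψ (f (ψ s))⁻¹ (Icc 0 ℓ) s := by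
  set F := IccExtend hb.le (fun x : Icc 0 b => f x) with hF
  have hFc : Continuous F := continuous_IccExtend_of_continuousOn hb.le hf.continuousOn
  obtain ⟨x₀, hx₀, hmin⟩ := isCompact_Icc.exists_isMinOn (nonempty_Icc.2 hb.le) hf.continuousOn
  set c := f x₀ with hc
  have hc0 : 0 < c := hpos x₀ hx₀
  have hFge : ∀ σ, c ≤ F σ := fun σ => hmin (projIcc 0 b hb.le σ).2
  set S : ℝ → ℝ := fun t => ∫ τ in (0 : ℝ)..t, F τ with hS
  have hSd : ∀ s, HasDerivAt S (F s) s := hasDerivAt_integral_IccExtend hb.le hf.continuousOn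
  have hS0 : S 0 = 0 := intervalIntegral.integral_same
  have hmono : StrictMono S := strictMono_of_deriv_pos fun s => by
    rw [(hSd s).deriv]; exact hc0.trans_le (hFge s)
  have hmono2 : Monotone fun s => S s - c * s := by
    have hd : ∀ s, HasDerivAt (fun s => S s - c * s) (F s - c) s := fun s => by
      have h1 := (hSd s).sub ((hasDerivAt_id s).const_mul c)
      rw [mul_one] at h1
      exact h1
    exact monotone_of_deriv_nonneg (fun s => (hd s).differentiableAt) fun s => by
      rw [(hd s).deriv]; linarith [hFge s]
  have hcont : Continuous S := continuous_iff_continuousAt.2 fun s => (hSd s).continuousAt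
  have htop : Tendsto S atTop atTop := by
    refine tendsto_atTop_mono' _ ?_ (tendsto_id.const_mul_atTop hc0)
    filter_upwards [eventually_ge_atTop (0 : ℝ)] with s hs
    have := hmono2 hs
    simp only [hS0, mul_zero, sub_zero] at this
    simp only [id]
    linarith
  have hbot : Tendsto S atBot atBot := by
    refine tendsto_atBot_mono' _ ?_ (tendsto_id.const_mul_atBot hc0)
    filter_upwards [eventually_le_atBot (0 : ℝ)] with s hs
    have := hmono2 hs
    simp only [hS0, mul_zero, sub_zero] at this
    simp only [id]
    linarith
  set e := hmono.orderIsoOfSurjective S (hcont.surjective htop hbot) with he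
  have heS : ∀ s, e s = S s := fun s => rfl
  have hSe : ∀ s, S (e.symm s) = s := fun s => e.apply_symm_apply s
  have heS' : ∀ s, e.symm (S s) = s := fun s => e.symm_apply_apply s
  have h0 : e.symm 0 = 0 := by have h1 := heS' 0; rwa [hS0] at h1
  have hd : ∀ s, HasDerivAt e.symm (F (e.symm s))⁻¹ s := fun s =>
    HasDerivAt.of_local_left_inverse e.symm.continuous.continuousAt (hSd _)
      (hc0.trans_le (hFge _)).ne' (Eventually.of_forall hSe)
  have hmaps : MapsTo e.symm (Icc 0 (S b)) (Icc 0 b) := fun s hs => by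
    constructor
    · rw [← h0]; exact e.symm.monotone hs.1
    · rw [← heS' b]; exact e.symm.monotone hs.2
  have hder : ∀ s ∈ Icc 0 (S b), HasDerivWithinAt e.symm (f (e.symm s))⁻¹ (Icc 0 (S b)) s := by
    intro s hs
    have h1 := (hd s).hasDerivWithinAt (s := Icc 0 (S b))
    have h2 : F (e.symm s) = f (e.symm s) := IccExtend_of_mem hb.le _ (hmaps hs)
    rwa [h2] at h1
  have hℓ : 0 < S b := by rw [← hS0]; exact hmono hb
  refine ⟨S b, e.symm, hℓ, ?_, h0, heS' b, hmaps, fun s hs => ?_, hder⟩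
  · exact contDiffOn_of_hasDerivWithinAt_ode (G := fun w => (f w)⁻¹) (T := Icc 0 b)
      (uniqueDiffOn_Icc hℓ) hder (hf.inv fun σ hσ => (hpos σ hσ).ne') hmaps
  · constructor
    · rw [← h0]; exact e.symm.strictMono hs.1
    · rw [← heS' b]; exact e.symm.strictMono hs.2

end RealReparametrization

noncomputable section Projections

variable {n : ℕ} [NeZero n] {N : Type*} [TopologicalSpace N] [T2Space N]
  [ChartedSpace (EuclideanHalfSpace n) N] [IsManifold (𝓡∂ n) ∞ N]

local notation "𝔼" => EuclideanSpace ℝ (Fin n)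

theorem bdryComp_eq {x : N} (v : TangentSpace (𝓡∂ n) x) : bdryComp v = (show 𝔼 from v) 0 :=
  congrArg (fun w : 𝔼 => w 0) (chartVec_apply x v)

theorem isBdryProj_congr_point (h : RMetric n N) {x y : N} (hxy : x = y) (u v : 𝔼) :
    IsBdryProj h (x := x) u v ↔ IsBdryProj h (x := y) u v := by
  subst hxy; rfl

theorem tangentBundle_ext {X Y : TangentBundle (𝓡∂ n) N} (h1 : X.proj = Y.proj)
    (h2 : (X.snd : 𝔼) = Y.snd) : X = Y := by
  obtain ⟨x, u⟩ := X
  obtain ⟨y, v⟩ := Y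
  obtain rfl : x = y := h1
  obtain rfl : u = v := h2
  rfl

theorem inner_smul_left' (h : RMetric n N) {x : N} (c : ℝ) (u v : TangentSpace (𝓡∂ n) x) :
    h.inner x (c • u) v = c * h.inner x u v :=
  DFunLike.congr_fun (map_smul (h.inner x) c u) v

theorem bdryComp_smul {x : N} (c : ℝ) (v : TangentSpace (𝓡∂ n) x) :
    bdryComp (c • v) = c * bdryComp v := by
  unfold bdryComp
  exact congrArg (fun w : 𝔼 => w 0) (map_smul (chartVec (𝓡∂ n) x) c v)

theorem IsBdryProj.smul {h : RMetric n N} {x : N} {v v' : TangentSpace (𝓡∂ n) x}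
    (H : IsBdryProj h v v') (c : ℝ) : IsBdryProj h (c • v) (c • v') := by
  refine ⟨by rw [bdryComp_smul, H.1, mul_zero], fun u hu => ?_⟩
  rw [← smul_sub, inner_smul_left', H.2 u hu, mul_zero]

theorem dtPlus_apply (om : SmoothOneForm (𝓡∂ n) N) (p : ℝ × N) (v : TangentSpace (stModel n) p) :
    dtPlus om p v = v.1 + om.form p.2 (show TangentSpace (𝓡∂ n) p.2 from v.2) :=
  congrArg₂ (· + ·) (dTime_apply p v) (congrArg (om.form p.2) (dSpace_apply p v))

theorem isLateralProj_iff {lam : N → ℝ} (hpos : ∀ x, 0 < lam x) (om : SmoothOneForm (𝓡∂ n) N)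
    (h : RMetric n N) {p : ℝ × N} {v v' : TangentSpace (stModel n) p} :
    IsLateralProj (stationaryMetric lam om h) v v' ↔
      dtPlus om p v = dtPlus om p v' ∧ IsBdryProj h (dSpace p v) (dSpace p v') := by
  have key : ∀ u, stationaryMetric lam om h p (v - v') u
      = lam p.2 * (-((dtPlus om p v - dtPlus om p v') * dtPlus om p u)
        + h.inner p.2 (dSpace p v - dSpace p v') (dSpace p u)) := fun u => by
    unfold stationaryMetric
    rw [map_sub, map_sub]
  constructor
  · rintro ⟨h1, h2⟩
    have h3 : dtPlus om p v = dtPlus om p v' := by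
      have h4 := h2 (partialT p) (by
        rw [bdryComp_eq]
        exact congrArg (fun w : 𝔼 => w 0) (dSpace_partialT p))
      have h5 : h.inner p.2 (dSpace p v - dSpace p v') (dSpace p (partialT p)) = 0 :=
        (congrArg (h.inner p.2 (dSpace p v - dSpace p v')) (dSpace_partialT p)).trans (map_zero _)
      rw [key, dtPlus_partialT, h5] at h4
      have := (mul_eq_zero.1 h4).resolve_left (hpos _).ne'
      linarith
    refine ⟨h3, h1, fun u hu => ?_⟩
    have h6 : dSpace p (show TangentSpace (stModel n) p from ((0 : ℝ), (u : 𝔼))) = u :=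
      dSpace_apply p _
    have h4 := h2 (show TangentSpace (stModel n) p from ((0 : ℝ), (u : 𝔼))) (by rw [h6]; exact hu)
    rw [key, h6, h3, sub_self, zero_mul, neg_zero, zero_add] at h4
    exact (mul_eq_zero.1 h4).resolve_left (hpos _).ne'
  · rintro ⟨h1, h2, h3⟩
    refine ⟨h2, fun u hu => ?_⟩
    rw [key, h1, h3 _ hu]
    ring

theorem timePart_eq (om : SmoothOneForm (𝓡∂ n) N) (h : RMetric n N)
    (P : TangentBundle (stModel n) (ℝ × N)) : timePart om h P = dtPlus om P.proj P.snd := by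
  unfold timePart
  rw [stationaryMetric_partialT]
  ring

end Projections

noncomputable section ScatteringCorrespondence

variable {n : ℕ} [NeZero n] {N : Type*} [TopologicalSpace N] [T2Space N]
  [ChartedSpace (EuclideanHalfSpace n) N] [IsManifold (𝓡∂ n) ∞ N]

local notation "𝔼" => EuclideanSpace ℝ (Fin n)

variable {lam : N → ℝ} {om : SmoothOneForm (𝓡∂ n) N} {h : RMetric n N} {Γ : ℝ → ℝ × N}
  {J J' : Set ℝ} {ψ : ℝ → ℝ}

theorem velE_comp {x : ℝ → N} {s : ℝ} (hx : ContMDiffWithinAt 𝓘(ℝ, ℝ) (𝓡∂ n) ∞ x J (ψ s))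
    (hψ : ContDiffWithinAt ℝ ∞ ψ J' s) (hm : MapsTo ψ J' J) (hJ' : UniqueDiffWithinAt ℝ J' s) :
    velE n (fun τ => x (ψ τ)) J' s = derivWithin ψ J' s • velE n x J (ψ s) :=
  velocity_comp hx hψ hm hJ'

theorem hNorm_comp {x : ℝ → N} {s : ℝ} (hx : ContMDiffWithinAt 𝓘(ℝ, ℝ) (𝓡∂ n) ∞ x J (ψ s))
    (hψ : ContDiffWithinAt ℝ ∞ ψ J' s) (hm : MapsTo ψ J' J) (hJ' : UniqueDiffWithinAt ℝ J' s) :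
    hNorm h (velocity (𝓡∂ n) (fun τ => x (ψ τ)) J' s)
      = |derivWithin ψ J' s| * hNorm h (velocity (𝓡∂ n) x J (ψ s)) := by
  rw [← hNorm_smul]
  exact congrArg (fun w : 𝔼 => hNorm h (x := x (ψ s)) w) (velocity_comp hx hψ hm hJ')

theorem contDiffOn_form_velocity (om : SmoothOneForm (𝓡∂ n) N) {x : ℝ → N}
    (hx : ContMDiffOn 𝓘(ℝ, ℝ) (𝓡∂ n) ∞ x J) (hJ : UniqueDiffOn ℝ J) :
    ContDiffOn ℝ ∞ (fun τ => om.form (x τ) (velocity (𝓡∂ n) x J τ)) J := by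
  intro σ hσ
  have hp : x σ ∈ (extChartAt (𝓡∂ n) (x σ)).source := mem_extChartAt_source _
  obtain ⟨U, hU, hσU, H⟩ := exists_chart_window hx.continuousOn hσ hp
  have hJU : J ∩ U ∈ 𝓝[J] σ :=
    inter_mem self_mem_nhdsWithin (mem_nhdsWithin_of_mem_nhds (hU.mem_nhds hσU))
  have hC : ContDiffOn ℝ ∞ (chartCurve n (x σ) x) (J ∩ U) := fun τ hτ =>
    (contDiffWithinAt_chartCurve (hx τ hτ.1) (H τ hτ)).mono inter_subset_left
  have hC' : ContDiffOn ℝ ∞ (derivWithin (chartCurve n (x σ) x) (J ∩ U)) (J ∩ U) :=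
    hC.derivWithin (hJ.inter hU) (by simp)
  have h1 : ContDiffOn ℝ ∞ (fun τ => formC om (x σ) (chartCurve n (x σ) x τ)) (J ∩ U) :=
    (contDiffOn_formC om (x σ)).comp hC fun τ hτ => (extChartAt (𝓡∂ n) (x σ)).map_source (H τ hτ)
  have h2 := h1.clm_apply hC'
  refine ((h2 σ ⟨hσ, hσU⟩).congr_of_mem (fun τ hτ => ?_) ⟨hσ, hσU⟩).mono_of_mem_nhdsWithin hJU
  have h3 := formC_velocity om ((hx τ hτ.1).mdifferentiableWithinAt (by simp)) (hJ τ hτ.1) (H τ hτ)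
  refine h3.symm.trans (congrArg (formC om (x σ) (chartCurve n (x σ) x τ)) ?_)
  exact (chartVel_mono (hx τ hτ.1) (H τ hτ) ((hJ.inter hU) τ hτ) inter_subset_left).symm

theorem exists_clock (om : SmoothOneForm (𝓡∂ n) N) {x : ℝ → N} {ℓ : ℝ} (hℓ : 0 < ℓ)
    (hx : ContMDiffOn 𝓘(ℝ, ℝ) (𝓡∂ n) ∞ x (Icc 0 ℓ)) (t₀ : ℝ) :
    ∃ t : ℝ → ℝ, t 0 = t₀ ∧ ContDiffOn ℝ ∞ t (Icc 0 ℓ) ∧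
      ∀ σ ∈ Icc 0 ℓ, clockRate om (fun τ => (t τ, x τ)) (Icc 0 ℓ) σ = 1 := by
  have hJ := uniqueDiffOn_Icc hℓ
  set g : ℝ → ℝ := fun τ => 1 - om.form (x τ) (velocity (𝓡∂ n) x (Icc 0 ℓ) τ) with hg
  have hgs : ContDiffOn ℝ ∞ g (Icc 0 ℓ) :=
    contDiffOn_const.sub (contDiffOn_form_velocity om hx hJ)
  set t : ℝ → ℝ := fun s => t₀ + ∫ τ in (0 : ℝ)..s, IccExtend hℓ.le (fun x : Icc 0 ℓ => g x) τ with ht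
  have hd : ∀ s ∈ Icc 0 ℓ, HasDerivWithinAt t (g s) (Icc 0 ℓ) s := by
    intro s hs
    have h1 := ((hasDerivAt_integral_IccExtend hℓ.le hgs.continuousOn s).const_add t₀).hasDerivWithinAt
      (s := Icc 0 ℓ)
    have h2 : IccExtend hℓ.le (fun x : Icc 0 ℓ => g x) s = g s := IccExtend_of_mem hℓ.le _ hs
    rwa [h2] at h1
  refine ⟨t, by simp [ht], contDiffOn_of_derivWithin_eq hJ hd hgs, fun σ hσ => ?_⟩
  have h1 : derivWithin t (Icc 0 ℓ) σ = g σ := (hd σ hσ).derivWithin (hJ σ hσ)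
  change derivWithin t (Icc 0 ℓ) σ + om.form (x σ) (velocity (𝓡∂ n) x (Icc 0 ℓ) σ) = 1
  rw [h1]
  ring

theorem contDiffOn_lam_comp (hlam : ContMDiff (𝓡∂ n) 𝓘(ℝ, ℝ) ∞ lam) {x : ℝ → N}
    (hx : ContMDiffOn 𝓘(ℝ, ℝ) (𝓡∂ n) ∞ x J) : ContDiffOn ℝ ∞ (fun τ => lam (x τ)) J :=
  contMDiffOn_iff_contDiffOn.1 (hlam.comp_contMDiffOn hx)

/-- The unit speed magnetic geodesic below a lightlike geodesic. -/
theorem exists_unit_reparametrization (hlam : ContMDiff (𝓡∂ n) 𝓘(ℝ, ℝ) ∞ lam)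
    (hpos : ∀ x, 0 < lam x) {b : ℝ} (hb : 0 < b)
    (hΓ : IsLightlikeGeodesicOn (stModel n) (stationaryMetric lam om h) Γ (Icc 0 b))
    (hfut : 0 < clockRate om Γ (Icc 0 b) 0) :
    ∃ (ℓ : ℝ) (ψ : ℝ → ℝ), 0 < ℓ ∧ ψ 0 = 0 ∧ ψ ℓ = b ∧ MapsTo ψ (Ioo 0 ℓ) (Ioo 0 b) ∧
      IsUnitMagneticGeodesicOn h om (fun s => spaceCurve Γ (ψ s)) (Icc 0 ℓ) ∧
      (∀ s ∈ Icc 0 ℓ, 0 < clockRate om Γ (Icc 0 b) (ψ s) ∧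
        lam (spaceCurve Γ (ψ s)) * clockRate om Γ (Icc 0 b) (ψ s)
          = lam (spaceCurve Γ 0) * clockRate om Γ (Icc 0 b) 0 ∧
        velE n (fun s => spaceCurve Γ (ψ s)) (Icc 0 ℓ) s
          = (clockRate om Γ (Icc 0 b) (ψ s))⁻¹ • velE n (spaceCurve Γ) (Icc 0 b) (ψ s)) ∧
      lineIntegral om (fun s => spaceCurve Γ (ψ s)) (Icc 0 ℓ) 0 ℓ
        = ℓ - (timeCurve Γ b - timeCurve Γ 0) := by
  have hJb := uniqueDiffOn_Icc hb
  have h0b : (0 : ℝ) ∈ Icc 0 b := ⟨le_rfl, hb.le⟩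
  have hnb : (Icc 0 b).Nontrivial := ⟨0, h0b, b, ⟨hb.le, le_rfl⟩, hb.ne⟩
  obtain ⟨ht, hx, k, hk, H⟩ :=
    (isLightlikeGeodesicOn_st_iff hlam hpos ordConnected_Icc hnb).1 hΓ
  set x := spaceCurve Γ with hxdef
  set θ := clockRate om Γ (Icc 0 b) with hθ
  have hkpos : 0 < k := by rw [← (H 0 h0b).1]; exact mul_pos (hpos _) hfut
  have hθeq : ∀ σ ∈ Icc 0 b, θ σ = k / lam (x σ) := fun σ hσ => by
    rw [eq_div_iff (hpos _).ne', mul_comm]; exact (H σ hσ).1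
  have hθpos : ∀ σ ∈ Icc 0 b, 0 < θ σ := fun σ hσ => by
    rw [hθeq σ hσ]; exact div_pos hkpos (hpos _)
  have hlx := contDiffOn_lam_comp (n := n) hlam hx
  have hθs : ContDiffOn ℝ ∞ θ (Icc 0 b) :=
    (contDiffOn_const.div hlx fun σ _ => (hpos _).ne').congr hθeq
  obtain ⟨ℓ, ψ, hℓ, hψs, hψ0, hψℓ, hmaps, hmapsI, hψd⟩ := exists_reparametrization hb hθs hθpos
  have hJ := uniqueDiffOn_Icc hℓ
  have h0 : (0 : ℝ) ∈ Icc 0 ℓ := ⟨le_rfl, hℓ.le⟩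
  have hnℓ : (Icc 0 ℓ).Nontrivial := ⟨0, h0, ℓ, ⟨hℓ.le, le_rfl⟩, hℓ.ne⟩
  have hψ' : ∀ s ∈ Icc 0 ℓ, derivWithin ψ (Icc 0 ℓ) s = (θ (ψ s))⁻¹ := fun s hs =>
    (hψd s hs).derivWithin (hJ s hs)
  have hψ'' : ∀ s ∈ Icc 0 ℓ, derivWithin (derivWithin ψ (Icc 0 ℓ)) (Icc 0 ℓ) s
      = derivWithin (fun τ => lam (x τ)) (Icc 0 b) (ψ s) / lam (x (ψ s)) / θ (ψ s) ^ 2 := by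
    intro s hs
    have h1 : ∀ τ ∈ Icc 0 ℓ, derivWithin ψ (Icc 0 ℓ) τ = lam (x (ψ τ)) / k := fun τ hτ => by
      rw [hψ' τ hτ, hθeq _ (hmaps hτ), inv_div]
    have h2 := (((hlx _ (hmaps hs)).differentiableWithinAt (by simp)).hasDerivWithinAt.scomp s
      (hψd s hs) hmaps).div_const k
    rw [derivWithin_congr h1 (h1 s hs)]
    refine (h2.derivWithin (hJ s hs)).trans ?_
    have h3 := (hpos (x (ψ s))).ne'
    rw [hθeq _ (hmaps hs), smul_eq_mul]
    field_simp
  have hvel : ∀ s ∈ Icc 0 ℓ, velE n (fun s => x (ψ s)) (Icc 0 ℓ) s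
      = (θ (ψ s))⁻¹ • velE n x (Icc 0 b) (ψ s) := fun s hs => by
    rw [velE_comp (hx _ (hmaps hs)) (hψs s hs) hmaps (hJ s hs), hψ' s hs]
  have hrate : ∀ s ∈ Icc 0 ℓ, clockRate om (fun τ => Γ (ψ τ)) (Icc 0 ℓ) s = 1 := fun s hs => by
    rw [clockRate_comp ht hx hψs hmaps hJ hs, hψ' s hs]
    exact inv_mul_cancel₀ (hθpos _ (hmaps hs)).ne'
  refine ⟨ℓ, ψ, hℓ, hψ0, hψℓ, hmapsI, ⟨⟨hx.comp (contMDiffOn_iff_contDiffOn.2 hψs) hmaps,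
    fun s hs => ?_⟩, fun s hs => ?_⟩, fun s hs => ⟨hθpos _ (hmaps hs), ?_, hvel s hs⟩, ?_⟩
  · have h1 := HasCovAccel.comp (h := h) hx hψs hmaps hJb hJ hs rfl (H _ (hmaps hs)).2.2
    have hθ0 := (hθpos _ (hmaps hs)).ne'
    have h3 : derivWithin ψ (Icc 0 ℓ) s ^ 2 • (θ (ψ s) • lorentzE h om (x (ψ s))
          (velE n x (Icc 0 b) (ψ s))
        - (derivWithin (fun τ => lam (x τ)) (Icc 0 b) (ψ s) / lam (x (ψ s)))
          • velE n x (Icc 0 b) (ψ s))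
        + derivWithin (derivWithin ψ (Icc 0 ℓ)) (Icc 0 ℓ) s • velE n x (Icc 0 b) (ψ s)
        = (1 : ℝ) • lorentzE h om (x (ψ s)) (velE n (fun s => x (ψ s)) (Icc 0 ℓ) s) := by
      rw [hvel s hs, lorentzE_smul, hψ'' s hs, hψ' s hs, smul_sub, smul_smul, smul_smul, one_smul]
      rw [show (θ (ψ s))⁻¹ ^ 2 * θ (ψ s) = (θ (ψ s))⁻¹ by field_simp,
        show (θ (ψ s))⁻¹ ^ 2 * (derivWithin (fun τ => lam (x τ)) (Icc 0 b) (ψ s) / lam (x (ψ s)))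
          = derivWithin (fun τ => lam (x τ)) (Icc 0 b) (ψ s) / lam (x (ψ s)) / θ (ψ s) ^ 2 by
            field_simp]
      abel
    exact (show (show TangentSpace (𝓡∂ n) (x (ψ s)) from _) = _ from h3) ▸ h1
  · rw [hNorm_comp (hx _ (hmaps hs)) (hψs s hs) hmaps (hJ s hs), hψ' s hs, (H _ (hmaps hs)).2.1,
      ← abs_mul, inv_mul_cancel₀ (hθpos _ (hmaps hs)).ne', abs_one]
  · rw [(H _ (hmaps hs)).1, (H 0 h0b).1]
  · have h1 := time_add_lineIntegral (Γ := fun τ => Γ (ψ τ)) (ht.comp hψs hmaps)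
      ordConnected_Icc hnℓ hrate h0 ⟨hℓ.le, le_rfl⟩
    have h2 : timeCurve (fun τ => Γ (ψ τ)) ℓ = timeCurve Γ b := by simp [timeCurve, hψℓ]
    have h3 : timeCurve (fun τ => Γ (ψ τ)) 0 = timeCurve Γ 0 := by simp [timeCurve, hψ0]
    rw [h2, h3, one_mul, sub_zero] at h1
    exact h1

/-- The lightlike geodesic above a unit speed magnetic geodesic. -/
theorem exists_lightlike_lift (hlam : ContMDiff (𝓡∂ n) 𝓘(ℝ, ℝ) ∞ lam)
    (hpos : ∀ x, 0 < lam x) {ℓ : ℝ} (hℓ : 0 < ℓ) {γ : ℝ → N}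
    (hγ : IsUnitMagneticGeodesicOn h om γ (Icc 0 ℓ)) (t₀ : ℝ) {k : ℝ} (hk : 0 < k) :
    ∃ (b : ℝ) (ψ : ℝ → ℝ) (Γ : ℝ → ℝ × N), 0 < b ∧ ψ 0 = 0 ∧ ψ b = ℓ ∧
      MapsTo ψ (Ioo 0 b) (Ioo 0 ℓ) ∧ spaceCurve Γ = (fun σ => γ (ψ σ)) ∧
      IsLightlikeGeodesicOn (stModel n) (stationaryMetric lam om h) Γ (Icc 0 b) ∧
      timeCurve Γ 0 = t₀ ∧
      timeCurve Γ b = t₀ + (ℓ - lineIntegral om γ (Icc 0 ℓ) 0 ℓ) ∧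
      ∀ σ ∈ Icc 0 b, clockRate om Γ (Icc 0 b) σ = k / lam (γ (ψ σ)) ∧
        velE n (spaceCurve Γ) (Icc 0 b) σ
          = clockRate om Γ (Icc 0 b) σ • velE n γ (Icc 0 ℓ) (ψ σ) := by
  have hJℓ := uniqueDiffOn_Icc hℓ
  have h0ℓ : (0 : ℝ) ∈ Icc 0 ℓ := ⟨le_rfl, hℓ.le⟩
  have hnℓ : (Icc 0 ℓ).Nontrivial := ⟨0, h0ℓ, ℓ, ⟨hℓ.le, le_rfl⟩, hℓ.ne⟩
  have hx := hγ.1.1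
  have hlx := contDiffOn_lam_comp (n := n) hlam hx
  obtain ⟨t, ht0, hts, hrate⟩ := exists_clock om hℓ hx t₀
  obtain ⟨b, ψ, hb, hψs, hψ0, hψb, hmaps, hmapsI, hψd⟩ := exists_reparametrization hℓ
    (f := fun s => lam (γ s) / k) (hlx.div_const k) (fun s _ => div_pos (hpos _) hk)
  have hJ := uniqueDiffOn_Icc hb
  have h0 : (0 : ℝ) ∈ Icc 0 b := ⟨le_rfl, hb.le⟩
  have hnb : (Icc 0 b).Nontrivial := ⟨0, h0, b, ⟨hb.le, le_rfl⟩, hb.ne⟩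
  set Λ : ℝ → ℝ × N := fun τ => (t τ, γ τ) with hΛ
  have hψ' : ∀ σ ∈ Icc 0 b, derivWithin ψ (Icc 0 b) σ = k / lam (γ (ψ σ)) := fun σ hσ => by
    rw [(hψd σ hσ).derivWithin (hJ σ hσ), inv_div]
  have hrate' : ∀ σ ∈ Icc 0 b, clockRate om (fun τ => Λ (ψ τ)) (Icc 0 b) σ
      = k / lam (γ (ψ σ)) := fun σ hσ => by
    rw [clockRate_comp (Γ := Λ) hts hx hψs hmaps hJ hσ, hrate _ (hmaps hσ), mul_one, hψ' σ hσ]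
  have hvel : ∀ σ ∈ Icc 0 b, velE n (fun τ => γ (ψ τ)) (Icc 0 b) σ
      = (k / lam (γ (ψ σ))) • velE n γ (Icc 0 ℓ) (ψ σ) := fun σ hσ => by
    rw [velE_comp (hx _ (hmaps hσ)) (hψs σ hσ) hmaps (hJ σ hσ), hψ' σ hσ]
  refine ⟨b, ψ, fun τ => Λ (ψ τ), hb, hψ0, hψb, hmapsI, rfl,
    (isLightlikeGeodesicOn_st_iff hlam hpos ordConnected_Icc hnb).2
      ⟨hts.comp hψs hmaps, hx.comp (contMDiffOn_iff_contDiffOn.2 hψs) hmaps, k, hk.ne',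
        fun σ hσ => ⟨?_, ?_, ?_⟩⟩, ?_, ?_, fun σ hσ => ⟨hrate' σ hσ, ?_⟩⟩
  · rw [hrate' σ hσ]
    exact mul_div_cancel₀ k (hpos _).ne'
  · rw [hrate' σ hσ]
    have h1 := hNorm_comp (h := h) (hx _ (hmaps hσ)) (hψs σ hσ) hmaps (hJ σ hσ)
    rw [hγ.2 _ (hmaps hσ), mul_one, hψ' σ hσ] at h1
    exact h1
  · have h1 := HasCovAccel.comp (h := h) hx hψs hmaps hJℓ hJ hσ rfl
      (a := (1 : ℝ) • lorentzE h om (γ (ψ σ)) (velE n γ (Icc 0 ℓ) (ψ σ))) (hγ.1.2 _ (hmaps hσ))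
    have hd := (((hlx _ (hmaps hσ)).differentiableWithinAt (by simp)).hasDerivWithinAt.scomp σ
      ((hψs σ hσ).differentiableWithinAt (by simp)).hasDerivWithinAt hmaps)
    have hd' : derivWithin (fun τ => lam (γ (ψ τ))) (Icc 0 b) σ
        = k / lam (γ (ψ σ)) * derivWithin (fun τ => lam (γ τ)) (Icc 0 ℓ) (ψ σ) := by
      rw [← hψ' σ hσ]
      exact hd.derivWithin (hJ σ hσ)
    have hψ'' : derivWithin (derivWithin ψ (Icc 0 b)) (Icc 0 b) σ
        = -(derivWithin (fun τ => lam (γ (ψ τ))) (Icc 0 b) σ / lam (γ (ψ σ)))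
          * (k / lam (γ (ψ σ))) := by
      rw [derivWithin_congr hψ' (hψ' σ hσ)]
      have h2 := (hasDerivWithinAt_const σ (Icc 0 b) k).div
        (hd.differentiableWithinAt.hasDerivWithinAt) (hpos _).ne'
      refine (h2.derivWithin (hJ σ hσ)).trans ?_
      have h3 := (hpos (γ (ψ σ))).ne'
      simp only [Function.comp_def]
      field_simp
      ring
    have h3 : derivWithin ψ (Icc 0 b) σ ^ 2 • (1 : ℝ) • lorentzE h om (γ (ψ σ))
          (velE n γ (Icc 0 ℓ) (ψ σ))
        + derivWithin (derivWithin ψ (Icc 0 b)) (Icc 0 b) σ • velE n γ (Icc 0 ℓ) (ψ σ)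
        = (k / lam (γ (ψ σ))) • lorentzE h om (γ (ψ σ)) (velE n (fun τ => γ (ψ τ)) (Icc 0 b) σ)
          - (derivWithin (fun τ => lam (γ (ψ τ))) (Icc 0 b) σ / lam (γ (ψ σ)))
            • velE n (fun τ => γ (ψ τ)) (Icc 0 b) σ := by
      rw [hvel σ hσ, lorentzE_smul, hψ'', hψ' σ hσ, one_smul, smul_smul, smul_smul, sq, neg_mul,
        neg_smul, sub_eq_add_neg]
    have h4 : (show TangentSpace (𝓡∂ n) (γ (ψ σ)) from _) = _ := h3
    rw [hrate' σ hσ]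
    exact h4 ▸ h1
  · change t (ψ 0) = t₀
    rw [hψ0, ht0]
  · have h1 := time_add_lineIntegral (Γ := Λ) hts ordConnected_Icc hnℓ hrate h0ℓ ⟨hℓ.le, le_rfl⟩
    change t (ψ b) = _
    have h2 : lineIntegral om γ (Icc 0 ℓ) 0 ℓ = 1 * (ℓ - 0) - (t ℓ - t 0) := h1
    rw [hψb, h2, ht0]
    ring
  · rw [hrate' σ hσ]
    exact hvel σ hσ

end ScatteringCorrespondence

noncomputable section ScatteringReduction

variable {n : ℕ} [NeZero n] {N : Type*} [TopologicalSpace N] [T2Space N]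
  [ChartedSpace (EuclideanHalfSpace n) N] [IsManifold (𝓡∂ n) ∞ N]

local notation "𝔼" => EuclideanSpace ℝ (Fin n)

variable {lam : N → ℝ} {om : SmoothOneForm (𝓡∂ n) N} {h : RMetric n N}

theorem exists_isBdryProj_iff {x : N} (v : 𝔼) (X : TangentBundle (𝓡∂ n) N) :
    (∃ v', IsBdryProj h (x := x) v v' ∧ X = ⟨x, v'⟩) ↔
      X.proj = x ∧ IsBdryProj h (x := x) v (show 𝔼 from X.snd) := by
  constructor
  · rintro ⟨v', h1, rfl⟩
    exact ⟨rfl, h1⟩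
  · rintro ⟨rfl, h1⟩
    exact ⟨X.snd, h1, rfl⟩

theorem exists_isLateralProj_iff (hpos : ∀ x, 0 < lam x) {p : ℝ × N}
    (v : TangentSpace (stModel n) p) (P : TangentBundle (stModel n) (ℝ × N)) :
    (∃ v', IsLateralProj (stationaryMetric lam om h) v v' ∧ P = ⟨p, v'⟩) ↔
      P.proj = p ∧ timePart om h P = dtPlus om p v ∧
        IsBdryProj h (x := p.2) (dSpace p v) (show 𝔼 from (spacePart P).snd) := by
  constructor
  · rintro ⟨v', h1, rfl⟩
    obtain ⟨h2, h3⟩ := (isLateralProj_iff hpos om h).1 h1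
    exact ⟨rfl, (timePart_eq om h _).trans h2.symm, h3⟩
  · rintro ⟨rfl, h1, h2⟩
    exact ⟨P.snd, (isLateralProj_iff hpos om h).2 ⟨h1.symm.trans (timePart_eq om h _), h2⟩, rfl⟩

theorem isMagneticChord_iff {ℓ : ℝ} {γ : ℝ → N} {X Y : TangentBundle (𝓡∂ n) N} :
    IsMagneticChord h om ℓ γ X Y ↔
      0 < ℓ ∧ IsUnitMagneticGeodesicOn h om γ (Icc 0 ℓ) ∧
      γ 0 ∈ (𝓡∂ n).boundary N ∧ γ ℓ ∈ (𝓡∂ n).boundary N ∧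
      (∀ σ ∈ Ioo 0 ℓ, γ σ ∈ (𝓡∂ n).interior N) ∧
      0 < velE n γ (Icc 0 ℓ) 0 0 ∧
      (X.proj = γ 0 ∧ IsBdryProj h (x := γ 0) (velE n γ (Icc 0 ℓ) 0) (show 𝔼 from X.snd)) ∧
      (Y.proj = γ ℓ ∧ IsBdryProj h (x := γ ℓ) (velE n γ (Icc 0 ℓ) ℓ) (show 𝔼 from Y.snd)) := by
  unfold IsMagneticChord
  rw [bdryComp_eq]
  exact and_congr_right fun _ => and_congr_right fun _ => and_congr_right fun _ =>
    and_congr_right fun _ => and_congr_right fun _ => and_congr_right fun _ =>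
    and_congr (exists_isBdryProj_iff _ _) (exists_isBdryProj_iff _ _)

theorem lorentzScattering_iff (hlam : ContMDiff (𝓡∂ n) 𝓘(ℝ, ℝ) ∞ lam) (hpos : ∀ x, 0 < lam x)
    {P Q : TangentBundle (stModel n) (ℝ × N)} :
    LorentzScattering (stationaryMetric lam om h) P Q ↔
      0 < timePart om h P ∧ lam Q.proj.2 * timePart om h Q = lam P.proj.2 * timePart om h P ∧
      ∃ ℓ γ, IsMagneticChord h om ℓ γ (scaleVec (timePart om h P)⁻¹ (spacePart P))
          (scaleVec (timePart om h Q)⁻¹ (spacePart Q)) ∧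
        Q.proj.1 - P.proj.1 = ℓ - lineIntegral om γ (Icc 0 ℓ) 0 ℓ := by
  constructor
  · rintro ⟨b, Γ, hb, hΓ, hfut, hΓ0, hΓb, hint, hin, hP, hQ⟩
    have hJb := uniqueDiffOn_Icc hb
    have h0b : (0 : ℝ) ∈ Icc 0 b := ⟨le_rfl, hb.le⟩
    have hbb : b ∈ Icc 0 b := ⟨hb.le, le_rfl⟩
    have hf0 := (isFuturePointing_velocity_iff hpos hΓ.1.1 hJb h0b).1 (hfut 0 h0b)
    obtain ⟨hP1, hP2, hP3⟩ := (exists_isLateralProj_iff hpos _ P).1 hP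
    obtain ⟨hQ1, hQ2, hQ3⟩ := (exists_isLateralProj_iff hpos _ Q).1 hQ
    rw [dtPlus_velocity (hΓ.1.1 _ h0b) (hJb _ h0b)] at hP2
    rw [dtPlus_velocity (hΓ.1.1 _ hbb) (hJb _ hbb)] at hQ2
    have hd0 := dSpace_velocity (hΓ.1.1 _ h0b) (hJb _ h0b)
    have hdb := dSpace_velocity (hΓ.1.1 _ hbb) (hJb _ hbb)
    obtain ⟨ℓ, ψ, hℓ, hψ0, hψℓ, hmaps, hγ, H, hI⟩ :=
      exists_unit_reparametrization hlam hpos hb hΓ hf0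
    have h0ℓ : (0 : ℝ) ∈ Icc 0 ℓ := ⟨le_rfl, hℓ.le⟩
    have hℓℓ : ℓ ∈ Icc 0 ℓ := ⟨hℓ.le, le_rfl⟩
    obtain ⟨-, -, H0⟩ := H 0 h0ℓ
    obtain ⟨hθb, hlb, Hb⟩ := H ℓ hℓℓ
    rw [hψ0] at H0
    rw [hψℓ] at hθb hlb Hb
    have e0 : (Γ 0).2 = spaceCurve Γ (ψ 0) := by rw [hψ0]; rfl
    have eb : (Γ b).2 = spaceCurve Γ (ψ ℓ) := by rw [hψℓ]; rfl
    refine ⟨hP2 ▸ hf0, ?_, ℓ, _, isMagneticChord_iff.2 ⟨hℓ, hγ, e0 ▸ hΓ0, eb ▸ hΓb,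
      fun σ hσ => hint _ (hmaps hσ), ?_, ⟨?_, ?_⟩, ?_, ?_⟩, ?_⟩
    · rw [hP1, hQ1, hP2, hQ2]
      exact hlb
    · rw [H0]
      rw [bdryComp_eq] at hin
      exact mul_pos (inv_pos.2 hf0) (lt_of_lt_of_eq hin (congrArg (fun w : 𝔼 => w 0) hd0))
    · exact (congrArg Prod.snd hP1).trans e0
    · rw [H0]
      refine (isBdryProj_congr_point h e0 _ _).1 ?_
      have h1 := hP3.smul (clockRate om Γ (Icc 0 b) 0)⁻¹
      rw [hd0] at h1
      rw [hP2]
      exact h1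
    · exact (congrArg Prod.snd hQ1).trans eb
    · rw [Hb]
      refine (isBdryProj_congr_point h eb _ _).1 ?_
      have h1 := hQ3.smul (clockRate om Γ (Icc 0 b) b)⁻¹
      rw [hdb] at h1
      rw [hQ2]
      exact h1
    · rw [hI, hP1, hQ1]
      simp only [timeCurve]
      ring
  · rintro ⟨hP0, hlPQ, ℓ, γ, hch, hT⟩
    obtain ⟨hℓ, hγ, hγ0, hγℓ, hint, hin, ⟨hX1, hX2⟩, hY1, hY2⟩ := isMagneticChord_iff.1 hch
    have hX1 : P.proj.2 = γ 0 := hX1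
    have hY1 : Q.proj.2 = γ ℓ := hY1
    have hX2 : IsBdryProj h (x := γ 0) (velE n γ (Icc 0 ℓ) 0)
      ((timePart om h P)⁻¹ • (show 𝔼 from (spacePart P).snd)) := hX2
    have hY2 : IsBdryProj h (x := γ ℓ) (velE n γ (Icc 0 ℓ) ℓ)
      ((timePart om h Q)⁻¹ • (show 𝔼 from (spacePart Q).snd)) := hY2
    set k := lam P.proj.2 * timePart om h P with hk
    have hkpos : 0 < k := mul_pos (hpos _) hP0
    have hQ0 : 0 < timePart om h Q := by
      by_contra hc
      push Not at hc
      have := mul_nonpos_of_nonneg_of_nonpos (hpos Q.proj.2).le hc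
      linarith
    obtain ⟨b, ψ, Γ, hb, hψ0, hψb, hmaps, hsp, hΓ, ht0, htb, H⟩ :=
      exists_lightlike_lift hlam hpos hℓ hγ P.proj.1 hkpos
    have hJb := uniqueDiffOn_Icc hb
    have h0b : (0 : ℝ) ∈ Icc 0 b := ⟨le_rfl, hb.le⟩
    have hbb : b ∈ Icc 0 b := ⟨hb.le, le_rfl⟩
    have hd0 := dSpace_velocity (hΓ.1.1 _ h0b) (hJb _ h0b)
    have hdb := dSpace_velocity (hΓ.1.1 _ hbb) (hJb _ hbb)
    obtain ⟨hc0, hv0⟩ := H 0 h0b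
    obtain ⟨hcb, hvb⟩ := H b hbb
    rw [hψ0] at hc0 hv0
    rw [hψb] at hcb hvb
    have hc0' : clockRate om Γ (Icc 0 b) 0 = timePart om h P := by
      rw [hc0, ← hX1, hk]; exact mul_div_cancel_left₀ _ (hpos _).ne'
    have hcb' : clockRate om Γ (Icc 0 b) b = timePart om h Q := by
      rw [hcb, ← hY1, ← hlPQ]; exact mul_div_cancel_left₀ _ (hpos _).ne'
    have hs : ∀ σ, (Γ σ).2 = γ (ψ σ) := fun σ => congrFun hsp σ
    have e0 : (Γ 0).2 = γ 0 := by rw [hs, hψ0]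
    have eb : (Γ b).2 = γ ℓ := by rw [hs, hψb]
    refine ⟨b, Γ, hb, hΓ, fun σ hσ => ?_, e0 ▸ hγ0, eb ▸ hγℓ,
      fun σ hσ => (hs σ) ▸ hint _ (hmaps hσ), ?_, (exists_isLateralProj_iff hpos _ P).2 ⟨?_, ?_, ?_⟩,
      (exists_isLateralProj_iff hpos _ Q).2 ⟨?_, ?_, ?_⟩⟩
    · refine (isFuturePointing_velocity_iff hpos hΓ.1.1 hJb hσ).2 ?_
      rw [(H σ hσ).1]
      exact div_pos hkpos (hpos _)
    · rw [bdryComp_eq]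
      refine lt_of_lt_of_eq (mul_pos hP0 hin) ?_
      rw [← hc0']
      exact congrArg (fun w : 𝔼 => w 0) (hd0.trans hv0).symm
    · exact Prod.ext ht0.symm (hX1.trans e0.symm)
    · rw [dtPlus_velocity (hΓ.1.1 _ h0b) (hJb _ h0b), hc0']
    · rw [hd0]
      refine (isBdryProj_congr_point h e0 (velE n (spaceCurve Γ) (Icc 0 b) 0) _).2 ?_
      rw [hv0, hc0']
      have h1 := hX2.smul (timePart om h P)
      have h2 : timePart om h P • (timePart om h P)⁻¹ • (show 𝔼 from (spacePart P).snd)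
        = (show 𝔼 from (spacePart P).snd) := smul_inv_smul₀ hP0.ne' _
      rw [← h2]
      exact h1
    · exact Prod.ext (by linarith [show (Γ b).1 = _ from htb]) (hY1.trans eb.symm)
    · rw [dtPlus_velocity (hΓ.1.1 _ hbb) (hJb _ hbb), hcb']
    · rw [hdb]
      refine (isBdryProj_congr_point h eb (velE n (spaceCurve Γ) (Icc 0 b) b) _).2 ?_
      rw [hvb, hcb']
      have h1 := hY2.smul (timePart om h Q)
      have h2 : timePart om h Q • (timePart om h Q)⁻¹ • (show 𝔼 from (spacePart Q).snd)
        = (show 𝔼 from (spacePart Q).snd) := smul_inv_smul₀ hQ0.ne' _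
      rw [← h2]
      exact h1

end ScatteringReduction

noncomputable section Chords

variable {n : ℕ} [NeZero n] {N : Type*} [TopologicalSpace N] [T2Space N]
  [ChartedSpace (EuclideanHalfSpace n) N] [IsManifold (𝓡∂ n) ∞ N]

local notation "𝔼" => EuclideanSpace ℝ (Fin n)

variable {om : SmoothOneForm (𝓡∂ n) N} {h : RMetric n N}

/-- The metric at `x` in the preferred chart at `x`. -/
def innerE (h : RMetric n N) (x : N) : EuclideanSpace ℝ (Fin n) →L[ℝ]
    EuclideanSpace ℝ (Fin n) →L[ℝ] ℝ := h.inner x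

/-- The one-form at `x` in the preferred chart at `x`. -/
def formE (om : SmoothOneForm (𝓡∂ n) N) (x : N) : EuclideanSpace ℝ (Fin n) →L[ℝ] ℝ := om.form x

theorem innerE_symm (h : RMetric n N) (x : N) (u v : 𝔼) : innerE h x u v = innerE h x v u :=
  h.symm x u v

theorem innerE_pos (h : RMetric n N) (x : N) {u : 𝔼} (hu : u ≠ 0) : 0 < innerE h x u u :=
  h.pos x u hu

theorem eq_zero_of_innerE_self {h : RMetric n N} {x : N} {u : 𝔼} (hu : innerE h x u u = 0) :
    u = 0 := by
  by_contra hne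
  exact (innerE_pos h x hne).ne' hu

/-- The length of a tangent vector at `x` given by its components in the preferred chart. -/
def normE (h : RMetric n N) (x : N) (u : EuclideanSpace ℝ (Fin n)) : ℝ := hNorm h (x := x) u

theorem normE_sq (h : RMetric n N) (x : N) (u : 𝔼) : normE h x u ^ 2 = innerE h x u u :=
  hNorm_sq h _

theorem normE_nonneg (h : RMetric n N) (x : N) (u : 𝔼) : 0 ≤ normE h x u := hNorm_nonneg h _

theorem normE_smul (h : RMetric n N) (x : N) (c : ℝ) (u : 𝔼) :
    normE h x (c • u) = |c| * normE h x u :=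
  hNorm_smul h c _

theorem normE_pos (h : RMetric n N) (x : N) {u : 𝔼} (hu : u ≠ 0) : 0 < normE h x u := by
  have h1 := innerE_pos h x hu
  rw [← normE_sq] at h1
  exact lt_of_le_of_ne (normE_nonneg h x u) fun h2 => by rw [← h2] at h1; simp at h1

theorem normE_zero (h : RMetric n N) (x : N) : normE h x 0 = 0 := by
  have := normE_smul h x 0 0
  simpa using this

theorem isBdryProj_iff {x : N} {v v' : 𝔼} : IsBdryProj h (x := x) v v' ↔
    v' 0 = 0 ∧ ∀ u : 𝔼, u 0 = 0 → innerE h x (v - v') u = 0 := by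
  constructor
  · rintro ⟨h1, h2⟩
    exact ⟨(bdryComp_eq _).symm.trans h1, fun u hu => h2 u ((bdryComp_eq _).trans hu)⟩
  · rintro ⟨h1, h2⟩
    exact ⟨(bdryComp_eq _).trans h1, fun u hu => h2 u ((bdryComp_eq _).symm.trans hu)⟩

theorem boundary_not_interior {x : N} (hx : x ∈ (𝓡∂ n).boundary N) : x ∉ (𝓡∂ n).interior N :=
  fun h => (ModelWithCorners.disjoint_interior_boundary (I := 𝓡∂ n) (M := N)).le_bot ⟨h, hx⟩

theorem isBdryProj_unique {x : N} {v v₁ v₂ : 𝔼} (h₁ : IsBdryProj h (x := x) v v₁)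
    (h₂ : IsBdryProj h (x := x) v v₂) : v₁ = v₂ := by
  obtain ⟨a₁, b₁⟩ := isBdryProj_iff.1 h₁
  obtain ⟨a₂, b₂⟩ := isBdryProj_iff.1 h₂
  have h0 : (v₁ - v₂) 0 = 0 := by simp [a₁, a₂]
  have h3 : innerE h x (v₁ - v₂) (v₁ - v₂) = 0 := by
    have e1 := b₁ _ h0
    have e2 := b₂ _ h0
    have e3 : innerE h x (v₁ - v₂) (v₁ - v₂) = innerE h x (v - v₂) (v₁ - v₂)
        - innerE h x (v - v₁) (v₁ - v₂) := by
      rw [← sub_apply, ← map_sub]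
      congr 2
      abel
    rw [e3, e1, e2, sub_zero]
  exact sub_eq_zero.1 (eq_zero_of_innerE_self h3)

/-- An inward vector is determined by its length and its boundary projection. -/
theorem eq_of_isBdryProj {x : N} {v w v' : 𝔼} (hv : 0 < v 0) (hw : 0 < w 0)
    (hvw : normE h x v = normE h x w) (h₁ : IsBdryProj h (x := x) v v')
    (h₂ : IsBdryProj h (x := x) w v') : v = w := by
  have b₁ := (isBdryProj_iff.1 h₁).2
  have b₂ := (isBdryProj_iff.1 h₂).2
  have hd : ∀ u : 𝔼, u 0 = 0 → innerE h x (v - w) u = 0 := fun u hu => by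
    have e3 : v - w = (v - v') - (w - v') := by abel
    rw [e3, map_sub, sub_apply, b₁ u hu, b₂ u hu, sub_zero]
  have hs : innerE h x (v - w) (v + w) = 0 := by
    have e1 : innerE h x v v = innerE h x w w := by rw [← normE_sq, ← normE_sq, hvw]
    rw [map_sub, sub_apply, map_add, map_add, e1, innerE_symm h x w v]
    ring
  have hpos : 0 < v 0 + w 0 := by linarith
  set c := (v 0 - w 0) / (v 0 + w 0) with hc
  have h3 := hd ((v - w) - c • (v + w)) (by
    simp only [PiLp.sub_apply, PiLp.smul_apply, PiLp.add_apply, smul_eq_mul, hc]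
    field_simp
    ring)
  rw [map_sub, map_smul, hs, smul_zero, sub_zero] at h3
  exact sub_eq_zero.1 (eq_zero_of_innerE_self h3)

theorem velE_congr {x y : ℝ → N} {J : Set ℝ} {t : ℝ} (ht : t ∈ J) (hxy : EqOn x y J) :
    velE n x J t = velE n y J t := by
  exact congrArg (fun L : ℝ →L[ℝ] 𝔼 => L 1)
    (mfderivWithin_congr (I := 𝓘(ℝ, ℝ)) (I' := 𝓡∂ n) (f₁ := x) (f := y) (s := J) (x := t)
      hxy (hxy ht))

theorem lineIntegral_congr {x y : ℝ → N} {a b c d : ℝ} (hxy : EqOn x y (Icc a b))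
    (hc : c ∈ Icc a b) (hd : d ∈ Icc a b) :
    lineIntegral om x (Icc a b) c d = lineIntegral om y (Icc a b) c d := by
  refine intervalIntegral.integral_congr fun t ht => ?_
  have ht' : t ∈ Icc a b := (uIcc_subset_Icc hc hd) ht
  change formE om (x t) (velE n x (Icc a b) t) = formE om (y t) (velE n y (Icc a b) t)
  rw [velE_congr ht' hxy, hxy ht']

theorem IsUnitMagneticGeodesicOn.mono_Icc {γ : ℝ → N} {ℓ ℓ' : ℝ} (hℓ : 0 < ℓ) (hle : ℓ ≤ ℓ')
    (hγ : IsUnitMagneticGeodesicOn h om γ (Icc 0 ℓ')) :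
    IsUnitMagneticGeodesicOn h om γ (Icc 0 ℓ) ∧
      ∀ s ∈ Icc 0 ℓ, velE n γ (Icc 0 ℓ) s = velE n γ (Icc 0 ℓ') s := by
  have hsub : Icc 0 ℓ ⊆ Icc 0 ℓ' := Icc_subset_Icc le_rfl hle
  refine ⟨isUnitMagneticGeodesicOn_iff.2 ((isUnitMagneticGeodesicOn_iff.1 hγ).mono
    (uniqueDiffOn_Icc (hℓ.trans_le hle)) (uniqueDiffOn_Icc hℓ) hsub), fun s hs => ?_⟩
  exact velocity_mono ((hγ.1.1 s (hsub hs)).mdifferentiableWithinAt (by simp))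
    (uniqueDiffOn_Icc hℓ s hs) hsub

theorem IsUnitMagneticGeodesicOn.eqOn {γ γ' : ℝ → N} {ℓ ℓ' : ℝ} (hℓ : 0 < ℓ) (hle : ℓ ≤ ℓ')
    (hγ : IsUnitMagneticGeodesicOn h om γ (Icc 0 ℓ))
    (hγ' : IsUnitMagneticGeodesicOn h om γ' (Icc 0 ℓ')) (h0 : γ 0 = γ' 0)
    (hv : velE n γ (Icc 0 ℓ) 0 = velE n γ' (Icc 0 ℓ') 0) : EqOn γ γ' (Icc 0 ℓ) := by
  obtain ⟨h1, h2⟩ := hγ'.mono_Icc hℓ hle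
  exact (isUnitMagneticGeodesicOn_iff.1 hγ).unique hℓ (isUnitMagneticGeodesicOn_iff.1 h1) h0
    (hv.trans (h2 0 ⟨le_rfl, hℓ.le⟩).symm)

theorem IsMagneticChord.velE_zero_eq {ℓ ℓ' : ℝ} {γ γ' : ℝ → N} {X Y Y' : TangentBundle (𝓡∂ n) N}
    (H : IsMagneticChord h om ℓ γ X Y) (H' : IsMagneticChord h om ℓ' γ' X Y') :
    γ 0 = γ' 0 ∧ velE n γ (Icc 0 ℓ) 0 = velE n γ' (Icc 0 ℓ') 0 := by
  obtain ⟨hℓ, hγ, -, -, -, hin, ⟨hX1, hX2⟩, -⟩ := isMagneticChord_iff.1 H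
  obtain ⟨hℓ', hγ', -, -, -, hin', ⟨hX1', hX2'⟩, -⟩ := isMagneticChord_iff.1 H'
  have e : γ 0 = γ' 0 := hX1.symm.trans hX1'
  refine ⟨e, eq_of_isBdryProj (h := h) (x := γ 0) hin hin' ?_ hX2
    ((isBdryProj_congr_point h e _ _).2 hX2')⟩
  rw [show normE h (γ 0) (velE n γ (Icc 0 ℓ) 0) = 1 from hγ.2 0 ⟨le_rfl, hℓ.le⟩, e]
  exact (hγ'.2 0 ⟨le_rfl, hℓ'.le⟩).symm

theorem IsMagneticChord.le_length {ℓ ℓ' : ℝ} {γ γ' : ℝ → N} {X Y Y' : TangentBundle (𝓡∂ n) N}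
    (H : IsMagneticChord h om ℓ γ X Y) (H' : IsMagneticChord h om ℓ' γ' X Y') : ℓ' ≤ ℓ := by
  obtain ⟨h0, hv⟩ := H.velE_zero_eq H'
  by_contra hlt
  push Not at hlt
  have h1 := IsUnitMagneticGeodesicOn.eqOn H.1 hlt.le H.2.1 H'.2.1 h0 hv ⟨H.1.le, le_rfl⟩
  exact boundary_not_interior H.2.2.2.1 (h1 ▸ H'.2.2.2.2.1 ℓ ⟨H.1, hlt⟩)

theorem IsMagneticChord.unique {ℓ ℓ' : ℝ} {γ γ' : ℝ → N} {X Y Y' : TangentBundle (𝓡∂ n) N}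
    (H : IsMagneticChord h om ℓ γ X Y) (H' : IsMagneticChord h om ℓ' γ' X Y') :
    ℓ = ℓ' ∧ EqOn γ γ' (Icc 0 ℓ) ∧ Y = Y' := by
  obtain rfl : ℓ = ℓ' := le_antisymm (H'.le_length H) (H.le_length H')
  obtain ⟨h0, hv⟩ := H.velE_zero_eq H'
  have he := IsUnitMagneticGeodesicOn.eqOn H.1 le_rfl H.2.1 H'.2.1 h0 hv
  have hℓ : ℓ ∈ Icc 0 ℓ := ⟨H.1.le, le_rfl⟩
  refine ⟨rfl, he, ?_⟩
  obtain ⟨-, -, -, -, -, -, -, hY1, hY2⟩ := isMagneticChord_iff.1 H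
  obtain ⟨-, -, -, -, -, -, -, hY1', hY2'⟩ := isMagneticChord_iff.1 H'
  refine tangentBundle_ext (hY1.trans ((he hℓ).trans hY1'.symm)) ?_
  rw [← velE_congr hℓ he] at hY2'
  exact isBdryProj_unique hY2 ((isBdryProj_congr_point h (he hℓ) _ _).2 hY2')

theorem magneticTravelTime_eq {ℓ : ℝ} {γ : ℝ → N} {X Y : TangentBundle (𝓡∂ n) N}
    (H : IsMagneticChord h om ℓ γ X Y) : magneticTravelTime h om X = ℓ := by
  have : {ℓ | ∃ γ Y, IsMagneticChord h om ℓ γ X Y} = {ℓ} := by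
    ext ℓ'
    exact ⟨fun ⟨γ', Y', H'⟩ => (H'.unique H).1, fun e => ⟨γ, Y, by rw [e]; exact H⟩⟩
  unfold magneticTravelTime
  rw [this, csInf_singleton]

theorem IsMagneticChord.isMagneticAction {ℓ : ℝ} {γ : ℝ → N} {X Y : TangentBundle (𝓡∂ n) N}
    (H : IsMagneticChord h om ℓ γ X Y) :
    IsMagneticAction h om X.proj Y.proj (ℓ - lineIntegral om γ (Icc 0 ℓ) 0 ℓ) := by
  obtain ⟨hℓ, hγ, -, -, -, -, ⟨hX1, -⟩, hY1, -⟩ := isMagneticChord_iff.1 H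
  exact Or.inr ⟨ℓ, γ, hℓ, hγ, hX1.symm, hY1.symm, rfl⟩

/-! ### The inverse of the magnetic exponential map -/

/-- The inverse of the magnetic exponential map at `x`. -/
def mlog (h : RMetric n N) (om : SmoothOneForm (𝓡∂ n) N) (x y : N) : EuclideanSpace ℝ (Fin n) :=
  Classical.epsilon fun u : EuclideanSpace ℝ (Fin n) => IsMagneticExp h om ⟨x, u⟩ y

theorem MagneticExpIsDiffeo.exists_inverse {x : N} (H : MagneticExpIsDiffeo h om x) :
    ∃ e : 𝔼 → N, (∀ (u : 𝔼) (y : N), IsMagneticExp h om ⟨x, u⟩ y ↔ u = mlog h om x y) ∧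
      (∀ y, e (mlog h om x y) = y) ∧
      ContMDiffOn 𝓘(ℝ, 𝔼) (𝓡∂ n) 1 e (range (mlog h om x)) ∧
      ContMDiffOn 𝓘(ℝ, 𝔼) (𝓡∂ n) ∞ e (range (mlog h om x) \ {0}) ∧
      ContMDiff (𝓡∂ n) 𝓘(ℝ, 𝔼) 1 (mlog h om x) ∧
      ContMDiffOn (𝓡∂ n) 𝓘(ℝ, 𝔼) ∞ (mlog h om x) {x}ᶜ := by
  obtain ⟨e, l, h1, h2, h3, h4, h5, h6, h7⟩ := H
  have hc : ∀ u : 𝔼, chartVec (𝓡∂ n) x u = u := fun u => chartVec_apply x u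
  have key : ∀ (u : 𝔼) (y : N), IsMagneticExp h om ⟨x, u⟩ y ↔ u = l y := by
    intro u y
    rw [h1 u y, hc]
    constructor
    · rintro ⟨hu, rfl⟩
      exact (h2 u hu).symm
    · rintro rfl
      exact h3 y
  have hl : mlog h om x = l := by
    funext y
    exact (key _ y).1 (Classical.epsilon_spec (p := fun u : 𝔼 => IsMagneticExp h om ⟨x, u⟩ y)
      ⟨l y, (key _ y).2 rfl⟩)
  have hD : magneticExpDomain h om x = range l :=
    Set.ext fun w => ⟨fun hw => ⟨e w, h2 w hw⟩, fun ⟨y, hy⟩ => hy ▸ (h3 y).1⟩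
  rw [hD] at h4 h5
  rw [hl]
  exact ⟨e, key, fun y => (h3 y).2, h4, h5, h6, h7⟩

end Chords

noncomputable section MagneticSegments

variable {n : ℕ} [NeZero n] {N : Type*} [TopologicalSpace N] [T2Space N]
  [ChartedSpace (EuclideanHalfSpace n) N] [IsManifold (𝓡∂ n) ∞ N]

local notation "𝔼" => EuclideanSpace ℝ (Fin n)

variable {om : SmoothOneForm (𝓡∂ n) N} {h : RMetric n N}

theorem MagneticExpIsDiffeo.mlog_eq_of_unit {x y : N} (H : MagneticExpIsDiffeo h om x) {ℓ : ℝ}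
    {γ : ℝ → N} (hℓ : 0 < ℓ) (hγ : IsUnitMagneticGeodesicOn h om γ (Icc 0 ℓ)) (h0 : γ 0 = x)
    (h1 : γ ℓ = y) : ℓ • velE n γ (Icc 0 ℓ) 0 = mlog h om x y := by
  obtain ⟨e, he, -⟩ := H.exists_inverse
  subst h0
  exact (he _ _).1 (Or.inr ⟨ℓ, γ, hℓ, hγ, rfl, h1⟩)

theorem MagneticExpIsDiffeo.mlog_self {x : N} (H : MagneticExpIsDiffeo h om x) :
    mlog h om x x = 0 := by
  obtain ⟨e, he, -⟩ := H.exists_inverse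
  exact ((he 0 x).1 (Or.inl rfl)).symm

theorem MagneticExpIsDiffeo.mlog_injective {x : N} (H : MagneticExpIsDiffeo h om x) :
    Function.Injective (mlog h om x) := by
  obtain ⟨e, -, he, -⟩ := H.exists_inverse
  exact Function.LeftInverse.injective he

theorem MagneticExpIsDiffeo.mlog_ne_zero {x y : N} (H : MagneticExpIsDiffeo h om x)
    (hxy : x ≠ y) : mlog h om x y ≠ 0 := fun h0 =>
  hxy (H.mlog_injective (H.mlog_self.trans h0.symm))

theorem MagneticExpIsDiffeo.exists_unit {x y : N} (H : MagneticExpIsDiffeo h om x) (hxy : x ≠ y) :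
    ∃ (ℓ : ℝ) (γ : ℝ → N), 0 < ℓ ∧ IsUnitMagneticGeodesicOn h om γ (Icc 0 ℓ) ∧ γ 0 = x ∧
      γ ℓ = y ∧ ℓ • velE n γ (Icc 0 ℓ) 0 = mlog h om x y := by
  obtain ⟨e, he, -⟩ := H.exists_inverse
  rcases (he _ y).2 rfl with h1 | ⟨ℓ, γ, hℓ, hγ, h1, h2⟩
  · exact absurd (congrArg TotalSpace.proj h1) hxy
  · have h3 : x = γ 0 := congrArg TotalSpace.proj h1
    exact ⟨ℓ, γ, hℓ, hγ, h3.symm, h2, H.mlog_eq_of_unit hℓ hγ h3.symm h2⟩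

theorem MagneticExpIsDiffeo.isMagneticAction_unique {x y : N} (H : MagneticExpIsDiffeo h om x)
    {a b : ℝ} (ha : IsMagneticAction h om x y a) (hb : IsMagneticAction h om x y b) : a = b := by
  have hne : ∀ {ℓ : ℝ} {γ : ℝ → N}, 0 < ℓ → IsUnitMagneticGeodesicOn h om γ (Icc 0 ℓ) →
      γ 0 = x → γ ℓ = y → x ≠ y := by
    rintro ℓ γ hℓ hγ h0 h1 rfl
    have h2 := H.mlog_eq_of_unit hℓ hγ h0 h1
    rw [H.mlog_self] at h2
    have h3 : normE h (γ 0) (velE n γ (Icc 0 ℓ) 0) = 1 := hγ.2 0 ⟨le_rfl, hℓ.le⟩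
    rw [(smul_eq_zero.1 h2).resolve_left hℓ.ne', normE_zero] at h3
    exact zero_ne_one h3
  rcases ha with ⟨hxy, rfl⟩ | ⟨ℓ, γ, hℓ, hγ, h0, h1, rfl⟩
  · rcases hb with ⟨-, rfl⟩ | ⟨ℓ, γ, hℓ, hγ, h0, h1, rfl⟩
    · rfl
    · exact absurd hxy (hne hℓ hγ h0 h1)
  · rcases hb with ⟨hxy, rfl⟩ | ⟨ℓ', γ', hℓ', hγ', h0', h1', rfl⟩
    · exact absurd hxy (hne hℓ hγ h0 h1)
    · have h2 := (H.mlog_eq_of_unit hℓ hγ h0 h1).trans (H.mlog_eq_of_unit hℓ' hγ' h0' h1').symm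
      have h3 : normE h x (velE n γ (Icc 0 ℓ) 0) = 1 := by
        rw [← h0]; exact hγ.2 0 ⟨le_rfl, hℓ.le⟩
      have h4 : normE h x (velE n γ' (Icc 0 ℓ') 0) = 1 := by
        rw [← h0']; exact hγ'.2 0 ⟨le_rfl, hℓ'.le⟩
      obtain rfl : ℓ = ℓ' := by
        have h5 := congrArg (normE h x) h2
        rwa [normE_smul, normE_smul, h3, h4, mul_one, mul_one, abs_of_pos hℓ, abs_of_pos hℓ'] at h5
      have h6 := smul_right_injective 𝔼 hℓ.ne' h2
      have he := IsUnitMagneticGeodesicOn.eqOn hℓ le_rfl hγ hγ' (h0.trans h0'.symm) h6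
      rw [lineIntegral_congr he ⟨le_rfl, hℓ.le⟩ ⟨hℓ.le, le_rfl⟩]

theorem MagneticExpIsDiffeo.magneticAction_eq {x y : N} (H : MagneticExpIsDiffeo h om x) {a : ℝ}
    (ha : IsMagneticAction h om x y a) : magneticAction h om x y = a := by
  have : {a | IsMagneticAction h om x y a} = {a} :=
    Set.ext fun b => ⟨fun hb => H.isMagneticAction_unique hb ha, fun hb => hb ▸ ha⟩
  unfold magneticAction
  rw [this, csInf_singleton]

theorem MagneticExpIsDiffeo.magneticAction_self {x : N} (H : MagneticExpIsDiffeo h om x) :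
    magneticAction h om x x = 0 :=
  H.magneticAction_eq (Or.inl ⟨rfl, rfl⟩)

theorem lightlike_scattering_projects {lam : N → ℝ} (hlam : ContMDiff (𝓡∂ n) 𝓘(ℝ, ℝ) ∞ lam)
    (hpos : ∀ x, 0 < lam x) {P Q : TangentBundle (stModel n) (ℝ × N)}
    (hPQ : LorentzScattering (stationaryMetric lam om h) P Q) (hP : timePart om h P = 1) :
    lam Q.proj.2 * timePart om h Q = lam P.proj.2 ∧
    MagneticScattering h om (spacePart P) (scaleVec (timePart om h Q)⁻¹ (spacePart Q)) ∧
    (∀ (ℓ : ℝ) (γ : ℝ → N) (Y : TangentBundle (𝓡∂ n) N),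
      IsMagneticChord h om ℓ γ (spacePart P) Y →
        magneticTravelTime h om (spacePart P) = ℓ ∧
        ℓ = Q.proj.1 - P.proj.1 + lineIntegral om γ (Icc 0 ℓ) 0 ℓ) ∧
    IsMagneticAction h om P.proj.2 Q.proj.2 (Q.proj.1 - P.proj.1) ∧
    (IsSimpleMagnetic h om → magneticAction h om P.proj.2 Q.proj.2 = Q.proj.1 - P.proj.1) := by
  obtain ⟨-, h2, ℓ, γ, hch, hT⟩ := (lorentzScattering_iff hlam hpos).1 hPQ
  have hX : scaleVec (timePart om h P)⁻¹ (spacePart P) = spacePart P := by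
    rw [hP, inv_one]
    exact tangentBundle_ext rfl (one_smul ℝ (show 𝔼 from (spacePart P).snd))
  rw [hX] at hch
  rw [hP, mul_one] at h2
  have hA : IsMagneticAction h om P.proj.2 Q.proj.2 (Q.proj.1 - P.proj.1) := by
    rw [hT]
    exact hch.isMagneticAction
  refine ⟨h2, ⟨ℓ, γ, hch⟩, fun ℓ' γ' Y' H' => ⟨magneticTravelTime_eq H', ?_⟩, hA,
    fun hs => (hs.1 _).magneticAction_eq hA⟩
  obtain ⟨rfl, he, -⟩ := H'.unique hch
  rw [hT, lineIntegral_congr he ⟨le_rfl, H'.1.le⟩ ⟨H'.1.le, le_rfl⟩]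
  ring

theorem affine_preimage_Icc {c d a b : ℝ} (hc : 0 < c) :
    (fun τ => c * τ + d) ⁻¹' Icc a b = Icc ((a - d) / c) ((b - d) / c) := by
  ext τ
  simp only [mem_preimage, mem_Icc, div_le_iff₀ hc, le_div_iff₀ hc]
  constructor <;> rintro ⟨h1, h2⟩ <;> constructor <;> linarith

theorem IsSpeedGeodesicOn.reparam {γ : ℝ → N} {r a b c d : ℝ} (hab : a < b) (hc : 0 < c)
    (hγ : IsSpeedGeodesicOn h om r γ (Icc a b)) :
    IsSpeedGeodesicOn h om (c * r) (fun τ => γ (c * τ + d)) (Icc ((a - d) / c) ((b - d) / c)) ∧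
    (∀ s ∈ Icc ((a - d) / c) ((b - d) / c),
      velE n (fun τ => γ (c * τ + d)) (Icc ((a - d) / c) ((b - d) / c)) s
        = c • velE n γ (Icc a b) (c * s + d)) ∧
    lineIntegral om (fun τ => γ (c * τ + d)) (Icc ((a - d) / c) ((b - d) / c))
      ((a - d) / c) ((b - d) / c) = lineIntegral om γ (Icc a b) a b := by
  have hlt : (a - d) / c < (b - d) / c := by gcongr
  have hJ' := uniqueDiffOn_Icc hlt
  have hpre := affine_preimage_Icc (d := d) (a := a) (b := b) hc
  have hm : MapsTo (fun τ => c * τ + d) (Icc ((a - d) / c) ((b - d) / c)) (Icc a b) :=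
    fun τ hτ => by rw [← hpre] at hτ; exact hτ
  have h1 := hγ.comp_affine (d := d) hc.ne' (uniqueDiffOn_Icc hab) (hpre ▸ hJ')
  have h2 : ∀ s ∈ Icc ((a - d) / c) ((b - d) / c),
      velE n (fun τ => γ (c * τ + d)) (Icc ((a - d) / c) ((b - d) / c)) s
        = c • velE n γ (Icc a b) (c * s + d) := fun s hs => by
    rw [velE_comp (ψ := fun τ => c * τ + d) (hγ.1.1 _ (hm hs))
      (contDiff_affine c d).contDiffWithinAt hm (hJ' s hs), derivWithin_affine hJ' c d hs]
  refine ⟨hpre ▸ h1, h2, ?_⟩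
  have h3 : lineIntegral om (fun τ => γ (c * τ + d)) (Icc ((a - d) / c) ((b - d) / c))
      ((a - d) / c) ((b - d) / c)
      = ∫ τ in ((a - d) / c)..((b - d) / c),
        c * (fun t => formE om (γ t) (velE n γ (Icc a b) t)) (c * τ + d) := by
    refine intervalIntegral.integral_congr fun τ hτ => ?_
    rw [uIcc_of_le hlt.le] at hτ
    change formE om (γ (c * τ + d)) (velE n (fun τ => γ (c * τ + d)) _ τ) = _
    rw [h2 τ hτ, map_smul]
    rfl
  have h4 := intervalIntegral.integral_comp_mul_add (a := (a - d) / c) (b := (b - d) / c)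
    (fun t => formE om (γ t) (velE n γ (Icc a b) t)) hc.ne' d
  rw [mul_div_cancel₀ _ hc.ne', mul_div_cancel₀ _ hc.ne', sub_add_cancel, sub_add_cancel] at h4
  rw [h3, intervalIntegral.integral_const_mul, h4, smul_eq_mul, mul_inv_cancel_left₀ hc.ne']
  rfl

theorem lineIntegral_mono {γ : ℝ → N} {J J' : Set ℝ} {c d : ℝ}
    (hγ : ContMDiffOn 𝓘(ℝ, ℝ) (𝓡∂ n) ∞ γ J) (hJ' : UniqueDiffOn ℝ J') (hsub : J' ⊆ J)
    (hcd : uIcc c d ⊆ J') : lineIntegral om γ J' c d = lineIntegral om γ J c d :=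
  intervalIntegral.integral_congr fun t ht => congrArg (formE om (γ t))
    (velocity_mono ((hγ t (hsub (hcd ht))).mdifferentiableWithinAt (by simp))
      (hJ' t (hcd ht)) hsub)

/-- The arcs of a magnetic geodesic realize the inverse exponential map and the action. -/
theorem IsSpeedGeodesicOn.mlog_and_action {γ : ℝ → N} {r a b : ℝ} {J : Set ℝ} (hr : 0 < r)
    (hγ : IsSpeedGeodesicOn h om r γ J) (hJ : UniqueDiffOn ℝ J) (hab : a < b)
    (hsub : Icc a b ⊆ J) (H : MagneticExpIsDiffeo h om (γ a)) :
    mlog h om (γ a) (γ b) = (b - a) • velE n γ J a ∧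
      magneticAction h om (γ a) (γ b) = r * (b - a) - lineIntegral om γ J a b := by
  have h0 := hγ.mono hJ (uniqueDiffOn_Icc hab) hsub
  have hv : velE n γ (Icc a b) a = velE n γ J a :=
    velocity_mono ((hγ.1.1 a (hsub ⟨le_rfl, hab.le⟩)).mdifferentiableWithinAt (by simp))
      (uniqueDiffOn_Icc hab a ⟨le_rfl, hab.le⟩) hsub
  have hI : lineIntegral om γ (Icc a b) a b = lineIntegral om γ J a b :=
    lineIntegral_mono hγ.1.1 (uniqueDiffOn_Icc hab) hsub (uIcc_of_le hab.le).le
  rw [← hv, ← hI]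
  obtain ⟨h1, h2, h3⟩ := h0.reparam (c := r⁻¹) (d := a) hab (inv_pos.2 hr)
  have hℓ : 0 < r * (b - a) := mul_pos hr (sub_pos.2 hab)
  have e1 : (a - a) / r⁻¹ = 0 := by simp
  have e2 : (b - a) / r⁻¹ = r * (b - a) := by rw [div_inv_eq_mul, mul_comm]
  rw [e1, e2, inv_mul_cancel₀ hr.ne'] at h1
  rw [e1, e2] at h2 h3
  have h4 : γ (r⁻¹ * 0 + a) = γ a := by simp
  have h5 : γ (r⁻¹ * (r * (b - a)) + a) = γ b := by
    rw [inv_mul_cancel_left₀ hr.ne', sub_add_cancel]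
  refine ⟨?_, ?_⟩
  · rw [← H.mlog_eq_of_unit hℓ (isUnitMagneticGeodesicOn_iff.2 h1) h4 h5, h2 0 ⟨le_rfl, hℓ.le⟩,
      smul_smul, mul_zero, zero_add]
    congr 1
    field_simp
  · refine H.magneticAction_eq (Or.inr ⟨_, _, hℓ, isUnitMagneticGeodesicOn_iff.2 h1, h4, h5, ?_⟩)
    rw [h3]

theorem MagneticExpIsDiffeo.exists_segment {x y : N} (H : MagneticExpIsDiffeo h om x)
    (hxy : x ≠ y) : ∃ γ : ℝ → N,
      IsSpeedGeodesicOn h om (normE h x (mlog h om x y)) γ (Icc 0 1) ∧ γ 0 = x ∧ γ 1 = y ∧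
      velE n γ (Icc 0 1) 0 = mlog h om x y := by
  obtain ⟨ℓ, γ, hℓ, hγ, h0, h1, h2⟩ := H.exists_unit hxy
  have hn : normE h x (mlog h om x y) = ℓ := by
    rw [← h2, normE_smul, abs_of_pos hℓ, ← h0]
    have : normE h (γ 0) (velE n γ (Icc 0 ℓ) 0) = 1 := hγ.2 0 ⟨le_rfl, hℓ.le⟩
    rw [this, mul_one]
  obtain ⟨h3, h4, -⟩ := (isUnitMagneticGeodesicOn_iff.1 hγ).reparam (c := ℓ) (d := 0) hℓ hℓ
  rw [sub_zero, sub_zero, zero_div, div_self hℓ.ne'] at h3 h4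
  refine ⟨fun τ => γ (ℓ * τ + 0), ?_, by simp [h0], by simp [h1], ?_⟩
  · rw [hn]
    rwa [mul_one] at h3
  · rw [h4 0 ⟨le_rfl, zero_le_one⟩, ← h2]
    simp

end MagneticSegments

section OneSidedMinimum

theorem nonneg_of_hasDerivWithinAt_min {f : ℝ → ℝ} {m a b t₀ : ℝ} (ht₀ : t₀ ∈ Ico a b)
    (hf : HasDerivWithinAt f m (Icc a b) t₀) (hmin : ∀ t ∈ Icc a b, f t₀ ≤ f t) : 0 ≤ m := by
  have h1 := (hf.mono (Ioc_subset_Icc_self.trans (Icc_subset_Icc_left ht₀.1)) :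
    HasDerivWithinAt f m (Ioc t₀ b) t₀)
  rw [hasDerivWithinAt_iff_tendsto_slope' (by simp)] at h1
  have hne : (𝓝[Ioc t₀ b] t₀).NeBot := by
    rw [nhdsWithin_Ioc_eq_nhdsGT ht₀.2]; infer_instance
  refine ge_of_tendsto h1 (eventually_of_mem self_mem_nhdsWithin fun t ht => ?_)
  rw [slope_def_field]
  exact div_nonneg (sub_nonneg.2 (hmin t ⟨ht₀.1.trans ht.1.le, ht.2⟩)) (sub_nonneg.2 ht.1.le)

theorem nonpos_of_hasDerivWithinAt_min {f : ℝ → ℝ} {m a b t₀ : ℝ} (ht₀ : t₀ ∈ Ioc a b)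
    (hf : HasDerivWithinAt f m (Icc a b) t₀) (hmin : ∀ t ∈ Icc a b, f t₀ ≤ f t) : m ≤ 0 := by
  have h1 := (hf.mono (Ico_subset_Icc_self.trans (Icc_subset_Icc_right ht₀.2)) :
    HasDerivWithinAt f m (Ico a t₀) t₀)
  rw [hasDerivWithinAt_iff_tendsto_slope' (by simp)] at h1
  have hne : (𝓝[Ico a t₀] t₀).NeBot := by
    rw [nhdsWithin_Ico_eq_nhdsLT ht₀.1]; infer_instance
  refine le_of_tendsto h1 (eventually_of_mem self_mem_nhdsWithin fun t ht => ?_)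
  rw [slope_def_field]
  exact div_nonpos_of_nonneg_of_nonpos (sub_nonneg.2 (hmin t ⟨ht.1, ht.2.le.trans ht₀.2⟩))
    (sub_nonpos.2 ht.2.le)

theorem second_deriv_nonneg_of_min {f f' : ℝ → ℝ} {m a b t₀ : ℝ} (hab : a < b)
    (ht₀ : t₀ ∈ Icc a b) (hf : ∀ᶠ t in 𝓝[Icc a b] t₀, HasDerivWithinAt f (f' t) (Icc a b) t)
    (hf0 : f' t₀ = 0) (hf' : HasDerivWithinAt f' m (Icc a b) t₀)
    (hmin : ∀ t ∈ Icc a b, f t₀ ≤ f t) : 0 ≤ m := by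
  by_contra hm
  push Not at hm
  rw [hasDerivWithinAt_iff_tendsto_slope] at hf'
  have h1 := hf'.eventually (gt_mem_nhds hm)
  rw [eventually_nhdsWithin_iff, Metric.eventually_nhds_iff] at h1 hf
  obtain ⟨δ₁, hδ₁, H₁⟩ := h1
  obtain ⟨δ₂, hδ₂, H₂⟩ := hf
  set δ := min δ₁ δ₂ with hδ
  have hδ0 : 0 < δ := lt_min hδ₁ hδ₂
  have D : ∀ t ∈ Icc a b, |t - t₀| < δ → HasDerivWithinAt f (f' t) (Icc a b) t :=
    fun t ht hd => H₂ (hd.trans_le (min_le_right _ _)) ht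
  have S : ∀ t ∈ Icc a b, t ≠ t₀ → |t - t₀| < δ → f' t / (t - t₀) < 0 := fun t ht hne hd => by
    have := H₁ (y := t) (hd.trans_le (min_le_left _ _)) ⟨ht, hne⟩
    rwa [slope_def_field, hf0, sub_zero] at this
  rcases ht₀.2.lt_or_eq with hlt | heq
  · obtain ⟨t₁, ht1, ht2⟩ : ∃ t₁, t₀ < t₁ ∧ t₁ < min b (t₀ + δ) :=
      exists_between (lt_min hlt (by linarith))
    have hb := ht2.trans_le (min_le_left _ _)
    have hd := ht2.trans_le (min_le_right _ _)
    have hsub : Icc t₀ t₁ ⊆ Icc a b := Icc_subset_Icc ht₀.1 hb.le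
    have hδt : ∀ t ∈ Icc t₀ t₁, |t - t₀| < δ := fun t ht => by
      rw [abs_of_nonneg (sub_nonneg.2 ht.1)]; linarith [ht.2]
    obtain ⟨c, hc, hc'⟩ := exists_hasDerivAt_eq_slope f f' ht1
      (fun t ht => ((D t (hsub ht) (hδt t ht)).mono hsub).continuousWithinAt)
      (fun t ht => (D t (hsub (Ioo_subset_Icc_self ht)) (hδt t (Ioo_subset_Icc_self ht))).hasDerivAt
        (Icc_mem_nhds (ht₀.1.trans_lt ht.1) (ht.2.trans hb)))
    have h3 := S c (hsub (Ioo_subset_Icc_self hc)) hc.1.ne' (hδt c (Ioo_subset_Icc_self hc))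
    rw [hc'] at h3
    have h4 := hmin t₁ (hsub ⟨ht1.le, le_rfl⟩)
    exact absurd h3 (not_lt.2 (div_nonneg (div_nonneg (by linarith) (by linarith))
      (by linarith [hc.1])))
  · have hlt : a < t₀ := heq ▸ hab
    obtain ⟨t₁, ht1, ht2⟩ : ∃ t₁, max a (t₀ - δ) < t₁ ∧ t₁ < t₀ :=
      exists_between (max_lt hlt (by linarith))
    have ha := (le_max_left _ _).trans_lt ht1
    have hd := (le_max_right _ _).trans_lt ht1
    have hsub : Icc t₁ t₀ ⊆ Icc a b := Icc_subset_Icc ha.le ht₀.2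
    have hδt : ∀ t ∈ Icc t₁ t₀, |t - t₀| < δ := fun t ht => by
      rw [abs_of_nonpos (sub_nonpos.2 ht.2)]; linarith [ht.1]
    obtain ⟨c, hc, hc'⟩ := exists_hasDerivAt_eq_slope f f' ht2
      (fun t ht => ((D t (hsub ht) (hδt t ht)).mono hsub).continuousWithinAt)
      (fun t ht => (D t (hsub (Ioo_subset_Icc_self ht)) (hδt t (Ioo_subset_Icc_self ht))).hasDerivAt
        (Icc_mem_nhds (ha.trans ht.1) (ht.2.trans_le ht₀.2)))
    have h3 := S c (hsub (Ioo_subset_Icc_self hc)) hc.2.ne (hδt c (Ioo_subset_Icc_self hc))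
    rw [hc'] at h3
    have h4 := hmin t₁ (hsub ⟨le_rfl, ht2.le⟩)
    exact absurd h3 (not_lt.2 (div_nonneg_of_nonpos
      (div_nonpos_of_nonpos_of_nonneg (by linarith) (by linarith)) (by linarith [hc.2])))

end OneSidedMinimum

noncomputable section BoundaryGeometry

variable {n : ℕ} [NeZero n] {N : Type*} [TopologicalSpace N] [T2Space N]
  [ChartedSpace (EuclideanHalfSpace n) N] [IsManifold (𝓡∂ n) ∞ N]

local notation "𝔼" => EuclideanSpace ℝ (Fin n)

variable {om : SmoothOneForm (𝓡∂ n) N} {h : RMetric n N}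

theorem interior_range_halfSpace : interior (range (𝓡∂ n)) = {z : 𝔼 | 0 < z 0} := by
  rw [range_halfSpace_model]
  exact interior_halfSpace 2 0 (0 : Fin n)

theorem isInteriorPoint_iff_chart {p y : N} (hy : y ∈ (extChartAt (𝓡∂ n) p).source) :
    y ∈ (𝓡∂ n).interior N ↔ 0 < (extChartAt (𝓡∂ n) p y) 0 := by
  have hy' : y ∈ (chartAt (EuclideanHalfSpace n) p).source := by rwa [extChartAt_source] at hy
  have h1 := ModelWithCorners.isInteriorPoint_iff_of_mem_atlas (I := 𝓡∂ n) (n := ∞) (by simp)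
    (chart_mem_atlas (EuclideanHalfSpace n) p) hy'
  have h2 : extChartAt (𝓡∂ n) p y ∈ interior (range (𝓡∂ n)) ↔ 0 < (extChartAt (𝓡∂ n) p y) 0 := by
    rw [interior_range_halfSpace]; rfl
  rw [← h2]
  refine h1.trans ⟨fun h3 => ?_, fun h3 => ?_⟩
  · exact OpenPartialHomeomorph.interior_extend_target_subset_interior_range _ h3
  · exact OpenPartialHomeomorph.mem_interior_extend_target _
      ((chartAt (EuclideanHalfSpace n) p).map_source hy') h3

theorem isBoundaryPoint_iff_chart {p y : N} (hy : y ∈ (extChartAt (𝓡∂ n) p).source) :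
    y ∈ (𝓡∂ n).boundary N ↔ (extChartAt (𝓡∂ n) p y) 0 = 0 := by
  have h1 : 0 ≤ (extChartAt (𝓡∂ n) p y) 0 := by
    have : extChartAt (𝓡∂ n) p y ∈ range (𝓡∂ n) := mem_range_self _
    rwa [range_halfSpace_model] at this
  rw [← ModelWithCorners.compl_interior, mem_compl_iff, isInteriorPoint_iff_chart hy, not_lt]
  exact ⟨fun h2 => le_antisymm h2 h1, fun h2 => h2.le⟩

theorem exists_boundary_covector (h : RMetric n N) (x : N) :
    ∃ y : 𝔼, ∀ v : 𝔼, innerE h x y v = v 0 := by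
  let L : 𝔼 →ₗ[ℝ] Module.Dual ℝ 𝔼 :=
    { toFun := fun y => (innerE h x y).toLinearMap
      map_add' := fun a b => by ext v; simp
      map_smul' := fun a b => by ext v; simp }
  have hinj : Function.Injective L := by
    rw [injective_iff_map_eq_zero]
    intro y hy
    exact eq_zero_of_innerE_self (h := h) (x := x) (LinearMap.congr_fun hy y)
  have hsurj : Function.Surjective L :=
    (LinearMap.injective_iff_surjective_of_finrank_eq_finrank
      (Subspace.dual_finrank_eq (K := ℝ) (V := 𝔼)).symm).1 hinj
  obtain ⟨y, hy⟩ := hsurj (EuclideanSpace.proj (0 : Fin n) : 𝔼 →L[ℝ] ℝ).toLinearMap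
  exact ⟨y, fun v => LinearMap.congr_fun hy v⟩

theorem exists_inward_covector (h : RMetric n N) (x : N) :
    ∃ y : 𝔼, (∀ v : 𝔼, innerE h x y v = v 0) ∧ 0 < y 0 := by
  obtain ⟨y, hy⟩ := exists_boundary_covector h x
  refine ⟨y, hy, ?_⟩
  rw [← hy y]
  refine innerE_pos h x fun h0 => ?_
  have h1 := hy (EuclideanSpace.single 0 1)
  rw [h0] at h1
  simp at h1

theorem exists_isBdryProj (h : RMetric n N) (x : N) (v : 𝔼) :
    ∃ v' : 𝔼, IsBdryProj h (x := x) v v' := by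
  obtain ⟨y, hy, hpos⟩ := exists_inward_covector h x
  refine ⟨v - (v 0 / y 0) • y, isBdryProj_iff.2 ⟨?_, fun u hu => ?_⟩⟩
  · simp [hpos.ne']
  · rw [sub_sub_cancel, map_smul, smul_apply, hy u, hu, smul_zero]

theorem isInwardUnitNormal_of_covector {x : N} {y : 𝔼} (hy : ∀ v : 𝔼, innerE h x y v = v 0)
    (hpos : 0 < y 0) : IsInwardUnitNormal h (x := x)
      (show TangentSpace (𝓡∂ n) x from (normE h x y)⁻¹ • y) := by
  have hy0 : y ≠ 0 := by rintro rfl; simp at hpos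
  have hn := normE_pos h x hy0
  refine ⟨?_, ?_, fun u hu => ?_⟩
  · rw [bdryComp_eq]
    exact mul_pos (inv_pos.2 hn) hpos
  · change innerE h x ((normE h x y)⁻¹ • y) ((normE h x y)⁻¹ • y) = 1
    rw [← normE_sq, normE_smul, abs_of_pos (inv_pos.2 hn), inv_mul_cancel₀ hn.ne', one_pow]
  · have key : ∀ w : 𝔼, w 0 = 0 → innerE h x ((normE h x y)⁻¹ • y) w = 0 := fun w hw => by
      rw [map_smul, smul_apply, hy, hw, smul_zero]
    exact key u ((bdryComp_eq u).symm.trans hu)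

/-- A unit speed magnetic geodesic is never tangent to a magnetically convex boundary. -/
theorem IsUnitMagneticGeodesicOn.velE_ne_tangent (hc : HasMagneticallyConvexBoundary h om)
    {γ : ℝ → N} {a b t₀ : ℝ} (hab : a < b) (hγ : IsUnitMagneticGeodesicOn h om γ (Icc a b))
    (ht₀ : t₀ ∈ Icc a b) (hb : γ t₀ ∈ (𝓡∂ n).boundary N) : velE n γ (Icc a b) t₀ 0 ≠ 0 := by
  intro h0
  have hJ := uniqueDiffOn_Icc hab
  set J := Icc a b with hJdef
  set p := γ t₀ with hp
  have hps : γ t₀ ∈ (extChartAt (𝓡∂ n) p).source := mem_extChartAt_source _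
  set c := chartCurve n p γ with hcdef
  have hsm := contDiffWithinAt_chartCurve (hγ.1.1 t₀ ht₀) hps
  obtain ⟨hd2, hd1⟩ := hasDerivWithinAt_of_contDiffWithinAt
    (hsm.of_le ENat.LEInfty.out) hJ ht₀
  have hvel : velE n γ J t₀ = derivWithin c J t₀ := velocity_eq_chartVel (hγ.1.1 t₀ ht₀)
  have hproj : ∀ {g : ℝ → 𝔼} {g' : 𝔼} {t : ℝ}, HasDerivWithinAt g g' J t →
      HasDerivWithinAt (fun τ => g τ 0) (g' 0) J t := fun {g g' t} hg =>
    (EuclideanSpace.proj (0 : Fin n) : 𝔼 →L[ℝ] ℝ).hasFDerivAt.comp_hasDerivWithinAt t hg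
  have hc0 : c t₀ 0 = 0 := (isBoundaryPoint_iff_chart hps).1 hb
  have hmin : ∀ t ∈ J, c t₀ 0 ≤ c t 0 := fun t _ => by
    have h1 := chartCurve_mem_range (n := n) p γ t
    rw [range_halfSpace_model] at h1
    rw [hc0]; exact h1
  have hm := second_deriv_nonneg_of_min hab ht₀ (f := fun τ => c τ 0)
    (f' := fun τ => derivWithin c J τ 0) (hd1.mono fun t ht => hproj ht) (by rw [← hvel, h0])
    (hproj hd2) hmin
  set A : 𝔼 := derivWithin (derivWithin c J) J t₀ with hA
  obtain ⟨y, hy, hypos⟩ := exists_inward_covector h p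
  have hν := isInwardUnitNormal_of_covector hy hypos
  set ν : 𝔼 := (normE h p y)⁻¹ • y with hνdef
  have hu1 : hNorm h (x := p) (show TangentSpace (𝓡∂ n) p from derivWithin c J t₀) = 1 := by
    have : normE h p (derivWithin c J t₀) = 1 := by rw [← hvel]; exact hγ.2 t₀ ht₀
    exact this
  have hu0 : bdryComp (x := p) (show TangentSpace (𝓡∂ n) p from derivWithin c J t₀) = 0 := by
    have : (derivWithin c J t₀) 0 = 0 := by rw [← hvel]; exact h0
    exact (bdryComp_eq _).trans this
  have hcon := hc p hb _ _ hu1 hu0 hν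
  have heq := hγ.1.2 t₀ ht₀ (show TangentSpace (𝓡∂ n) p from ν)
  have e1 : chartMetric (𝓡∂ n) (hTensor h) p (c t₀) A ν = innerE h p A ν := metC_self h p A ν
  have e2 : 0 ≤ innerE h p A ν := by
    rw [innerE_symm, hνdef, map_smul, smul_apply, hy]
    exact mul_nonneg (inv_nonneg.2 (normE_nonneg h p y)) hm
  have e3 : (chartVec (𝓡∂ n) p (show TangentSpace (𝓡∂ n) p from ν) : 𝔼) = ν := chartVec_apply p _
  have e4 : (chartVec (𝓡∂ n) p (show TangentSpace (𝓡∂ n) p from derivWithin c J t₀) : 𝔼)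
      = derivWithin c J t₀ := chartVec_apply p _
  have e5 : innerE h p (lorentzE h om p (derivWithin c J t₀)) ν
      = innerE h p A ν + christoffel (𝓡∂ n) (hTensor h) p (derivWithin c J t₀)
        (derivWithin c J t₀) ν := by
    rw [← e1, ← hvel]
    rw [← hvel] at e4
    have heq' := heq
    rw [e3] at heq'
    refine Eq.trans ?_ (heq'.trans ?_)
    · exact congrArg (fun w : 𝔼 => innerE h p w ν) (one_smul ℝ _).symm
    · rw [hvel]
      rfl
  unfold secondForm at hcon
  rw [e3, e4] at hcon
  have hcon' : innerE h p (lorentzE h om p (derivWithin c J t₀)) ν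
    < christoffel (𝓡∂ n) (hTensor h) p (derivWithin c J t₀) (derivWithin c J t₀) ν := hcon
  linarith

end BoundaryGeometry

noncomputable section ChordExistence

variable {n : ℕ} [NeZero n] {N : Type*} [TopologicalSpace N] [T2Space N]
  [ChartedSpace (EuclideanHalfSpace n) N] [IsManifold (𝓡∂ n) ∞ N]

local notation "𝔼" => EuclideanSpace ℝ (Fin n)

variable {om : SmoothOneForm (𝓡∂ n) N} {h : RMetric n N}

theorem hasDerivWithinAt_bdry_component {γ : ℝ → N} {J : Set ℝ} {t : ℝ}
    (hγ : ContMDiffWithinAt 𝓘(ℝ, ℝ) (𝓡∂ n) ∞ γ J t) :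
    HasDerivWithinAt (fun τ => chartCurve n (γ t) γ τ 0) (velE n γ J t 0) J t := by
  have h1 := hasDerivWithinAt_chartCurve hγ (mem_extChartAt_source (γ t))
  have h2 : velE n γ J t = chartVel n (γ t) γ J t := velocity_eq_chartVel hγ
  rw [h2]
  exact (EuclideanSpace.proj (0 : Fin n) : 𝔼 →L[ℝ] ℝ).hasFDerivAt.comp_hasDerivWithinAt t h1

theorem bdry_component_min {γ : ℝ → N} {t : ℝ} (hb : γ t ∈ (𝓡∂ n).boundary N) (τ : ℝ) :
    chartCurve n (γ t) γ t 0 ≤ chartCurve n (γ t) γ τ 0 := by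
  have h1 := chartCurve_mem_range (n := n) (γ t) γ τ
  rw [range_halfSpace_model] at h1
  have h2 : chartCurve n (γ t) γ t 0 = 0 :=
    (isBoundaryPoint_iff_chart (mem_extChartAt_source (γ t))).1 hb
  rw [h2]
  exact h1

theorem velE_bdry_nonneg {γ : ℝ → N} {a b t : ℝ}
    (hγ : ContMDiffOn 𝓘(ℝ, ℝ) (𝓡∂ n) ∞ γ (Icc a b)) (ht : t ∈ Ico a b)
    (hb : γ t ∈ (𝓡∂ n).boundary N) : 0 ≤ velE n γ (Icc a b) t 0 :=
  nonneg_of_hasDerivWithinAt_min (f := fun τ => chartCurve n (γ t) γ τ 0) ht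
    (hasDerivWithinAt_bdry_component (hγ t (Ico_subset_Icc_self ht)))
    fun τ _ => bdry_component_min hb τ

theorem velE_bdry_nonpos {γ : ℝ → N} {a b t : ℝ}
    (hγ : ContMDiffOn 𝓘(ℝ, ℝ) (𝓡∂ n) ∞ γ (Icc a b)) (ht : t ∈ Ioc a b)
    (hb : γ t ∈ (𝓡∂ n).boundary N) : velE n γ (Icc a b) t 0 ≤ 0 :=
  nonpos_of_hasDerivWithinAt_min (f := fun τ => chartCurve n (γ t) γ τ 0) ht
    (hasDerivWithinAt_bdry_component (hγ t (Ioc_subset_Icc_self ht)))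
    fun τ _ => bdry_component_min hb τ

theorem IsUnitMagneticGeodesicOn.mem_interior (hc : HasMagneticallyConvexBoundary h om)
    {γ : ℝ → N} {a b t : ℝ} (hγ : IsUnitMagneticGeodesicOn h om γ (Icc a b)) (ht : t ∈ Ioo a b) :
    γ t ∈ (𝓡∂ n).interior N := by
  by_contra hni
  have hb : γ t ∈ (𝓡∂ n).boundary N := by
    rw [← ModelWithCorners.compl_interior]; exact hni
  exact hγ.velE_ne_tangent hc (ht.1.trans ht.2) (Ioo_subset_Icc_self ht) hb (le_antisymm
    (velE_bdry_nonpos hγ.1.1 (Ioo_subset_Ioc_self ht) hb)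
    (velE_bdry_nonneg hγ.1.1 (Ioo_subset_Ico_self ht) hb))

theorem IsSpeedGeodesicOn.mem_interior (hc : HasMagneticallyConvexBoundary h om)
    {γ : ℝ → N} {r a b t : ℝ} (hr : 0 < r) (hγ : IsSpeedGeodesicOn h om r γ (Icc a b))
    (ht : t ∈ Ioo a b) : γ t ∈ (𝓡∂ n).interior N := by
  obtain ⟨h1, -⟩ := hγ.reparam (c := r⁻¹) (d := 0) (ht.1.trans ht.2) (inv_pos.2 hr)
  rw [inv_mul_cancel₀ hr.ne'] at h1
  have h2 := (isUnitMagneticGeodesicOn_iff.2 h1).mem_interior hc (t := t / r⁻¹) (by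
    simp only [sub_zero]
    exact ⟨by have := ht.1; gcongr, by have := ht.2; gcongr⟩)
  rwa [mul_div_cancel₀ _ (inv_ne_zero hr.ne'), add_zero] at h2

/-- In a simple system, any two boundary points are joined by a chord. -/
theorem IsSimpleMagnetic.exists_chord (hs : IsSimpleMagnetic h om) {x y : N}
    (hx : x ∈ (𝓡∂ n).boundary N) (hy : y ∈ (𝓡∂ n).boundary N) (hxy : x ≠ y) :
    ∃ (ℓ : ℝ) (γ : ℝ → N) (X Y : TangentBundle (𝓡∂ n) N), IsMagneticChord h om ℓ γ X Y ∧
      X.proj = x ∧ Y.proj = y := by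
  obtain ⟨ℓ, γ, hℓ, hγ, rfl, rfl, -⟩ := (hs.1 x).exists_unit hxy
  obtain ⟨v', hv'⟩ := exists_isBdryProj h (γ 0) (velE n γ (Icc 0 ℓ) 0)
  obtain ⟨w', hw'⟩ := exists_isBdryProj h (γ ℓ) (velE n γ (Icc 0 ℓ) ℓ)
  refine ⟨ℓ, γ, ⟨γ 0, v'⟩, ⟨γ ℓ, w'⟩, isMagneticChord_iff.2 ⟨hℓ, hγ, hx, hy,
    fun σ hσ => hγ.mem_interior hs.2 hσ, ?_, ⟨rfl, hv'⟩, ⟨rfl, hw'⟩⟩, rfl, rfl⟩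
  exact lt_of_le_of_ne (velE_bdry_nonneg hγ.1.1 ⟨le_rfl, hℓ⟩ hx)
    (hγ.velE_ne_tangent hs.2 hℓ ⟨le_rfl, hℓ.le⟩ hx).symm

theorem IsMagneticChord.proj_ne (hs : IsSimpleMagnetic h om) {ℓ : ℝ} {γ : ℝ → N}
    {X Y : TangentBundle (𝓡∂ n) N} (H : IsMagneticChord h om ℓ γ X Y) : X.proj ≠ Y.proj := by
  obtain ⟨hℓ, hγ, -, -, -, -, ⟨hX1, -⟩, hY1, -⟩ := isMagneticChord_iff.1 H
  intro he
  have h2 := (hs.1 (γ 0)).mlog_eq_of_unit hℓ hγ rfl (hY1.symm.trans (he.symm.trans hX1))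
  rw [(hs.1 _).mlog_self] at h2
  have h3 : normE h (γ 0) (velE n γ (Icc 0 ℓ) 0) = 1 := hγ.2 0 ⟨le_rfl, hℓ.le⟩
  rw [(smul_eq_zero.1 h2).resolve_left hℓ.ne', normE_zero] at h3
  exact zero_ne_one h3

theorem IsMagneticChord.magneticAction_eq (hs : IsSimpleMagnetic h om) {ℓ : ℝ} {γ : ℝ → N}
    {X Y : TangentBundle (𝓡∂ n) N} (H : IsMagneticChord h om ℓ γ X Y) :
    magneticAction h om X.proj Y.proj = ℓ - lineIntegral om γ (Icc 0 ℓ) 0 ℓ :=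
  (hs.1 _).magneticAction_eq H.isMagneticAction

/-- The Lorentzian scattering relation in terms of the magnetic one and the action. -/
theorem IsSimpleMagnetic.lorentzScattering_iff (hs : IsSimpleMagnetic h om) {lam : N → ℝ}
    (hlam : ContMDiff (𝓡∂ n) 𝓘(ℝ, ℝ) ∞ lam) (hpos : ∀ x, 0 < lam x)
    {P Q : TangentBundle (stModel n) (ℝ × N)} :
    LorentzScattering (stationaryMetric lam om h) P Q ↔
      0 < timePart om h P ∧ lam Q.proj.2 * timePart om h Q = lam P.proj.2 * timePart om h P ∧
      MagneticScattering h om (scaleVec (timePart om h P)⁻¹ (spacePart P))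
          (scaleVec (timePart om h Q)⁻¹ (spacePart Q)) ∧
        Q.proj.1 - P.proj.1 = magneticAction h om P.proj.2 Q.proj.2 := by
  rw [_root_.lorentzScattering_iff hlam hpos]
  refine and_congr_right fun _ => and_congr_right fun _ => ⟨?_, ?_⟩
  · rintro ⟨ℓ, γ, H, hT⟩
    exact ⟨⟨ℓ, γ, H⟩, hT.trans (H.magneticAction_eq hs).symm⟩
  · rintro ⟨⟨ℓ, γ, H⟩, hT⟩
    exact ⟨ℓ, γ, H, hT.trans (H.magneticAction_eq hs)⟩

/-- The tangent vector of `ℝ × N` with given time and space parts. -/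
theorem exists_timePart_spacePart (om : SmoothOneForm (𝓡∂ n) N) (h : RMetric n N) (t c : ℝ)
    (X : TangentBundle (𝓡∂ n) N) : ∃ P : TangentBundle (stModel n) (ℝ × N),
      P.proj = (t, X.proj) ∧ timePart om h P = c ∧ spacePart P = X := by
  let w : ℝ × 𝔼 := (c - formE om X.proj X.snd, X.snd)
  refine ⟨⟨(t, X.proj), w⟩, rfl, ?_, ?_⟩
  · rw [timePart_eq, dtPlus_apply]
    exact sub_add_cancel c _
  · exact tangentBundle_ext rfl (dSpace_apply (t, X.proj) _)

theorem IsSimpleMagnetic.reducedScattering_iff (hs : IsSimpleMagnetic h om) {lam : N → ℝ}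
    (hlam : ContMDiff (𝓡∂ n) 𝓘(ℝ, ℝ) ∞ lam) (hpos : ∀ x, 0 < lam x) (t s : ℝ)
    (X Y : TangentBundle (𝓡∂ n) N) :
    ReducedScattering lam om h t X s Y ↔
      MagneticScattering h om X Y ∧ s - t = magneticAction h om X.proj Y.proj := by
  have h1X : ∀ X : TangentBundle (𝓡∂ n) N, scaleVec (1 : ℝ)⁻¹ X = X := fun X => by
    rw [inv_one]
    exact tangentBundle_ext rfl (one_smul ℝ (show 𝔼 from X.snd))
  constructor
  · rintro ⟨P, Q, hPQ, rfl, hP1, rfl, rfl, rfl⟩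
    obtain ⟨-, -, h3, h4⟩ := (hs.lorentzScattering_iff hlam hpos).1 hPQ
    rw [hP1, h1X] at h3
    exact ⟨h3, h4⟩
  · rintro ⟨hXY, hT⟩
    obtain ⟨P, hP1, hP2, hP3⟩ := exists_timePart_spacePart om h t 1 X
    set c := lam X.proj / lam Y.proj with hc
    have hc0 : 0 < c := div_pos (hpos _) (hpos _)
    obtain ⟨Q, hQ1, hQ2, hQ3⟩ := exists_timePart_spacePart om h s c (scaleVec c Y)
    have hY : scaleVec c⁻¹ (scaleVec c Y) = Y :=
      tangentBundle_ext rfl (inv_smul_smul₀ hc0.ne' (show 𝔼 from Y.snd))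
    refine ⟨P, Q, (hs.lorentzScattering_iff hlam hpos).2 ⟨by rw [hP2]; exact one_pos, ?_, ?_, ?_⟩,
      by rw [hP1], hP2, hP3, by rw [hQ1], by rw [hQ2, hQ3, hY]⟩
    · rw [hP1, hQ1, hP2, hQ2, hc, mul_one]
      exact mul_div_cancel₀ _ (hpos _).ne'
    · rw [hP2, hP3, hQ2, hQ3, hY, h1X]
      exact hXY
    · rw [hP1, hQ1]
      exact hT

end ChordExistence

section VariationIdentity

variable {E : Type*} [NormedAddCommGroup E] [NormedSpace ℝ E]

/-- Along a family of magnetic geodesics `c(·, τ)` of speed `r(τ)`, with variation field `c_τ`, the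
`s`-derivative of `m(c_s, c_τ) / r - f(c_τ)` is the `τ`-derivative of the Lagrangian
`r - f(c_s)`. -/
theorem variation_identity {S : Set E} {m : E → E →L[ℝ] E →L[ℝ] ℝ} {f : E → E →L[ℝ] ℝ}
    {c : ℝ × ℝ → E} {P : ℝ × ℝ} (hc : ContDiffAt ℝ 2 c P) (hS : ∀ᶠ Q in 𝓝 P, c Q ∈ S)
    (hm : DifferentiableWithinAt ℝ m S (c P)) (hf : DifferentiableWithinAt ℝ f S (c P))
    (hsymm : ∀ u v, m (c P) u v = m (c P) v u) {r : ℝ → ℝ} {r' : ℝ} (hr : HasDerivAt r r' P.2)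
    (hr0 : r P.2 ≠ 0)
    (hE : ∀ᶠ Q in 𝓝 P, m (c Q) (fderiv ℝ c Q (1, 0)) (fderiv ℝ c Q (1, 0)) = r Q.2 ^ 2)
    (hmag : MagEqAt S m f (r P.2) (c P) (fderiv ℝ c P (1, 0))
      (fderiv ℝ (fderiv ℝ c) P (1, 0) (1, 0))) :
    ∃ b' q' : ℝ × ℝ →L[ℝ] ℝ,
      HasFDerivAt (fun Q => m (c Q) (fderiv ℝ c Q (1, 0)) (fderiv ℝ c Q (0, 1)) / r Q.2
        - f (c Q) (fderiv ℝ c Q (0, 1))) b' P ∧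
      HasFDerivAt (fun Q => r Q.2 - f (c Q) (fderiv ℝ c Q (1, 0))) q' P ∧
      b' (1, 0) = q' (0, 1) := by
  have hc1 : HasFDerivAt c (fderiv ℝ c P) P := (hc.differentiableAt (by norm_num)).hasFDerivAt
  have hD : HasFDerivAt (fderiv ℝ c) (fderiv ℝ (fderiv ℝ c) P) P :=
    ((hc.fderiv_right (m := 1) (by norm_num)).differentiableAt (by norm_num)).hasFDerivAt
  have hs : HasFDerivAt (fun Q => fderiv ℝ c Q (1, 0)) ((fderiv ℝ (fderiv ℝ c) P).flip (1, 0)) P := by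
    simpa using hD.clm_apply (hasFDerivAt_const ((1, 0) : ℝ × ℝ) P)
  have ht : HasFDerivAt (fun Q => fderiv ℝ c Q (0, 1)) ((fderiv ℝ (fderiv ℝ c) P).flip (0, 1)) P := by
    simpa using hD.clm_apply (hasFDerivAt_const ((0, 1) : ℝ × ℝ) P)
  have hsy : fderiv ℝ (fderiv ℝ c) P (0, 1) (1, 0) = fderiv ℝ (fderiv ℝ c) P (1, 0) (0, 1) :=
    (hc.isSymmSndFDerivAt (by simp)) (0, 1) (1, 0)
  have hM := hm.hasFDerivWithinAt.comp_hasFDerivAt P hc1 hS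
  have hF := hf.hasFDerivWithinAt.comp_hasFDerivAt P hc1 hS
  have hr2 : HasFDerivAt (fun Q : ℝ × ℝ => r Q.2)
      (r' • (ContinuousLinearMap.snd ℝ ℝ ℝ)) P :=
    hr.comp_hasFDerivAt P (hasFDerivAt_snd)
  have hri : HasFDerivAt (fun Q : ℝ × ℝ => (r Q.2)⁻¹)
      ((-r' / r P.2 ^ 2) • (ContinuousLinearMap.snd ℝ ℝ ℝ)) P :=
    (hr.fun_inv hr0).comp_hasFDerivAt P (hasFDerivAt_snd)
  set cs := fderiv ℝ c P (1, 0) with hcs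
  set ct := fderiv ℝ c P (0, 1) with hct
  set css := fderiv ℝ (fderiv ℝ c) P (1, 0) (1, 0) with hcss
  set cst := fderiv ℝ (fderiv ℝ c) P (1, 0) (0, 1) with hcst
  set m' := fderivWithin ℝ m S (c P) with hm'
  set f' := fderivWithin ℝ f S (c P) with hf'
  have hMst := (hM.clm_apply hs).clm_apply ht
  have hMss := (hM.clm_apply hs).clm_apply hs
  have hFt := hF.clm_apply ht
  have hFs := hF.clm_apply hs
  have hen : m' ct cs cs + 2 * m (c P) cs cst = 2 * r P.2 * r' := by
    have h1 := (hMss.congr_of_eventuallyEq (hE.mono fun Q hQ => hQ.symm)).unique (hr2.pow 2)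
    have h2 := DFunLike.congr_fun h1 (0, 1)
    simp only [add_apply, ContinuousLinearMap.comp_apply, ContinuousLinearMap.flip_apply,
      Function.comp_apply, smul_apply, smul_eq_mul, ContinuousLinearMap.coe_snd', ← hcs, ← hct,
      hsy, hsymm cst cs] at h2
    simp only [Nat.cast_ofNat, Nat.add_one_sub_one, pow_one, mul_one, nsmul_eq_mul] at h2
    linarith
  have hmg := hmag ct
  refine ⟨_, _, ((hMst.mul hri).sub hFt), hr2.sub hFs, ?_⟩
  simp only [add_apply, sub_apply, ContinuousLinearMap.comp_apply, ContinuousLinearMap.flip_apply,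
    Function.comp_apply, smul_apply, smul_eq_mul, ContinuousLinearMap.coe_snd', ← hcs, ← hct,
    ← hcss, hsy, ← hcst]
  have h3 : m (c P) css ct + m' cs cs ct + m (c P) cs cst
      = r P.2 * (r' + f' cs ct - f' ct cs) := by linarith
  field_simp
  linear_combination r P.2 * h3

end VariationIdentity

noncomputable section FirstVariation

variable {n : ℕ} [NeZero n] {N : Type*} [TopologicalSpace N] [T2Space N]
  [ChartedSpace (EuclideanHalfSpace n) N] [IsManifold (𝓡∂ n) ∞ N]

local notation "𝔼" => EuclideanSpace ℝ (Fin n)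

variable {om : SmoothOneForm (𝓡∂ n) N} {h : RMetric n N}

theorem metC_chartVel_chartVel (h : RMetric n N) {γ₁ γ₂ : ℝ → N} {J₁ J₂ : Set ℝ} {σ₁ σ₂ : ℝ}
    {p x : N} (e₁ : γ₁ σ₁ = x) (e₂ : γ₂ σ₂ = x)
    (h₁ : MDifferentiableWithinAt 𝓘(ℝ, ℝ) (𝓡∂ n) γ₁ J₁ σ₁)
    (h₂ : MDifferentiableWithinAt 𝓘(ℝ, ℝ) (𝓡∂ n) γ₂ J₂ σ₂) (hJ₁ : UniqueDiffWithinAt ℝ J₁ σ₁)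
    (hJ₂ : UniqueDiffWithinAt ℝ J₂ σ₂) (hp : x ∈ (extChartAt (𝓡∂ n) p).source) :
    metC h p (extChartAt (𝓡∂ n) p x) (chartVel n p γ₁ J₁ σ₁) (chartVel n p γ₂ J₂ σ₂)
      = innerE h x (velE n γ₁ J₁ σ₁) (velE n γ₂ J₂ σ₂) := by
  subst e₁
  rw [metC_apply]
  have hp' : γ₁ σ₁ ∈ (chartAt (EuclideanHalfSpace n) p).source := by rwa [extChartAt_source] at hp
  have a₁ := velocity_eq_coordField h₁ hJ₁ hp'
  have a₂ := velocity_eq_coordField h₂ hJ₂ (e₂.symm ▸ hp')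
  rw [e₂] at a₂
  have a₁' : velE n γ₁ J₁ σ₁ = (coordField (𝓡∂ n) p (extChartAt (𝓡∂ n) p (γ₁ σ₁))
      (chartVel n p γ₁ J₁ σ₁) : 𝔼) := a₁
  have a₂' : velE n γ₂ J₂ σ₂ = (coordField (𝓡∂ n) p (extChartAt (𝓡∂ n) p (γ₁ σ₁))
      (chartVel n p γ₂ J₂ σ₂) : 𝔼) := a₂
  rw [a₁', a₂']
  exact inner_congr_point h ((extChartAt (𝓡∂ n) p).left_inv hp) _ _

variable {G : ℝ × ℝ → N} {a b : ℝ} {k : WithTop ℕ∞}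

theorem contDiffWithinAt_chart_family {R : Set (ℝ × ℝ)} {P : ℝ × ℝ} {p : N} (hk : k ≤ ∞)
    (hG : ContMDiffWithinAt 𝓘(ℝ, ℝ × ℝ) (𝓡∂ n) k G R P)
    (hp : G P ∈ (extChartAt (𝓡∂ n) p).source) :
    ContDiffWithinAt ℝ k (fun Q => extChartAt (𝓡∂ n) p (G Q)) R P := by
  rw [← contMDiffWithinAt_iff_contDiffWithinAt]
  rw [extChartAt_source] at hp
  exact ((contMDiffAt_extChartAt' (n := ∞) hp).of_le hk).comp_contMDiffWithinAt P hG

theorem contMDiffWithinAt_partial_fst {s τ : ℝ} {A B : Set ℝ} (hτ : τ ∈ B)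
    (hG : ContMDiffWithinAt 𝓘(ℝ, ℝ × ℝ) (𝓡∂ n) k G (A ×ˢ B) (s, τ)) :
    ContMDiffWithinAt 𝓘(ℝ, ℝ) (𝓡∂ n) k (fun σ => G (σ, τ)) A s :=
  ContMDiffWithinAt.comp s (g := G) (f := fun σ : ℝ => (σ, τ)) hG
    ((contDiff_id.prodMk contDiff_const).contMDiff s).contMDiffWithinAt fun _ hσ => ⟨hσ, hτ⟩

theorem contMDiffWithinAt_partial_snd {s τ : ℝ} {A B : Set ℝ} (hs : s ∈ A)
    (hG : ContMDiffWithinAt 𝓘(ℝ, ℝ × ℝ) (𝓡∂ n) k G (A ×ˢ B) (s, τ)) :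
    ContMDiffWithinAt 𝓘(ℝ, ℝ) (𝓡∂ n) k (fun σ => G (s, σ)) B τ :=
  ContMDiffWithinAt.comp τ (g := G) (f := fun σ : ℝ => (s, σ)) hG
    ((contDiff_const.prodMk contDiff_id).contMDiff τ).contMDiffWithinAt fun _ hσ => ⟨hs, hσ⟩

theorem chartVel_partial {s τ : ℝ} {A B : Set ℝ} (hA : UniqueDiffOn ℝ A) (hB : UniqueDiffOn ℝ B)
    (hs : s ∈ A) (hτ : τ ∈ B) {p : N}
    (hG : ContMDiffWithinAt 𝓘(ℝ, ℝ × ℝ) (𝓡∂ n) 1 G (A ×ˢ B) (s, τ))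
    (hp : G (s, τ) ∈ (extChartAt (𝓡∂ n) p).source) :
    chartVel n p (fun σ => G (σ, τ)) A s
        = fderivWithin ℝ (fun Q => extChartAt (𝓡∂ n) p (G Q)) (A ×ˢ B) (s, τ) (1, 0) ∧
      chartVel n p (fun σ => G (s, σ)) B τ
        = fderivWithin ℝ (fun Q => extChartAt (𝓡∂ n) p (G Q)) (A ×ˢ B) (s, τ) (0, 1) := by
  have h1 := ((contDiffWithinAt_chart_family (ENat.LEInfty.out) hG hp).differentiableWithinAt
    (by norm_num)).hasFDerivWithinAt
  constructor
  · have h2 : HasDerivWithinAt (fun σ : ℝ => (σ, τ)) ((1 : ℝ), (0 : ℝ)) A s :=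
      (hasDerivWithinAt_id s A).prodMk (hasDerivWithinAt_const s A τ)
    have h3 : MapsTo (fun σ : ℝ => (σ, τ)) A (A ×ˢ B) := fun σ hσ => ⟨hσ, hτ⟩
    exact (h1.comp_hasDerivWithinAt s h2 h3).derivWithin (hA s hs)
  · have h2 : HasDerivWithinAt (fun σ : ℝ => (s, σ)) ((0 : ℝ), (1 : ℝ)) B τ :=
      (hasDerivWithinAt_const τ B s).prodMk (hasDerivWithinAt_id τ B)
    have h3 : MapsTo (fun σ : ℝ => (s, σ)) B (A ×ˢ B) := fun σ hσ => ⟨hs, hσ⟩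
    exact (h1.comp_hasDerivWithinAt τ h2 h3).derivWithin (hB τ hτ)

/-- The Lagrangian along the curves `G(·, τ)`. -/
def famLagrangian (om : SmoothOneForm (𝓡∂ n) N) (G : ℝ × ℝ → N) (A : Set ℝ) (r : ℝ → ℝ)
    (P : ℝ × ℝ) : ℝ :=
  r P.2 - formE om (G P) (velE n (fun σ => G (σ, P.2)) A P.1)

/-- The momentum of the curves `G(·, τ)` paired with the variation field. -/
def famMomentum (h : RMetric n N) (om : SmoothOneForm (𝓡∂ n) N) (G : ℝ × ℝ → N) (A B : Set ℝ)
    (r : ℝ → ℝ) (P : ℝ × ℝ) : ℝ :=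
  innerE h (G P) (velE n (fun σ => G (σ, P.2)) A P.1) (velE n (fun σ => G (P.1, σ)) B P.2) / r P.2
    - formE om (G P) (velE n (fun σ => G (P.1, σ)) B P.2)

theorem fam_eq_chart {A B : Set ℝ} (hA : UniqueDiffOn ℝ A) (hB : UniqueDiffOn ℝ B) {P : ℝ × ℝ}
    (hP : P ∈ A ×ˢ B) {p : N} (hG : ContMDiffWithinAt 𝓘(ℝ, ℝ × ℝ) (𝓡∂ n) 1 G (A ×ˢ B) P)
    (hp : G P ∈ (extChartAt (𝓡∂ n) p).source) (r : ℝ → ℝ) :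
    let c := fun Q => extChartAt (𝓡∂ n) p (G Q)
    famLagrangian om G A r P = r P.2 - formC om p (c P) (fderivWithin ℝ c (A ×ˢ B) P (1, 0)) ∧
    famMomentum h om G A B r P
      = metC h p (c P) (fderivWithin ℝ c (A ×ˢ B) P (1, 0)) (fderivWithin ℝ c (A ×ˢ B) P (0, 1))
          / r P.2 - formC om p (c P) (fderivWithin ℝ c (A ×ˢ B) P (0, 1)) ∧
    metC h p (c P) (fderivWithin ℝ c (A ×ˢ B) P (1, 0)) (fderivWithin ℝ c (A ×ˢ B) P (1, 0))
      = normE h (G P) (velE n (fun σ => G (σ, P.2)) A P.1) ^ 2 := by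
  obtain ⟨s, τ⟩ := P
  intro c
  obtain ⟨e₁, e₂⟩ := chartVel_partial hA hB hP.1 hP.2 hG hp
  have m₁ := (contMDiffWithinAt_partial_fst hP.2 hG).mdifferentiableWithinAt one_ne_zero
  have m₂ := (contMDiffWithinAt_partial_snd hP.1 hG).mdifferentiableWithinAt one_ne_zero
  have f₁ := formC_velocity om m₁ (hA s hP.1) hp
  have f₂ := formC_velocity om m₂ (hB τ hP.2) hp
  have g₁ := metC_chartVel_chartVel h (γ₁ := fun σ => G (σ, τ)) (γ₂ := fun σ => G (s, σ)) rfl rfl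
    m₁ m₂ (hA s hP.1) (hB τ hP.2) hp
  have g₂ := metC_chartVel_chartVel h (γ₁ := fun σ => G (σ, τ)) (γ₂ := fun σ => G (σ, τ)) rfl rfl
    m₁ m₁ (hA s hP.1) (hA s hP.1) hp
  rw [e₁, e₂] at g₁
  rw [e₁] at g₂
  have f₁' : formC om p (c (s, τ)) (fderivWithin ℝ c (A ×ˢ B) (s, τ) (1, 0))
    = formE om (G (s, τ)) (velE n (fun σ => G (σ, τ)) A s) := by rw [← e₁]; exact f₁
  have f₂' : formC om p (c (s, τ)) (fderivWithin ℝ c (A ×ˢ B) (s, τ) (0, 1))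
    = formE om (G (s, τ)) (velE n (fun σ => G (s, σ)) B τ) := by rw [← e₂]; exact f₂
  refine ⟨?_, ?_, ?_⟩
  · rw [f₁']; rfl
  · rw [f₂', g₁]; rfl
  · rw [g₂, normE_sq]

theorem continuousOn_fam (hab : a < b) (hG : ContMDiffOn 𝓘(ℝ, ℝ × ℝ) (𝓡∂ n) 1 G (Icc 0 1 ×ˢ Icc a b))
    {r : ℝ → ℝ} (hr : ContinuousOn r (Icc a b)) (hr0 : ∀ τ ∈ Icc a b, 0 < r τ) :
    ContinuousOn (famLagrangian om G (Icc 0 1) r) (Icc 0 1 ×ˢ Icc a b) ∧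
      ContinuousOn (famMomentum h om G (Icc 0 1) (Icc a b) r) (Icc 0 1 ×ˢ Icc a b) := by
  set R := Icc (0 : ℝ) 1 ×ˢ Icc a b with hR
  have hA := uniqueDiffOn_Icc (zero_lt_one' ℝ)
  have hB := uniqueDiffOn_Icc hab
  have hRu : UniqueDiffOn ℝ R := hA.prod hB
  have hrR : ContinuousOn (fun Q : ℝ × ℝ => r Q.2) R :=
    hr.comp continuousOn_snd fun Q hQ => hQ.2
  have key : ∀ P ∈ R, ∃ U : Set (ℝ × ℝ), IsOpen U ∧ P ∈ U ∧
      (∀ Q ∈ R ∩ U, G Q ∈ (extChartAt (𝓡∂ n) (G P)).source) ∧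
      ContinuousOn (fun Q => extChartAt (𝓡∂ n) (G P) (G Q)) (R ∩ U) ∧
      ContinuousOn (fun Q => fderivWithin ℝ (fun Q => extChartAt (𝓡∂ n) (G P) (G Q)) R Q)
        (R ∩ U) := by
    intro P hP
    obtain ⟨U, hU, hPU⟩ := continuousOn_iff'.1 hG.continuousOn _
      (isOpen_extChartAt_source (I := 𝓡∂ n) (G P))
    have hsrc : ∀ Q ∈ R ∩ U, G Q ∈ (extChartAt (𝓡∂ n) (G P)).source := fun Q hQ => by
      have : Q ∈ G ⁻¹' (extChartAt (𝓡∂ n) (G P)).source ∩ R := by rw [hPU]; exact hQ.symm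
      exact this.1
    have hcd : ContDiffOn ℝ 1 (fun Q => extChartAt (𝓡∂ n) (G P) (G Q)) (R ∩ U) := fun Q hQ =>
      (contDiffWithinAt_chart_family ENat.LEInfty.out (hG Q hQ.1) (hsrc Q hQ)).mono inter_subset_left
    refine ⟨U, hU, ?_, hsrc, hcd.continuousOn, ?_⟩
    · have : P ∈ U ∩ R := by rw [← hPU]; exact ⟨mem_extChartAt_source _, hP⟩
      exact this.1
    · exact (hcd.continuousOn_fderivWithin (hRu.inter hU) le_rfl).congr fun Q hQ =>
        (fderivWithin_inter (hU.mem_nhds hQ.2)).symm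
  have hmC : ∀ P : ℝ × ℝ, ∀ U : Set (ℝ × ℝ), (∀ Q ∈ R ∩ U, G Q ∈ (extChartAt (𝓡∂ n) (G P)).source) →
      ContinuousOn (fun Q => extChartAt (𝓡∂ n) (G P) (G Q)) (R ∩ U) →
      ContinuousOn (fun Q => metC h (G P) (extChartAt (𝓡∂ n) (G P) (G Q))) (R ∩ U) ∧
      ContinuousOn (fun Q => formC om (G P) (extChartAt (𝓡∂ n) (G P) (G Q))) (R ∩ U) :=
    fun P U hsrc hc =>
      ⟨(contDiffOn_metC h (G P)).continuousOn.comp hc fun Q hQ =>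
        (extChartAt (𝓡∂ n) (G P)).map_source (hsrc Q hQ),
      (contDiffOn_formC om (G P)).continuousOn.comp hc fun Q hQ =>
        (extChartAt (𝓡∂ n) (G P)).map_source (hsrc Q hQ)⟩
  constructor <;> intro P hP <;> obtain ⟨U, hU, hPU, hsrc, hc, hd⟩ := key P hP <;>
    obtain ⟨hm, hf⟩ := hmC P U hsrc hc <;>
    have hd1 := hd.clm_apply (continuousOn_const (c := ((1, 0) : ℝ × ℝ))) <;>
    have hd2 := hd.clm_apply (continuousOn_const (c := ((0, 1) : ℝ × ℝ))) <;>
    have hrU := hrR.mono (inter_subset_left (t := U)) <;>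
    have hnhds : R ∩ U ∈ 𝓝[R] P :=
      inter_mem self_mem_nhdsWithin (mem_nhdsWithin_of_mem_nhds (hU.mem_nhds hPU))
  · refine ContinuousWithinAt.mono_of_mem_nhdsWithin ?_ hnhds
    exact ((hrU.sub (hf.clm_apply hd1)).congr fun Q hQ =>
      (fam_eq_chart (h := h) hA hB hQ.1 (hG Q hQ.1) (hsrc Q hQ) r).1) P ⟨hP, hPU⟩
  · refine ContinuousWithinAt.mono_of_mem_nhdsWithin ?_ hnhds
    exact (((((hm.clm_apply hd1).clm_apply hd2).div hrU fun Q hQ => (hr0 _ hQ.1.2).ne').sub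
      (hf.clm_apply hd2)).congr fun Q hQ =>
      (fam_eq_chart (h := h) hA hB hQ.1 (hG Q hQ.1) (hsrc Q hQ) r).2.1) P ⟨hP, hPU⟩

end FirstVariation

theorem derivWithin_eq_fderiv_fderiv {E : Type*} [NormedAddCommGroup E] [NormedSpace ℝ E]
    {c : ℝ × ℝ → E} {P : ℝ × ℝ} (hc : ContDiffAt ℝ 2 c P) {g : ℝ → E} {J : Set ℝ}
    (hJ : J ∈ 𝓝 P.1) (hg : g =ᶠ[𝓝 P.1] fun s => fderiv ℝ c (s, P.2) (1, 0)) :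
    derivWithin g J P.1 = fderiv ℝ (fderiv ℝ c) P (1, 0) (1, 0) := by
  obtain ⟨s, τ⟩ := P
  rw [derivWithin_of_mem_nhds hJ]
  refine (hg.deriv_eq).trans (HasDerivAt.deriv ?_)
  have h4 : HasFDerivAt (fderiv ℝ c) (fderiv ℝ (fderiv ℝ c) (s, τ)) (s, τ) :=
    ((hc.fderiv_right (m := 1) (by norm_num)).differentiableAt (by norm_num)).hasFDerivAt
  have h5 : HasDerivAt (fun s : ℝ => (s, τ)) ((1 : ℝ), (0 : ℝ)) s :=
    (hasDerivAt_id s).prodMk (hasDerivAt_const s τ)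
  have h6 : HasDerivAt (fun s => fderiv ℝ c (s, τ))
    (fderiv ℝ (fderiv ℝ c) (s, τ) (1, 0)) s := h4.comp_hasDerivAt s h5
  have h7 := h6.clm_apply (hasDerivAt_const s ((1, 0) : ℝ × ℝ))
  rw [map_zero, add_zero] at h7
  exact h7

noncomputable section FirstVariationFormula

variable {n : ℕ} [NeZero n] {N : Type*} [TopologicalSpace N] [T2Space N]
  [ChartedSpace (EuclideanHalfSpace n) N] [IsManifold (𝓡∂ n) ∞ N]

local notation "𝔼" => EuclideanSpace ℝ (Fin n)

variable {om : SmoothOneForm (𝓡∂ n) N} {h : RMetric n N} {G : ℝ × ℝ → N} {a b : ℝ} {r : ℝ → ℝ}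

theorem fam_hasFDerivAt (hab : a < b)
    (hG : ContMDiffOn 𝓘(ℝ, ℝ × ℝ) (𝓡∂ n) ∞ G (Ioo 0 1 ×ˢ Ioo a b))
    (hG1 : ContMDiffOn 𝓘(ℝ, ℝ × ℝ) (𝓡∂ n) 1 G (Icc 0 1 ×ˢ Icc a b))
    (hgeo : ∀ τ ∈ Icc a b, IsSpeedGeodesicOn h om (r τ) (fun s => G (s, τ)) (Icc 0 1))
    (hr0 : ∀ τ ∈ Icc a b, 0 < r τ) {P : ℝ × ℝ} (hP : P ∈ Ioo (0 : ℝ) 1 ×ˢ Ioo a b)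
    (hr : DifferentiableAt ℝ r P.2) :
    ∃ b' q' : ℝ × ℝ →L[ℝ] ℝ,
      HasFDerivAt (famMomentum h om G (Icc 0 1) (Icc a b) r) b' P ∧
      HasFDerivAt (famLagrangian om G (Icc 0 1) r) q' P ∧ b' (1, 0) = q' (0, 1) := by
  set O := Ioo (0 : ℝ) 1 ×ˢ Ioo a b with hO
  set R := Icc (0 : ℝ) 1 ×ˢ Icc a b with hR
  have hOR : O ⊆ R := prod_mono Ioo_subset_Icc_self Ioo_subset_Icc_self
  have hOo : IsOpen O := isOpen_Ioo.prod isOpen_Ioo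
  have hA := uniqueDiffOn_Icc (zero_lt_one' ℝ)
  have hB := uniqueDiffOn_Icc hab
  set p := G P with hp
  set c : ℝ × ℝ → 𝔼 := fun Q => extChartAt (𝓡∂ n) p (G Q) with hc
  have hUo : IsOpen (O ∩ G ⁻¹' (extChartAt (𝓡∂ n) p).source) :=
    hG.continuousOn.isOpen_inter_preimage hOo (isOpen_extChartAt_source p)
  set U := O ∩ G ⁻¹' (extChartAt (𝓡∂ n) p).source with hU
  have hPU : P ∈ U := ⟨hP, mem_extChartAt_source _⟩
  have hUn : ∀ Q ∈ U, U ∈ 𝓝 Q := fun Q hQ => hUo.mem_nhds hQ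
  have hRn : ∀ Q ∈ U, R ∈ 𝓝 Q := fun Q hQ => mem_of_superset (hOo.mem_nhds hQ.1) hOR
  have hcd : ∀ Q ∈ U, ContDiffAt ℝ ∞ c Q := fun Q hQ =>
    (contDiffWithinAt_chart_family le_rfl (hG Q hQ.1) hQ.2).contDiffAt (hOo.mem_nhds hQ.1)
  have hfd : ∀ Q ∈ U, fderivWithin ℝ c R Q = fderiv ℝ c Q := fun Q hQ =>
    fderivWithin_of_mem_nhds (hRn Q hQ)
  have hfam := fun Q (hQ : Q ∈ U) =>
    fam_eq_chart (h := h) (om := om) hA hB (hOR hQ.1) (hG1 Q (hOR hQ.1)) hQ.2 r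
  have hE : ∀ Q ∈ U, metC h p (c Q) (fderiv ℝ c Q (1, 0)) (fderiv ℝ c Q (1, 0)) = r Q.2 ^ 2 := by
    intro Q hQ
    have h1 := (hfam Q hQ).2.2
    have h2 : normE h (G Q) (velE n (fun σ => G (σ, Q.2)) (Icc 0 1) Q.1) = |r Q.2| :=
      (hgeo Q.2 (hOR hQ.1).2).2 Q.1 (hOR hQ.1).1
    rw [h2, sq_abs] at h1
    rw [← hfd Q hQ]
    exact h1
  have hz : c P ∈ (extChartAt (𝓡∂ n) p).target := (extChartAt (𝓡∂ n) p).map_source hPU.2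
  have hPs := (hOR hP).1
  have hPτ := (hOR hP).2
  have hsec : chartVel n p (fun s => G (s, P.2)) (Icc 0 1) =ᶠ[𝓝 P.1]
      fun s => fderiv ℝ c (s, P.2) (1, 0) := by
    have h1 : ∀ᶠ s in 𝓝 P.1, (s, P.2) ∈ U :=
      (continuous_id.prodMk continuous_const).continuousAt.eventually_mem (hUn P hPU)
    filter_upwards [h1] with s hs
    rw [(chartVel_partial hA hB (hOR hs.1).1 hPτ (hG1 _ (hOR hs.1)) hs.2).1]
    exact congrArg (fun L : ℝ × ℝ →L[ℝ] 𝔼 => L (1, 0)) (hfd _ hs)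
  have hmag : MagEqAt (range (𝓡∂ n)) (metC h p) (formC om p) (r P.2) (c P) (fderiv ℝ c P (1, 0))
      (fderiv ℝ (fderiv ℝ c) P (1, 0) (1, 0)) := by
    have h1 := (covAccel_iff_magEqAt_chart h om ((hgeo P.2 hPτ).1.1 P.1 hPs) hA hPs hPU.2).1
      ((hgeo P.2 hPτ).1.2 P.1 hPs)
    have h2 : derivWithin (fun s => extChartAt (𝓡∂ n) p (G (s, P.2))) (Icc 0 1) P.1
      = fderiv ℝ c P (1, 0) := hsec.self_of_nhds
    have hmem : Icc (0 : ℝ) 1 ∈ 𝓝 P.1 := Icc_mem_nhds hP.1.1 hP.1.2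
    have h3 : derivWithin (derivWithin (fun s => extChartAt (𝓡∂ n) p (G (s, P.2))) (Icc 0 1))
        (Icc 0 1) P.1 = fderiv ℝ (fderiv ℝ c) P (1, 0) (1, 0) :=
      derivWithin_eq_fderiv_fderiv ((hcd P hPU).of_le ENat.LEInfty.out) hmem hsec
    rw [h2, h3] at h1
    exact h1
  obtain ⟨b', q', hb', hq', hbq⟩ := variation_identity (S := range (𝓡∂ n)) ((hcd P hPU).of_le ENat.LEInfty.out)
    (Eventually.of_forall fun Q => mem_range_self _) (differentiableWithinAt_metC h p hz)
    (differentiableWithinAt_formC om p hz) (metC_symm h p (c P)) hr.hasDerivAt (hr0 _ hPτ).ne'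
    (eventually_of_mem (hUn P hPU) hE) hmag
  refine ⟨b', q', hb'.congr_of_eventuallyEq ?_, hq'.congr_of_eventuallyEq ?_, hbq⟩
  · filter_upwards [hUn P hPU] with Q hQ
    rw [(hfam Q hQ).2.1, ← hfd Q hQ]
  · filter_upwards [hUn P hPU] with Q hQ
    rw [(hfam Q hQ).1, ← hfd Q hQ]

theorem velE_const {γ : ℝ → N} {J : Set ℝ} {t : ℝ} {x : N} (ht : t ∈ J) (hγ : ∀ s ∈ J, γ s = x) :
    velE n γ J t = 0 := by
  rw [velE_congr (y := fun _ => x) ht hγ]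
  exact congrArg (fun L : ℝ →L[ℝ] 𝔼 => L 1)
    (mfderivWithin_const (I := 𝓘(ℝ, ℝ)) (I' := 𝓡∂ n) (s := J) (x := t) (c := x))

/-- The first variation formula for the action of magnetic geodesics issuing from a fixed point. -/
theorem first_variation (hab : a < b)
    (hG : ContMDiffOn 𝓘(ℝ, ℝ × ℝ) (𝓡∂ n) ∞ G (Ioo 0 1 ×ˢ Ioo a b))
    (hG1 : ContMDiffOn 𝓘(ℝ, ℝ × ℝ) (𝓡∂ n) 1 G (Icc 0 1 ×ˢ Icc a b))
    (hgeo : ∀ τ ∈ Icc a b, IsSpeedGeodesicOn h om (r τ) (fun s => G (s, τ)) (Icc 0 1))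
    (hr0 : ∀ τ ∈ Icc a b, 0 < r τ) (hrc : ContinuousOn r (Icc a b))
    (hr : ∀ τ ∈ Ioo a b, DifferentiableAt ℝ r τ) {x : N} (hx : ∀ τ ∈ Icc a b, G (0, τ) = x) :
    (r b - lineIntegral om (fun s => G (s, b)) (Icc 0 1) 0 1)
        - (r a - lineIntegral om (fun s => G (s, a)) (Icc 0 1) 0 1)
      = ∫ τ in a..b, famMomentum h om G (Icc 0 1) (Icc a b) r (1, τ) := by
  set R := Icc (0 : ℝ) 1 ×ˢ Icc a b with hR
  set O := Ioo (0 : ℝ) 1 ×ˢ Ioo a b with hO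
  have huR : uIcc (0 : ℝ) 1 ×ˢ uIcc a b = R := by
    rw [uIcc_of_le zero_le_one, uIcc_of_le hab.le]
  have huO : Ioo (min (0 : ℝ) 1) (max 0 1) ×ˢ Ioo (min a b) (max a b) = O := by
    rw [min_eq_left hab.le, max_eq_right hab.le, min_eq_left zero_le_one, max_eq_right zero_le_one]
  obtain ⟨hq, hb⟩ := continuousOn_fam (h := h) (om := om) hab hG1 hrc hr0
  have H : ∀ P : ℝ × ℝ, ∃ b' q' : ℝ × ℝ →L[ℝ] ℝ, (P ∈ O →
      HasFDerivAt (famMomentum h om G (Icc 0 1) (Icc a b) r) b' P ∧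
      HasFDerivAt (famLagrangian om G (Icc 0 1) r) q' P) ∧ b' (1, 0) = q' (0, 1) := by
    intro P
    by_cases hP : P ∈ O
    · obtain ⟨b', q', h1, h2, h3⟩ := fam_hasFDerivAt hab hG hG1 hgeo hr0 hP (hr _ hP.2)
      exact ⟨b', q', fun _ => ⟨h1, h2⟩, h3⟩
    · exact ⟨0, 0, fun h1 => absurd h1 hP, rfl⟩
  choose b' q' hd he using H
  have hzero : ∀ P, b' P (1, 0) + (-q' P) (0, 1) = 0 := fun P => by
    rw [neg_apply, he P, add_neg_cancel]
  have h1 := integral2_divergence_prod_of_hasFDerivAt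
    (famMomentum h om G (Icc 0 1) (Icc a b) r) (fun P => -famLagrangian om G (Icc 0 1) r P) b'
    (fun P => -q' P) 0 a 1 b (by rw [huR]; exact hb) (by rw [huR]; exact hq.neg)
    (by rw [huO]; exact fun P hP => (hd P hP).1) (by rw [huO]; exact fun P hP => (hd P hP).2.neg)
    (by simp only [hzero]; exact integrableOn_zero)
  simp only [hzero, intervalIntegral.integral_zero, intervalIntegral.integral_neg] at h1
  have h0 : ∫ τ in a..b, famMomentum h om G (Icc 0 1) (Icc a b) r (0, τ) = 0 := by
    refine (intervalIntegral.integral_congr (g := fun _ => 0) fun τ hτ => ?_).trans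
      intervalIntegral.integral_zero
    rw [uIcc_of_le hab.le] at hτ
    have h2 := velE_const (n := n) hτ hx
    simp only [famMomentum]
    rw [h2, map_zero, map_zero, zero_div, sub_zero]
  have hL : ∀ τ ∈ Icc a b, ∫ s in (0 : ℝ)..1, famLagrangian om G (Icc 0 1) r (s, τ)
      = r τ - lineIntegral om (fun s => G (s, τ)) (Icc 0 1) 0 1 := by
    intro τ hτ
    have h3 : IntervalIntegrable (fun s => formE om (G (s, τ)) (velE n (fun σ => G (σ, τ))
        (Icc 0 1) s)) volume 0 1 := by
      refine ContinuousOn.intervalIntegrable ?_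
      rw [uIcc_of_le zero_le_one]
      exact (contDiffOn_form_velocity om (hgeo τ hτ).1.1
        (uniqueDiffOn_Icc (zero_lt_one' ℝ))).continuousOn
    have h4 := intervalIntegral.integral_sub
      (intervalIntegrable_const (c := r τ) (μ := volume) (a := (0 : ℝ)) (b := 1)) h3
    rw [intervalIntegral.integral_const, sub_zero, one_smul] at h4
    exact h4
  rw [h0, hL a ⟨le_rfl, hab.le⟩, hL b ⟨hab.le, le_rfl⟩] at h1
  linarith

end FirstVariationFormula

noncomputable section ActionDerivative

variable {n : ℕ} [NeZero n] {N : Type*} [TopologicalSpace N] [T2Space N]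
  [ChartedSpace (EuclideanHalfSpace n) N] [IsManifold (𝓡∂ n) ∞ N]

local notation "𝔼" => EuclideanSpace ℝ (Fin n)

variable {om : SmoothOneForm (𝓡∂ n) N} {h : RMetric n N} {a b : ℝ}

theorem IsSpeedGeodesicOn.congr {γ γ' : ℝ → N} {k : ℝ} {J : Set ℝ} (hJ : UniqueDiffOn ℝ J)
    (hγ : IsSpeedGeodesicOn h om k γ J) (he : EqOn γ' γ J) : IsSpeedGeodesicOn h om k γ' J := by
  have hsm : ContMDiffOn 𝓘(ℝ, ℝ) (𝓡∂ n) ∞ γ' J := hγ.1.1.congr he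
  refine ⟨⟨hsm, fun σ hσ => ?_⟩, fun σ hσ => ?_⟩
  · have hp : γ' σ ∈ (extChartAt (𝓡∂ n) (γ' σ)).source := mem_extChartAt_source _
    have hp2 : γ σ ∈ (extChartAt (𝓡∂ n) (γ' σ)).source := (he hσ) ▸ hp
    refine (covAccel_iff_magEqAt_chart h om (hsm σ hσ) hJ hσ hp).2 ?_
    have h1 := (covAccel_iff_magEqAt_chart h om (hγ.1.1 σ hσ) hJ hσ hp2).1 (hγ.1.2 σ hσ)
    have h2 : EqOn (fun τ => extChartAt (𝓡∂ n) (γ' σ) (γ' τ))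
        (fun τ => extChartAt (𝓡∂ n) (γ' σ) (γ τ)) J := fun τ hτ => by
      simp only [he hτ]
    have h3 : EqOn (derivWithin (fun τ => extChartAt (𝓡∂ n) (γ' σ) (γ' τ)) J)
        (derivWithin (fun τ => extChartAt (𝓡∂ n) (γ' σ) (γ τ)) J) J := fun τ hτ =>
      derivWithin_congr h2 (h2 hτ)
    rw [derivWithin_congr h3 (h3 hσ), h3 hσ,
      show extChartAt (𝓡∂ n) (γ' σ) (γ' σ) = extChartAt (𝓡∂ n) (γ' σ) (γ σ) from h2 hσ]
    exact h1
  · have h1 : normE h (γ' σ) (velE n γ' J σ) = normE h (γ σ) (velE n γ J σ) := by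
      rw [velE_congr hσ he, he hσ]
    exact h1.trans (hγ.2 σ hσ)

/-- The unit velocity with which the magnetic geodesic from `x` arrives at `y`. -/
def arrivalVel (h : RMetric n N) (om : SmoothOneForm (𝓡∂ n) N) (x y : N) :
    EuclideanSpace ℝ (Fin n) :=
  Classical.epsilon fun w => ∃ ℓ γ, 0 < ℓ ∧ IsUnitMagneticGeodesicOn h om γ (Icc 0 ℓ) ∧
    γ 0 = x ∧ γ ℓ = y ∧ w = velE n γ (Icc 0 ℓ) ℓ

/-- The unit velocity with which the magnetic geodesic to `y` departs from `x`. -/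
def departVel (h : RMetric n N) (om : SmoothOneForm (𝓡∂ n) N) (x y : N) :
    EuclideanSpace ℝ (Fin n) :=
  (normE h x (mlog h om x y))⁻¹ • mlog h om x y

theorem MagneticExpIsDiffeo.unit_unique {x : N} (H : MagneticExpIsDiffeo h om x) {ℓ ℓ' : ℝ}
    {γ γ' : ℝ → N} (hℓ : 0 < ℓ) (hγ : IsUnitMagneticGeodesicOn h om γ (Icc 0 ℓ)) (h0 : γ 0 = x)
    (hℓ' : 0 < ℓ') (hγ' : IsUnitMagneticGeodesicOn h om γ' (Icc 0 ℓ')) (h0' : γ' 0 = x)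
    (h1 : γ ℓ = γ' ℓ') : ℓ = ℓ' ∧ EqOn γ γ' (Icc 0 ℓ) := by
  have h2 := (H.mlog_eq_of_unit hℓ hγ h0 h1).trans (H.mlog_eq_of_unit hℓ' hγ' h0' rfl).symm
  have h3 : normE h x (velE n γ (Icc 0 ℓ) 0) = 1 := by
    rw [← h0]; exact hγ.2 0 ⟨le_rfl, hℓ.le⟩
  have h4 : normE h x (velE n γ' (Icc 0 ℓ') 0) = 1 := by
    rw [← h0']; exact hγ'.2 0 ⟨le_rfl, hℓ'.le⟩
  obtain rfl : ℓ = ℓ' := by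
    have h5 := congrArg (normE h x) h2
    rwa [normE_smul, normE_smul, h3, h4, mul_one, mul_one, abs_of_pos hℓ, abs_of_pos hℓ'] at h5
  exact ⟨rfl, IsUnitMagneticGeodesicOn.eqOn hℓ le_rfl hγ hγ' (h0.trans h0'.symm)
    (smul_right_injective 𝔼 hℓ.ne' h2)⟩

theorem MagneticExpIsDiffeo.arrivalVel_eq {x : N} (H : MagneticExpIsDiffeo h om x) {ℓ : ℝ}
    {γ : ℝ → N} (hℓ : 0 < ℓ) (hγ : IsUnitMagneticGeodesicOn h om γ (Icc 0 ℓ)) (h0 : γ 0 = x) :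
    arrivalVel h om x (γ ℓ) = velE n γ (Icc 0 ℓ) ℓ := by
  have hex : ∃ w : 𝔼, ∃ ℓ' γ', 0 < ℓ' ∧ IsUnitMagneticGeodesicOn h om γ' (Icc 0 ℓ') ∧
      γ' 0 = x ∧ γ' ℓ' = γ ℓ ∧ w = velE n γ' (Icc 0 ℓ') ℓ' := ⟨_, ℓ, γ, hℓ, hγ, h0, rfl, rfl⟩
  obtain ⟨ℓ', γ', hℓ', hγ', h0', h1', hw⟩ := Classical.epsilon_spec hex
  obtain ⟨rfl, he⟩ := H.unit_unique hℓ hγ h0 hℓ' hγ' h0' h1'.symm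
  have hm : ℓ ∈ Icc 0 ℓ := ⟨hℓ.le, le_rfl⟩
  exact hw.trans (velE_congr hm he).symm

theorem MagneticExpIsDiffeo.departVel_eq {x : N} (H : MagneticExpIsDiffeo h om x) {ℓ : ℝ}
    {γ : ℝ → N} (hℓ : 0 < ℓ) (hγ : IsUnitMagneticGeodesicOn h om γ (Icc 0 ℓ)) (h0 : γ 0 = x) :
    departVel h om x (γ ℓ) = velE n γ (Icc 0 ℓ) 0 := by
  have h3 : normE h x (velE n γ (Icc 0 ℓ) 0) = 1 := by
    rw [← h0]; exact hγ.2 0 ⟨le_rfl, hℓ.le⟩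
  unfold departVel
  rw [← H.mlog_eq_of_unit hℓ hγ h0 rfl, normE_smul, h3, abs_of_pos hℓ, mul_one,
    inv_smul_smul₀ hℓ.ne']

theorem IsSpeedGeodesicOn.arrivalVel_eq {γ : ℝ → N} {r : ℝ} (hr : 0 < r)
    (hγ : IsSpeedGeodesicOn h om r γ (Icc 0 1)) (H : MagneticExpIsDiffeo h om (γ 0)) :
    arrivalVel h om (γ 0) (γ 1) = r⁻¹ • velE n γ (Icc 0 1) 1 := by
  obtain ⟨h1, h2, -⟩ := hγ.reparam (c := r⁻¹) (d := 0) one_pos (inv_pos.2 hr)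
  have e1 : ((0 : ℝ) - 0) / r⁻¹ = 0 := by simp
  have e2 : ((1 : ℝ) - 0) / r⁻¹ = r := by simp
  rw [e1, e2, inv_mul_cancel₀ hr.ne'] at h1
  rw [e1, e2] at h2
  have h3 := H.arrivalVel_eq hr (isUnitMagneticGeodesicOn_iff.2 h1) (by simp)
  have h4 : r⁻¹ * r + 0 = 1 := by rw [inv_mul_cancel₀ hr.ne', add_zero]
  rw [h2 r ⟨hr.le, le_rfl⟩, h4] at h3
  exact h3

theorem contDiffWithinAt_normE {f : ℝ → 𝔼} {J : Set ℝ} {t : ℝ} (x : N)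
    (hf : ContDiffWithinAt ℝ ∞ f J t) (h0 : f t ≠ 0) :
    ContDiffWithinAt ℝ ∞ (fun τ => normE h x (f τ)) J t := by
  have h1 : ContDiffWithinAt ℝ ∞ (fun τ => innerE h x (f τ) (f τ)) J t :=
    (contDiffWithinAt_const.clm_apply hf).clm_apply hf
  exact h1.sqrt (innerE_pos h x h0).ne'

/-- The rate of change of the action `𝔸(x, y(τ))`. -/
def actionRate (h : RMetric n N) (om : SmoothOneForm (𝓡∂ n) N) (x : N) (y : ℝ → N) (J : Set ℝ)
    (τ : ℝ) : ℝ :=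
  innerE h (y τ) (arrivalVel h om x (y τ)) (velE n y J τ) - formE om (y τ) (velE n y J τ)

theorem MagneticExpIsDiffeo.segment_eq {x : N} (H : MagneticExpIsDiffeo h om x) :
    ∃ e : 𝔼 → N, ContMDiffOn 𝓘(ℝ, 𝔼) (𝓡∂ n) 1 e (range (mlog h om x)) ∧
      ContMDiffOn 𝓘(ℝ, 𝔼) (𝓡∂ n) ∞ e (range (mlog h om x) \ {0}) ∧
      (∀ y, e (mlog h om x y) = y) ∧
      ∀ y, x ≠ y → (∀ s ∈ Icc (0 : ℝ) 1, s • mlog h om x y ∈ range (mlog h om x)) ∧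
        IsSpeedGeodesicOn h om (normE h x (mlog h om x y)) (fun s => e (s • mlog h om x y))
          (Icc 0 1) := by
  obtain ⟨e, -, he, h1, h2, -, -⟩ := H.exists_inverse
  refine ⟨e, h1, h2, he, fun y hxy => ?_⟩
  obtain ⟨γ, hγ, rfl, rfl, hv⟩ := H.exists_segment hxy
  have hr : 0 < normE h (γ 0) (mlog h om (γ 0) (γ 1)) := normE_pos h _ (H.mlog_ne_zero hxy)
  have key : ∀ s ∈ Icc (0 : ℝ) 1, mlog h om (γ 0) (γ s) = s • mlog h om (γ 0) (γ 1) := by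
    intro s hs
    rcases hs.1.eq_or_lt with rfl | hs0
    · rw [H.mlog_self, zero_smul]
    · have h3 := (hγ.mlog_and_action hr (uniqueDiffOn_Icc one_pos) hs0
        (Icc_subset_Icc le_rfl hs.2) H).1
      rw [h3, hv, sub_zero]
  refine ⟨fun s hs => ⟨γ s, key s hs⟩, hγ.congr (uniqueDiffOn_Icc one_pos) fun s hs => ?_⟩
  rw [← key s hs, he]

theorem MagneticExpIsDiffeo.action_integral {x : N} (H : MagneticExpIsDiffeo h om x) (hab : a < b)
    {y : ℝ → N} (hy : ContMDiffOn 𝓘(ℝ, ℝ) (𝓡∂ n) ∞ y (Icc a b)) (hyx : ∀ τ ∈ Icc a b, x ≠ y τ) :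
    ContinuousOn (actionRate h om x y (Icc a b)) (Icc a b) ∧
      magneticAction h om x (y b) - magneticAction h om x (y a)
        = ∫ τ in a..b, actionRate h om x y (Icc a b) τ := by
  obtain ⟨e, he1, he2, he3, hseg⟩ := H.segment_eq
  obtain ⟨-, -, -, -, -, -, hl⟩ := H.exists_inverse
  set L : ℝ → 𝔼 := fun τ => mlog h om x (y τ) with hL
  have hLs : ContDiffOn ℝ ∞ L (Icc a b) :=
    contMDiffOn_iff_contDiffOn.1 (hl.comp hy fun τ hτ => (hyx τ hτ).symm)
  have hL0 : ∀ τ ∈ Icc a b, L τ ≠ 0 := fun τ hτ => H.mlog_ne_zero (hyx τ hτ)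
  set r : ℝ → ℝ := fun τ => normE h x (L τ) with hr
  have hr0 : ∀ τ ∈ Icc a b, 0 < r τ := fun τ hτ => normE_pos h x (hL0 τ hτ)
  have hrs : ContDiffOn ℝ ∞ r (Icc a b) := fun τ hτ =>
    contDiffWithinAt_normE x (hLs τ hτ) (hL0 τ hτ)
  set G : ℝ × ℝ → N := fun P => e (P.1 • L P.2) with hG
  have hin : ContDiffOn ℝ ∞ (fun P : ℝ × ℝ => P.1 • L P.2) (Icc 0 1 ×ˢ Icc a b) :=
    contDiffOn_fst.smul (hLs.comp contDiffOn_snd fun P hP => hP.2)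
  have hmaps : MapsTo (fun P : ℝ × ℝ => P.1 • L P.2) (Icc 0 1 ×ˢ Icc a b) (range (mlog h om x)) :=
    fun P hP => (hseg _ (hyx _ hP.2)).1 _ hP.1
  have hG1 : ContMDiffOn 𝓘(ℝ, ℝ × ℝ) (𝓡∂ n) 1 G (Icc 0 1 ×ˢ Icc a b) :=
    he1.comp (contMDiffOn_iff_contDiffOn.2 (hin.of_le ENat.LEInfty.out)) hmaps
  have hsub : Ioo (0 : ℝ) 1 ×ˢ Ioo a b ⊆ Icc 0 1 ×ˢ Icc a b :=
    prod_mono Ioo_subset_Icc_self Ioo_subset_Icc_self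
  have hGi : ContMDiffOn 𝓘(ℝ, ℝ × ℝ) (𝓡∂ n) ∞ G (Ioo 0 1 ×ˢ Ioo a b) :=
    he2.comp (contMDiffOn_iff_contDiffOn.2 (hin.mono hsub)) fun P hP =>
      ⟨hmaps (hsub hP), fun h0 => (smul_eq_zero.1 h0).elim hP.1.1.ne' (hL0 _ (hsub hP).2)⟩
  have hgeo : ∀ τ ∈ Icc a b, IsSpeedGeodesicOn h om (r τ) (fun s => G (s, τ)) (Icc 0 1) :=
    fun τ hτ => (hseg _ (hyx τ hτ)).2
  have hG0 : ∀ τ, G (0, τ) = x := fun τ => by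
    have h1 := he3 x
    rw [H.mlog_self] at h1
    simp only [hG, zero_smul, h1]
  have hGy : ∀ τ, G (1, τ) = y τ := fun τ => by
    simp only [hG, one_smul]
    exact he3 _
  have hA : ∀ τ ∈ Icc a b, magneticAction h om x (y τ)
      = r τ - lineIntegral om (fun s => G (s, τ)) (Icc 0 1) 0 1 := by
    intro τ hτ
    have h1 := ((hgeo τ hτ).mlog_and_action (hr0 τ hτ) (uniqueDiffOn_Icc one_pos) one_pos le_rfl
      (by rw [hG0]; exact H)).2
    rw [hG0, hGy, sub_zero, mul_one] at h1
    exact h1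
  have hrate : ∀ τ ∈ Icc a b, famMomentum h om G (Icc 0 1) (Icc a b) r (1, τ)
      = actionRate h om x y (Icc a b) τ := by
    intro τ hτ
    have h1 := (hgeo τ hτ).arrivalVel_eq (hr0 τ hτ) (by rw [hG0]; exact H)
    rw [hG0, hGy] at h1
    simp only [famMomentum, actionRate, h1, hGy, map_smul, smul_apply, smul_eq_mul]
    ring
  have hcont := (continuousOn_fam (h := h) (om := om) hab hG1 hrs.continuousOn hr0).2
  constructor
  · have h1 : ContinuousOn (fun τ : ℝ => famMomentum h om G (Icc 0 1) (Icc a b) r (1, τ))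
        (Icc a b) := hcont.comp (by fun_prop) fun τ hτ => ⟨⟨zero_le_one, le_rfl⟩, hτ⟩
    exact h1.congr fun τ hτ => (hrate τ hτ).symm
  · rw [hA b ⟨hab.le, le_rfl⟩, hA a ⟨le_rfl, hab.le⟩, first_variation hab hGi hG1 hgeo hr0
      hrs.continuousOn (fun τ hτ => ((hrs τ (Ioo_subset_Icc_self hτ)).contDiffAt
        (Icc_mem_nhds hτ.1 hτ.2)).differentiableAt (by simp)) (fun τ _ => hG0 τ)]
    refine intervalIntegral.integral_congr fun τ hτ => hrate τ ?_
    rwa [uIcc_of_le hab.le] at hτ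

theorem MagneticExpIsDiffeo.hasDerivWithinAt_action {x : N} (H : MagneticExpIsDiffeo h om x)
    (hab : a < b) {y : ℝ → N} (hy : ContMDiffOn 𝓘(ℝ, ℝ) (𝓡∂ n) ∞ y (Icc a b))
    (hyx : ∀ τ ∈ Icc a b, x ≠ y τ) :
    ContinuousOn (actionRate h om x y (Icc a b)) (Icc a b) ∧
      ∀ τ ∈ Icc a b, HasDerivWithinAt (fun τ => magneticAction h om x (y τ))
        (actionRate h om x y (Icc a b) τ) (Icc a b) τ := by
  obtain ⟨hc, -⟩ := H.action_integral hab hy hyx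
  refine ⟨hc, ?_⟩
  set g := actionRate h om x y (Icc a b) with hg
  have key : ∀ τ ∈ Icc a b, magneticAction h om x (y τ) = magneticAction h om x (y a)
      + ∫ s in a..τ, IccExtend hab.le (fun s : Icc a b => g s) s := by
    intro τ hτ
    rcases hτ.1.eq_or_lt with rfl | hlt
    · simp
    · have hsub : Icc a τ ⊆ Icc a b := Icc_subset_Icc le_rfl hτ.2
      have h1 := (H.action_integral hlt (hy.mono hsub) fun s hs => hyx s (hsub hs)).2
      have h2 : ∫ s in a..τ, actionRate h om x y (Icc a τ) s
          = ∫ s in a..τ, IccExtend hab.le (fun s : Icc a b => g s) s := by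
        refine intervalIntegral.integral_congr fun s hs => ?_
        rw [uIcc_of_le hlt.le] at hs
        have h3 : velE n y (Icc a τ) s = velE n y (Icc a b) s :=
          velocity_mono ((hy s (hsub hs)).mdifferentiableWithinAt (by simp))
            (uniqueDiffOn_Icc hlt s hs) hsub
        have h4 : IccExtend hab.le (fun s : Icc a b => g s) s = g s :=
          IccExtend_of_mem hab.le _ (hsub hs)
        simp only [h4]
        simp only [hg, actionRate, h3]
      rw [← h2, ← h1]
      ring
  intro τ hτ
  have h1 := ((hasDerivAt_integral_IccExtend hab.le hc τ).const_add
    (magneticAction h om x (y a))).hasDerivWithinAt (s := Icc a b)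
  have h2 : IccExtend hab.le (fun s : Icc a b => g s) τ = g τ := IccExtend_of_mem hab.le _ hτ
  rw [h2] at h1
  exact h1.congr key (key τ hτ)

end ActionDerivative

noncomputable section BoundaryConnected

variable {n : ℕ} [NeZero n] {N : Type*} [TopologicalSpace N] [T2Space N]
  [ChartedSpace (EuclideanHalfSpace n) N] [IsManifold (𝓡∂ n) ∞ N]

local notation "𝔼" => EuclideanSpace ℝ (Fin n)

variable {om : SmoothOneForm (𝓡∂ n) N} {h : RMetric n N}

theorem MagneticExpIsDiffeo.range_mlog_mem_nhds {x y : N} (H : MagneticExpIsDiffeo h om x)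
    (hy : y ∈ (𝓡∂ n).interior N) : range (mlog h om x) ∈ 𝓝 (mlog h om x y) := by
  obtain ⟨e, -, he, he1, -, hl, -⟩ := H.exists_inverse
  set φ := extChartAt (𝓡∂ n) y with hφ
  have hys : y ∈ φ.source := mem_extChartAt_source y
  set z := φ y with hz
  have htar : φ.target ∈ 𝓝 z := by
    have h1 : z ∈ interior (range (𝓡∂ n)) := by
      rw [interior_range_halfSpace]; exact (isInteriorPoint_iff_chart hys).1 hy
    have h2 := extChartAt_target_mem_nhdsWithin (I := 𝓡∂ n) y
    rwa [nhdsWithin_eq_nhds.2 (mem_interior_iff_mem_nhds.1 h1)] at h2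
  set F : 𝔼 → 𝔼 := fun w => mlog h om x (φ.symm w) with hF
  have hFz : F z = mlog h om x y := congrArg (mlog h om x) (φ.left_inv hys)
  have hF1 : ContDiffAt ℝ 1 F z := by
    have h1 : ContMDiffOn 𝓘(ℝ, 𝔼) 𝓘(ℝ, 𝔼) 1 F φ.target :=
      hl.comp_contMDiffOn ((contMDiffOn_extChartAt_symm (n := ∞) y).of_le ENat.LEInfty.out)
    exact (contMDiffOn_iff_contDiffOn.1 h1).contDiffAt htar
  have hFd := (hF1.hasStrictFDerivAt one_ne_zero)
  have hE : DifferentiableWithinAt ℝ (fun w => φ (e w)) (range (mlog h om x)) (F z) := by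
    have h2 : e (F z) = y := by rw [hFz, he]
    have h3 : e (F z) ∈ (chartAt (EuclideanHalfSpace n) y).source := by
      rw [h2]; exact mem_chart_source _ y
    have h1 := ((contMDiffAt_extChartAt' (n := ∞) (I := 𝓡∂ n) h3).of_le
      (show (1 : WithTop ℕ∞) ≤ ∞ from ENat.LEInfty.out)).comp_contMDiffWithinAt (F z)
      (he1 (F z) ⟨_, rfl⟩)
    exact (contMDiffWithinAt_iff_contDiffWithinAt.1 h1).differentiableWithinAt one_ne_zero
  have hcomp := hE.hasFDerivWithinAt.comp_hasFDerivAt z hFd.hasFDerivAt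
    (Eventually.of_forall fun w => ⟨_, rfl⟩)
  have hid : ((fun w => φ (e w)) ∘ F) =ᶠ[𝓝 z] id := by
    filter_upwards [htar] with w hw
    simp only [Function.comp_apply, hF, he, id]
    exact φ.right_inv hw
  have hinv := (hcomp.congr_of_eventuallyEq hid.symm).unique (hasFDerivAt_id z)
  have hinj : Function.Injective (fderiv ℝ F z) := by
    intro u v huv
    have h1 := DFunLike.congr_fun hinv u
    have h2 := DFunLike.congr_fun hinv v
    simp only [ContinuousLinearMap.comp_apply, ContinuousLinearMap.id_apply] at h1 h2
    rw [← h1, ← h2, huv]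
  have hsurj : (fderiv ℝ F z).range = ⊤ :=
    LinearMap.range_eq_top.2 (LinearMap.injective_iff_surjective.1 hinj)
  have hmap := hFd.map_nhds_eq_of_surj hsurj
  rw [← hFz, ← hmap]
  exact mem_map.2 (univ_mem' fun w => ⟨_, rfl⟩)

theorem IsSimpleMagnetic.isPreconnected_boundary [CompactSpace N] (hn : 2 ≤ n)
    (hs : IsSimpleMagnetic h om) : IsPreconnected ((𝓡∂ n).boundary N) := by
  by_cases hsub : ((𝓡∂ n).boundary N).Subsingleton
  · exact hsub.isPreconnected
  rw [not_subsingleton_iff] at hsub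
  obtain ⟨p, hp, q, hq, hpq⟩ := hsub
  obtain ⟨x, hx⟩ : ∃ x, x ∈ (𝓡∂ n).interior N := by
    obtain ⟨ℓ, γ, X, Y, hch, -, -⟩ := hs.exists_chord hp hq hpq
    exact ⟨γ (ℓ / 2), hch.2.2.2.2.1 _ ⟨half_pos hch.1, half_lt_self hch.1⟩⟩
  have H := hs.1 x
  obtain ⟨e, -, he, -, -, hl, -⟩ := H.exists_inverse
  obtain ⟨e', -, -, he', hseg⟩ := H.segment_eq
  set l := mlog h om x with hldef
  have hlc : Continuous l := hl.continuous
  have hne : ∀ y ∈ (𝓡∂ n).boundary N, x ≠ y := by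
    rintro y hy rfl
    exact boundary_not_interior hy hx
  have hl0 : ∀ y ∈ (𝓡∂ n).boundary N, l y ≠ 0 := fun y hy => H.mlog_ne_zero (hne y hy)
  set ρ : N → 𝔼 := fun y => ‖l y‖⁻¹ • l y with hρ
  have hρc : ContinuousOn ρ ((𝓡∂ n).boundary N) :=
    (hlc.norm.continuousOn.inv₀ fun y hy => norm_ne_zero_iff.2 (hl0 y hy)).smul hlc.continuousOn
  have hinj : InjOn ρ ((𝓡∂ n).boundary N) := by
    have key : ∀ y₁ ∈ (𝓡∂ n).boundary N, ∀ y₂ ∈ (𝓡∂ n).boundary N, ρ y₁ = ρ y₂ →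
        ‖l y₂‖ ≤ ‖l y₁‖ := by
      intro y₁ h₁ y₂ h₂ he12
      by_contra hlt
      push Not at hlt
      have n1 := norm_pos_iff.2 (hl0 y₁ h₁)
      have n2 := norm_pos_iff.2 (hl0 y₂ h₂)
      have h3 : l y₁ = (‖l y₁‖ / ‖l y₂‖) • l y₂ := by
        have h4 := congrArg (fun w => ‖l y₁‖ • w) he12
        simp only [hρ, smul_inv_smul₀ n1.ne'] at h4
        rw [div_eq_mul_inv, mul_smul]
        exact h4
      have h5 := (hseg y₂ (hne y₂ h₂)).2.mem_interior hs.2 (normE_pos h x (hl0 y₂ h₂))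
        (t := ‖l y₁‖ / ‖l y₂‖) ⟨div_pos n1 n2, (div_lt_one n2).2 hlt⟩
      rw [← h3, he'] at h5
      exact boundary_not_interior h₁ h5
    intro y₁ h₁ y₂ h₂ he12
    have h3 : ‖l y₁‖ = ‖l y₂‖ := le_antisymm (key _ h₂ _ h₁ he12.symm) (key _ h₁ _ h₂ he12)
    have h4 : ‖l y₁‖⁻¹ • l y₁ = ‖l y₂‖⁻¹ • l y₂ := he12
    rw [h3] at h4
    exact H.mlog_injective (smul_right_injective 𝔼
      (inv_ne_zero (norm_ne_zero_iff.2 (hl0 y₂ h₂))) h4)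
  have hsurj : ∀ u ∈ Metric.sphere (0 : 𝔼) 1, ∃ y ∈ (𝓡∂ n).boundary N, ρ y = u := by
    intro u hu
    have hu1 : ‖u‖ = 1 := by simpa using hu
    have hD : IsCompact (range l) := isCompact_range hlc
    set T : Set ℝ := {s | 0 ≤ s ∧ s • u ∈ range l} with hT
    have hT0 : (0 : ℝ) ∈ T := ⟨le_rfl, x, by rw [zero_smul]; exact H.mlog_self⟩
    have hTc : IsCompact T := by
      obtain ⟨C, hC⟩ := hD.isBounded.exists_norm_le
      refine Metric.isCompact_of_isClosed_isBounded ?_ ?_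
      · exact isClosed_Ici.inter (hD.isClosed.preimage (continuous_id.smul continuous_const))
      · refine isBounded_iff_forall_norm_le.2 ⟨C, fun s hs => ?_⟩
        have := hC _ hs.2
        rwa [norm_smul, hu1, mul_one] at this
    obtain ⟨s, hsT, hmax⟩ := hTc.exists_isMaxOn ⟨0, hT0⟩ continuousOn_id
    obtain ⟨y, hy⟩ := hsT.2
    have hyb : y ∈ (𝓡∂ n).boundary N := by
      rw [← ModelWithCorners.compl_interior]
      intro hyi
      have h1 := H.range_mlog_mem_nhds hyi
      rw [← hldef, hy] at h1
      have h2 : ∀ᶠ t : ℝ in 𝓝 s, t • u ∈ range l :=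
        (continuous_id.smul continuous_const).continuousAt.eventually_mem h1
      obtain ⟨t, ht1, ht2⟩ := ((h2.filter_mono nhdsWithin_le_nhds).and
        (self_mem_nhdsWithin : Ioi s ∈ 𝓝[>] s)).exists
      have h3 := hmax (show t ∈ T from ⟨hsT.1.trans (le_of_lt ht2), ht1⟩)
      exact absurd ht2 (not_lt.2 h3)
    have hs0 : 0 < s := by
      refine lt_of_le_of_ne hsT.1 fun h0 => hl0 y hyb ?_
      rw [hy, ← h0, zero_smul]
    refine ⟨y, hyb, ?_⟩
    simp only [hρ]
    rw [hy, norm_smul, hu1, mul_one, Real.norm_of_nonneg hs0.le, inv_smul_smul₀ hs0.ne']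
  have hbc : IsClosed ((𝓡∂ n).boundary N) :=
    ModelWithCorners.isClosed_boundary (n := ∞) (by simp)
  have hsph : IsPreconnected (Metric.sphere (0 : 𝔼) 1) := by
    refine isPreconnected_sphere ?_ 0 1
    rw [rank_eq_card_basis (EuclideanSpace.basisFun (Fin n) ℝ).toBasis]
    simp only [Fintype.card_fin]
    exact_mod_cast hn
  rw [isPreconnected_closed_iff] at hsph ⊢
  intro t t' ht ht' hcov ⟨y, hy1, hy2⟩ ⟨y', hy1', hy2'⟩
  have himg : ∀ t : Set N, IsClosed t → IsClosed (ρ '' ((𝓡∂ n).boundary N ∩ t)) := fun t ht =>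
    (((hbc.inter ht).isCompact).image_of_continuousOn (hρc.mono inter_subset_left)).isClosed
  have hmem : ∀ y ∈ (𝓡∂ n).boundary N, ρ y ∈ Metric.sphere (0 : 𝔼) 1 := fun y hy => by
    simp only [hρ, mem_sphere_zero_iff_norm, norm_smul, norm_inv, norm_norm]
    exact inv_mul_cancel₀ (norm_ne_zero_iff.2 (hl0 y hy))
  obtain ⟨u, -, ⟨a, ha, hau⟩, b, hb, hbu⟩ := hsph _ _ (himg t ht) (himg t' ht')
    (fun u hu => by
      obtain ⟨y, hy, rfl⟩ := hsurj u hu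
      exact (hcov hy).imp (fun h1 => ⟨y, ⟨hy, h1⟩, rfl⟩) fun h1 => ⟨y, ⟨hy, h1⟩, rfl⟩)
    ⟨ρ y, hmem y hy1, y, ⟨hy1, hy2⟩, rfl⟩ ⟨ρ y', hmem y' hy1', y', ⟨hy1', hy2'⟩, rfl⟩
  have hab := hinj ha.1 hb.1 (hau.trans hbu.symm)
  exact ⟨a, ha.1, ha.2, hab ▸ hb.2⟩

end BoundaryConnected

noncomputable section LogContinuity

variable {n : ℕ} [NeZero n] {N : Type*} [TopologicalSpace N] [T2Space N]
  [ChartedSpace (EuclideanHalfSpace n) N] [IsManifold (𝓡∂ n) ∞ N]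

local notation "𝔼" => EuclideanSpace ℝ (Fin n)

variable {om : SmoothOneForm (𝓡∂ n) N} {h : RMetric n N}

theorem isSpeedGeodesicOn_const (p : N) (J : Set ℝ) :
    IsSpeedGeodesicOn h om 0 (fun _ => p) J := by
  refine ⟨⟨contMDiffOn_const, fun σ hσ e => ?_⟩, fun σ hσ => ?_⟩
  · have h0 : ∀ (z : 𝔼) (v : 𝔼), chartMetric (𝓡∂ n) (hTensor h) p z 0 v = 0 := fun z v => by
      simp only [chartMetric, hTensor, map_zero, zero_apply]
    have h1 : ∀ u v : 𝔼, chartMetricDeriv (𝓡∂ n) (hTensor h) p 0 u v = 0 := fun u v => by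
      simp only [chartMetricDeriv, map_zero]
    have h2 : ∀ u : 𝔼, chartMetricDeriv (𝓡∂ n) (hTensor h) p u 0 0 = 0 := fun u => by
      simp only [chartMetricDeriv, h0]
      simp
    have h3 : (0 : ℝ) = chartMetric (𝓡∂ n) (hTensor h) p (extChartAt (𝓡∂ n) p p) 0
          (chartVec (𝓡∂ n) p e) + christoffel (𝓡∂ n) (hTensor h) p 0 0 (chartVec (𝓡∂ n) p e) := by
      rw [h0, christoffel, h1, h2]
      simp
    simpa [hTensor] using h3
  · have h1 : normE h p (velE n (fun _ => p) J σ) = 0 := by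
      rw [velE_const hσ fun _ _ => rfl, normE_zero]
    rw [abs_zero]
    exact h1

theorem IsSpeedGeodesicOn.const_of_zero {γ : ℝ → N} {a b t : ℝ} (hab : a < b)
    (hγ : IsSpeedGeodesicOn h om 0 γ (Icc a b)) (ht : t ∈ Icc a b) : γ t = γ a := by
  have ha : a ∈ Icc a b := ⟨le_rfl, hab.le⟩
  have h0 : velE n γ (Icc a b) a = 0 := by
    by_contra hne
    have h1 := normE_pos h (γ a) hne
    have h2 : normE h (γ a) (velE n γ (Icc a b) a) = |0| := hγ.2 a ha
    rw [abs_zero] at h2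
    linarith
  have h2 : velE n (fun _ => γ a) (Icc a b) a = 0 := velE_const ha fun _ _ => rfl
  exact hγ.unique hab (isSpeedGeodesicOn_const (γ a) _) rfl (h0.trans h2.symm) ht

theorem IsSpeedGeodesicOn.mlog_eq {γ : ℝ → N} {r : ℝ} (hr : 0 ≤ r)
    (hγ : IsSpeedGeodesicOn h om r γ (Icc 0 1)) (H : MagneticExpIsDiffeo h om (γ 0)) :
    mlog h om (γ 0) (γ 1) = velE n γ (Icc 0 1) 0 := by
  rcases hr.eq_or_lt with rfl | hr
  · have h1 := fun t ht => hγ.const_of_zero (t := t) one_pos ht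
    have h0 : (0 : ℝ) ∈ Icc (0 : ℝ) 1 := ⟨le_rfl, zero_le_one⟩
    rw [h1 1 ⟨zero_le_one, le_rfl⟩, H.mlog_self, velE_const (x := γ 0) h0 h1]
  · have h1 := (hγ.mlog_and_action hr (uniqueDiffOn_Icc one_pos) one_pos Subset.rfl H).1
    rwa [sub_zero, one_smul] at h1

theorem IsSpeedGeodesicOn.normE_mlog {γ : ℝ → N} {r : ℝ} (hr : 0 ≤ r)
    (hγ : IsSpeedGeodesicOn h om r γ (Icc 0 1)) (H : MagneticExpIsDiffeo h om (γ 0)) :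
    normE h (γ 0) (mlog h om (γ 0) (γ 1)) = r := by
  rw [hγ.mlog_eq hr H]
  exact (hγ.2 0 ⟨le_rfl, zero_le_one⟩).trans (abs_of_nonneg hr)

theorem MagneticExpIsDiffeo.exists_geodesic {x : N} (H : MagneticExpIsDiffeo h om x) (y : N) :
    ∃ γ, IsSpeedGeodesicOn h om (normE h x (mlog h om x y)) γ (Icc 0 1) ∧ γ 0 = x ∧ γ 1 = y := by
  by_cases hxy : x = y
  · subst hxy
    refine ⟨fun _ => x, ?_, rfl, rfl⟩
    rw [H.mlog_self, normE_zero]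
    exact isSpeedGeodesicOn_const x _
  · obtain ⟨γ, h1, h2, h3, -⟩ := H.exists_segment hxy
    exact ⟨γ, h1, h2, h3⟩

variable [CompactSpace N]

theorem tendsto_geodesic_ultrafilter (H : ∀ x, MagneticExpIsDiffeo h om x) {ι : Type*}
    (𝓕 : Ultrafilter ι) {γ : ι → ℝ → N} {r : ι → ℝ} (hr : ∀ i, 0 ≤ r i)
    (hγ : ∀ i, IsSpeedGeodesicOn h om (r i) (γ i) (Icc 0 1)) {x y : N}
    (hx : Tendsto (fun i => γ i 0) 𝓕 (𝓝 x)) (hy : Tendsto (fun i => γ i 1) 𝓕 (𝓝 y)) :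
    Tendsto r 𝓕 (𝓝 (normE h x (mlog h om x y))) ∧
      Tendsto (fun i => chartVel n x (γ i) (Icc 0 1) 0) 𝓕 (𝓝 (mlog h om x y)) := by
  have h01 : (0 : ℝ) ∈ Icc (0 : ℝ) 1 := ⟨le_rfl, zero_le_one⟩
  have h11 : (1 : ℝ) ∈ Icc (0 : ℝ) 1 := ⟨zero_le_one, le_rfl⟩
  have hnt : (Icc (0 : ℝ) 1).Nontrivial := ⟨0, h01, 1, h11, zero_ne_one⟩
  have key : ∀ (k : ι → ℝ) (σ : ι → ℝ → N) (T : ℝ), (∀ i, k i ∈ Icc 0 T) →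
      (∀ i, IsSpeedGeodesicOn h om (k i) (σ i) (Icc 0 1)) →
      Tendsto (fun i => σ i 0) 𝓕 (𝓝 x) → ∃ X : ℝ → N, X 0 = x ∧
        Tendsto k 𝓕 (𝓝 (normE h x (mlog h om x (X 1)))) ∧
        Tendsto (fun i => σ i 1) 𝓕 (𝓝 (X 1)) ∧
        Tendsto (fun i => chartVel n x (σ i) (Icc 0 1) 0) 𝓕 (𝓝 (mlog h om x (X 1))) := by
    intro k σ T hk hσ hσ0
    obtain ⟨κ, hκ, hκl⟩ := isCompact_Icc.ultrafilter_le_nhds (𝓕.map k)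
      (tendsto_principal.2 (Eventually.of_forall hk))
    have hκt : Tendsto k 𝓕 (𝓝 κ) := hκl
    obtain ⟨X, hX, hXt, hXv⟩ := exists_limit_geodesic h om 𝓕 hκt ordConnected_Icc hnt hσ
    have hX0 : X 0 = x := tendsto_nhds_unique (hXt 0 h01) hσ0
    have h1 := hX.normE_mlog hκ.1 (H _)
    have h2 := hX.mlog_eq hκ.1 (H _)
    have h3 := hXv 0 h01
    rw [hX0] at h1 h2 h3
    refine ⟨X, hX0, h1 ▸ hκt, hXt 1 h11, ?_⟩
    rw [h2]
    exact h3
  obtain ⟨-, -, -, -, -, hl, -⟩ := (H x).exists_inverse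
  have hlc : Continuous fun y => normE h x (mlog h om x y) := by
    have h1 : Continuous fun w : 𝔼 => innerE h x w w := by fun_prop
    exact Real.continuous_sqrt.comp (h1.comp hl.continuous)
  obtain ⟨T, hT⟩ := (isCompact_range hlc).bddAbove
  have hT1 : ∀ y, normE h x (mlog h om x y) < max T 0 + 1 := fun y =>
    (hT ⟨y, rfl⟩).trans_lt ((le_max_left _ _).trans_lt (lt_add_one _))
  set T' := max T 0 + 1 with hT'
  have hT0 : 0 < T' := by positivity
  set c : ι → ℝ := fun i => if r i ≤ T' then 1 else T' / r i with hc
  have hc0 : ∀ i, 0 < c i ∧ c i ≤ 1 ∧ c i * r i ≤ T' ∧ (c i * r i < T' → c i = 1) := by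
    intro i
    by_cases hi : r i ≤ T'
    · have : c i = 1 := if_pos hi
      rw [this]
      exact ⟨one_pos, le_rfl, by rwa [one_mul], fun _ => rfl⟩
    · have h1 : c i = T' / r i := if_neg hi
      push Not at hi
      have h2 := hT0.trans hi
      rw [h1, div_mul_cancel₀ _ h2.ne']
      exact ⟨div_pos hT0 h2, ((div_lt_one h2).2 hi).le, le_rfl, fun h => absurd h (lt_irrefl _)⟩
  have hσ : ∀ i, IsSpeedGeodesicOn h om (c i * r i) (fun τ => γ i (c i * τ + 0)) (Icc 0 1) := by
    intro i
    have h1 := ((hγ i).reparam (d := 0) one_pos (hc0 i).1).1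
    refine h1.mono (uniqueDiffOn_Icc ?_) (uniqueDiffOn_Icc one_pos) (Icc_subset_Icc ?_ ?_)
    · rw [sub_zero, sub_zero, zero_div]; exact div_pos one_pos (hc0 i).1
    · simp
    · rw [sub_zero]; exact (one_le_div (hc0 i).1).2 (hc0 i).2.1
  obtain ⟨X, -, hXk, -, -⟩ := key _ _ T' (fun i => ⟨mul_nonneg (hc0 i).1.le (hr i), (hc0 i).2.2.1⟩)
    hσ (by simpa using hx)
  have hev : ∀ᶠ i in (𝓕 : Filter ι), r i ≤ T' := by
    filter_upwards [hXk.eventually_lt_const (hT1 _)] with i hi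
    have h1 := (hc0 i).2.2.2 hi
    rw [h1, one_mul] at hi
    exact hi.le
  set k : ι → ℝ := fun i => if r i ≤ T' then r i else 0 with hk
  set σ : ι → ℝ → N := fun i => if r i ≤ T' then γ i else fun _ => γ i 0 with hσ'
  have hke : k =ᶠ[𝓕] r := hev.mono fun i hi => if_pos hi
  have hσe : ∀ᶠ i in (𝓕 : Filter ι), σ i = γ i := hev.mono fun i hi => if_pos hi
  obtain ⟨X, -, h1, h2, h3⟩ := key k σ T' (fun i => by
      by_cases hi : r i ≤ T'
      · simp only [hk, if_pos hi]; exact ⟨hr i, hi⟩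
      · simp only [hk, if_neg hi]; exact ⟨le_rfl, hT0.le⟩)
    (fun i => by
      by_cases hi : r i ≤ T'
      · simp only [hk, hσ', if_pos hi]; exact hγ i
      · simp only [hk, hσ', if_neg hi]; exact isSpeedGeodesicOn_const _ _)
    (hx.congr' (hσe.mono fun i hi => (congrFun hi 0).symm))
  have hXy : X 1 = y := tendsto_nhds_unique h2 (hy.congr' (hσe.mono fun i hi => (congrFun hi 1).symm))
  rw [hXy] at h1 h3
  exact ⟨h1.congr' hke, h3.congr' (hσe.mono fun i hi => by rw [hi])⟩

end LogContinuity

noncomputable section DiagonalAsymptotics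

variable {n : ℕ} [NeZero n] {N : Type*} [TopologicalSpace N] [T2Space N]
  [ChartedSpace (EuclideanHalfSpace n) N] [IsManifold (𝓡∂ n) ∞ N]

local notation "𝔼" => EuclideanSpace ℝ (Fin n)

variable {om : SmoothOneForm (𝓡∂ n) N} {h : RMetric n N} {ι : Type*}

theorem continuous_normE (h : RMetric n N) (x : N) : Continuous (normE h x) := by
  have h1 : Continuous fun w : 𝔼 => innerE h x w w := by fun_prop
  exact Real.continuous_sqrt.comp h1

theorem tendsto_clm_apply {F G : Type*} [NormedAddCommGroup F] [NormedSpace ℝ F]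
    [NormedAddCommGroup G] [NormedSpace ℝ G] {l : Filter ι} {A : ι → F →L[ℝ] G} {A₀ : F →L[ℝ] G}
    {u : ι → F} {u₀ : F} (hA : Tendsto A l (𝓝 A₀)) (hu : Tendsto u l (𝓝 u₀)) :
    Tendsto (fun i => A i (u i)) l (𝓝 (A₀ u₀)) :=
  ((isBoundedBilinearMap_apply (𝕜 := ℝ) (E := F) (F := G)).continuous.tendsto (A₀, u₀)).comp
    (hA.prodMk_nhds hu)

theorem tendsto_chart_displacement {l : Filter ι} {q : N} {k T s : ι → ℝ} {R : ℝ}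
    {σ : ι → ℝ → N} (hk : ∀ᶠ i in l, k i ∈ Icc (-R) R)
    (hσ : ∀ᶠ i in l, IsSpeedGeodesicOn h om (k i) (σ i) (Icc 0 (T i)))
    (hs : ∀ᶠ i in l, 0 < s i ∧ s i ≤ T i) (hs0 : Tendsto s l (𝓝 0))
    (h0 : Tendsto (fun i => σ i 0) l (𝓝 q)) :
    Tendsto (fun i => (s i)⁻¹ • (chartCurve n q (σ i) (s i) - chartCurve n q (σ i) 0)
        - chartVel n q (σ i) (Icc 0 (T i)) 0) l (𝓝 0) ∧
      (∃ L, ∀ᶠ i in l, ‖chartVel n q (σ i) (Icc 0 (T i)) 0‖ ≤ L) ∧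
      (∀ᶠ i in l, ∀ t ∈ Icc 0 (s i), σ i t ∈ (extChartAt (𝓡∂ n) q).source) ∧
      ∀ t : ι → ℝ, (∀ᶠ i in l, t i ∈ Icc 0 (s i)) →
        Tendsto (fun i => chartCurve n q (σ i) (t i)) l (𝓝 (extChartAt (𝓡∂ n) q q)) ∧
        Tendsto (fun i => σ i (t i)) l (𝓝 q) ∧
        Tendsto (fun i => chartVel n q (σ i) (Icc 0 (T i)) (t i)
          - chartVel n q (σ i) (Icc 0 (T i)) 0) l (𝓝 0) := by
  obtain ⟨ρ, L, B, Λ, hb⟩ := exists_chartBounds h om q R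
  have hρ := hb.rho_pos
  have hδ : 0 < ρ / (4 * L) := div_pos hρ (by linarith [hb.L_pos])
  set φ := extChartAt (𝓡∂ n) q with hφ
  have hc0 : Tendsto (fun i => chartCurve n q (σ i) 0) l (𝓝 (φ q)) :=
    (continuousAt_extChartAt (I := 𝓡∂ n) q).tendsto.comp h0
  have hsrc : ∀ᶠ i in l, σ i 0 ∈ φ.source := h0.eventually (extChartAt_source_mem_nhds q)
  have hball : ∀ᶠ i in l, chartCurve n q (σ i) 0 ∈ Metric.ball (φ q) (ρ / 2) :=
    hc0.eventually (Metric.ball_mem_nhds _ (half_pos hρ))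
  have hall : ∀ᶠ i in l, ‖chartVel n q (σ i) (Icc 0 (T i)) 0‖ ≤ L ∧ 0 < s i ∧
      (∀ t ∈ Icc 0 (s i), σ i t ∈ φ.source) ∧
      (∀ t ∈ Icc 0 (s i), ‖chartCurve n q (σ i) t - chartCurve n q (σ i) 0‖ ≤ L * s i) ∧
      (∀ t ∈ Icc 0 (s i), ‖chartVel n q (σ i) (Icc 0 (T i)) t
          - chartVel n q (σ i) (Icc 0 (T i)) 0‖ ≤ B * s i) ∧
      ‖chartCurve n q (σ i) (s i) - chartCurve n q (σ i) 0
          - s i • chartVel n q (σ i) (Icc 0 (T i)) 0‖ ≤ B * s i ^ 2 := by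
    filter_upwards [hk, hσ, hs, hs0.eventually_lt_const hδ, hsrc, hball]
      with i hki hσi hsi hsδ hsr hbl
    have hT : 0 < T i := hsi.1.trans_le hsi.2
    have h0J : (0 : ℝ) ∈ Icc 0 (T i) := ⟨le_rfl, hT.le⟩
    have hnt : (Icc 0 (T i)).Nontrivial := ⟨0, h0J, T i, ⟨hT.le, le_rfl⟩, hT.ne⟩
    have habs : ∀ t ∈ Icc 0 (s i), |t - 0| ≤ ρ / (4 * L) ∧ t ∈ Icc 0 (T i) ∧ |t - 0| ≤ s i := by
      intro t ht
      rw [sub_zero, abs_of_nonneg ht.1]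
      exact ⟨ht.2.trans hsδ.le, ⟨ht.1, ht.2.trans hsi.2⟩, ht.2⟩
    have h00 : |(0 : ℝ) - 0| ≤ ρ / (4 * L) := by simpa using hδ.le
    have hest := fun t ht => hb.estimates hki hσi ordConnected_Icc hnt h0J hsr hbl h0J h00
      (habs t ht).2.1 (habs t ht).1
    refine ⟨hb.norm_chartVel_le hki hσi (uniqueDiffOn_Icc hT) h0J hsr
      (Metric.ball_subset_ball (by linarith) hbl), hsi.1, fun t ht => (hb.stays hki hσi
      ordConnected_Icc hnt h0J hsr hbl (habs t ht).2.1 (habs t ht).1).1, fun t ht => ?_,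
      fun t ht => ?_, ?_⟩
    · exact (hest t ht).1.trans (mul_le_mul_of_nonneg_left (habs t ht).2.2 hb.L_pos.le)
    · exact (hest t ht).2.1.trans (mul_le_mul_of_nonneg_left (habs t ht).2.2 hb.B_nonneg)
    · have h1 := (hest (s i) ⟨hsi.1.le, le_rfl⟩).2.2.1
      rwa [sub_zero, abs_of_pos hsi.1] at h1
  have hlin : ∀ C : ℝ, Tendsto (fun i => C * s i) l (𝓝 0) := fun C => by
    simpa using hs0.const_mul C
  refine ⟨?_, ⟨L, hall.mono fun i hi => hi.1⟩, hall.mono fun i hi => hi.2.2.1, fun t ht => ?_⟩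
  · refine squeeze_zero_norm' ?_ (hlin B)
    filter_upwards [hall] with i hi
    obtain ⟨-, hsi, -, -, -, h1⟩ := hi
    have h2 : (s i)⁻¹ • (chartCurve n q (σ i) (s i) - chartCurve n q (σ i) 0)
        - chartVel n q (σ i) (Icc 0 (T i)) 0 = (s i)⁻¹ • (chartCurve n q (σ i) (s i)
          - chartCurve n q (σ i) 0 - s i • chartVel n q (σ i) (Icc 0 (T i)) 0) := by
      rw [smul_sub _ (_ - _), inv_smul_smul₀ hsi.ne']
    rw [h2, norm_smul, norm_inv, Real.norm_of_nonneg hsi.le]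
    calc (s i)⁻¹ * _ ≤ (s i)⁻¹ * (B * s i ^ 2) :=
          mul_le_mul_of_nonneg_left h1 (inv_nonneg.2 hsi.le)
      _ = B * s i := by field_simp
  · have h1 : Tendsto (fun i => chartCurve n q (σ i) (t i) - chartCurve n q (σ i) 0) l (𝓝 0) :=
      squeeze_zero_norm' ((hall.and ht).mono fun i hi => hi.1.2.2.2.1 _ hi.2) (hlin L)
    have h2 : Tendsto (fun i => chartCurve n q (σ i) (t i)) l (𝓝 (φ q)) := by
      simpa using h1.add hc0
    refine ⟨h2, ?_, squeeze_zero_norm'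
      ((hall.and ht).mono fun i hi => hi.1.2.2.2.2.1 _ hi.2) (hlin B)⟩
    have hst : ∀ᶠ i in l, σ i (t i) ∈ φ.source :=
      (hall.and ht).mono fun i hi => hi.1.2.2.1 _ hi.2
    have h3 : Tendsto (fun i => φ.symm (chartCurve n q (σ i) (t i))) l (𝓝 (φ.symm (φ q))) :=
      ((continuousOn_extChartAt_symm (I := 𝓡∂ n) q) (φ q)
        (mem_extChartAt_target q)).tendsto.comp (tendsto_nhdsWithin_iff.2
          ⟨h2, hst.mono fun i hi => φ.map_source hi⟩)
    rw [φ.left_inv (mem_extChartAt_source q)] at h3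
    exact h3.congr' (hst.mono fun i hi => φ.left_inv hi)

theorem tendsto_short_geodesic (𝓕 : Ultrafilter ι) {q : N} {η : ι → ℝ → N} {r : ι → ℝ}
    (hη : ∀ᶠ i in (𝓕 : Filter ι), 0 < r i ∧ IsSpeedGeodesicOn h om 1 (η i) (Icc 0 (r i)))
    (hr : Tendsto r 𝓕 (𝓝 0)) (h0 : Tendsto (fun i => η i 0) 𝓕 (𝓝 q)) :
    ∃ V : 𝔼, normE h q V = 1 ∧
      Tendsto (fun i => chartVel n q (η i) (Icc 0 (r i)) 0) 𝓕 (𝓝 V) ∧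
      Tendsto (fun i => (r i)⁻¹ • (chartCurve n q (η i) (r i) - chartCurve n q (η i) 0)) 𝓕
        (𝓝 V) ∧
      Tendsto (fun i => (r i)⁻¹ * lineIntegral om (η i) (Icc 0 (r i)) 0 (r i)) 𝓕
        (𝓝 (formE om q V)) := by
  obtain ⟨hd, ⟨L, hL⟩, hsrc, ht⟩ := tendsto_chart_displacement (l := (𝓕 : Filter ι))
    (k := fun _ => 1) (R := 1) (Eventually.of_forall fun _ => by simp) (hη.mono fun i hi => hi.2)
    (hη.mono fun i hi => ⟨hi.1, le_rfl⟩) hr h0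
  set φ := extChartAt (𝓡∂ n) q with hφ
  obtain ⟨V, -, hV⟩ := (isCompact_closedBall (0 : 𝔼) L).ultrafilter_le_nhds
    (𝓕.map fun i => chartVel n q (η i) (Icc 0 (r i)) 0)
    (tendsto_principal.2 (hL.mono fun i hi => mem_closedBall_zero_iff.2 hi))
  replace hV : Tendsto (fun i => chartVel n q (η i) (Icc 0 (r i)) 0) 𝓕 (𝓝 V) := hV
  have htar : ∀ t : ι → ℝ, (∀ᶠ i in (𝓕 : Filter ι), t i ∈ Icc 0 (r i)) →
      Tendsto (fun i => chartCurve n q (η i) (t i)) 𝓕 (𝓝[φ.target] (φ q)) := fun t hti =>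
    tendsto_nhdsWithin_iff.2 ⟨(ht t hti).1, (hsrc.and hti).mono fun i hi =>
      φ.map_source (hi.1 _ hi.2)⟩
  have ht0 := htar 0 (hη.mono fun i hi => ⟨le_rfl, hi.1.le⟩)
  refine ⟨V, ?_, hV, by simpa using hd.add hV, ?_⟩
  · have h1 : Tendsto (fun i => metC h q (chartCurve n q (η i) 0)) 𝓕 (𝓝 (metC h q (φ q))) :=
      ((contDiffOn_metC h q).continuousOn (φ q) (mem_extChartAt_target q)).tendsto.comp ht0
    have h2 := tendsto_clm_apply (tendsto_clm_apply h1 hV) hV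
    have h3 : metC h q (φ q) V V = 1 := by
      refine tendsto_nhds_unique h2 (tendsto_const_nhds.congr' ?_)
      filter_upwards [hη, hsrc] with i hi hs
      have h0i : (0 : ℝ) ∈ Icc 0 (r i) := ⟨le_rfl, hi.1.le⟩
      have h4 := hi.2.metC_chartVel h0i (uniqueDiffOn_Icc hi.1 0 h0i) (hs 0 h0i)
      rw [one_pow] at h4
      exact h4.symm
    rw [metC_self] at h3
    have h4 : innerE h q V V = 1 := h3
    rw [← normE_sq] at h4
    exact (pow_eq_one_iff_of_nonneg (normE_nonneg h q V) two_ne_zero).1 h4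
  · have hmean : ∀ i, ∃ t, (0 < r i ∧ IsSpeedGeodesicOn h om 1 (η i) (Icc 0 (r i))) →
        t ∈ Icc 0 (r i) ∧ om.form (η i t) (velocity (𝓡∂ n) (η i) (Icc 0 (r i)) t)
          = (r i)⁻¹ * lineIntegral om (η i) (Icc 0 (r i)) 0 (r i) := by
      intro i
      by_cases hi : 0 < r i ∧ IsSpeedGeodesicOn h om 1 (η i) (Icc 0 (r i))
      · have hc := (contDiffOn_form_velocity om hi.2.1.1 (uniqueDiffOn_Icc hi.1)).continuousOn
        rw [← uIcc_of_le hi.1.le] at hc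
        obtain ⟨t, ht, he⟩ := exists_eq_interval_average hi.1.ne hc
        rw [interval_average_eq, sub_zero, smul_eq_mul] at he
        rw [uIoo_of_le hi.1.le] at ht
        rw [uIcc_of_le hi.1.le] at he
        exact ⟨t, fun _ => ⟨Ioo_subset_Icc_self ht, he⟩⟩
      · exact ⟨0, fun h => absurd h hi⟩
    choose t hti using hmean
    have htI : ∀ᶠ i in (𝓕 : Filter ι), t i ∈ Icc 0 (r i) := hη.mono fun i hi => (hti i hi).1
    have h1 : Tendsto (fun i => formC om q (chartCurve n q (η i) (t i))) 𝓕
        (𝓝 (formC om q (φ q))) :=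
      ((contDiffOn_formC om q).continuousOn (φ q) (mem_extChartAt_target q)).tendsto.comp
        (htar t htI)
    have h2 : Tendsto (fun i => chartVel n q (η i) (Icc 0 (r i)) (t i)) 𝓕 (𝓝 V) := by
      simpa using (ht t htI).2.2.add hV
    have h3 := tendsto_clm_apply h1 h2
    rw [formC_self] at h3
    refine Tendsto.congr' ?_ h3
    filter_upwards [hη, hsrc] with i hi hs
    obtain ⟨h4, h5⟩ := hti i hi
    rw [← h5]
    exact formC_velocity om ((hi.2.1.1 (t i) h4).mdifferentiableWithinAt (by simp))
      (uniqueDiffOn_Icc hi.1 _ h4) (hs _ h4)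

theorem MagneticExpIsDiffeo.exists_unit_geodesic {x y : N} (H : MagneticExpIsDiffeo h om x)
    (hxy : x ≠ y) : 0 < normE h x (mlog h om x y) ∧ ∃ γ, IsSpeedGeodesicOn h om 1 γ
      (Icc 0 (normE h x (mlog h om x y))) ∧ γ 0 = x ∧ γ (normE h x (mlog h om x y)) = y := by
  obtain ⟨ℓ, γ, hℓ, hγ, rfl, rfl, h1⟩ := H.exists_unit hxy
  have h2 : normE h (γ 0) (mlog h om (γ 0) (γ ℓ)) = ℓ := by
    have h3 : normE h (γ 0) (velE n γ (Icc 0 ℓ) 0) = 1 := hγ.2 0 ⟨le_rfl, hℓ.le⟩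
    rw [← h1, normE_smul, h3, mul_one, abs_of_pos hℓ]
  rw [h2]
  exact ⟨hℓ, γ, isUnitMagneticGeodesicOn_iff.1 hγ, rfl, rfl⟩

variable [CompactSpace N]

theorem tendsto_normE_mlog (H : ∀ x, MagneticExpIsDiffeo h om x) (x y : N) :
    Tendsto (fun p : N × N => normE h p.1 (mlog h om p.1 p.2)) (𝓝 (x, y))
      (𝓝 (normE h x (mlog h om x y))) := by
  choose g hg hg0 hg1 using fun p : N × N => (H p.1).exists_geodesic p.2
  refine (tendsto_iff_ultrafilter _ _ _).2 fun 𝓕 h𝓕 => ?_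
  refine (tendsto_geodesic_ultrafilter H 𝓕 (fun p => normE_nonneg h _ _) hg ?_ ?_).1
  · simp only [hg0]; exact (continuous_fst.tendsto (x, y)).mono_left h𝓕
  · simp only [hg1]; exact (continuous_snd.tendsto (x, y)).mono_left h𝓕

/-- Near the diagonal, the action is asymptotic to the Randers norm `|u|_h - ω(u)` of the
difference of the coordinates. -/
theorem tendsto_action_diagonal (H : ∀ x, MagneticExpIsDiffeo h om x) (q : N) :
    Tendsto (fun p : N × N => (magneticAction h om p.1 p.2
        - (normE h q (extChartAt (𝓡∂ n) q p.2 - extChartAt (𝓡∂ n) q p.1)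
          - formE om q (extChartAt (𝓡∂ n) q p.2 - extChartAt (𝓡∂ n) q p.1)))
        / ‖extChartAt (𝓡∂ n) q p.2 - extChartAt (𝓡∂ n) q p.1‖) (𝓝 (q, q)) (𝓝 0) := by
  refine (tendsto_iff_ultrafilter _ _ _).2 fun 𝓕 h𝓕 => ?_
  by_cases hne : ∀ᶠ p in (𝓕 : Filter (N × N)), p.1 ≠ p.2
  · have hex : ∀ p : N × N, ∃ γ, p.1 ≠ p.2 → 0 < normE h p.1 (mlog h om p.1 p.2) ∧
        IsSpeedGeodesicOn h om 1 γ (Icc 0 (normE h p.1 (mlog h om p.1 p.2))) ∧ γ 0 = p.1 ∧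
        γ (normE h p.1 (mlog h om p.1 p.2)) = p.2 := fun p => by
      by_cases hp : p.1 = p.2
      · exact ⟨fun _ => q, fun h => absurd hp h⟩
      · obtain ⟨h1, γ, h2⟩ := (H p.1).exists_unit_geodesic hp
        exact ⟨γ, fun _ => ⟨h1, h2⟩⟩
    choose η hη using hex
    set r : N × N → ℝ := fun p => normE h p.1 (mlog h om p.1 p.2) with hr
    have hr0 : Tendsto r 𝓕 (𝓝 0) := by
      have h1 := (tendsto_normE_mlog H q q).mono_left h𝓕
      rwa [(H q).mlog_self, normE_zero] at h1
    have hη0 : Tendsto (fun p => η p 0) 𝓕 (𝓝 q) :=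
      ((continuous_fst.tendsto (q, q)).mono_left h𝓕).congr' (hne.mono fun p hp => (hη p hp).2.2.1.symm)
    obtain ⟨V, hV1, -, hV, hω⟩ := tendsto_short_geodesic 𝓕
      (hne.mono fun p hp => ⟨(hη p hp).1, (hη p hp).2.1⟩) hr0 hη0
    have hV0 : V ≠ 0 := by
      rintro rfl
      rw [normE_zero] at hV1
      exact zero_ne_one hV1
    have h1 := (((tendsto_const_nhds (x := (1 : ℝ))).sub hω).sub
      ((((continuous_normE h q).tendsto V).comp hV).sub
        (((formE om q).continuous.tendsto V).comp hV))).div hV.norm (norm_ne_zero_iff.2 hV0)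
    rw [hV1, sub_self, zero_div] at h1
    refine h1.congr' ?_
    filter_upwards [hne] with p hp
    obtain ⟨hp0, hg, hp1, hp2⟩ := hη p hp
    have hA := (hg.mlog_and_action one_pos (uniqueDiffOn_Icc hp0) hp0 Subset.rfl (H _)).2
    rw [hp1, hp2, one_mul, sub_zero] at hA
    change magneticAction h om p.1 p.2 = r p - lineIntegral om (η p) (Icc 0 (r p)) 0 (r p) at hA
    change η p (r p) = p.2 at hp2
    have hp0' : 0 < r p := hp0
    set L := lineIntegral om (η p) (Icc 0 (r p)) 0 (r p) with hL
    have e1 : chartCurve n q (η p) (r p) = extChartAt (𝓡∂ n) q p.2 := congrArg _ hp2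
    have e0 : chartCurve n q (η p) 0 = extChartAt (𝓡∂ n) q p.1 := congrArg _ hp1
    change (1 - (r p)⁻¹ * L - (normE h q ((r p)⁻¹ • (chartCurve n q (η p) (r p)
      - chartCurve n q (η p) 0)) - formE om q ((r p)⁻¹ • (chartCurve n q (η p) (r p)
      - chartCurve n q (η p) 0)))) / ‖(r p)⁻¹ • (chartCurve n q (η p) (r p)
      - chartCurve n q (η p) 0)‖ = _
    rw [e1, e0, hA, normE_smul, norm_smul, map_smul, Real.norm_eq_abs, abs_inv, abs_of_pos hp0',
      smul_eq_mul, ← mul_div_mul_left _ ‖_‖ (inv_ne_zero hp0'.ne')]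
    congr 1
    field_simp
  · have heq : ∀ᶠ p in (𝓕 : Filter (N × N)), p.1 = p.2 := by
      simpa using Ultrafilter.eventually_not.2 hne
    refine tendsto_const_nhds.congr' (heq.mono fun p hp => ?_)
    simp only [hp, sub_self, norm_zero, div_zero]

end DiagonalAsymptotics

noncomputable section ActionInitialPoint

variable {n : ℕ} [NeZero n] {N : Type*} [TopologicalSpace N] [T2Space N]
  [ChartedSpace (EuclideanHalfSpace n) N] [IsManifold (𝓡∂ n) ∞ N]

local notation "𝔼" => EuclideanSpace ℝ (Fin n)

variable {om : SmoothOneForm (𝓡∂ n) N} {h : RMetric n N} {ι : Type*}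

theorem innerE_le {x : N} {u v : 𝔼} (hu : normE h x u = 1) (hv : 0 < normE h x v) :
    innerE h x u v ≤ normE h x v := by
  set r := normE h x v with hr
  have h1 : 0 ≤ innerE h x (r • u - v) (r • u - v) := by
    rw [← normE_sq]; positivity
  have h2 : innerE h x (r • u - v) (r • u - v)
      = r ^ 2 * innerE h x u u - 2 * r * innerE h x u v + innerE h x v v := by
    simp only [map_sub, map_smul, sub_apply, smul_apply, smul_eq_mul,
      innerE_symm h x v u]
    ring
  rw [h2, ← normE_sq, ← normE_sq, hu, ← hr] at h1
  nlinarith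

theorem MagneticExpIsDiffeo.normE_arrivalVel {x y : N} (H : MagneticExpIsDiffeo h om x)
    (hxy : x ≠ y) : normE h y (arrivalVel h om x y) = 1 := by
  obtain ⟨ℓ, γ, hℓ, hγ, h0, rfl, -⟩ := H.exists_unit hxy
  rw [H.arrivalVel_eq hℓ hγ h0]
  exact hγ.2 ℓ ⟨hℓ.le, le_rfl⟩

theorem MagneticExpIsDiffeo.action_sub_le {x : N} (H : MagneticExpIsDiffeo h om x) {γ : ℝ → N}
    {r a b : ℝ} (hr : 0 < r) (hab : a < b) (hγ : IsSpeedGeodesicOn h om r γ (Icc a b))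
    (hne : ∀ t ∈ Icc a b, x ≠ γ t) :
    magneticAction h om x (γ b) - magneticAction h om x (γ a)
      ≤ r * (b - a) - lineIntegral om γ (Icc a b) a b := by
  obtain ⟨hc, he⟩ := H.action_integral hab hγ.1.1 hne
  have hω := (contDiffOn_form_velocity om hγ.1.1 (uniqueDiffOn_Icc hab)).continuousOn
  rw [he]
  have h1 : r * (b - a) - lineIntegral om γ (Icc a b) a b
      = ∫ τ in a..b, (r - om.form (γ τ) (velocity (𝓡∂ n) γ (Icc a b) τ)) := by
    rw [intervalIntegral.integral_sub intervalIntegrable_const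
      (hω.intervalIntegrable_of_Icc hab.le), intervalIntegral.integral_const, smul_eq_mul, mul_comm]
    rfl
  rw [h1]
  refine intervalIntegral.integral_mono_on hab.le (hc.intervalIntegrable_of_Icc hab.le)
    ((continuousOn_const.sub hω).intervalIntegrable_of_Icc hab.le) fun τ hτ => ?_
  have h2 : normE h (γ τ) (velE n γ (Icc a b) τ) = r := (hγ.2 τ hτ).trans (abs_of_pos hr)
  have h3 := innerE_le (H.normE_arrivalVel (hne τ hτ)) (h2.symm ▸ hr)
  rw [h2] at h3
  exact sub_le_sub_right h3 _

theorem IsSpeedGeodesicOn.action_sub_le {x : N} (H : MagneticExpIsDiffeo h om x) {γ : ℝ → N}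
    {r a b s : ℝ} (hr : 0 < r) (hγ : IsSpeedGeodesicOn h om r γ (Icc a b)) (hs : s ∈ Ioo a b)
    (H' : MagneticExpIsDiffeo h om (γ a)) (hne : ∀ t ∈ Icc s b, x ≠ γ t) :
    magneticAction h om x (γ b) - magneticAction h om (γ a) (γ b)
      ≤ magneticAction h om x (γ s) - magneticAction h om (γ a) (γ s) := by
  have hab := hs.1.trans hs.2
  have hu := uniqueDiffOn_Icc hab
  have hsub : Icc s b ⊆ Icc a b := Icc_subset_Icc hs.1.le le_rfl
  have h1 := (hγ.mlog_and_action hr hu hab Subset.rfl H').2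
  have h2 := (hγ.mlog_and_action hr hu hs.1 (Icc_subset_Icc le_rfl hs.2.le) H').2
  have h3 := H.action_sub_le hr hs.2 (hγ.mono hu (uniqueDiffOn_Icc hs.2) hsub) hne
  have h4 : lineIntegral om γ (Icc s b) s b = lineIntegral om γ (Icc a b) s b :=
    lineIntegral_mono hγ.1.1 (uniqueDiffOn_Icc hs.2) hsub (by rw [uIcc_of_le hs.2.le])
  have hω := (contDiffOn_form_velocity om hγ.1.1 hu).continuousOn
  have h5 : lineIntegral om γ (Icc a b) a s + lineIntegral om γ (Icc a b) s b
      = lineIntegral om γ (Icc a b) a b :=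
    intervalIntegral.integral_add_adjacent_intervals
      ((hω.mono (Icc_subset_Icc le_rfl hs.2.le)).intervalIntegrable_of_Icc hs.1.le)
      ((hω.mono hsub).intervalIntegrable_of_Icc hs.2.le)
  rw [h4] at h3
  linarith

variable [CompactSpace N]

/-- The action `𝔸(x, y)` is superdifferentiable in `x` along the boundary, locally uniformly. -/
theorem IsSimpleMagnetic.action_initial_le (hs : IsSimpleMagnetic h om) {q y : N} (hqy : q ≠ y)
    {ε : ℝ} (hε : 0 < ε) :
    ∀ᶠ p : N × N in 𝓝 (q, q), p.2 ∈ (𝓡∂ n).boundary N →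
      magneticAction h om p.2 y - magneticAction h om p.1 y
        ≤ (formE om q - innerE h q (departVel h om q y))
            (extChartAt (𝓡∂ n) q p.2 - extChartAt (𝓡∂ n) q p.1)
          + ε * ‖extChartAt (𝓡∂ n) q p.2 - extChartAt (𝓡∂ n) q p.1‖ := by
  have H := hs.1
  set φ := extChartAt (𝓡∂ n) q with hφ
  set p₀ := formE om q - innerE h q (departVel h om q y) with hp₀
  refine mem_iff_ultrafilter.2 fun 𝓕 h𝓕 => ?_
  by_contra hcon
  have hcon' : ∀ᶠ p : N × N in (𝓕 : Filter (N × N)), p.2 ∈ (𝓡∂ n).boundary N ∧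
      p₀ (φ p.2 - φ p.1) + ε * ‖φ p.2 - φ p.1‖
        < magneticAction h om p.2 y - magneticAction h om p.1 y := by
    have := Ultrafilter.eventually_not.2 hcon
    filter_upwards [this] with p hp
    push Not at hp
    exact hp
  set m := mlog h om q y with hm
  set r₀ := normE h q m with hr₀
  have hm0 : m ≠ 0 := (H q).mlog_ne_zero hqy
  have hr₀0 : 0 < r₀ := normE_pos h q hm0
  have h1t : Tendsto (fun p : N × N => p.1) 𝓕 (𝓝 q) := (continuous_fst.tendsto (q, q)).mono_left h𝓕
  have h2t : Tendsto (fun p : N × N => p.2) 𝓕 (𝓝 q) := (continuous_snd.tendsto (q, q)).mono_left h𝓕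
  have hφ1 : Tendsto (fun p : N × N => φ p.1) 𝓕 (𝓝 (φ q)) :=
    (continuousAt_extChartAt (I := 𝓡∂ n) q).tendsto.comp h1t
  have hφ2 : Tendsto (fun p : N × N => φ p.2) 𝓕 (𝓝 (φ q)) :=
    (continuousAt_extChartAt (I := 𝓡∂ n) q).tendsto.comp h2t
  set ξ : N × N → 𝔼 := fun p => φ p.2 - φ p.1 with hξ
  have hξ0 : Tendsto ξ 𝓕 (𝓝 0) := by simpa using hφ2.sub hφ1
  have hξne : ∀ᶠ p in (𝓕 : Filter (N × N)), ξ p ≠ 0 := by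
    filter_upwards [hcon', h1t.eventually (extChartAt_source_mem_nhds (I := 𝓡∂ n) q),
      h2t.eventually (extChartAt_source_mem_nhds (I := 𝓡∂ n) q)] with p hp hp1 hp2 h0
    have h3 : p.2 = p.1 := φ.injOn hp2 hp1 (sub_eq_zero.1 h0)
    have h4 := hp.2
    rw [h3, sub_self, sub_self, map_zero, norm_zero, mul_zero, add_zero] at h4
    exact lt_irrefl _ h4
  obtain ⟨e, he1, he⟩ := (isCompact_sphere (0 : 𝔼) 1).ultrafilter_le_nhds
    (𝓕.map fun p => ‖ξ p‖⁻¹ • ξ p) (tendsto_principal.2 (hξne.mono fun p hp => by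
      rw [mem_sphere_zero_iff_norm, norm_smul, norm_inv, norm_norm,
        inv_mul_cancel₀ (norm_ne_zero_iff.2 hp)]))
  replace he : Tendsto (fun p => ‖ξ p‖⁻¹ • ξ p) 𝓕 (𝓝 e) := he
  rw [mem_sphere_zero_iff_norm] at he1
  obtain ⟨K, hK0, hKm, hKε⟩ : ∃ K : ℝ, 0 < K ∧ 1 < K * ‖m‖ ∧
      innerE h q e e / (2 * (K * r₀)) < ε := by
    have hm1 := norm_pos_iff.2 hm0
    have hi : 0 ≤ innerE h q e e := by rw [← normE_sq]; positivity
    refine ⟨2 / ‖m‖ + innerE h q e e / (r₀ * ε), by positivity, ?_, ?_⟩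
    · have h3 : 2 / ‖m‖ * ‖m‖ = 2 := div_mul_cancel₀ _ hm1.ne'
      have h4 : 0 ≤ innerE h q e e / (r₀ * ε) * ‖m‖ := by positivity
      rw [add_mul]; linarith
    · have h3 : 0 < 2 / ‖m‖ * r₀ := by positivity
      have h4 : innerE h q e e / (r₀ * ε) * r₀ = innerE h q e e / ε := by field_simp
      rw [div_lt_iff₀ (by positivity), add_mul, h4]
      have h5 : ε * (2 * (2 / ‖m‖ * r₀ + innerE h q e e / ε))
          = 2 * ε * (2 / ‖m‖ * r₀) + 2 * innerE h q e e := by field_simp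
      rw [h5]
      have : 0 < 2 * ε * (2 / ‖m‖ * r₀) := by positivity
      linarith
  choose g hg hg0 hg1 using fun p : N × N => (H p.1).exists_geodesic y
  set r : N × N → ℝ := fun p => normE h p.1 (mlog h om p.1 y) with hr
  have hg0t : Tendsto (fun p => g p 0) 𝓕 (𝓝 q) := by simp only [hg0]; exact h1t
  obtain ⟨hrt, hvt⟩ := tendsto_geodesic_ultrafilter H 𝓕 (fun p => normE_nonneg h _ _) hg hg0t
    (by simp only [hg1]; exact tendsto_const_nhds)
  set s : N × N → ℝ := fun p => K * ‖ξ p‖ with hsdef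
  have hs0 : Tendsto s 𝓕 (𝓝 0) := by simpa using hξ0.norm.const_mul K
  have hs1 : ∀ᶠ p in (𝓕 : Filter (N × N)), s p ∈ Ioo 0 1 := by
    filter_upwards [hξne, hs0.eventually_lt_const one_pos] with p hp hp1
    exact ⟨mul_pos hK0 (norm_pos_iff.2 hp), hp1⟩
  obtain ⟨hd, -, -, hst⟩ := tendsto_chart_displacement (l := (𝓕 : Filter (N × N))) (R := r₀ + 1)
    (k := r) (σ := g) (T := fun _ => 1) (s := s)
    ((hrt.eventually_lt_const (lt_add_one r₀)).mono fun p hp =>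
      ⟨by have := normE_nonneg h p.1 (mlog h om p.1 y); linarith, hp.le⟩)
    (Eventually.of_forall hg) (hs1.mono fun p hp => ⟨hp.1, hp.2.le⟩) hs0 hg0t
  have hsq := (hst s (hs1.mono fun p hp => ⟨hp.1.le, le_rfl⟩)).2.1
  set d : N × N → 𝔼 := fun p => φ (g p (s p)) - φ p.1 with hdd
  have hdt : Tendsto (fun p => ‖ξ p‖⁻¹ • d p) 𝓕 (𝓝 (K • m)) := by
    have h3 : Tendsto (fun p => (s p)⁻¹ • d p) 𝓕 (𝓝 m) := by
      have h4 := hd.add hvt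
      simp only [sub_add_cancel, zero_add, chartCurve, hg0] at h4
      exact h4
    refine (h3.const_smul K).congr fun p => ?_
    rw [smul_smul, hsdef, mul_inv, mul_inv_cancel_left₀ hK0.ne']
  have hdξ : Tendsto (fun p => ‖ξ p‖⁻¹ • (d p - ξ p)) 𝓕 (𝓝 (K • m - e)) := by
    simpa only [smul_sub] using hdt.sub he
  have key : ∀ (u : N × N → 𝔼) (U : 𝔼) (z : N × N → N), U ≠ 0 → Tendsto z 𝓕 (𝓝 q) →
      (∀ p, u p = φ (g p (s p)) - φ (z p)) → Tendsto (fun p => ‖ξ p‖⁻¹ • u p) 𝓕 (𝓝 U) →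
      Tendsto (fun p => ‖ξ p‖⁻¹ * magneticAction h om (z p) (g p (s p))) 𝓕
        (𝓝 (normE h q U - formE om q U)) := by
    intro u U z hU hz hu hut
    have h3 := (tendsto_action_diagonal H q).comp (hz.prodMk_nhds hsq)
    have h4 := (h3.mul hut.norm).add ((((continuous_normE h q).tendsto U).comp hut).sub
        (((formE om q).continuous.tendsto U).comp hut))
    rw [zero_mul, zero_add] at h4
    refine h4.congr' ?_
    filter_upwards [hξne, hut.eventually_ne hU] with p hp hup
    have hup0 : u p ≠ 0 := fun h0 => hup (by rw [h0, smul_zero])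
    have hn1 := norm_pos_iff.2 hp
    have hn2 := norm_pos_iff.2 hup0
    simp only [Function.comp_apply, ← hφ, ← hu, norm_smul, normE_smul, map_smul, smul_eq_mul,
      norm_inv, norm_norm, abs_inv, abs_norm]
    field_simp
    ring
  have hA1 := key d (K • m) (fun p => p.1) (smul_ne_zero hK0.ne' hm0) h1t (fun p => rfl) hdt
  have hA2 := key (fun p => d p - ξ p) (K • m - e) (fun p => p.2) (fun h0 => by
      have h3 := congrArg norm (sub_eq_zero.1 h0)
      rw [norm_smul, he1, Real.norm_of_nonneg hK0.le] at h3
      linarith) h2t (fun p => by simp only [hdd, hξ]; abel) hdξ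
  have hlim : normE h q (K • m - e) - formE om q (K • m - e) - (normE h q (K • m)
      - formE om q (K • m)) < p₀ e + ε := by
    have h3 : normE h q (K • m) = K * r₀ := by rw [normE_smul, abs_of_pos hK0]
    have hKr : 0 < K * r₀ := mul_pos hK0 hr₀0
    have h4 : normE h q (K • m - e) ^ 2 = (K * r₀) ^ 2 - 2 * K * innerE h q m e
        + innerE h q e e := by
      rw [normE_sq, mul_pow, hr₀, normE_sq]
      simp only [map_sub, map_smul, sub_apply, smul_apply, smul_eq_mul,
        innerE_symm h q e m]
      ring
    have h5 : p₀ e = formE om q e - r₀⁻¹ * innerE h q m e := by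
      simp only [hp₀, departVel, map_smul, sub_apply, smul_apply, smul_eq_mul]
      rfl
    have h6 : normE h q (K • m - e) ≤ (normE h q (K • m - e) ^ 2 / (K * r₀) + K * r₀) / 2 := by
      have h7 := sq_nonneg (normE h q (K • m - e) - K * r₀)
      have h8 : normE h q (K • m - e) * (K * r₀) * 2
          ≤ normE h q (K • m - e) ^ 2 + (K * r₀) ^ 2 := by linarith
      rw [div_add' _ _ _ hKr.ne', div_div, le_div_iff₀ (by positivity)]
      linarith
    have h9 : (normE h q (K • m - e) ^ 2 / (K * r₀) + K * r₀) / 2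
        = K * r₀ - r₀⁻¹ * innerE h q m e + innerE h q e e / (2 * (K * r₀)) := by
      rw [h4]; field_simp; ring
    rw [h3, h5, map_sub]
    linarith
  have hfin := (hA2.sub hA1).eventually_lt (((p₀.continuous.tendsto e).comp he).add_const ε) hlim
  obtain ⟨p, ⟨hpb, hp1⟩, hp2, hp3, hp4, hp5, hp6⟩ := (hcon'.and (hfin.and (hs1.and (hξne.and
    ((hrt.eventually_const_lt hr₀0).and (h2t.eventually_ne hqy)))))).exists
  have hne : ∀ t ∈ Icc (s p) 1, p.2 ≠ g p t := by
    rintro t ht h0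
    rcases ht.2.eq_or_lt with rfl | ht1
    · exact hp6 (h0.trans (hg1 p))
    · exact boundary_not_interior (h0 ▸ hpb)
        ((hg p).mem_interior hs.2 hp5 ⟨hp3.1.trans_le ht.1, ht1⟩)
  have h3 := (hg p).action_sub_le (H p.2) hp5 hp3 (H _) hne
  rw [hg0, hg1] at h3
  have hn1 := norm_pos_iff.2 hp4
  simp only [Function.comp_apply, map_smul, smul_eq_mul, ← mul_sub] at hp2
  have h4 : magneticAction h om p.2 (g p (s p)) - magneticAction h om p.1 (g p (s p))
      < p₀ (ξ p) + ε * ‖ξ p‖ := by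
    have h5 := mul_lt_mul_of_pos_left hp2 hn1
    rw [mul_add, mul_inv_cancel_left₀ hn1.ne', mul_inv_cancel_left₀ hn1.ne'] at h5
    linarith
  exact absurd (hp1.trans_le h3) (not_lt.2 h4.le)

end ActionInitialPoint

noncomputable section BoundaryCurves

variable {n : ℕ} [NeZero n] {N : Type*} [TopologicalSpace N] [T2Space N]
  [ChartedSpace (EuclideanHalfSpace n) N] [IsManifold (𝓡∂ n) ∞ N]

local notation "𝔼" => EuclideanSpace ℝ (Fin n)

variable {om : SmoothOneForm (𝓡∂ n) N} {h : RMetric n N}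

/-- The curve `z + τ ζ` in the preferred chart at `q`. -/
def chartLine (q : N) (z ζ : EuclideanSpace ℝ (Fin n)) (τ : ℝ) : N :=
  (extChartAt (𝓡∂ n) q).symm (z + τ • ζ)

theorem chartLine_zero (q : N) (ζ : 𝔼) : chartLine q (extChartAt (𝓡∂ n) q q) ζ 0 = q := by
  rw [chartLine, zero_smul, add_zero]
  exact (extChartAt (𝓡∂ n) q).left_inv (mem_extChartAt_source q)

theorem contMDiffOn_chartLine {q : N} {z ζ : 𝔼} {J : Set ℝ}
    (hJ : ∀ τ ∈ J, z + τ • ζ ∈ (extChartAt (𝓡∂ n) q).target) :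
    ContMDiffOn 𝓘(ℝ, ℝ) (𝓡∂ n) ∞ (chartLine q z ζ) J := by
  have h1 : ContDiff ℝ ∞ fun τ : ℝ => z + τ • ζ := by fun_prop
  exact (contMDiffOn_extChartAt_symm (n := ∞) q).comp h1.contMDiff.contMDiffOn hJ

theorem derivWithin_chartLine {q : N} {z ζ : 𝔼} {J : Set ℝ} {τ : ℝ} (hu : UniqueDiffOn ℝ J)
    (hJ : ∀ τ ∈ J, z + τ • ζ ∈ (extChartAt (𝓡∂ n) q).target) (hτ : τ ∈ J) :
    derivWithin (fun τ => extChartAt (𝓡∂ n) q (chartLine q z ζ τ)) J τ = ζ := by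
  have h1 : EqOn (fun τ => extChartAt (𝓡∂ n) q (chartLine q z ζ τ)) (fun τ => z + τ • ζ) J :=
    fun τ hτ => (extChartAt (𝓡∂ n) q).right_inv (hJ τ hτ)
  rw [derivWithin_congr h1 (h1 hτ)]
  have h2 : HasDerivAt (fun τ : ℝ => z + τ • ζ) ((1 : ℝ) • ζ) τ :=
    ((hasDerivAt_id τ).smul_const ζ).const_add z
  rw [one_smul] at h2
  exact h2.hasDerivWithinAt.derivWithin (hu τ hτ)

theorem velE_chartLine {q : N} {ζ : 𝔼} {J : Set ℝ} (hu : UniqueDiffOn ℝ J)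
    (hJ : ∀ τ ∈ J, extChartAt (𝓡∂ n) q q + τ • ζ ∈ (extChartAt (𝓡∂ n) q).target)
    (h0 : (0 : ℝ) ∈ J) : velE n (chartLine q (extChartAt (𝓡∂ n) q q) ζ) J 0 = ζ := by
  have h1 := chartLine_zero q ζ
  have h2 : velE n (chartLine q (extChartAt (𝓡∂ n) q q) ζ) J 0
      = chartVel n (chartLine q (extChartAt (𝓡∂ n) q q) ζ 0) (chartLine q _ ζ) J 0 :=
    velocity_eq_chartVel (contMDiffOn_chartLine hJ 0 h0)
  rw [h2, h1]
  exact derivWithin_chartLine hu hJ h0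

theorem velE_boundary_curve {c : ℝ → N} {J : Set ℝ} {τ : ℝ} (hu : UniqueDiffOn ℝ J)
    (hc : ContMDiffOn 𝓘(ℝ, ℝ) (𝓡∂ n) ∞ c J) (hb : ∀ τ ∈ J, c τ ∈ (𝓡∂ n).boundary N) (hτ : τ ∈ J) :
    velE n c J τ 0 = 0 := by
  have h1 : velE n c J τ = chartVel n (c τ) c J τ := velocity_eq_chartVel (hc τ hτ)
  have h2 := hasDerivWithinAt_chartCurve (hc τ hτ) (mem_extChartAt_source (I := 𝓡∂ n) (c τ))
  have h3 : HasDerivWithinAt (fun s => chartCurve n (c τ) c s 0) (chartVel n (c τ) c J τ 0) J τ :=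
    ((EuclideanSpace.proj (𝕜 := ℝ) (0 : Fin n)).hasFDerivAt.comp_hasDerivWithinAt τ h2)
  have h4 : (fun s => chartCurve n (c τ) c s 0) =ᶠ[𝓝[J] τ] fun _ => 0 := by
    filter_upwards [(hc τ hτ).continuousWithinAt.eventually
      (extChartAt_source_mem_nhds (I := 𝓡∂ n) (c τ)), self_mem_nhdsWithin] with s hs hsJ
    exact (isBoundaryPoint_iff_chart hs).1 (hb s hsJ)
  rw [h1]
  exact (hu τ hτ).eq_deriv J h3 ((hasDerivWithinAt_const τ J 0).congr_of_eventuallyEq h4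
    ((isBoundaryPoint_iff_chart (mem_extChartAt_source (I := 𝓡∂ n) (c τ))).1 (hb τ hτ)))

theorem exists_boundary_chart_ball {q : N} {S : Set N} (hS : S ∈ 𝓝 q) :
    ∃ ρ > 0, ∀ z ∈ Metric.ball (extChartAt (𝓡∂ n) q q) ρ, z 0 = 0 →
      z ∈ (extChartAt (𝓡∂ n) q).target ∧ (extChartAt (𝓡∂ n) q).symm z ∈ S ∩ (𝓡∂ n).boundary N := by
  set φ := extChartAt (𝓡∂ n) q with hφ
  have h1 : φ.target ∩ φ.symm ⁻¹' S ∈ 𝓝[range (𝓡∂ n)] (φ q) := by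
    have h2 := extChartAt_target_mem_nhdsWithin (I := 𝓡∂ n) q
    have h3 : φ.symm ⁻¹' S ∈ 𝓝[φ.target] (φ q) := by
      refine (continuousOn_extChartAt_symm (I := 𝓡∂ n) q (φ q)
        (mem_extChartAt_target q)).preimage_mem_nhdsWithin ?_
      rwa [← hφ, φ.left_inv (mem_extChartAt_source q)]
    rw [nhdsWithin_extChartAt_target_eq] at h3
    exact inter_mem h2 h3
  obtain ⟨ρ, hρ, hsub⟩ := Metric.mem_nhdsWithin_iff.1 h1
  refine ⟨ρ, hρ, fun z hz hz0 => ?_⟩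
  have hzr : z ∈ range (𝓡∂ n) := by
    rw [range_modelWithCornersEuclideanHalfSpace]
    exact hz0.ge
  obtain ⟨h4, h5⟩ := hsub ⟨hz, hzr⟩
  refine ⟨h4, h5, (isBoundaryPoint_iff_chart (φ.map_target h4)).2 ?_⟩
  rw [← hφ, φ.right_inv h4, hz0]

/-- Boundary points close to `q` are joined by lines in the chart at `q`. -/
theorem eventually_boundary_line {q : N} {S : Set N} (hS : S ∈ 𝓝 q)
    (hq : q ∈ (𝓡∂ n).boundary N) :
    ∀ᶠ y in 𝓝[(𝓡∂ n).boundary N] q, y ∈ (extChartAt (𝓡∂ n) q).source ∧ ∀ τ ∈ Icc (0 : ℝ) 1,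
      extChartAt (𝓡∂ n) q q + τ • (extChartAt (𝓡∂ n) q y - extChartAt (𝓡∂ n) q q)
        ∈ (extChartAt (𝓡∂ n) q).target ∧
      chartLine q (extChartAt (𝓡∂ n) q q) (extChartAt (𝓡∂ n) q y - extChartAt (𝓡∂ n) q q) τ
        ∈ S ∩ (𝓡∂ n).boundary N := by
  obtain ⟨ρ, hρ, hball⟩ := exists_boundary_chart_ball (n := n) hS
  filter_upwards [self_mem_nhdsWithin,
    nhdsWithin_le_nhds (extChartAt_source_mem_nhds (I := 𝓡∂ n) q),
    nhdsWithin_le_nhds ((continuousAt_extChartAt (I := 𝓡∂ n) q).preimage_mem_nhds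
      (Metric.ball_mem_nhds _ hρ))] with y hy hys hyb
  refine ⟨hys, fun τ hτ => hball _ ?_ ?_⟩
  · exact (convex_ball _ ρ).add_smul_sub_mem (Metric.mem_ball_self hρ) hyb hτ
  · have e1 := (isBoundaryPoint_iff_chart hys).1 hy
    have e2 := (isBoundaryPoint_iff_chart (mem_extChartAt_source (I := 𝓡∂ n) q)).1 hq
    simp only [PiLp.add_apply, PiLp.smul_apply, PiLp.sub_apply, e1, e2, sub_zero, smul_zero,
      add_zero]

theorem exists_tangent_line {q : N} {S : Set N} (hS : S ∈ 𝓝 q) (hq : q ∈ (𝓡∂ n).boundary N)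
    {ζ : 𝔼} (hζ : ζ 0 = 0) :
    ∃ δ > (0 : ℝ), ∀ τ ∈ Icc (0 : ℝ) 1, extChartAt (𝓡∂ n) q q + τ • (δ • ζ : 𝔼)
        ∈ (extChartAt (𝓡∂ n) q).target ∧
      chartLine q (extChartAt (𝓡∂ n) q q) (δ • ζ) τ ∈ S ∩ (𝓡∂ n).boundary N := by
  obtain ⟨ρ, hρ, hball⟩ := exists_boundary_chart_ball (n := n) hS
  refine ⟨ρ / (2 * (‖ζ‖ + 1)), by positivity, fun τ hτ => hball _ ?_ ?_⟩
  · rw [mem_ball_iff_norm, add_sub_cancel_left, norm_smul, norm_smul, Real.norm_of_nonneg hτ.1,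
      Real.norm_of_nonneg (by positivity)]
    have h1 : ρ / (2 * (‖ζ‖ + 1)) * ‖ζ‖ < ρ := by
      rw [div_mul_eq_mul_div, div_lt_iff₀ (by positivity)]
      nlinarith [norm_nonneg ζ]
    have h2 : 0 ≤ ρ / (2 * (‖ζ‖ + 1)) * ‖ζ‖ := by positivity
    nlinarith [hτ.1, hτ.2]
  · have e2 := (isBoundaryPoint_iff_chart (mem_extChartAt_source (I := 𝓡∂ n) q)).1 hq
    simp only [PiLp.add_apply, PiLp.smul_apply, e2, hζ, smul_zero, add_zero]

theorem tendsto_chartLine {q : N} {ζ : 𝔼}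
    (hJ : ∀ τ ∈ Icc (0 : ℝ) 1, extChartAt (𝓡∂ n) q q + τ • ζ ∈ (extChartAt (𝓡∂ n) q).target) :
    Tendsto (chartLine q (extChartAt (𝓡∂ n) q q) ζ) (𝓝[>] 0) (𝓝 q) ∧
      ∀ᶠ τ : ℝ in 𝓝[>] 0, τ ∈ Ioo (0 : ℝ) 1 ∧
        extChartAt (𝓡∂ n) q (chartLine q (extChartAt (𝓡∂ n) q q) ζ τ) - extChartAt (𝓡∂ n) q q
          = τ • ζ := by
  have hev : ∀ᶠ τ : ℝ in 𝓝[>] 0, τ ∈ Ioo (0 : ℝ) 1 := Ioo_mem_nhdsGT one_pos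
  constructor
  · have h1 := (contMDiffOn_chartLine hJ 0 ⟨le_rfl, zero_le_one⟩).continuousWithinAt.tendsto
    rw [chartLine_zero] at h1
    refine h1.mono_left (nhdsWithin_le_iff.2 (hev.mono fun τ hτ => Ioo_subset_Icc_self hτ))
  · filter_upwards [hev] with τ hτ
    refine ⟨hτ, ?_⟩
    rw [chartLine, (extChartAt (𝓡∂ n) q).right_inv (hJ τ (Ioo_subset_Icc_self hτ)),
      add_sub_cancel_left]

variable [CompactSpace N]

theorem tendsto_action_self (H : ∀ x, MagneticExpIsDiffeo h om x) (q : N) :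
    Tendsto (magneticAction h om q) (𝓝 q) (𝓝 0) := by
  set φ := extChartAt (𝓡∂ n) q with hφ
  have h1 : Tendsto (fun y => φ y - φ q) (𝓝 q) (𝓝 0) := by
    have := (continuousAt_extChartAt (I := 𝓡∂ n) q).tendsto.sub_const (φ q)
    rwa [sub_self] at this
  have h2 : Tendsto (fun y : N => (q, y)) (𝓝 q) (𝓝 (q, q)) :=
    tendsto_const_nhds.prodMk_nhds tendsto_id
  have h3 := ((((tendsto_action_diagonal H q).comp h2).mul h1.norm).add
    ((((continuous_normE h q).tendsto 0).comp h1).sub (((formE om q).continuous.tendsto 0).comp h1)))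
  rw [zero_mul, normE_zero, map_zero, sub_zero, zero_add] at h3
  refine h3.congr' ?_
  filter_upwards [extChartAt_source_mem_nhds (I := 𝓡∂ n) q] with y hy
  simp only [Function.comp_apply, ← hφ]
  by_cases h0 : φ y - φ q = 0
  · have h4 : y = q := φ.injOn hy (mem_extChartAt_source q) (sub_eq_zero.1 h0)
    rw [h0, h4, (H q).magneticAction_self, norm_zero, normE_zero, map_zero]
    simp
  · rw [div_mul_cancel₀ _ (norm_ne_zero_iff.2 h0)]
    ring

theorem tendsto_action_self_div (H : ∀ x, MagneticExpIsDiffeo h om x) {q : N} {ζ : 𝔼}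
    (hJ : ∀ τ ∈ Icc (0 : ℝ) 1, extChartAt (𝓡∂ n) q q + τ • ζ ∈ (extChartAt (𝓡∂ n) q).target)
    (hζ : ζ ≠ 0) :
    Tendsto (fun τ => magneticAction h om q (chartLine q (extChartAt (𝓡∂ n) q q) ζ τ) / τ)
      (𝓝[>] 0) (𝓝 (normE h q ζ - formE om q ζ)) := by
  obtain ⟨hc, hev⟩ := tendsto_chartLine hJ
  have h1 := (((tendsto_action_diagonal H q).comp
    ((tendsto_const_nhds (x := q)).prodMk_nhds hc)).mul_const ‖ζ‖).add_const
      (normE h q ζ - formE om q ζ)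
  rw [zero_mul, zero_add] at h1
  refine h1.congr' ?_
  filter_upwards [hev] with τ ⟨hτ, he⟩
  have hτ0 := hτ.1
  have hζ0 := norm_pos_iff.2 hζ
  simp only [Function.comp_apply]
  rw [he, normE_smul, map_smul, norm_smul, Real.norm_eq_abs, abs_of_pos hτ0, smul_eq_mul]
  field_simp
  ring

theorem IsSimpleMagnetic.tendsto_action_initial (hs : IsSimpleMagnetic h om) {q y : N} (hqy : q ≠ y)
    {ζ : 𝔼} (hJ : ∀ τ ∈ Icc (0 : ℝ) 1,
      extChartAt (𝓡∂ n) q q + τ • ζ ∈ (extChartAt (𝓡∂ n) q).target ∧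
      chartLine q (extChartAt (𝓡∂ n) q q) ζ τ ∈ (𝓡∂ n).boundary N) :
    Tendsto (fun τ => (magneticAction h om (chartLine q (extChartAt (𝓡∂ n) q q) ζ τ) y
        - magneticAction h om q y) / τ) (𝓝[>] 0)
      (𝓝 (formE om q ζ - innerE h q (departVel h om q y) ζ)) := by
  obtain ⟨hc, hev⟩ := tendsto_chartLine fun τ hτ => (hJ τ hτ).1
  have hq : q ∈ (𝓡∂ n).boundary N := by
    have := (hJ 0 ⟨le_rfl, zero_le_one⟩).2
    rwa [chartLine_zero] at this
  rw [Metric.tendsto_nhds]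
  intro ε hε
  set η := ε / (‖ζ‖ + 1) with hη
  have hη0 : 0 < η := by positivity
  have hηζ : η * ‖ζ‖ < ε := by
    rw [hη, div_mul_eq_mul_div, div_lt_iff₀ (by positivity)]
    nlinarith [norm_nonneg ζ]
  have h1 := hs.action_initial_le hqy hη0
  filter_upwards [hev, ((tendsto_const_nhds (x := q)).prodMk_nhds hc).eventually h1,
    (hc.prodMk_nhds (tendsto_const_nhds (x := q))).eventually h1] with τ ⟨hτ, he⟩ h2 h3
  have h4 := h2 (hJ τ (Ioo_subset_Icc_self hτ)).2
  have h5 := h3 hq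
  have he' := congrArg Neg.neg he
  rw [neg_sub] at he'
  simp only [he, he', map_neg, norm_neg, map_smul, smul_eq_mul, norm_smul, Real.norm_eq_abs,
    abs_of_pos hτ.1, sub_apply] at h4 h5
  rw [Real.dist_eq]
  set D := magneticAction h om (chartLine q (extChartAt (𝓡∂ n) q q) ζ τ) y
        - magneticAction h om q y with hD
  have h6 : D / τ - (formE om q ζ - innerE h q (departVel h om q y) ζ)
      = (D - τ * (formE om q ζ - innerE h q (departVel h om q y) ζ)) / τ := by
    have := hτ.1
    field_simp
  rw [h6, abs_div, abs_of_pos hτ.1, div_lt_iff₀ hτ.1]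
  refine (abs_le.2 ⟨?_, ?_⟩ : _ ≤ τ * (η * ‖ζ‖)).trans_lt ?_
  · linarith
  · linarith
  · rw [mul_comm]; exact mul_lt_mul_of_pos_right hηζ hτ.1

end BoundaryCurves

noncomputable section ScatteringFromAction

variable {n : ℕ} [NeZero n] {N : Type*} [TopologicalSpace N] [T2Space N]
  [ChartedSpace (EuclideanHalfSpace n) N] [IsManifold (𝓡∂ n) ∞ N]

local notation "𝔼" => EuclideanSpace ℝ (Fin n)

variable {om om₂ : SmoothOneForm (𝓡∂ n) N} {h h₂ : RMetric n N}

theorem innerE_eq_of_normE {q : N} (hh : ∀ ζ : 𝔼, ζ 0 = 0 → normE h q ζ = normE h₂ q ζ) {ζ ζ' : 𝔼}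
    (hζ : ζ 0 = 0) (hζ' : ζ' 0 = 0) : innerE h q ζ ζ' = innerE h₂ q ζ ζ' := by
  have h1 : ∀ u : 𝔼, u 0 = 0 → innerE h q u u = innerE h₂ q u u := fun u hu => by
    rw [← normE_sq, ← normE_sq, hh u hu]
  have h2 := h1 (ζ + ζ') (by simp [hζ, hζ'])
  simp only [map_add, add_apply, h1 ζ hζ, h1 ζ' hζ', innerE_symm _ q ζ' ζ] at h2
  linarith

theorem isBdryProj_eq_iff {q : N} (hh : ∀ ζ : 𝔼, ζ 0 = 0 → normE h q ζ = normE h₂ q ζ)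
    {v v' w w' : 𝔼} (hv : IsBdryProj (x := q) h v v') (hw : IsBdryProj (x := q) h₂ w w') :
    v' = w' ↔ ∀ ζ : 𝔼, ζ 0 = 0 → innerE h q v ζ = innerE h₂ q w ζ := by
  obtain ⟨hv0, hv⟩ := isBdryProj_iff.1 hv
  obtain ⟨hw0, hw⟩ := isBdryProj_iff.1 hw
  simp only [map_sub, sub_apply, sub_eq_zero] at hv hw
  constructor
  · rintro rfl ζ hζ
    rw [hv ζ hζ, hw ζ hζ, innerE_eq_of_normE hh hv0 hζ]
  · intro H
    have h0 : (v' - w') 0 = 0 := by simp [hv0, hw0]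
    have h1 : innerE h q (v' - w') (v' - w') = 0 := by
      rw [map_sub (innerE h q) v' w', sub_apply, ← hv _ h0, H _ h0, hw _ h0,
        innerE_eq_of_normE hh hw0 h0, sub_self]
    exact sub_eq_zero.1 (eq_zero_of_innerE_self h1)

theorem IsMagneticChord.bdryProj (hs : IsSimpleMagnetic h om) {ℓ : ℝ} {γ : ℝ → N}
    {X Y : TangentBundle (𝓡∂ n) N} (hch : IsMagneticChord h om ℓ γ X Y) :
    X.proj ∈ (𝓡∂ n).boundary N ∧ Y.proj ∈ (𝓡∂ n).boundary N ∧
    IsBdryProj (x := X.proj) h (departVel h om X.proj Y.proj) X.snd ∧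
      IsBdryProj (x := Y.proj) h (arrivalVel h om X.proj Y.proj) Y.snd := by
  obtain ⟨hℓ, hγ, hb0, hb1, -, -, ⟨hX, hX'⟩, hY, hY'⟩ := isMagneticChord_iff.1 hch
  obtain ⟨x, v⟩ := X
  obtain ⟨y, w⟩ := Y
  obtain rfl : x = γ 0 := hX
  obtain rfl : y = γ ℓ := hY
  refine ⟨hb0, hb1, ?_, ?_⟩
  · have h1 := (hs.1 (γ 0)).departVel_eq hℓ hγ rfl
    rw [← h1] at hX'
    exact hX'
  · have h1 := (hs.1 (γ 0)).arrivalVel_eq hℓ hγ rfl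
    rw [← h1] at hY'
    exact hY'

theorem MagneticExpIsDiffeo.arrivalVel_rate {x q : N} (H : MagneticExpIsDiffeo h om x) {ζ : 𝔼}
    (hJ : ∀ τ ∈ Icc (0 : ℝ) 1, extChartAt (𝓡∂ n) q q + τ • ζ ∈ (extChartAt (𝓡∂ n) q).target ∧
      x ≠ chartLine q (extChartAt (𝓡∂ n) q q) ζ τ) :
    HasDerivWithinAt (fun τ => magneticAction h om x (chartLine q (extChartAt (𝓡∂ n) q q) ζ τ))
      (innerE h q (arrivalVel h om x q) ζ - formE om q ζ) (Icc 0 1) 0 := by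
  have hJ1 := fun τ hτ => (hJ τ hτ).1
  have h0 : (0 : ℝ) ∈ Icc (0 : ℝ) 1 := ⟨le_rfl, zero_le_one⟩
  have h1 := (H.hasDerivWithinAt_action one_pos (contMDiffOn_chartLine hJ1)
    fun τ hτ => (hJ τ hτ).2).2 0 h0
  rw [actionRate, velE_chartLine (uniqueDiffOn_Icc one_pos) hJ1 h0, chartLine_zero] at h1
  exact h1

variable [CompactSpace N]

theorem boundary_data_eq_of_action (hs : IsSimpleMagnetic h om) (hs₂ : IsSimpleMagnetic h₂ om₂)
    (hA : ∀ x ∈ (𝓡∂ n).boundary N, ∀ y ∈ (𝓡∂ n).boundary N,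
      magneticAction h om x y = magneticAction h₂ om₂ x y)
    {q : N} (hq : q ∈ (𝓡∂ n).boundary N) {ζ : 𝔼} (hζ : ζ 0 = 0) :
    normE h q ζ = normE h₂ q ζ ∧ formE om q ζ = formE om₂ q ζ := by
  rcases eq_or_ne ζ 0 with rfl | hζ0
  · simp [normE_zero]
  have one : ∀ u : 𝔼, u 0 = 0 → u ≠ 0 →
      normE h q u - formE om q u = normE h₂ q u - formE om₂ q u := by
    intro u hu hu0
    obtain ⟨δ, hδ, hJ⟩ := exists_tangent_line (n := n) univ_mem hq hu
    have hδu : δ • u ≠ 0 := smul_ne_zero hδ.ne' hu0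
    have h1 := tendsto_action_self_div hs.1 (fun τ hτ => (hJ τ hτ).1) hδu
    have h2 := tendsto_action_self_div hs₂.1 (fun τ hτ => (hJ τ hτ).1) hδu
    obtain ⟨-, hev⟩ := tendsto_chartLine fun τ hτ => (hJ τ hτ).1
    have h3 := tendsto_nhds_unique h1 (h2.congr' (hev.mono fun τ hτ => by
      beta_reduce
      rw [hA q hq _ (hJ τ (Ioo_subset_Icc_self hτ.1)).2.2]))
    rw [normE_smul, normE_smul, map_smul, map_smul, abs_of_pos hδ, smul_eq_mul, smul_eq_mul,
      ← mul_sub, ← mul_sub] at h3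
    exact mul_left_cancel₀ hδ.ne' h3
  have h1 := one ζ hζ hζ0
  have h2 := one (-ζ) (by simp [hζ]) (neg_ne_zero.2 hζ0)
  have h3 : ∀ g : RMetric n N, normE g q (-ζ) = normE g q ζ := fun g => by
    rw [← neg_one_smul ℝ ζ, normE_smul, abs_neg, abs_one, one_mul]
  rw [h3, h3, map_neg, map_neg] at h2
  constructor <;> linarith

theorem depart_and_arrival_eq_of_action (hs : IsSimpleMagnetic h om)
    (hs₂ : IsSimpleMagnetic h₂ om₂)
    (hA : ∀ x ∈ (𝓡∂ n).boundary N, ∀ y ∈ (𝓡∂ n).boundary N,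
      magneticAction h om x y = magneticAction h₂ om₂ x y)
    {q y : N} (hq : q ∈ (𝓡∂ n).boundary N) (hy : y ∈ (𝓡∂ n).boundary N) (hqy : q ≠ y) {ζ : 𝔼}
    (hζ : ζ 0 = 0) :
    innerE h q (departVel h om q y) ζ = innerE h₂ q (departVel h₂ om₂ q y) ζ ∧
      innerE h q (arrivalVel h om y q) ζ = innerE h₂ q (arrivalVel h₂ om₂ y q) ζ := by
  have hω := (boundary_data_eq_of_action hs hs₂ hA hq hζ).2
  have hS : ({y}ᶜ : Set N) ∈ 𝓝 q := isOpen_compl_singleton.mem_nhds hqy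
  obtain ⟨δ, hδ, hJ⟩ := exists_tangent_line (n := n) hS hq hζ
  have h0 : (0 : ℝ) ∈ Icc (0 : ℝ) 1 := ⟨le_rfl, zero_le_one⟩
  have hJ' : ∀ τ ∈ Icc (0 : ℝ) 1,
      extChartAt (𝓡∂ n) q q + τ • (δ • ζ : 𝔼) ∈ (extChartAt (𝓡∂ n) q).target ∧
      chartLine q (extChartAt (𝓡∂ n) q q) (δ • ζ) τ ∈ (𝓡∂ n).boundary N := fun τ hτ =>
    ⟨(hJ τ hτ).1, (hJ τ hτ).2.2⟩
  have hJ'' : ∀ τ ∈ Icc (0 : ℝ) 1,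
      extChartAt (𝓡∂ n) q q + τ • (δ • ζ : 𝔼) ∈ (extChartAt (𝓡∂ n) q).target ∧
      y ≠ chartLine q (extChartAt (𝓡∂ n) q q) (δ • ζ) τ := fun τ hτ =>
    ⟨(hJ τ hτ).1, fun h => (hJ τ hτ).2.1 h.symm⟩
  obtain ⟨-, hev⟩ := tendsto_chartLine fun τ hτ => (hJ τ hτ).1
  constructor
  · have h1 := hs.tendsto_action_initial hqy hJ'
    have h2 := hs₂.tendsto_action_initial hqy hJ'
    have h3 := tendsto_nhds_unique h1 (h2.congr' (hev.mono fun τ hτ => by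
      beta_reduce
      rw [hA _ (hJ τ (Ioo_subset_Icc_self hτ.1)).2.2 y hy, hA q hq y hy]))
    simp only [map_smul, smul_eq_mul, ← mul_sub, hω] at h3
    linarith [mul_left_cancel₀ hδ.ne' h3]
  · have h1 := (hs.1 y).arrivalVel_rate hJ''
    have h2 := (hs₂.1 y).arrivalVel_rate hJ''
    have h3 := (uniqueDiffOn_Icc one_pos 0 h0).eq_deriv _ h1 (h2.congr
      (fun τ hτ => hA y hy _ (hJ τ hτ).2.2) (hA y hy _ (hJ 0 h0).2.2))
    simp only [map_smul, smul_eq_mul, ← mul_sub, hω] at h3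
    linarith [mul_left_cancel₀ hδ.ne' h3]

theorem magneticScattering_of_action (hs : IsSimpleMagnetic h om) (hs₂ : IsSimpleMagnetic h₂ om₂)
    (hA : ∀ x ∈ (𝓡∂ n).boundary N, ∀ y ∈ (𝓡∂ n).boundary N,
      magneticAction h om x y = magneticAction h₂ om₂ x y)
    {X Y : TangentBundle (𝓡∂ n) N} (hXY : MagneticScattering h om X Y) :
    MagneticScattering h₂ om₂ X Y := by
  obtain ⟨ℓ, γ, hch⟩ := hXY
  have hne := hch.proj_ne hs
  obtain ⟨hx, hy, hv, hw⟩ := hch.bdryProj hs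
  obtain ⟨ℓ', γ', ⟨x', v'⟩, ⟨y', w'⟩, hch', hX', hY'⟩ := hs₂.exists_chord hx hy hne
  obtain ⟨x, v⟩ := X
  obtain ⟨y, w⟩ := Y
  obtain rfl : x' = x := hX'
  obtain rfl : y' = y := hY'
  obtain ⟨-, -, hv', hw'⟩ := hch'.bdryProj hs₂
  have h1 := (isBdryProj_eq_iff (fun ζ hζ => (boundary_data_eq_of_action hs hs₂ hA hx hζ).1)
    hv hv').2 fun ζ hζ => (depart_and_arrival_eq_of_action hs hs₂ hA hx hy hne hζ).1
  have h2 := (isBdryProj_eq_iff (fun ζ hζ => (boundary_data_eq_of_action hs hs₂ hA hy hζ).1)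
    hw hw').2 fun ζ hζ => (depart_and_arrival_eq_of_action hs hs₂ hA hy hx hne.symm hζ).2
  have h3 : v = v' := h1
  have h4 : w = w' := h2
  rw [h3, h4]
  exact ⟨ℓ', γ', hch'⟩

end ScatteringFromAction

noncomputable section ActionFromScattering

theorem IsPreconnected.eq_of_eventually_eq {α : Type*} [TopologicalSpace α] {C : Set α}
    (hC : IsPreconnected C) {f : α → ℝ} {p q : α}
    (hp : p ∈ C → ContinuousWithinAt f C p) (hq : q ∈ C → ContinuousWithinAt f C q)
    (hf : ∀ x ∈ C, x ≠ p → x ≠ q → ∀ᶠ y in 𝓝[C] x, f y = f x) {a b : α} (ha : a ∈ C)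
    (hb : b ∈ C) : f a = f b := by
  have hcont : ContinuousOn f C := fun x hx => by
    by_cases hxp : x = p
    · subst hxp; exact hp hx
    by_cases hxq : x = q
    · subst hxq; exact hq hx
    exact (tendsto_const_nhds (x := f x)).congr' ((hf x hx hxp hxq).mono fun y hy => hy.symm)
  by_contra hab
  wlog hlt : f a < f b generalizing a b
  · exact this hb ha (Ne.symm hab) (lt_of_le_of_ne (not_lt.1 hlt) (Ne.symm hab))
  obtain ⟨t, ht, htpq⟩ : ∃ t ∈ Ioo (f a) (f b), t ∉ ({f p, f q} : Set ℝ) :=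
    ((Ioo_infinite hlt).sdiff (toFinite {f p, f q})).nonempty
  obtain ⟨c, hc, hct⟩ := (hC.intermediate_value ha hb hcont) (Ioo_subset_Icc_self ht)
  have hpre := isPreconnected_iff_preconnectedSpace.1 hC
  set T : Set C := {x | f x = t} with hT
  have hclosed : IsClosed T :=
    isClosed_singleton.preimage (continuousOn_iff_continuous_domRestrict.1 hcont)
  have hopen : IsOpen T := isOpen_iff_mem_nhds.2 fun x hx => by
    have h1 := hf x x.2 (fun h => htpq (by rw [← hx, h]; simp)) fun h => htpq (by rw [← hx, h]; simp)
    rw [nhdsWithin_eq_map_subtype_coe x.2] at h1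
    exact (eventually_map.1 h1).mono fun y hy => hy.trans hx
  rcases isClopen_iff.1 (⟨hclosed, hopen⟩ : IsClopen T) with h1 | h1
  · exact (h1 ▸ (show (⟨c, hc⟩ : C) ∈ T from hct) : (⟨c, hc⟩ : C) ∈ (∅ : Set C))
  · have h2 : (⟨a, ha⟩ : C) ∈ T := h1 ▸ mem_univ _
    exact absurd (show f a = t from h2) ht.1.ne

variable {n : ℕ} [NeZero n] {N : Type*} [TopologicalSpace N] [T2Space N]
  [ChartedSpace (EuclideanHalfSpace n) N] [IsManifold (𝓡∂ n) ∞ N]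

local notation "𝔼" => EuclideanSpace ℝ (Fin n)

variable {om om₂ : SmoothOneForm (𝓡∂ n) N} {h h₂ : RMetric n N}

theorem IsBdryProj.normE_le_one {x : N} {v v' : 𝔼} (hv : normE h x v = 1)
    (hp : IsBdryProj (x := x) h v v') : normE h x v' ≤ 1 := by
  obtain ⟨h2, h3⟩ := isBdryProj_iff.1 hp
  rcases eq_or_ne v' 0 with rfl | hv'
  · rw [normE_zero]; exact zero_le_one
  · have h4 := normE_pos h x hv'
    have h5 := innerE_le hv h4
    have h6 := h3 v' h2
    rw [map_sub, sub_apply, sub_eq_zero] at h6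
    rw [h6, ← normE_sq] at h5
    nlinarith

theorem IsMagneticChord.normE_le_one {ℓ : ℝ} {γ : ℝ → N} {X Y : TangentBundle (𝓡∂ n) N}
    (hch : IsMagneticChord h om ℓ γ X Y) : normE h X.proj X.snd ≤ 1 := by
  obtain ⟨hℓ, hγ, -, -, -, -, ⟨hX, hX'⟩, -, -⟩ := isMagneticChord_iff.1 hch
  obtain ⟨x, v⟩ := X
  obtain rfl : x = γ 0 := hX
  exact IsBdryProj.normE_le_one (hγ.2 0 ⟨le_rfl, hℓ.le⟩) hX'

variable [CompactSpace N]

theorem normE_le_of_scattering (hs : IsSimpleMagnetic h om)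
    (hS : ∀ X Y, MagneticScattering h om X Y → MagneticScattering h₂ om₂ X Y)
    {q : N} (hq : q ∈ (𝓡∂ n).boundary N) {ζ : 𝔼} (hζ : ζ 0 = 0) :
    normE h₂ q ζ ≤ normE h q ζ := by
  rcases eq_or_ne ζ 0 with rfl | hζ0
  · simp [normE_zero]
  obtain ⟨δ, hδ, hJ⟩ := exists_tangent_line (n := n) univ_mem hq hζ
  obtain ⟨hct, hev⟩ := tendsto_chartLine fun τ hτ => (hJ τ hτ).1
  set c := chartLine q (extChartAt (𝓡∂ n) q q) (δ • ζ) with hc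
  set 𝓕 : Ultrafilter ℝ := Ultrafilter.of (𝓝[>] 0) with h𝓕
  have hle : (𝓕 : Filter ℝ) ≤ 𝓝[>] 0 := Ultrafilter.of_le _
  have H := hs.1 q
  have hev' : ∀ᶠ τ in (𝓕 : Filter ℝ), q ≠ c τ ∧ c τ ∈ (𝓡∂ n).boundary N ∧
      extChartAt (𝓡∂ n) q (c τ) - extChartAt (𝓡∂ n) q q = (τ * δ) • ζ := by
    filter_upwards [hle hev] with τ ⟨hτ, he⟩
    rw [smul_smul] at he
    refine ⟨fun h0 => ?_, (hJ τ (Ioo_subset_Icc_self hτ)).2.2, he⟩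
    rw [← h0, sub_self] at he
    exact smul_ne_zero (mul_pos hτ.1 hδ).ne' hζ0 he.symm
  have hex : ∀ τ : ℝ, ∃ γ, q ≠ c τ → 0 < normE h q (mlog h om q (c τ)) ∧
      IsSpeedGeodesicOn h om 1 γ (Icc 0 (normE h q (mlog h om q (c τ)))) ∧ γ 0 = q ∧
      γ (normE h q (mlog h om q (c τ))) = c τ := fun τ => by
    by_cases hp : q = c τ
    · exact ⟨fun _ => q, fun h => absurd hp h⟩
    · obtain ⟨h1, γ, h2⟩ := H.exists_unit_geodesic hp
      exact ⟨γ, fun _ => ⟨h1, h2⟩⟩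
  choose η hη using hex
  set r : ℝ → ℝ := fun τ => normE h q (mlog h om q (c τ)) with hr
  have hr0 : Tendsto r 𝓕 (𝓝 0) := by
    have h1 := (tendsto_normE_mlog hs.1 q q).comp
      ((tendsto_const_nhds (x := q)).prodMk_nhds (hct.mono_left hle))
    rwa [H.mlog_self, normE_zero] at h1
  have hη0 : Tendsto (fun τ => η τ 0) 𝓕 (𝓝 q) :=
    tendsto_const_nhds.congr' (hev'.mono fun τ hτ => (hη τ hτ.1).2.2.1.symm)
  obtain ⟨V, hV1, hVv, hVd, -⟩ := tendsto_short_geodesic 𝓕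
    (hev'.mono fun τ hτ => ⟨(hη τ hτ.1).1, (hη τ hτ.1).2.1⟩) hr0 hη0
  have hdep : Tendsto (fun τ => departVel h om q (c τ)) 𝓕 (𝓝 V) := by
    refine hVv.congr' (hev'.mono fun τ hτ => ?_)
    obtain ⟨h1, h2, h3, h4⟩ := hη τ hτ.1
    have h5 := H.departVel_eq h1 (isUnitMagneticGeodesicOn_iff.2 h2) h3
    have h6 : velE n (η τ) (Icc 0 (r τ)) 0 = chartVel n (η τ 0) (η τ) (Icc 0 (r τ)) 0 :=
      velocity_eq_chartVel (h2.1.1 0 ⟨le_rfl, h1.le⟩)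
    rw [h3] at h6
    rw [h4] at h5
    exact (h5.trans h6).symm
  have hdir : Tendsto (fun τ => ((r τ)⁻¹ * (τ * δ)) • ζ) 𝓕 (𝓝 V) := by
    refine hVd.congr' (hev'.mono fun τ hτ => ?_)
    obtain ⟨h1, h2, h3, h4⟩ := hη τ hτ.1
    have e1 : chartCurve n q (η τ) (r τ) = extChartAt (𝓡∂ n) q (c τ) := congrArg _ h4
    have e0 : chartCurve n q (η τ) 0 = extChartAt (𝓡∂ n) q q := congrArg _ h3
    rw [e1, e0, hτ.2.2, smul_smul]
  have hnζ := normE_pos h q hζ0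
  have hVζ : V = (normE h q ζ)⁻¹ • ζ := by
    have h1 := ((continuous_normE h q).tendsto V).comp hdir
    rw [hV1] at h1
    have h2 : Tendsto (fun τ => (r τ)⁻¹ * (τ * δ)) 𝓕 (𝓝 (normE h q ζ)⁻¹) := by
      have h3 := h1.mul_const (normE h q ζ)⁻¹
      rw [one_mul] at h3
      refine h3.congr' ?_
      filter_upwards [hle hev, hev'] with τ hτ hτ'
      have h4 : 0 < (r τ)⁻¹ * (τ * δ) :=
        mul_pos (inv_pos.2 (hη τ hτ'.1).1) (mul_pos hτ.1.1 hδ)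
      simp only [Function.comp_apply]
      rw [normE_smul, abs_of_pos h4, mul_inv_cancel_right₀ hnζ.ne']
    exact tendsto_nhds_unique hdir (h2.smul_const ζ)
  obtain ⟨ν, hν, hν0⟩ := exists_inward_covector h q
  have hproj : Tendsto (fun τ => departVel h om q (c τ)
      - ((ν 0)⁻¹ * departVel h om q (c τ) 0) • ν) 𝓕 (𝓝 V) := by
    have h1 := ((EuclideanSpace.proj (𝕜 := ℝ) (0 : Fin n)).continuous.tendsto V).comp hdep
    have h2 := hdep.sub ((h1.const_mul (ν 0)⁻¹).smul_const ν)
    have h3 : V 0 = 0 := by rw [hVζ, PiLp.smul_apply, hζ, smul_zero]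
    have h4 : EuclideanSpace.proj (𝕜 := ℝ) (0 : Fin n) V = 0 := h3
    rw [h4, mul_zero, zero_smul, sub_zero] at h2
    exact h2
  have hle1 : normE h₂ q V ≤ 1 := by
    refine le_of_tendsto (((continuous_normE h₂ q).tendsto V).comp hproj) ?_
    filter_upwards [hev'] with τ hτ
    obtain ⟨ℓ, γ, ⟨x, v⟩, Y, hch, hX, hY⟩ := hs.exists_chord hq hτ.2.1 hτ.1
    obtain rfl : x = q := hX
    have h1 := (hch.bdryProj hs).2.2.1
    rw [hY] at h1
    have h2 : IsBdryProj (x := x) h (departVel h om x (c τ)) (departVel h om x (c τ)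
        - ((ν 0)⁻¹ * departVel h om x (c τ) 0) • ν : 𝔼) := by
      refine isBdryProj_iff.2 ⟨?_, fun u hu => ?_⟩
      · simp only [PiLp.sub_apply, PiLp.smul_apply, smul_eq_mul]
        field_simp
        ring
      · rw [sub_sub_cancel, map_smul, smul_apply, hν u, hu, smul_zero]
    obtain ⟨ℓ', γ', hch'⟩ := hS _ _ ⟨ℓ, γ, hch⟩
    have h3 := hch'.normE_le_one
    have h4 := isBdryProj_unique h2 h1
    exact (congrArg (normE h₂ x) h4).le.trans h3
  rw [hVζ, normE_smul, abs_of_pos (inv_pos.2 hnζ), inv_mul_le_iff₀ hnζ, mul_one] at hle1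
  exact hle1

section

variable (hs : IsSimpleMagnetic h om) (hs₂ : IsSimpleMagnetic h₂ om₂)
  (hS : ∀ X Y, MagneticScattering h om X Y ↔ MagneticScattering h₂ om₂ X Y)
include hs hs₂ hS

theorem arrival_eq_of_scattering {x y : N} (hx : x ∈ (𝓡∂ n).boundary N)
    (hy : y ∈ (𝓡∂ n).boundary N) (hxy : x ≠ y) {ζ : 𝔼} (hζ : ζ 0 = 0) :
    innerE h y (arrivalVel h om x y) ζ = innerE h₂ y (arrivalVel h₂ om₂ x y) ζ := by
  obtain ⟨ℓ, γ, X, Y, hch, rfl, rfl⟩ := hs.exists_chord hx hy hxy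
  obtain ⟨ℓ', γ', hch'⟩ := (hS _ _).1 ⟨ℓ, γ, hch⟩
  exact (isBdryProj_eq_iff (fun ζ hζ => le_antisymm
    (normE_le_of_scattering hs₂ (fun X Y => (hS X Y).2) hy hζ)
    (normE_le_of_scattering hs (fun X Y => (hS X Y).1) hy hζ))
    (hch.bdryProj hs).2.2.2 (hch'.bdryProj hs₂).2.2.2).1 rfl ζ hζ

theorem hasDerivWithinAt_action_sub {x q : N} (hx : x ∈ (𝓡∂ n).boundary N) {ζ : 𝔼}
    (hJ : ∀ τ ∈ Icc (0 : ℝ) 1, extChartAt (𝓡∂ n) q q + τ • ζ ∈ (extChartAt (𝓡∂ n) q).target ∧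
      x ≠ chartLine q (extChartAt (𝓡∂ n) q q) ζ τ ∧
      chartLine q (extChartAt (𝓡∂ n) q q) ζ τ ∈ (𝓡∂ n).boundary N) {τ : ℝ} (hτ : τ ∈ Icc (0 : ℝ) 1) :
    HasDerivWithinAt (fun τ => magneticAction h om x (chartLine q (extChartAt (𝓡∂ n) q q) ζ τ)
        - magneticAction h₂ om₂ x (chartLine q (extChartAt (𝓡∂ n) q q) ζ τ))
      (formE om₂ (chartLine q (extChartAt (𝓡∂ n) q q) ζ τ)
          (velE n (chartLine q (extChartAt (𝓡∂ n) q q) ζ) (Icc 0 1) τ)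
        - formE om (chartLine q (extChartAt (𝓡∂ n) q q) ζ τ)
          (velE n (chartLine q (extChartAt (𝓡∂ n) q q) ζ) (Icc 0 1) τ)) (Icc 0 1) τ := by
  have hc := contMDiffOn_chartLine fun τ hτ => (hJ τ hτ).1
  have h1 := ((hs.1 x).hasDerivWithinAt_action one_pos hc fun τ hτ => (hJ τ hτ).2.1).2 τ hτ
  have h2 := ((hs₂.1 x).hasDerivWithinAt_action one_pos hc fun τ hτ => (hJ τ hτ).2.1).2 τ hτ
  have h3 := h1.sub h2
  have h4 := arrival_eq_of_scattering hs hs₂ hS hx (hJ τ hτ).2.2 (hJ τ hτ).2.1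
    (velE_boundary_curve (uniqueDiffOn_Icc one_pos) hc (fun τ hτ => (hJ τ hτ).2.2) hτ)
  rw [actionRate, actionRate, h4, sub_sub_sub_cancel_left] at h3
  exact h3

theorem continuousWithinAt_action_sub {x q : N} (hx : x ∈ (𝓡∂ n).boundary N)
    (hq : q ∈ (𝓡∂ n).boundary N) :
    ContinuousWithinAt (fun y => magneticAction h om x y - magneticAction h₂ om₂ x y)
      ((𝓡∂ n).boundary N) q := by
  by_cases hxq : x = q
  · subst hxq
    have h1 := (tendsto_action_self hs.1 x).sub (tendsto_action_self hs₂.1 x)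
    have h2 : ContinuousAt (fun y => magneticAction h om x y - magneticAction h₂ om₂ x y) x := by
      unfold ContinuousAt
      beta_reduce
      rwa [(hs.1 x).magneticAction_self, (hs₂.1 x).magneticAction_self]
    exact h2.continuousWithinAt
  set φ := extChartAt (𝓡∂ n) q with hφ
  set F : 𝔼 → (𝔼 →L[ℝ] ℝ) := fun z => formC om₂ q z - formC om q z with hF
  have hS1 : φ.source ∩ {y | ‖F (φ y)‖ < ‖F (φ q)‖ + 1} ∈ 𝓝 q := by
    have h1 : ContinuousWithinAt F φ.target (φ q) :=
      ((contDiffOn_formC om₂ q).continuousOn.sub (contDiffOn_formC om q).continuousOn) _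
        (mem_extChartAt_target q)
    have h2 : Tendsto φ (𝓝 q) (𝓝[φ.target] (φ q)) := tendsto_nhdsWithin_iff.2
      ⟨continuousAt_extChartAt (I := 𝓡∂ n) q, by
        filter_upwards [extChartAt_source_mem_nhds (I := 𝓡∂ n) q] with y hy
        exact φ.map_source hy⟩
    exact inter_mem (extChartAt_source_mem_nhds q)
      ((h1.tendsto.comp h2).norm.eventually_lt_const (lt_add_one _))
  have hS2 : ({x}ᶜ : Set N) ∈ 𝓝 q := isOpen_compl_singleton.mem_nhds (Ne.symm hxq)
  have hzero : Tendsto (fun y => (‖F (φ q)‖ + 1) * ‖φ y - φ q‖) (𝓝[(𝓡∂ n).boundary N] q) (𝓝 0) := by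
    have h1 : Tendsto (fun y => φ y - φ q) (𝓝[(𝓡∂ n).boundary N] q) (𝓝 0) := by
      have := ((continuousAt_extChartAt (I := 𝓡∂ n) q).tendsto.sub_const (φ q)).mono_left
        (nhdsWithin_le_nhds (s := (𝓡∂ n).boundary N))
      rwa [sub_self] at this
    simpa using h1.norm.const_mul (‖F (φ q)‖ + 1)
  have hgoal := squeeze_zero_norm' (f := fun y => (magneticAction h om x y
    - magneticAction h₂ om₂ x y) - (magneticAction h om x q - magneticAction h₂ om₂ x q)) (by
      filter_upwards [eventually_boundary_line (inter_mem hS1 hS2) hq] with y ⟨hys, hJ⟩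
      set ζ := φ y - φ q with hζ
      have hJ' : ∀ τ ∈ Icc (0 : ℝ) 1, φ q + τ • ζ ∈ φ.target ∧ x ≠ chartLine q (φ q) ζ τ ∧
          chartLine q (φ q) ζ τ ∈ (𝓡∂ n).boundary N := fun τ hτ =>
        ⟨(hJ τ hτ).1, fun h => (hJ τ hτ).2.1.2 h.symm, (hJ τ hτ).2.2⟩
      have h1 := norm_image_sub_le_of_norm_deriv_le_segment_01'
        (fun τ hτ => hasDerivWithinAt_action_sub hs hs₂ hS hx hJ' hτ)
        (C := (‖F (φ q)‖ + 1) * ‖ζ‖) (fun τ hτ => by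
          have hτ' := Ico_subset_Icc_self hτ
          have hc := contMDiffOn_chartLine fun τ hτ => (hJ τ hτ).1
          have e : ∀ o : SmoothOneForm (𝓡∂ n) N, formE o (chartLine q (φ q) ζ τ)
              (velE n (chartLine q (φ q) ζ) (Icc 0 1) τ)
                = formC o q (φ (chartLine q (φ q) ζ τ)) ζ := fun o => by
            have h2 := formC_velocity o ((hc τ hτ').mdifferentiableWithinAt (by simp))
              (uniqueDiffOn_Icc one_pos τ hτ') (hJ τ hτ').2.1.1.1
            rw [derivWithin_chartLine (uniqueDiffOn_Icc one_pos) (fun τ hτ => (hJ τ hτ).1) hτ'] at h2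
            exact h2.symm
          rw [e, e, ← sub_apply]
          exact ((F _).le_opNorm ζ).trans (mul_le_mul_of_nonneg_right
            (le_of_lt (hJ τ hτ').2.1.1.2) (norm_nonneg ζ)))
      have h2 : chartLine q (φ q) ζ 1 = y := by
        rw [chartLine, one_smul, hζ, add_sub_cancel]
        exact φ.left_inv hys
      rw [h2, chartLine_zero] at h1
      exact h1) hzero
  exact tendsto_sub_nhds_zero_iff.1 hgoal

theorem eventually_action_sub_eq {x x' q : N} (hx : x ∈ (𝓡∂ n).boundary N)
    (hx' : x' ∈ (𝓡∂ n).boundary N) (hq : q ∈ (𝓡∂ n).boundary N) (hxq : q ≠ x) (hxq' : q ≠ x') :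
    ∀ᶠ y in 𝓝[(𝓡∂ n).boundary N] q,
      (magneticAction h om x y - magneticAction h₂ om₂ x y)
          - (magneticAction h om x' y - magneticAction h₂ om₂ x' y)
        = (magneticAction h om x q - magneticAction h₂ om₂ x q)
          - (magneticAction h om x' q - magneticAction h₂ om₂ x' q) := by
  filter_upwards [eventually_boundary_line (inter_mem (isOpen_compl_singleton.mem_nhds hxq)
    (isOpen_compl_singleton.mem_nhds hxq')) hq] with y ⟨hys, hJ⟩
  have hd : ∀ τ ∈ Icc (0 : ℝ) 1, _ := fun τ hτ =>
    (hasDerivWithinAt_action_sub hs hs₂ hS hx (fun τ hτ => ⟨(hJ τ hτ).1,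
      fun h => (hJ τ hτ).2.1.1 h.symm, (hJ τ hτ).2.2⟩) hτ).sub
    (hasDerivWithinAt_action_sub hs hs₂ hS hx' (fun τ hτ => ⟨(hJ τ hτ).1,
      fun h => (hJ τ hτ).2.1.2 h.symm, (hJ τ hτ).2.2⟩) hτ)
  have h1 := norm_image_sub_le_of_norm_deriv_le_segment_01' hd (C := 0) fun τ hτ => by
    rw [sub_self, norm_zero]
  rw [norm_le_zero_iff, sub_eq_zero] at h1
  have h2 : chartLine q (extChartAt (𝓡∂ n) q q)
      (extChartAt (𝓡∂ n) q y - extChartAt (𝓡∂ n) q q) 1 = y := by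
    rw [chartLine, one_smul, add_sub_cancel]
    exact (extChartAt (𝓡∂ n) q).left_inv hys
  simp only [Pi.sub_apply, h2, chartLine_zero] at h1
  exact h1

theorem eventually_action_sub_eq_of_form {x q : N}
    (hω : ∀ y ∈ (𝓡∂ n).boundary N, ∀ u : 𝔼, u 0 = 0 → formE om y u = formE om₂ y u)
    (hx : x ∈ (𝓡∂ n).boundary N) (hq : q ∈ (𝓡∂ n).boundary N) (hxq : q ≠ x) :
    ∀ᶠ y in 𝓝[(𝓡∂ n).boundary N] q,
      magneticAction h om x y - magneticAction h₂ om₂ x y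
        = magneticAction h om x q - magneticAction h₂ om₂ x q := by
  filter_upwards [eventually_boundary_line (isOpen_compl_singleton.mem_nhds hxq) hq]
    with y ⟨hys, hJ⟩
  have h1 := norm_image_sub_le_of_norm_deriv_le_segment_01' (C := 0)
    (fun τ hτ => hasDerivWithinAt_action_sub hs hs₂ hS hx (fun τ hτ => ⟨(hJ τ hτ).1,
      fun h => (hJ τ hτ).2.1 h.symm, (hJ τ hτ).2.2⟩) hτ) fun τ hτ => by
    have hτ' := Ico_subset_Icc_self hτ
    rw [hω _ (hJ τ hτ').2.2 _ (velE_boundary_curve (uniqueDiffOn_Icc one_pos)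
      (contMDiffOn_chartLine fun τ hτ => (hJ τ hτ).1) (fun τ hτ => (hJ τ hτ).2.2) hτ'),
      sub_self, norm_zero]
  rw [norm_le_zero_iff, sub_eq_zero] at h1
  have h2 : chartLine q (extChartAt (𝓡∂ n) q q)
      (extChartAt (𝓡∂ n) q y - extChartAt (𝓡∂ n) q q) 1 = y := by
    rw [chartLine, one_smul, add_sub_cancel]
    exact (extChartAt (𝓡∂ n) q).left_inv hys
  rw [h2, chartLine_zero] at h1
  exact h1

theorem action_eq_of_scattering (hn : 2 ≤ n)
    (hω : ∀ y ∈ (𝓡∂ n).boundary N, ∀ u : 𝔼, u 0 = 0 → formE om y u = formE om₂ y u)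
    {x y : N} (hx : x ∈ (𝓡∂ n).boundary N) (hy : y ∈ (𝓡∂ n).boundary N) :
    magneticAction h om x y = magneticAction h₂ om₂ x y := by
  have hc := continuousWithinAt_action_sub hs hs₂ hS hx hx
  have h1 := (hs.isPreconnected_boundary hn).eq_of_eventually_eq (fun _ => hc) (fun _ => hc)
    (fun q hq hqx _ => eventually_action_sub_eq_of_form hs hs₂ hS hω hx hq hqx) hy hx
  rw [(hs.1 x).magneticAction_self, (hs₂.1 x).magneticAction_self, sub_self] at h1
  exact sub_eq_zero.1 h1

theorem exists_action_shift_of_scattering (hn : 2 ≤ n) :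
    ∃ φ : N → ℝ, ∀ x ∈ (𝓡∂ n).boundary N, ∀ y ∈ (𝓡∂ n).boundary N,
      magneticAction h₂ om₂ x y = magneticAction h om x y + φ x - φ y := by
  by_cases hne : ((𝓡∂ n).boundary N).Nonempty
  · obtain ⟨p, hp⟩ := hne
    refine ⟨fun y => magneticAction h om p y - magneticAction h₂ om₂ p y, fun x hx y hy => ?_⟩
    have hc : ∀ z ∈ (𝓡∂ n).boundary N, ContinuousWithinAt _ ((𝓡∂ n).boundary N) z := fun z hz =>
      (continuousWithinAt_action_sub hs hs₂ hS hx hz).sub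
        (continuousWithinAt_action_sub hs hs₂ hS hp hz)
    have h1 := (hs.isPreconnected_boundary hn).eq_of_eventually_eq (hc x) (hc p)
      (fun q hq hqx hqp => eventually_action_sub_eq hs hs₂ hS hx hp hq hqx hqp) hy hx
    have h2 := (hs.1 x).magneticAction_self
    have h3 := (hs₂.1 x).magneticAction_self
    simp only [Pi.sub_apply, h2, h3] at h1
    linarith
  · exact ⟨0, fun x hx => absurd ⟨x, hx⟩ hne⟩

end

end ActionFromScattering

noncomputable section Rigidity

variable {n : ℕ} [NeZero n] {N : Type*} [TopologicalSpace N] [T2Space N]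
  [ChartedSpace (EuclideanHalfSpace n) N] [IsManifold (𝓡∂ n) ∞ N]

local notation "𝔼" => EuclideanSpace ℝ (Fin n)

variable {om om₂ : SmoothOneForm (𝓡∂ n) N} {h h₂ : RMetric n N} {lam lam₂ : N → ℝ}

theorem MagneticScattering.boundary {X Y : TangentBundle (𝓡∂ n) N}
    (hXY : MagneticScattering h om X Y) :
    (X.proj ∈ (𝓡∂ n).boundary N ∧ bdryComp X.snd = 0) ∧
      Y.proj ∈ (𝓡∂ n).boundary N ∧ bdryComp Y.snd = 0 := by
  obtain ⟨ℓ, γ, -, -, h0, h1, -, -, ⟨v', hv, rfl⟩, w', hw, rfl⟩ := hXY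
  exact ⟨⟨h0, hv.1⟩, h1, hw.1⟩

theorem timePart_eq_of_form {P : TangentBundle (stModel n) (ℝ × N)} {c : ℝ} (hc : c ≠ 0)
    (hP : bdryComp (scaleVec c (spacePart P)).snd = 0)
    (hω : ∀ u : 𝔼, u 0 = 0 → formE om P.proj.2 u = formE om₂ P.proj.2 u) :
    timePart om h P = timePart om₂ h₂ P := by
  have h1 : bdryComp (c • dSpace P.proj P.snd) = 0 := hP
  have h2 : bdryComp (dSpace P.proj P.snd) = 0 := by
    rw [bdryComp, map_smul] at h1
    have h3 : c * bdryComp (dSpace P.proj P.snd) = 0 := h1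
    exact (mul_eq_zero.1 h3).resolve_left hc
  rw [bdryComp_eq] at h2
  rw [timePart_eq, timePart_eq]
  exact congrArg (dTime P.proj P.snd + ·) (hω _ h2)

variable [CompactSpace N]

theorem lorentzScattering_of_action (hs : IsSimpleMagnetic h om) (hs₂ : IsSimpleMagnetic h₂ om₂)
    (hA : ∀ x ∈ (𝓡∂ n).boundary N, ∀ y ∈ (𝓡∂ n).boundary N,
      magneticAction h om x y = magneticAction h₂ om₂ x y)
    {P Q : TangentBundle (stModel n) (ℝ × N)}
    (hPQ : LorentzScattering (stationaryMetric (fun _ => 1) om h) P Q) :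
    LorentzScattering (stationaryMetric (fun _ => 1) om₂ h₂) P Q := by
  obtain ⟨h1, h2, h3, h4⟩ :=
    (hs.lorentzScattering_iff contMDiff_const (fun _ => one_pos)).1 hPQ
  rw [one_mul, one_mul] at h2
  obtain ⟨⟨hP, hP'⟩, hQ, hQ'⟩ := h3.boundary
  have hω := fun q hq u hu => (boundary_data_eq_of_action hs hs₂ hA (q := q) hq (ζ := u) hu).2
  have e1 : timePart om h P = timePart om₂ h₂ P :=
    timePart_eq_of_form (inv_ne_zero h1.ne') hP' (hω _ hP)
  have e2 : timePart om h Q = timePart om₂ h₂ Q :=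
    timePart_eq_of_form (inv_ne_zero (h2.symm ▸ h1.ne')) hQ' (hω _ hQ)
  refine (hs₂.lorentzScattering_iff contMDiff_const (fun _ => one_pos)).2 ⟨e1 ▸ h1, ?_, ?_, ?_⟩
  · rw [← e1, ← e2, h2]
  · rw [← e1, ← e2]
    exact magneticScattering_of_action hs hs₂ hA h3
  · rw [h4]
    exact hA _ hP _ hQ

/-- The scattering relations and the boundary action of simple magnetic systems determine each
other. -/
theorem simple_scattering_rigidity (hn : 2 ≤ n) (hlam : ContMDiff (𝓡∂ n) 𝓘(ℝ, ℝ) ∞ lam)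
    (hpos : ∀ x, 0 < lam x) (hlam₂ : ContMDiff (𝓡∂ n) 𝓘(ℝ, ℝ) ∞ lam₂) (hpos₂ : ∀ x, 0 < lam₂ x)
    (hs : IsSimpleMagnetic h om) (hs₂ : IsSimpleMagnetic h₂ om₂) :
    List.TFAE [
      ∀ P Q, LorentzScattering (stationaryMetric (fun _ => 1) om h) P Q ↔
        LorentzScattering (stationaryMetric (fun _ => 1) om₂ h₂) P Q,
      ∀ t X s Y, ReducedScattering lam om h t X s Y ↔ ReducedScattering lam₂ om₂ h₂ t X s Y,
      ∀ x ∈ (𝓡∂ n).boundary N, ∀ y ∈ (𝓡∂ n).boundary N,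
        magneticAction h om x y = magneticAction h₂ om₂ x y,
      (∀ X Y, MagneticScattering h om X Y ↔ MagneticScattering h₂ om₂ X Y) ∧
        ∀ x ∈ (𝓡∂ n).boundary N, ∀ u : TangentSpace (𝓡∂ n) x, bdryComp u = 0 →
          om.form x u = om₂.form x u] := by
  have hself : ∀ x : N, magneticAction h om x x = magneticAction h₂ om₂ x x := fun x => by
    rw [(hs.1 x).magneticAction_self, (hs₂.1 x).magneticAction_self]
  tfae_have 1 → 3 := fun H x hx y hy => by
    by_cases hxy : x = y
    · rw [hxy, hself]
    obtain ⟨ℓ, γ, X, Y, hch, rfl, rfl⟩ := hs.exists_chord hx hy hxy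
    obtain ⟨P, hP, hP1, hPX⟩ := exists_timePart_spacePart om h 0 1 X
    obtain ⟨Q, hQ, hQ1, hQY⟩ :=
      exists_timePart_spacePart om h (magneticAction h om X.proj Y.proj) 1 Y
    have h1 : LorentzScattering (stationaryMetric (fun _ => 1) om h) P Q := by
      refine (hs.lorentzScattering_iff contMDiff_const (fun _ => one_pos)).2 ⟨?_, ?_, ?_, ?_⟩
      · rw [hP1]; exact one_pos
      · rw [hP1, hQ1]
      · rw [hP1, hQ1, hPX, hQY, inv_one]
        have h2 : ∀ Z : TangentBundle (𝓡∂ n) N, scaleVec 1 Z = Z := fun Z => by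
          obtain ⟨z, u⟩ := Z
          simp [scaleVec]
        rw [h2, h2]
        exact ⟨ℓ, γ, hch⟩
      · rw [hP, hQ, sub_zero]
    have h2 := ((hs₂.lorentzScattering_iff contMDiff_const (fun _ => one_pos)).1
      ((H P Q).1 h1)).2.2.2
    rw [hP, hQ, sub_zero] at h2
    exact h2
  tfae_have 2 → 3 := fun H x hx y hy => by
    by_cases hxy : x = y
    · rw [hxy, hself]
    obtain ⟨ℓ, γ, X, Y, hch, rfl, rfl⟩ := hs.exists_chord hx hy hxy
    have h1 := (hs.reducedScattering_iff hlam hpos 0 (magneticAction h om X.proj Y.proj) X Y).2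
      ⟨⟨ℓ, γ, hch⟩, sub_zero _⟩
    have h2 := ((hs₂.reducedScattering_iff hlam₂ hpos₂ _ _ _ _).1 ((H _ _ _ _).1 h1)).2
    rwa [sub_zero] at h2
  tfae_have 3 → 4 := fun H =>
    ⟨fun X Y => ⟨magneticScattering_of_action hs hs₂ H,
      magneticScattering_of_action hs₂ hs fun x hx y hy => (H x hx y hy).symm⟩,
      fun x hx u hu => (boundary_data_eq_of_action hs hs₂ H hx ((bdryComp_eq u).symm.trans hu)).2⟩
  tfae_have 4 → 3 := fun H x hx y hy =>
    action_eq_of_scattering hs hs₂ H.1 hn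
      (fun z hz u hu => H.2 z hz u ((bdryComp_eq _).trans hu)) hx hy
  tfae_have 3 → 1 := fun H P Q => ⟨lorentzScattering_of_action hs hs₂ H,
    lorentzScattering_of_action hs₂ hs fun x hx y hy => (H x hx y hy).symm⟩
  tfae_have 3 → 2 := fun H t X s Y => by
    rw [hs.reducedScattering_iff hlam hpos, hs₂.reducedScattering_iff hlam₂ hpos₂]
    have h1 := (tfae_3_to_4 H).1 X Y
    rw [← h1]
    refine and_congr_right fun h2 => ?_
    rw [H _ h2.boundary.1.1 _ h2.boundary.2.1]
  tfae_finish

theorem reducedScattering_shift (hn : 2 ≤ n) (hlam : ContMDiff (𝓡∂ n) 𝓘(ℝ, ℝ) ∞ lam)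
    (hpos : ∀ x, 0 < lam x) (hlam₂ : ContMDiff (𝓡∂ n) 𝓘(ℝ, ℝ) ∞ lam₂) (hpos₂ : ∀ x, 0 < lam₂ x)
    (hs : IsSimpleMagnetic h om) (hs₂ : IsSimpleMagnetic h₂ om₂)
    (hS : ∀ X Y, MagneticScattering h om X Y ↔ MagneticScattering h₂ om₂ X Y) :
    ∃ φ : N → ℝ,
      (∀ x ∈ (𝓡∂ n).boundary N, ∀ y ∈ (𝓡∂ n).boundary N,
        magneticAction h₂ om₂ x y = magneticAction h om x y + φ x - φ y) ∧
      ∀ t X s Y, ReducedScattering lam₂ om₂ h₂ t X s Y ↔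
        ReducedScattering lam om h t X (s + φ Y.proj - φ X.proj) Y := by
  obtain ⟨φ, hφ⟩ := exists_action_shift_of_scattering hs hs₂ hS hn
  refine ⟨φ, hφ, fun t X s Y => ?_⟩
  rw [hs.reducedScattering_iff hlam hpos, hs₂.reducedScattering_iff hlam₂ hpos₂, ← hS]
  refine and_congr_right fun h2 => ?_
  rw [hφ _ h2.boundary.1.1 _ h2.boundary.2.1]
  constructor <;> intro h3 <;> linarith

end Rigidity

end Development

theorem mainTheorem3 {n : ℕ} [NeZero n] {N : Type*} [TopologicalSpace N] [T2Space N]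
    [CompactSpace N] [ChartedSpace (EuclideanHalfSpace n) N] [IsManifold (𝓡∂ n) ∞ N]
    (h : RMetric n N) (hconv : HasStrictlyConvexBoundary h)
    (om : SmoothOneForm (𝓡∂ n) N)
    (lam : N → ℝ) (hlam : ContMDiff (𝓡∂ n) 𝓘(ℝ, ℝ) ∞ lam) (hpos : ∀ x, 0 < lam x) :
    -- (a) lightlike geodesics of the metric with `λ = 1`
    (∀ (J : Set ℝ) (Γ : ℝ → ℝ × N), J.OrdConnected → J.Nontrivial →
      IsLightlikeGeodesicOn (stModel n) (stationaryMetric (fun _ => 1) om h) Γ J →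
      ∃ k : ℝ, k ≠ 0 ∧
        (∀ σ ∈ J, derivWithin (fun τ => (Γ τ).1) J σ
          + om.form (Γ σ).2 (velocity (𝓡∂ n) (fun τ => (Γ τ).2) J σ) = k) ∧
        IsMagneticGeodesicOn h om k (fun τ => (Γ τ).2) J ∧
        (∀ σ ∈ J, hNorm h (velocity (𝓡∂ n) (fun τ => (Γ τ).2) J σ) = |k|) ∧
        (∀ σ ∈ J, IsFuturePointing (stationaryMetric (fun _ => 1) om h)
          (velocity (stModel n) Γ J σ) ↔ 0 < k) ∧
        (∀ σ₀ ∈ J, ∃ C : ℝ, ∀ σ ∈ J,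
          (Γ σ).1 + lineIntegral om (fun τ => (Γ τ).2) J σ₀ σ - k * σ = C) ∧
        -- affine changes of the parameter multiply `k` by a nonzero constant
        (∀ c d : ℝ, c ≠ 0 →
          IsLightlikeGeodesicOn (stModel n) (stationaryMetric (fun _ => 1) om h)
            (fun τ => Γ (c * τ + d)) ((fun τ => c * τ + d) ⁻¹' J) ∧
          ∀ σ ∈ (fun τ => c * τ + d) ⁻¹' J,
            derivWithin (fun τ => (Γ (c * τ + d)).1) ((fun τ => c * τ + d) ⁻¹' J) σ
              + om.form (Γ (c * σ + d)).2
                (velocity (𝓡∂ n) (fun τ => (Γ (c * τ + d)).2) ((fun τ => c * τ + d) ⁻¹' J) σ)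
              = c * k)) ∧
    -- (b) the scattering relation of `λ (-(dt + ω)² + h)` projects to the magnetic one
    (∀ P Q : TangentBundle (stModel n) (ℝ × N),
      LorentzScattering (stationaryMetric lam om h) P Q → timePart om h P = 1 →
        lam Q.proj.2 * timePart om h Q = lam P.proj.2 ∧
        MagneticScattering h om (spacePart P) (scaleVec (timePart om h Q)⁻¹ (spacePart Q)) ∧
        (∀ (ℓ : ℝ) (γ : ℝ → N) (Y : TangentBundle (𝓡∂ n) N),
          IsMagneticChord h om ℓ γ (spacePart P) Y →
            magneticTravelTime h om (spacePart P) = ℓ ∧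
            ℓ = Q.proj.1 - P.proj.1 + lineIntegral om γ (Icc 0 ℓ) 0 ℓ) ∧
        IsMagneticAction h om P.proj.2 Q.proj.2 (Q.proj.1 - P.proj.1) ∧
        (IsSimpleMagnetic h om →
          magneticAction h om P.proj.2 Q.proj.2 = Q.proj.1 - P.proj.1)) ∧
    -- (c) the three quantities determine each other, for simple magnetic systems
    (2 ≤ n → IsSimpleMagnetic h om →
      ∀ (h₂ : RMetric n N) (om₂ : SmoothOneForm (𝓡∂ n) N) (lam₂ : N → ℝ),
        ContMDiff (𝓡∂ n) 𝓘(ℝ, ℝ) ∞ lam₂ → (∀ x, 0 < lam₂ x) → IsSimpleMagnetic h₂ om₂ →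
        List.TFAE [
          ∀ P Q, LorentzScattering (stationaryMetric (fun _ => 1) om h) P Q ↔
            LorentzScattering (stationaryMetric (fun _ => 1) om₂ h₂) P Q,
          ∀ t X s Y, ReducedScattering lam om h t X s Y ↔ ReducedScattering lam₂ om₂ h₂ t X s Y,
          ∀ x ∈ (𝓡∂ n).boundary N, ∀ y ∈ (𝓡∂ n).boundary N,
            magneticAction h om x y = magneticAction h₂ om₂ x y,
          (∀ X Y, MagneticScattering h om X Y ↔ MagneticScattering h₂ om₂ X Y) ∧
            ∀ x ∈ (𝓡∂ n).boundary N, ∀ u : TangentSpace (𝓡∂ n) x, bdryComp u = 0 →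
              om.form x u = om₂.form x u] ∧
        -- without knowledge of `ω` on the boundary, up to boundary time shifts
        ((∀ X Y, MagneticScattering h om X Y ↔ MagneticScattering h₂ om₂ X Y) →
          ∃ φ : N → ℝ,
            (∀ x ∈ (𝓡∂ n).boundary N, ∀ y ∈ (𝓡∂ n).boundary N,
              magneticAction h₂ om₂ x y = magneticAction h om x y + φ x - φ y) ∧
            ∀ t X s Y, ReducedScattering lam₂ om₂ h₂ t X s Y ↔
              ReducedScattering lam om h t X (s + φ Y.proj - φ X.proj) Y)) := by
  refine ⟨fun J Γ hJ hJn hΓ => lightlike_geodesics_project hJ hJn hΓ,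
    fun P Q hPQ hP => lightlike_scattering_projects hlam hpos hPQ hP,
    fun hn hs h₂ om₂ lam₂ hlam₂ hpos₂ hs₂ =>
      ⟨simple_scattering_rigidity hn hlam hpos hlam₂ hpos₂ hs hs₂,
        reducedScattering_shift hn hlam hpos hlam₂ hpos₂ hs hs₂⟩⟩
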